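/- Let $0<p<\tfrac12$, $\lambda\in\mathbb R$, $h>0$, and let $D=\{0<\xi<h,\ -h<\eta<h\}$. Consider the generalized Euler–Darboux equation $$U_{\xi\eta}-\frac{p}{\eta-(\operatorname{sgn}\eta)\,\xi}\,U_\xi+\frac{p}{(\operatorname{sgn}\eta)\,\eta-\xi}\,U_\eta-(\operatorname{sgn}\eta)\,\lambda U=0 \tag{1}$$ in the four open triangles into which the lines $\eta=\pm\xi$ and $\eta=0$ divide $D$. Write ${}_0F_1(a;z)=\sum_{n\ge0}\frac{z^n}{(a)_n\,n!}$ and, for functions $T,N$ on $(0,h)$ and $0\le a\le b\le h$, $$C[T,N](a,b)=\int_b^h T(s)(s-a)^p(s-b)^p\,{}_0F_1\bigl(1+p;\lambda(s-a)(s-b)\bigr)ds+\int_a^b N(s)(b-s)^p(s-a)^p\,{}_0F_1\bigl(1+p;-\lambda(b-s)(s-a)\bigr)ds .$$ A function $U$ belongs to the class $R_h$ if there are functions $T_k,N_k$ $(k=1,2,3,4)$, continuous on $(0,h)$ and absolutely integrable on $[0,h]$, such that for $0<a<b<h$ $$U(a,b)=C[T_1,N_1](a,b),\quad U(b,a)=C[T_2,N_2](a,b),\quad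 U(b,-a)=C[T_3,N_3](a,b),\quad U(a,-b)=C[T_4,N_4](a,b).$$ **Problem $\Delta_2^*$.** Given $\varphi_1,\varphi_2:[0,h]\to\mathbb R$, find $U\in R_h$, continuous on $\overline D$ (in particular across $\eta=\pm\xi$ and $\eta=0$), which is $C^1$ and has the derivative $U_{\xi\eta}$ in the four open triangles and satisfies (1) there, and such that * $U(\xi,h)=\varphi_1(\xi)$ and $U(\xi,-h)=\varphi_2(\xi)$ for $0\le\xi\le h$; * for every $0<\xi<h$ the limits $$\nu_1=\lim_{\eta\to\xi+0}(\eta-\xi)^{-2p}(U_\xi-U_\eta),\qquad \nu_2=\lim_{\eta\to\xi-0}(\xi-\eta)^{-2p}(U_\xi-U_\eta),$$ $$\nu_3=\lim_{-\eta\to\xi-0}(\eta+\xi)^{-2p}(U_\xi+U_\eta),\qquad \nu_4=\lim_{-\eta\to\xi+0}(-\xi-\eta)^{-2p}(U_\xi+U_\eta)$$ exist and satisfy $\nu_1=-\nu_2$, $\nu_3=-\nu_4$; * for every $0<\xi<h$ the limits below exist and $\displaystyle\lim_{\eta\to0+0}(U_\eta-U_\xi)=\lim_{\eta\to0-0}(U_\eta+U_\xi)$.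 **Theorem.** Suppose that for $i=1,2$: $\varphi_i\in C^2[0,h]$; $\varphi_i(0)=\varphi_i'(0)=0$; $\varphi_i(\xi)=(h-\xi)^{1+p+\varepsilon}\varphi_i^*(\xi)$ on $[0,h]$ with some $\varepsilon>0$ and some $\varphi_i^*\in C[0,h]$; and $\int_0^h\varphi_i(s)(h-s)^{-p-2}ds=0$. Then Problem $\Delta_2^*$ has exactly one solution $U$ on $\overline D$, and it is given explicitly by $$U(\xi,\eta)=C[T^{(i)},N^{(i)}]\bigl(\min(\xi,|\eta|),\max(\xi,|\eta|)\bigr),\qquad i=1\text{ if }\eta\ge0,\quad i=2\text{ if }\eta<0,$$ where, with the operator ($c\in\{0,h\}$, $0<x<h$) $$(J_cg)(x)=\frac{\sin\pi p}{\pi}\Bigl(-\Psi'(x)-2\lambda\int_x^h{}_0F_1\bigl(2;\lambda(s-x)^2\bigr)\Psi(s)\,ds\Bigr),\quad \Psi(x)=\int_x^h g(\xi)(\xi-x)^{-p}\,{}_0F_1\bigl(1-p;-\lambda(x-c)(\xi-x)\bigr)d\xi,$$ one has $$N^{(i)}(s)=-\frac1p\,(h-s)^{-p}\,(J_h\varphi_i')(s),\qquad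 T^{(i)}(s)=s^{-p}\,(J_0M^{(i)})(s),$$ $$M^{(i)}(\xi)=\int_0^\xi N^{(i)}(s)\,s^p(\xi-s)^{p-1}\,{}_0F_1\bigl(p;-\lambda s(\xi-s)\bigr)ds .$$ -/

import Mathlib

open Set Filter Topology MeasureTheory

noncomputable section

namespace EulerDarboux

/-- The confluent hypergeometric limit function `₀F₁(a; z) = ∑ zⁿ / ((a)ₙ n!)`. -/
def hyp01 (a z : ℝ) : ℝ :=
  ∑' n : ℕ, z ^ n / ((ascPochhammer ℝ n).eval a * (n.factorial : ℝ))

/-- The partial derivative `U_ξ`. -/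
def dXi (U : ℝ → ℝ → ℝ) (ξ η : ℝ) : ℝ := deriv (fun x => U x η) ξ

/-- The partial derivative `U_η`. -/
def dEta (U : ℝ → ℝ → ℝ) (ξ η : ℝ) : ℝ := deriv (fun y => U ξ y) η

/-- The closed rectangle `0 ≤ ξ ≤ h`, `-h ≤ η ≤ h`. -/
def rect (h : ℝ) : Set (ℝ × ℝ) := Icc 0 h ×ˢ Icc (-h) h

/-- The union of the four open characteristic triangles: the open rectangle without the singular
lines `η = ξ`, `η = -ξ` and without the characteristic `η = 0`. -/
def triangles (h : ℝ) : Set (ℝ × ℝ) :=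
  {z | z.1 ∈ Ioo 0 h ∧ z.2 ∈ Ioo (-h) h ∧ z.2 ≠ 0 ∧ z.2 ≠ z.1 ∧ z.2 ≠ -z.1}

/-- `U` is a classical solution of the generalized Euler-Darboux equation in each of the four open
triangles: it is `C¹` there, has the mixed derivative `U_ξη`, and satisfies the equation. -/
def SolvesEquation (p lam h : ℝ) (U : ℝ → ℝ → ℝ) : Prop :=
  ContDiffOn ℝ 1 (fun z : ℝ × ℝ => U z.1 z.2) (triangles h) ∧
  ∀ ξ η : ℝ, (ξ, η) ∈ triangles h →
    DifferentiableAt ℝ (fun y => dXi U ξ y) η ∧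
    dEta (dXi U) ξ η - p / (η - Real.sign η * ξ) * dXi U ξ η
      + p / (Real.sign η * η - ξ) * dEta U ξ η - Real.sign η * lam * U ξ η = 0

/-- The formula representing the solution of the Cauchy problem in the triangle `0 < a < b < h`
with data on `a = b`, for densities `T` and `N`. -/
def cauchyFormula (p lam h : ℝ) (T N : ℝ → ℝ) (a b : ℝ) : ℝ :=
  (∫ s in b..h, T s * (s - a) ^ p * (s - b) ^ p * hyp01 (1 + p) (lam * (s - a) * (s - b))) +
  ∫ s in a..b, N s * (b - s) ^ p * (s - a) ^ p * hyp01 (1 + p) (-lam * (b - s) * (s - a))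

/-- The densities admitted in the class `R_h`: continuous on `(0, h)` and absolutely integrable. -/
def IsDensity (h : ℝ) (f : ℝ → ℝ) : Prop :=
  ContinuousOn f (Ioo 0 h) ∧ IntegrableOn f (Icc 0 h)

/-- The class `R_h`: in each of the four triangles, `U` is given by the Cauchy formula with some
admissible densities. The equation is invariant under `(ξ, η) ↦ (η, ξ)` for `η > 0` and under
`(ξ, η) ↦ (ξ, -η)`, so the formulas in the triangles `0 < η < ξ`, `0 < -η < ξ` and `0 < ξ < -η`
are the images of the one in `0 < ξ < η`. -/
def InClassR (p lam h : ℝ) (U : ℝ → ℝ → ℝ) : Prop :=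
  ∃ T N : Fin 4 → ℝ → ℝ, (∀ k, IsDensity h (T k) ∧ IsDensity h (N k)) ∧
    ∀ a b : ℝ, 0 < a → a < b → b < h →
      U a b = cauchyFormula p lam h (T 0) (N 0) a b ∧
      U b a = cauchyFormula p lam h (T 1) (N 1) a b ∧
      U b (-a) = cauchyFormula p lam h (T 2) (N 2) a b ∧
      U a (-b) = cauchyFormula p lam h (T 3) (N 3) a b

/-- Frankl's conditions: the limits `ν₁, ν₂` (at `η = ξ` from above and below) and `ν₃, ν₄`
(at `η = -ξ` from above and below) exist and satisfy `ν₁ = -ν₂`, `ν₃ = -ν₄` on `(0, h)`. -/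
def FranklConditions (p h : ℝ) (U : ℝ → ℝ → ℝ) : Prop :=
  ∀ ξ ∈ Ioo 0 h, ∃ ν₁ ν₂ ν₃ ν₄ : ℝ,
    Tendsto (fun η => (η - ξ) ^ (-2 * p) * (dXi U ξ η - dEta U ξ η)) (𝓝[>] ξ) (𝓝 ν₁) ∧
    Tendsto (fun η => (ξ - η) ^ (-2 * p) * (dXi U ξ η - dEta U ξ η)) (𝓝[<] ξ) (𝓝 ν₂) ∧
    Tendsto (fun η => (η + ξ) ^ (-2 * p) * (dXi U ξ η + dEta U ξ η)) (𝓝[>] (-ξ)) (𝓝 ν₃) ∧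
    Tendsto (fun η => (-ξ - η) ^ (-2 * p) * (dXi U ξ η + dEta U ξ η)) (𝓝[<] (-ξ)) (𝓝 ν₄) ∧
    ν₁ = -ν₂ ∧ ν₃ = -ν₄

/-- The conjugation condition on `η = 0`: both one-sided limits exist and coincide. -/
def ConjugationCondition (h : ℝ) (U : ℝ → ℝ → ℝ) : Prop :=
  ∀ ξ ∈ Ioo 0 h, ∃ l : ℝ,
    Tendsto (fun η => dEta U ξ η - dXi U ξ η) (𝓝[>] 0) (𝓝 l) ∧
    Tendsto (fun η => dEta U ξ η + dXi U ξ η) (𝓝[<] 0) (𝓝 l)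

/-- `U` solves Problem `Δ₂*` with boundary data `φ₁`, `φ₂` in the class `R_h`. -/
structure SolvesDeltaTwoStar (p lam h : ℝ) (φ₁ φ₂ : ℝ → ℝ) (U : ℝ → ℝ → ℝ) : Prop where
  continuous : ContinuousOn (fun z : ℝ × ℝ => U z.1 z.2) (rect h)
  equation : SolvesEquation p lam h U
  classR : InClassR p lam h U
  boundary_top : ∀ ξ ∈ Icc 0 h, U ξ h = φ₁ ξ
  boundary_bottom : ∀ ξ ∈ Icc 0 h, U ξ (-h) = φ₂ ξ
  frankl : FranklConditions p h U
  conjugation : ConjugationCondition h U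

/-- The conditions imposed on the given functions. -/
structure AdmissibleDatum (p h : ℝ) (φ : ℝ → ℝ) : Prop where
  contDiff : ContDiffOn ℝ 2 φ (Icc 0 h)
  zero : φ 0 = 0
  deriv_zero : derivWithin φ (Icc 0 h) 0 = 0
  factor : ∃ ε > 0, ∃ φs : ℝ → ℝ, ContinuousOn φs (Icc 0 h) ∧
    ∀ ξ ∈ Icc 0 h, φ ξ = (h - ξ) ^ (1 + p + ε) * φs ξ
  moment : ∫ s in (0 : ℝ)..h, φ s * (h - s) ^ (-p - 2) = 0

/-- `Ψ(x) = ∫_x^h g(ξ) (ξ - x)^{-p} ₀F₁(1 - p; -λ (x - c)(ξ - x)) dξ`. -/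
def psi (p lam h c : ℝ) (g : ℝ → ℝ) (x : ℝ) : ℝ :=
  ∫ ξ in x..h, g ξ * (ξ - x) ^ (-p) * hyp01 (1 - p) (-lam * (x - c) * (ξ - x))

/-- The operator `J_c g (x) = (sin πp / π) (-Ψ'(x) - 2λ ∫_x^h ₀F₁(2; λ (s - x)²) Ψ(s) ds)`. -/
def opJ (p lam h c : ℝ) (g : ℝ → ℝ) (x : ℝ) : ℝ :=
  Real.sin (Real.pi * p) / Real.pi *
    (-deriv (psi p lam h c g) x
      - 2 * lam * ∫ s in x..h, hyp01 2 (lam * (s - x) ^ 2) * psi p lam h c g s)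

/-- The density `N` of the explicit solution:
`N(s) = -(1/p) (h - s)^{-p} (J_h φ')(s)`. -/
def densityN (p lam h : ℝ) (φ : ℝ → ℝ) (s : ℝ) : ℝ :=
  -(1 / p) * (h - s) ^ (-p) * opJ p lam h h (derivWithin φ (Icc 0 h)) s

/-- `M(ξ) = ∫_0^ξ N(s) s^p (ξ - s)^{p-1} ₀F₁(p; -λ s (ξ - s)) ds`. -/
def opM (p lam : ℝ) (N : ℝ → ℝ) (ξ : ℝ) : ℝ :=
  ∫ s in (0 : ℝ)..ξ, N s * s ^ p * (ξ - s) ^ (p - 1) * hyp01 p (-lam * s * (ξ - s))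

/-- The density `T` of the explicit solution: `T(s) = s^{-p} (J_0 M)(s)`. -/
def densityT (p lam h : ℝ) (φ : ℝ → ℝ) (s : ℝ) : ℝ :=
  s ^ (-p) * opJ p lam h 0 (opM p lam (densityN p lam h φ)) s

/-- The explicit solution: the Cauchy formula in the variables `min ξ |η|`, `max ξ |η|`, with
densities computed from `φ₁` for `η ≥ 0` and from `φ₂` for `η < 0`. -/
def explicitSolution (p lam h : ℝ) (φ₁ φ₂ : ℝ → ℝ) (ξ η : ℝ) : ℝ :=
  let φ := if 0 ≤ η then φ₁ else φ₂
  cauchyFormula p lam h (densityT p lam h φ) (densityN p lam h φ) (min ξ |η|) (max ξ |η|)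

end EulerDarboux

end

noncomputable section

namespace EulerDarboux

section

/-! ### The function `₀F₁` -/

/-! In each triangle a function of the class `R_h` is the Cauchy formula of a pair of densities T,
N, and this formula satisfies the equation whatever the densities are: differentiation lowers the
exponents, giving U_a - U_b = p(b - a)H and U_ab = p²H + λU with H = `cauchyH`
(`cauchyA_sub_cauchyB`, `hasDerivAt_cauchyA_right`). The problem thus has eight unknown densities,
and every side condition becomes an Abel equation or a pointwise relation between them.

On a = b the formula is an Abel integral of T of order 2p, so continuity across η = ±ξ equates the T
of adjacent triangles (`eq_zero_of_cauchyFormula_diag`). The weighted normal derivative tends to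
p(T·`gammaRight` - N·`gammaMid`) (`tendsto_cauchy_diag`), so Frankl's conditions then equate the N.
On b = h only N is seen, through p ∫_a^h A_h(N (h - s)^p) with A_c = `opA`; hence N solves A_h(N (h
- s)^p) = -φ'/p. On a = 0 the value is p ∫_b^h A_0(T s^p) + p ∫_0^b M. The choice A_0(T s^p) = M
makes it independent of b, hence equal to φ(0) = 0 (`cauchyFormula_zero`). With this T the
derivative across a = 0 vanishes too: t H(0,t) = -p ∫_t^h H(0,x) dx, a homogeneous Volterra
equation; here φ'(0) = 0 enters (`cauchyH_zero`). So the two halves of the rectangle fit together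
along η = 0 with zero data, which gives existence.

For uniqueness, N is already determined. Let t₁, t₂ be the differences between the actual and the
explicit T in the two triangles adjacent to η = 0. Continuity across η = 0 gives t₁ = t₂, and the
conjugation condition gives t₁ = -t₂, because the two halves are mirror images
(`classR_eqOn_densityT`).

The analytic core is that `opJ` solves A_c f = g. A beta convolution of two functions ₀F₁ reduces
the composition of Ψ with A_c to the regular kernel ₀F₁(1; λ(s - x)²) (`psi_opA`), whose inverse is
the Volterra expression in `opJ` (`integral_hyp01_volterra`). Injectivity of weakly singular
operators (`eq_zero_of_abel_eq_zero`) then yields A_c J_c g = g (`opA_opJ`). What must be supplied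
is an integrable derivative of Ψ. For g = φ' it comes from φ ∈ C² and φ'(h) = 0; for g = M it comes
from Hölder continuity of M with an exponent above p and a Marchaud derivative
(`exists_holderIcc_opM`, `exists_primitive_psi`). -/

lemma min_le_ascPochhammer {a : ℝ} (ha : 0 < a) (n : ℕ) :
    min a 1 ≤ (ascPochhammer ℝ n).eval a := by
  rcases n with _ | n
  · simp
  · refine (min_le_left _ _).trans ?_
    induction n with
    | zero => simp
    | succ k ih =>
      rw [ascPochhammer_succ_eval]
      have : (1 : ℝ) ≤ a + ((k + 1 : ℕ) : ℝ) := by push_cast; linarith [k.cast_nonneg (α := ℝ)]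
      nlinarith

/-- Since the Pochhammer symbols stay above min(a, 1), the series is dominated by a multiple of the
exponential series. -/
lemma norm_hyp01_term_le {a : ℝ} (ha : 0 < a) (z : ℝ) (n : ℕ) :
    ‖z ^ n / ((ascPochhammer ℝ n).eval a * (n.factorial : ℝ))‖
      ≤ (min a 1)⁻¹ * (|z| ^ n / n.factorial) := by
  have h1 := min_le_ascPochhammer ha n
  have h0 : 0 < min a 1 := lt_min ha one_pos
  have h2 : (0 : ℝ) < n.factorial := by exact_mod_cast n.factorial_pos
  have h3 := h0.trans_le h1
  rw [norm_div, norm_pow, Real.norm_eq_abs, Real.norm_eq_abs, abs_of_pos (mul_pos h3 h2),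
    inv_mul_eq_div, div_div, mul_comm (n.factorial : ℝ)]
  gcongr

lemma summable_hyp01 {a : ℝ} (ha : 0 < a) (z : ℝ) :
    Summable fun n : ℕ => ‖z ^ n / ((ascPochhammer ℝ n).eval a * (n.factorial : ℝ))‖ :=
  Summable.of_nonneg_of_le (fun _ => norm_nonneg _) (norm_hyp01_term_le ha z)
    ((Real.summable_pow_div_factorial |z|).mul_left _)

lemma hasSum_hyp01 {a : ℝ} (ha : 0 < a) (z : ℝ) :
    HasSum (fun n : ℕ => z ^ n / ((ascPochhammer ℝ n).eval a * (n.factorial : ℝ)))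
      (hyp01 a z) :=
  (summable_hyp01 ha z).of_norm.hasSum

@[simp] lemma hyp01_zero (a : ℝ) : hyp01 a 0 = 1 := by
  rw [hyp01, tsum_eq_single 0 (fun n hn => by simp [hn])]
  simp

lemma ascPochhammer_eval_succ_left (a : ℝ) (n : ℕ) :
    (ascPochhammer ℝ (n + 1)).eval a = a * (ascPochhammer ℝ n).eval (a + 1) := by
  rw [ascPochhammer_succ_left]; simp

lemma hyp01_deriv_term {a : ℝ} (ha : 0 < a) (y : ℝ) (n : ℕ) :
    ((n + 1 : ℕ) : ℝ) * y ^ n / ((ascPochhammer ℝ (n + 1)).eval a * ((n + 1).factorial : ℝ)) =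
      y ^ n / ((ascPochhammer ℝ n).eval (a + 1) * (n.factorial : ℝ)) / a := by
  have h1 := (lt_min (by linarith : 0 < a + 1) one_pos).trans_le
    (min_le_ascPochhammer (by linarith : 0 < a + 1) n)
  have h2 : (0 : ℝ) < n.factorial := by exact_mod_cast n.factorial_pos
  rw [ascPochhammer_eval_succ_left, Nat.factorial_succ]
  push_cast
  field_simp

lemma hasDerivAt_hyp01 {a : ℝ} (ha : 0 < a) (z : ℝ) :
    HasDerivAt (hyp01 a) (hyp01 (a + 1) z / a) z := by
  set g' : ℕ → ℝ → ℝ := fun n y =>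
    (n : ℝ) * y ^ (n - 1) / ((ascPochhammer ℝ n).eval a * (n.factorial : ℝ)) with hg'
  have ha1 : 0 < a + 1 := by linarith
  have hs : ∀ y, g' 0 y = 0 := by simp [hg']
  have hss : ∀ n y, g' (n + 1) y =
      y ^ n / ((ascPochhammer ℝ n).eval (a + 1) * (n.factorial : ℝ)) / a := fun n y => by
    simp only [hg', Nat.add_sub_cancel]; exact hyp01_deriv_term ha y n
  -- Termwise differentiation takes place on the ball of radius R, where the derived terms are
  -- dominated by their values at R.
  set R := |z| + 1
  set u : ℕ → ℝ := fun n => ‖g' n R‖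
  have hu : Summable u := by
    rw [← summable_nat_add_iff 1]
    simp only [u, hss, norm_div _ a]
    exact (summable_hyp01 ha1 R).div_const _
  have hR : 0 < R := by positivity
  have key := hasDerivAt_tsum_of_isPreconnected (u := u)
    (g := fun n y => y ^ n / ((ascPochhammer ℝ n).eval a * (n.factorial : ℝ))) (g' := g')
    (t := Metric.ball 0 R) (y₀ := 0) (y := z) hu Metric.isOpen_ball
    (convex_ball _ _).isPreconnected
    (fun n y _ => by simpa [hg'] using (hasDerivAt_pow n y).div_const _)
    (fun n y hy => by
      simp only [u, hg', norm_div, norm_mul, norm_pow]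
      have : ‖y‖ ≤ ‖R‖ := by
        rw [mem_ball_zero_iff] at hy; rw [Real.norm_of_nonneg hR.le]; exact hy.le
      gcongr)
    (by simpa using hR) ((summable_hyp01 ha 0).of_norm)
    (by simp [R])
  have e : ∑' n, g' n z = hyp01 (a + 1) z / a := by
    have hsum : HasSum (fun n => g' (n + 1) z) (hyp01 (a + 1) z / a) := by
      simp only [hss]; exact (hasSum_hyp01 ha1 z).div_const a
    have := (hasSum_nat_add_iff' (f := fun n => g' n z) 1).mp (by simpa [hs] using hsum)
    exact this.tsum_eq
  rw [e] at key
  exact key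

lemma continuous_hyp01 {a : ℝ} (ha : 0 < a) : Continuous (hyp01 a) :=
  continuous_iff_continuousAt.2 fun z => (hasDerivAt_hyp01 ha z).continuousAt

lemma contDiff_one_hyp01 {a : ℝ} (ha : 0 < a) : ContDiff ℝ 1 (hyp01 a) := by
  rw [contDiff_one_iff_deriv]
  refine ⟨fun z => (hasDerivAt_hyp01 ha z).differentiableAt, ?_⟩
  rw [funext fun z => (hasDerivAt_hyp01 ha z).deriv]
  exact (continuous_hyp01 (by linarith)).div_const a

lemma ascPochhammer_eval_pos {a : ℝ} (ha : 0 < a) (n : ℕ) : 0 < (ascPochhammer ℝ n).eval a :=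
  ascPochhammer_pos n a ha

/-- Compare coefficients: 1/(a)_n - 1/(a+1)_n = n/(a (a+1)_n). The factor n cancels against n! and
leaves the series with parameter a + 2, shifted by one. -/
lemma hyp01_contiguous {a : ℝ} (ha : 0 < a) (z : ℝ) :
    hyp01 a z = hyp01 (a + 1) z + z / (a * (a + 1)) * hyp01 (a + 2) z := by
  have h4 := (hasSum_hyp01 ha z).sub (hasSum_hyp01 (by linarith : 0 < a + 1) z)
  have h3 := (hasSum_hyp01 (by linarith : 0 < a + 2) z).mul_left (z / (a * (a + 1)))
  have h5 := (hasSum_nat_add_iff' 1).mpr h4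
  have h6 : ∀ n : ℕ, z ^ (n + 1) / ((ascPochhammer ℝ (n + 1)).eval a *
      ((n + 1).factorial : ℝ)) - z ^ (n + 1) / ((ascPochhammer ℝ (n + 1)).eval (a + 1) *
      ((n + 1).factorial : ℝ)) =
      z / (a * (a + 1)) * (z ^ n / ((ascPochhammer ℝ n).eval (a + 2) * (n.factorial : ℝ))) := by
    intro n
    have e1 := ascPochhammer_eval_succ_left (a + 1) n
    have e2 := ascPochhammer_eval_succ_left a (n + 1)
    rw [ascPochhammer_succ_eval, e1] at e2
    rw [show a + 1 + 1 = a + 2 by ring] at e1 e2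
    have p1 := ascPochhammer_eval_pos (by linarith : 0 < a + 2) n
    have p2 := ascPochhammer_eval_pos ha (n + 1)
    have p3 : (0 : ℝ) < n.factorial := by exact_mod_cast n.factorial_pos
    have e3 : (ascPochhammer ℝ (n + 1)).eval a =
        a * ((a + 1) * (ascPochhammer ℝ n).eval (a + 2)) / (a + (n + 1 : ℕ)) := by
      rw [← e2]; field_simp
    rw [e3, e1, Nat.factorial_succ]
    push_cast
    have : 0 < a + (n + 1) := by positivity
    field_simp
    ring
  simp only [h6] at h5
  have := h5.unique h3
  simp at this
  linarith

/-- The rule behind most later differentiations: exponent and parameter drop together, as in the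
derivative of z^a. -/
lemma hasDerivAt_rpow_mul_hyp01 {a : ℝ} (ha : 0 < a) (c : ℝ) {z : ℝ} (hz : 0 < z) :
    HasDerivAt (fun z => z ^ a * hyp01 (1 + a) (c * z)) (a * (z ^ (a - 1) * hyp01 a (c * z))) z := by
  have h1 := Real.hasDerivAt_rpow_const (p := a) (Or.inl hz.ne')
  have h2 := (hasDerivAt_hyp01 (by linarith : 0 < 1 + a) (c * z)).comp z
    ((hasDerivAt_id z).const_mul c)
  refine (h1.mul h2).congr_deriv ?_
  rw [hyp01_contiguous ha (c * z)]
  have e : z ^ a = z ^ (a - 1) * z := by rw [Real.rpow_sub_one hz.ne']; field_simp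
  simp only [Function.comp, e, mul_one]
  rw [show 1 + a + 1 = a + 2 by ring, show a + 1 = 1 + a by ring]
  field_simp

/-- When the parameter already equals the exponent, a second term with raised parameter appears. It
is the source of λU in the equation. -/
lemma hasDerivAt_rpow_mul_hyp01_self {a : ℝ} (ha : 0 < a) (c : ℝ) {z : ℝ} (hz : 0 < z) :
    HasDerivAt (fun z => z ^ a * hyp01 a (c * z))
      (a * (z ^ (a - 1) * hyp01 a (c * z)) + c / a * (z ^ a * hyp01 (1 + a) (c * z))) z := by
  have h1 := Real.hasDerivAt_rpow_const (p := a) (Or.inl hz.ne')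
  have h2 := (hasDerivAt_hyp01 ha (c * z)).comp z ((hasDerivAt_id z).const_mul c)
  refine (h1.mul h2).congr_deriv ?_
  simp only [Function.comp, mul_one, add_comm a 1]
  ring

/-! ### Beta integrals -/

lemma intervalIntegrable_sub_rpow {α : ℝ} (hα : 0 < α) (x c d : ℝ) :
    IntervalIntegrable (fun s => (s - x) ^ (α - 1)) volume c d := by
  have := (intervalIntegral.intervalIntegrable_rpow' (r := α - 1) (a := c - x) (b := d - x)
    (by linarith)).comp_sub_right x
  simpa using this

lemma intervalIntegrable_rpow_sub {α : ℝ} (hα : 0 < α) (x c d : ℝ) :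
    IntervalIntegrable (fun s => (x - s) ^ (α - 1)) volume c d := by
  have := (intervalIntegral.intervalIntegrable_rpow' (r := α - 1) (a := x - c) (b := x - d)
    (by linarith)).comp_sub_left x
  simpa using this

lemma intervalIntegrable_beta {a b L : ℝ} (ha : 0 < a) (hb : 0 < b) (hL : 0 < L) :
    IntervalIntegrable (fun y => y ^ (a - 1) * (L - y) ^ (b - 1)) volume 0 L := by
  have h1 : IntervalIntegrable (fun y => y ^ (a - 1) * (L - y) ^ (b - 1)) volume 0 (L / 2) := by
    refine (intervalIntegral.intervalIntegrable_rpow' (by linarith)).mul_continuousOn ?_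
    refine ContinuousOn.rpow_const (by fun_prop) fun y hy => Or.inl ?_
    rw [uIcc_of_le (by linarith)] at hy
    linarith [hy.2]
  have h2 : IntervalIntegrable (fun y => y ^ (a - 1) * (L - y) ^ (b - 1)) volume (L / 2) L := by
    refine (intervalIntegrable_rpow_sub hb _ _ _).continuousOn_mul ?_
    refine ContinuousOn.rpow_const (by fun_prop) fun y hy => Or.inl ?_
    rw [uIcc_of_le (by linarith)] at hy
    linarith [hy.1]
  exact h1.trans h2

lemma integral_beta {a b L : ℝ} (ha : 0 < a) (hb : 0 < b) (hL : 0 < L) :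
    ∫ y in (0 : ℝ)..L, y ^ (a - 1) * (L - y) ^ (b - 1) =
      L ^ (a + b - 1) * ProbabilityTheory.beta a b := by
  rw [ProbabilityTheory.beta_eq_betaIntegralReal a b ha hb]
  have h := Complex.betaIntegral_scaled a b hL
  have e : ∫ x in (0 : ℝ)..L, (x : ℂ) ^ ((a : ℂ) - 1) * ((L : ℂ) - x) ^ ((b : ℂ) - 1) =
      ((∫ y in (0 : ℝ)..L, y ^ (a - 1) * (L - y) ^ (b - 1) : ℝ) : ℂ) := by
    rw [← intervalIntegral.integral_ofReal]
    refine intervalIntegral.integral_congr fun y hy => ?_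
    rw [uIcc_of_le hL.le] at hy
    have h1 := Complex.ofReal_cpow hy.1 (a - 1)
    have h2 := Complex.ofReal_cpow (sub_nonneg.2 hy.2) (b - 1)
    push_cast at h1 h2 ⊢
    rw [h1, h2]
  rw [e] at h
  have h3 := Complex.ofReal_cpow hL.le (a + b - 1)
  push_cast at h3
  rw [← h3] at h
  have := congrArg Complex.re h
  rwa [Complex.re_ofReal_mul, Complex.ofReal_re] at this

lemma Gamma_add_nat {a : ℝ} (ha : 0 < a) (n : ℕ) :
    Real.Gamma (a + n) = (ascPochhammer ℝ n).eval a * Real.Gamma a := by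
  induction n with
  | zero => simp
  | succ k ih =>
    have : a + ((k + 1 : ℕ) : ℝ) = (a + k) + 1 := by push_cast; ring
    rw [this, Real.Gamma_add_one (by positivity), ih, ascPochhammer_succ_eval]
    ring

/-- Integer shifts of the beta function produce exactly the Pochhammer quotients that occur as
coefficients of ₀F₁. -/
lemma beta_add_nat {a b : ℝ} (ha : 0 < a) (hb : 0 < b) (i j : ℕ) :
    ProbabilityTheory.beta (a + i) (b + j) = ProbabilityTheory.beta a b *
      ((ascPochhammer ℝ i).eval a * (ascPochhammer ℝ j).eval b /
        (ascPochhammer ℝ (i + j)).eval (a + b)) := by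
  have e : a + i + (b + j) = (a + b) + ((i + j : ℕ) : ℝ) := by push_cast; ring
  rw [ProbabilityTheory.beta, ProbabilityTheory.beta, e, Gamma_add_nat ha, Gamma_add_nat hb,
    Gamma_add_nat (add_pos ha hb)]
  have h1 := ascPochhammer_eval_pos (add_pos ha hb) (i + j)
  have h2 := Real.Gamma_pos_of_pos (add_pos ha hb)
  field_simp

lemma hasSum_integral_mul {w : ℝ → ℝ} {L : ℝ} (hL : 0 ≤ L) (hw : IntervalIntegrable w volume 0 L)
    {c : ℕ → ℝ → ℝ} (hc : ∀ k, Continuous (c k)) {C : ℕ → ℝ} (hC : Summable C)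
    (hb : ∀ k, ∀ y ∈ Icc 0 L, ‖c k y‖ ≤ C k) {S : ℝ → ℝ}
    (hS : ∀ y ∈ Icc 0 L, HasSum (fun k => c k y) (S y)) :
    HasSum (fun k => ∫ y in (0 : ℝ)..L, w y * c k y) (∫ y in (0 : ℝ)..L, w y * S y) := by
  have hm : ∀ y, y ∈ uIoc (0 : ℝ) L → y ∈ Icc 0 L := fun y hy => by
    rw [uIoc_of_le hL] at hy; exact Ioc_subset_Icc_self hy
  refine intervalIntegral.hasSum_integral_of_dominated_convergence
    (fun k y => ‖w y‖ * C k) (fun k => ?_) (fun k => ?_) ?_ ?_ ?_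
  · exact hw.aestronglyMeasurable_restrict_uIoc.mul (hc k).aestronglyMeasurable
  · refine ae_of_all _ fun y hy => ?_
    rw [norm_mul]
    exact mul_le_mul_of_nonneg_left (hb k y (hm y hy)) (norm_nonneg _)
  · exact ae_of_all _ fun y _ => hC.mul_left _
  · simp_rw [tsum_mul_left]
    exact hw.norm.mul_const _
  · exact ae_of_all _ fun y hy => (hS y (hm y hy)).mul_left _

lemma hasSum_mul_antidiagonal {f g : ℕ → ℝ} (hf : Summable fun n => ‖f n‖)
    (hg : Summable fun n => ‖g n‖) :
    HasSum (fun k => ∑ ij ∈ Finset.HasAntidiagonal.antidiagonal k, f ij.1 * g ij.2) ((∑' n, f n) * ∑' n, g n) := by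
  rw [tsum_mul_tsum_eq_tsum_sum_antidiagonal_of_summable_norm hf hg]
  exact (summable_norm_sum_mul_antidiagonal_of_summable_norm hf hg).of_norm.hasSum

lemma add_pow_div_factorial (u v : ℝ) (k : ℕ) :
    ∑ ij ∈ Finset.HasAntidiagonal.antidiagonal k, u ^ ij.1 / ij.1.factorial * (v ^ ij.2 / ij.2.factorial) =
      (u + v) ^ k / k.factorial := by
  rw [(Commute.all u v).add_pow', Finset.sum_div]
  refine Finset.sum_congr rfl fun ij hij => ?_
  rw [Finset.HasAntidiagonal.mem_antidiagonal] at hij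
  have h := Nat.choose_mul_factorial_mul_factorial (show ij.1 ≤ k by omega)
  rw [show k - ij.1 = ij.2 by omega] at h
  have h' : (k.choose ij.1 : ℝ) * ij.1.factorial * ij.2.factorial = k.factorial := by
    exact_mod_cast h
  have h1 : (0 : ℝ) < ij.1.factorial := by exact_mod_cast ij.1.factorial_pos
  have h2 : (0 : ℝ) < ij.2.factorial := by exact_mod_cast ij.2.factorial_pos
  have h3 : (0 : ℝ) < k.factorial := by exact_mod_cast k.factorial_pos
  rw [nsmul_eq_mul]
  field_simp
  rw [← h']; ring

/-- Termwise integration of a Cauchy product against an integrable weight. The dominating series is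
itself the Cauchy product of the summable majorants. -/
lemma hasSum_integral_cauchyProduct {L : ℝ} (hL : 0 ≤ L) {w : ℝ → ℝ}
    (hw : IntervalIntegrable w volume 0 L) {f g : ℕ → ℝ → ℝ} {F G : ℕ → ℝ}
    (hf : ∀ n, Continuous (f n)) (hg : ∀ n, Continuous (g n))
    (hF : Summable fun n => ‖F n‖) (hG : Summable fun n => ‖G n‖)
    (hfF : ∀ n, ∀ t ∈ Icc 0 L, ‖f n t‖ ≤ ‖F n‖) (hgG : ∀ n, ∀ t ∈ Icc 0 L, ‖g n t‖ ≤ ‖G n‖) :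
    HasSum (fun k => ∑ ij ∈ Finset.HasAntidiagonal.antidiagonal k, ∫ t in (0 : ℝ)..L,
      w t * (f ij.1 t * g ij.2 t))
      (∫ t in (0 : ℝ)..L, w t * ((∑' n, f n t) * ∑' n, g n t)) := by
  have hX : Summable fun n => ‖‖F n‖‖ := by simpa only [norm_norm] using hF
  have hY : Summable fun n => ‖‖G n‖‖ := by simpa only [norm_norm] using hG
  have key := hasSum_integral_mul hL hw
    (c := fun k t => ∑ ij ∈ Finset.HasAntidiagonal.antidiagonal k, f ij.1 t * g ij.2 t)
    (S := fun t => (∑' n, f n t) * ∑' n, g n t)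
    (fun k => continuous_finsetSum _ fun ij _ => (hf ij.1).mul (hg ij.2))
    (hasSum_mul_antidiagonal hX hY).summable
    (fun k t ht => (norm_sum_le _ _).trans (Finset.sum_le_sum fun ij _ => by
      rw [norm_mul]
      exact mul_le_mul (hfF _ t ht) (hgG _ t ht) (norm_nonneg _) (norm_nonneg _)))
    (fun t ht => hasSum_mul_antidiagonal (f := fun n => f n t) (g := fun n => g n t)
      (hF.of_nonneg_of_le (fun _ => norm_nonneg _) (fun n => hfF n t ht))
      (hG.of_nonneg_of_le (fun _ => norm_nonneg _) (fun n => hgG n t ht)))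
  refine (congrArg (fun F => HasSum F _) (funext fun k => ?_)).mp key
  simp_rw [Finset.mul_sum]
  exact intervalIntegral.integral_finsetSum fun ij _ =>
    hw.mul_continuousOn ((hf ij.1).mul (hg ij.2)).continuousOn

lemma hasSum_integral_mul_hyp01 {a b L : ℝ} (ha : 0 < a) (hb : 0 < b) (hL : 0 ≤ L) {w x y : ℝ → ℝ}
    (hw : IntervalIntegrable w volume 0 L) (hx : Continuous x) (hy : Continuous y) {X Y : ℝ}
    (hxX : ∀ t ∈ Icc 0 L, |x t| ≤ |X|) (hyY : ∀ t ∈ Icc 0 L, |y t| ≤ |Y|) :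
    HasSum (fun k => ∑ ij ∈ Finset.HasAntidiagonal.antidiagonal k, ∫ t in (0 : ℝ)..L,
      w t * (x t ^ ij.1 / ((ascPochhammer ℝ ij.1).eval a * (ij.1.factorial : ℝ)) *
        (y t ^ ij.2 / ((ascPochhammer ℝ ij.2).eval b * (ij.2.factorial : ℝ)))))
      (∫ t in (0 : ℝ)..L, w t * (hyp01 a (x t) * hyp01 b (y t))) := by
  have hmono : ∀ (e : ℝ) (n : ℕ) (x y : ℝ), |x| ≤ |y| → ‖x ^ n / e‖ ≤ ‖y ^ n / e‖ := by
    intro e n x y hxy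
    rw [norm_div, norm_div, norm_pow, norm_pow]
    exact div_le_div_of_nonneg_right (pow_le_pow_left₀ (norm_nonneg _) hxy _) (norm_nonneg _)
  exact hasSum_integral_cauchyProduct hL hw
    (f := fun n t => x t ^ n / ((ascPochhammer ℝ n).eval a * (n.factorial : ℝ)))
    (g := fun n t => y t ^ n / ((ascPochhammer ℝ n).eval b * (n.factorial : ℝ)))
    (fun n => (hx.pow n).div_const ((ascPochhammer ℝ n).eval a * (n.factorial : ℝ)))
    (fun n => (hy.pow n).div_const ((ascPochhammer ℝ n).eval b * (n.factorial : ℝ)))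
    (summable_hyp01 ha X) (summable_hyp01 hb Y)
    (fun n t ht => hmono _ n _ _ (hxX t ht)) (fun n t ht => hmono _ n _ _ (hyY t ht))

/-- The beta convolution of two functions `₀F₁`. -/
lemma integral_beta_hyp01 {a b L : ℝ} (ha : 0 < a) (hb : 0 < b) (hL : 0 < L) (u v : ℝ) :
    ∫ y in (0 : ℝ)..L, y ^ (a - 1) * (L - y) ^ (b - 1) *
      (hyp01 a (u * y) * hyp01 b (v * (L - y))) =
      L ^ (a + b - 1) * ProbabilityTheory.beta a b * hyp01 (a + b) ((u + v) * L) := by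
  have key := hasSum_integral_mul_hyp01 ha hb hL.le (intervalIntegrable_beta ha hb hL)
    (x := fun y => u * y) (y := fun y => v * (L - y)) (by fun_prop) (by fun_prop)
    (X := u * L) (Y := v * L)
    (fun y hy => by
      rw [abs_mul, abs_mul, abs_of_nonneg hy.1, abs_of_pos hL]
      exact mul_le_mul_of_nonneg_left hy.2 (abs_nonneg _))
    (fun y hy => by
      rw [abs_mul, abs_mul, abs_of_nonneg (sub_nonneg.2 hy.2), abs_of_pos hL]
      exact mul_le_mul_of_nonneg_left (by linarith [hy.1]) (abs_nonneg _))
  refine key.unique ?_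
  have h2 := (hasSum_hyp01 (add_pos ha hb) ((u + v) * L)).mul_left
    (L ^ (a + b - 1) * ProbabilityTheory.beta a b)
  refine (congrArg (fun F => HasSum F _) (funext fun k => ?_)).mp h2
  -- At order k the binomial expansion of (u + v)^k is matched, pair by pair, with the beta
  -- integrals for i + j = k.
  rw [mul_pow, ← mul_div_assoc, mul_comm ((ascPochhammer ℝ k).eval (a + b)), ← div_div,
    mul_div_assoc _ _ (k.factorial : ℝ), mul_comm _ (L ^ k), mul_div_assoc (L ^ k),
    ← add_pow_div_factorial, Finset.mul_sum, Finset.mul_sum, Finset.sum_div]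
  refine Finset.sum_congr rfl fun ij hij => ?_
  rw [Finset.HasAntidiagonal.mem_antidiagonal] at hij
  have h3 := integral_beta (a := a + ij.1) (b := b + ij.2) (by positivity) (by positivity) hL
  have h4 : ∫ y in (0 : ℝ)..L, y ^ (a - 1) * (L - y) ^ (b - 1) *
      ((u * y) ^ ij.1 / ((ascPochhammer ℝ ij.1).eval a * (ij.1.factorial : ℝ)) *
        ((v * (L - y)) ^ ij.2 / ((ascPochhammer ℝ ij.2).eval b * (ij.2.factorial : ℝ)))) = ∫ y in (0 : ℝ)..L,
      (u ^ ij.1 * v ^ ij.2 / ((ascPochhammer ℝ ij.1).eval a * ij.1.factorial *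
        ((ascPochhammer ℝ ij.2).eval b * ij.2.factorial))) *
      (y ^ (a + ij.1 - 1) * (L - y) ^ (b + ij.2 - 1)) := by
    refine intervalIntegral.integral_congr_ae ?_
    have hne : ∀ᵐ y : ℝ, y ≠ L := by simp [ae_iff]
    filter_upwards [hne] with y hyL hy
    rw [uIoc_of_le hL.le] at hy
    have hy2 : 0 < L - y := sub_pos.2 (lt_of_le_of_ne hy.2 hyL)
    rw [show a + ij.1 - 1 = (a - 1) + ij.1 by ring, show b + ij.2 - 1 = (b - 1) + ij.2 by ring,
      Real.rpow_add_natCast hy.1.ne', Real.rpow_add_natCast hy2.ne']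
    simp only [mul_pow]
    ring
  rw [h4, intervalIntegral.integral_const_mul, h3, beta_add_nat ha hb, hij,
    show a + (ij.1 : ℝ) + (b + ij.2) - 1 = (a + b - 1) + ((ij.1 + ij.2 : ℕ) : ℝ) by
      push_cast; ring, Real.rpow_add_natCast hL.ne', hij]
  have p1 := ascPochhammer_eval_pos ha ij.1
  have p2 := ascPochhammer_eval_pos hb ij.2
  field_simp

/-- The sum telescopes: the partial sum over i < m has a closed form whose correction term vanishes
at m = k + 1. -/
lemma sum_catalan_mul_centralBinom (k : ℕ) :
    ∑ ij ∈ Finset.HasAntidiagonal.antidiagonal k,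
      (Nat.centralBinom ij.1 : ℝ) / (ij.1 + 1) * Nat.centralBinom ij.2 =
      Nat.centralBinom (k + 1) / 2 := by
  rw [Finset.Nat.sum_antidiagonal_eq_sum_range_succ
    (fun i j => (Nat.centralBinom i : ℝ) / (i + 1) * Nat.centralBinom j)]
  have hc : ∀ n : ℕ, (Nat.centralBinom (n + 1) : ℝ) =
      2 * (2 * n + 1) * Nat.centralBinom n / (n + 1) := fun n => by
    have := Nat.succ_mul_centralBinom_succ n
    have h : ((n : ℝ) + 1) * Nat.centralBinom (n + 1) = 2 * (2 * n + 1) * Nat.centralBinom n := by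
      exact_mod_cast this
    field_simp
    linarith
  have key : ∀ m ≤ k + 1, ∑ i ∈ Finset.range m,
      (Nat.centralBinom i : ℝ) / (i + 1) * Nat.centralBinom (k - i) =
      Nat.centralBinom (k + 1) / 2 -
        ((k : ℝ) + 1 - m) / (2 * (k + 1)) * Nat.centralBinom m * Nat.centralBinom (k + 1 - m) := by
    intro m
    induction m with
    | zero => intro _; simp; field_simp; simp
    | succ m ih =>
      intro hm
      rw [Finset.sum_range_succ, ih (by omega)]
      obtain ⟨d, rfl⟩ : ∃ d, k = m + d := ⟨k - m, by omega⟩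
      rw [show m + d - m = d by omega, show m + d + 1 - m = d + 1 by omega,
        show m + d + 1 - (m + 1) = d by omega, hc d, hc m]
      push_cast
      field_simp
      ring
  rw [key (k + 1) le_rfl]
  push_cast
  simp

lemma ascPochhammer_eval_two (n : ℕ) : (ascPochhammer ℝ n).eval 2 = (n + 1).factorial := by
  have := ascPochhammer_eval_succ_left 1 n
  rw [ascPochhammer_eval_one] at this
  rw [this]; norm_num

/-- At order λ^k the beta integrals turn the first factor into Catalan numbers and the second into
central binomial coefficients. The identity makes ₀F₁(2; ·) the resolvent kernel for ₀F₁(1; ·) in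
`integral_hyp01_volterra`. -/
lemma integral_hyp01_two_mul_hyp01_one (lam : ℝ) {z : ℝ} (hz : 0 < z) :
    ∫ t in (0 : ℝ)..z, hyp01 2 (lam * t ^ 2) * hyp01 1 (lam * (z - t) ^ 2) =
      z * hyp01 2 (lam * z ^ 2) := by
  have key := hasSum_integral_mul_hyp01 two_pos one_pos hz.le (w := fun _ => 1)
    intervalIntegrable_const (x := fun t => lam * t ^ 2) (y := fun t => lam * (z - t) ^ 2)
    (by fun_prop) (by fun_prop) (X := lam * z ^ 2) (Y := lam * z ^ 2)
    (fun y hy => by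
      rw [abs_mul, abs_mul, abs_pow, abs_pow, abs_of_nonneg hy.1, abs_of_pos hz]
      exact mul_le_mul_of_nonneg_left (pow_le_pow_left₀ hy.1 hy.2 2) (abs_nonneg _))
    (fun y hy => by
      rw [abs_mul, abs_mul, abs_pow, abs_pow, abs_of_nonneg (sub_nonneg.2 hy.2), abs_of_pos hz]
      exact mul_le_mul_of_nonneg_left
        (pow_le_pow_left₀ (sub_nonneg.2 hy.2) (by linarith [hy.1]) 2) (abs_nonneg _))
  simp only [one_mul] at key
  refine key.unique ?_
  have h2 := (hasSum_hyp01 two_pos (lam * z ^ 2)).mul_left z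
  refine (congrArg (fun F => HasSum F _) (funext fun k => ?_)).mp h2
  have h5 : ∀ ij ∈ Finset.HasAntidiagonal.antidiagonal k, ∫ y in (0 : ℝ)..z,
      (lam * y ^ 2) ^ ij.1 / ((ascPochhammer ℝ ij.1).eval 2 * (ij.1.factorial : ℝ)) *
        ((lam * (z - y) ^ 2) ^ ij.2 / ((ascPochhammer ℝ ij.2).eval 1 * (ij.2.factorial : ℝ))) =
      lam ^ k * z ^ (2 * k + 1) / (2 * k + 1).factorial *
        ((Nat.centralBinom ij.1 : ℝ) / (ij.1 + 1) * Nat.centralBinom ij.2) := by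
    intro ij hij
    rw [Finset.HasAntidiagonal.mem_antidiagonal] at hij
    have h3 := integral_beta (a := (2 * ij.1 : ℕ) + 1) (b := (2 * ij.2 : ℕ) + 1)
      (by positivity) (by positivity) hz
    simp only [add_sub_cancel_right, Real.rpow_natCast] at h3
    have h4 : ∀ y : ℝ,
      (lam * y ^ 2) ^ ij.1 / ((ascPochhammer ℝ ij.1).eval 2 * (ij.1.factorial : ℝ)) *
        ((lam * (z - y) ^ 2) ^ ij.2 / ((ascPochhammer ℝ ij.2).eval 1 * (ij.2.factorial : ℝ))) =
      (lam ^ k / ((ij.1 + 1).factorial * ij.1.factorial * (ij.2.factorial * ij.2.factorial))) *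
        (y ^ (2 * ij.1) * (z - y) ^ (2 * ij.2)) := fun y => by
      simp only [mul_pow, ascPochhammer_eval_two, ascPochhammer_eval_one, ← hij, pow_add,
        ← pow_mul]
      ring
    simp_rw [h4]
    rw [intervalIntegral.integral_const_mul, h3, ProbabilityTheory.beta,
      show ((2 * ij.1 : ℕ) : ℝ) + 1 + ((2 * ij.2 : ℕ) + 1) = ((2 * k + 1 : ℕ) : ℝ) + 1 by
        rw [← hij]; push_cast; ring, add_sub_cancel_right, Real.rpow_natCast,
      Real.Gamma_nat_eq_factorial, Real.Gamma_nat_eq_factorial, Real.Gamma_nat_eq_factorial,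
      Nat.centralBinom_eq_two_mul_choose, Nat.centralBinom_eq_two_mul_choose,
      Nat.cast_choose ℝ (by omega : ij.1 ≤ 2 * ij.1), Nat.cast_choose ℝ (by omega : ij.2 ≤ 2 * ij.2),
      show 2 * ij.1 - ij.1 = ij.1 by omega, show 2 * ij.2 - ij.2 = ij.2 by omega,
      Nat.factorial_succ ij.1]
    push_cast
    field_simp
  rw [Finset.sum_congr rfl h5, ← Finset.mul_sum, sum_catalan_mul_centralBinom,
    Nat.centralBinom_eq_two_mul_choose, Nat.cast_choose ℝ (by omega : k + 1 ≤ 2 * (k + 1)),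
    show 2 * (k + 1) - (k + 1) = k + 1 by omega, ascPochhammer_eval_two,
    show 2 * (k + 1) = (2 * k + 1) + 1 by ring, Nat.factorial_succ (2 * k + 1),
    Nat.factorial_succ k]
  push_cast
  field_simp
  ring

end

section

/-! ### Abel-type integrals: exchange of the order of integration -/

/-- The triangle `y ≤ x ≤ s ≤ e` in the `(s, x)`-plane. -/
def tri (y e : ℝ) : Set (ℝ × ℝ) := {q | y ≤ q.2 ∧ q.2 ≤ q.1 ∧ q.1 ≤ e}

lemma isCompact_tri (y e : ℝ) : IsCompact (tri y e) := by
  have hc : IsClosed (tri y e) :=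
    (isClosed_le continuous_const continuous_snd).inter
      ((isClosed_le continuous_snd continuous_fst).inter
        (isClosed_le continuous_fst continuous_const))
  refine (isCompact_Icc (a := (y, y)) (b := (e, e))).of_isClosed_subset hc ?_
  rintro ⟨s, x⟩ ⟨h1, h2, h3⟩
  simp only at h1 h2 h3
  exact ⟨⟨h1.trans h2, h1⟩, ⟨h3, h2.trans h3⟩⟩

lemma intervalIntegrable_beta' {a b x s : ℝ} (ha : 0 < a) (hb : 0 < b) (hx : x < s) :
    IntervalIntegrable (fun ξ => (ξ - x) ^ (a - 1) * (s - ξ) ^ (b - 1)) volume x s := by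
  have := (intervalIntegrable_beta ha hb (sub_pos.2 hx)).comp_sub_right x
  simpa using this

lemma integral_beta' {a b x s : ℝ} (ha : 0 < a) (hb : 0 < b) (hx : x < s) :
    ∫ ξ in x..s, (ξ - x) ^ (a - 1) * (s - ξ) ^ (b - 1) =
      (s - x) ^ (a + b - 1) * ProbabilityTheory.beta a b := by
  rw [← integral_beta ha hb (sub_pos.2 hx)]
  have := intervalIntegral.integral_comp_sub_right
    (f := fun y => y ^ (a - 1) * (s - x - y) ^ (b - 1)) (a := x) (b := s) x
  simpa using this

section swap

variable {f : ℝ → ℝ} {g : ℝ → ℝ → ℝ} {α β y e : ℝ}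

/-- Integrating the weight over x first gives a multiple of (s - y)^(α+β-1), which is bounded
because α + β ≥ 1; integrability of f then suffices. -/
lemma integrable_abel_weight (hα : 0 < α) (hβ : 0 < β) (hαβ : 1 ≤ α + β)
    (hf : IntegrableOn f (Ioc y e)) :
    Integrable (fun q : ℝ × ℝ => f q.1 *
      (if q.2 < q.1 then (q.2 - y) ^ (β - 1) * (q.1 - q.2) ^ (α - 1) else 0))
      ((volume.restrict (Ioc y e)).prod (volume.restrict (Ioc y e))) := by
  have hmw : Measurable fun q : ℝ × ℝ =>
      (if q.2 < q.1 then (q.2 - y) ^ (β - 1) * (q.1 - q.2) ^ (α - 1) else 0) :=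
    Measurable.ite (measurableSet_lt measurable_snd measurable_fst) (by fun_prop) (by fun_prop)
  have hint : ∀ s ∈ Ioc y e, IntegrableOn (fun x =>
      (if x < s then (x - y) ^ (β - 1) * (s - x) ^ (α - 1) else 0)) (Ioc y e) ∧
      ∫ x in Ioc y e, (if x < s then (x - y) ^ (β - 1) * (s - x) ^ (α - 1) else 0) =
        (s - y) ^ (β + α - 1) * ProbabilityTheory.beta β α := by
    intro s hs
    have e1 : ∀ x, (if x < s then (x - y) ^ (β - 1) * (s - x) ^ (α - 1) else 0) =
        (Iio s).indicator (fun x => (x - y) ^ (β - 1) * (s - x) ^ (α - 1)) x := fun x => by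
      simp [indicator_apply]
    have e2 : Ioc y e ∩ Iio s = Ioo y s := by
      ext x; simp only [mem_inter_iff, mem_Ioc, mem_Iio, mem_Ioo]
      exact ⟨fun h => ⟨h.1.1, h.2⟩, fun h => ⟨⟨h.1, h.2.le.trans hs.2⟩, h.2⟩⟩
    simp_rw [e1]
    constructor
    · rw [IntegrableOn, integrable_indicator_iff measurableSet_Iio, IntegrableOn,
        Measure.restrict_restrict measurableSet_Iio, inter_comm, e2]
      exact ((intervalIntegrable_iff_integrableOn_Ioc_of_le hs.1.le).1
        (intervalIntegrable_beta' hβ hα hs.1)).mono_set Ioo_subset_Ioc_self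
    · rw [setIntegral_indicator measurableSet_Iio, e2, ← integral_Ioc_eq_integral_Ioo,
        ← intervalIntegral.integral_of_le hs.1.le, integral_beta' hβ hα hs.1]
  have hm : AEStronglyMeasurable (fun q : ℝ × ℝ => f q.1 *
      (if q.2 < q.1 then (q.2 - y) ^ (β - 1) * (q.1 - q.2) ^ (α - 1) else 0))
      ((volume.restrict (Ioc y e)).prod (volume.restrict (Ioc y e))) :=
    hf.aestronglyMeasurable.comp_fst.mul hmw.aestronglyMeasurable
  refine (integrable_prod_iff hm).2 ⟨?_, ?_⟩
  · refine (ae_restrict_iff' measurableSet_Ioc).2 (ae_of_all _ fun s hs => ?_)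
    exact (hint s hs).1.const_mul (f s)
  · have hb : IntegrableOn (fun s => ‖f s‖ * ((s - y) ^ (β + α - 1) * ProbabilityTheory.beta β α))
        (Ioc y e) := by
      refine hf.norm.mul_bdd (c := (e - y) ^ (β + α - 1) * ProbabilityTheory.beta β α)
        (Measurable.aestronglyMeasurable (by fun_prop)) ?_
      refine (ae_restrict_iff' measurableSet_Ioc).2 (ae_of_all _ fun s hs => ?_)
      have h1 := (ProbabilityTheory.beta_pos hβ hα).le
      have h2 : 0 ≤ s - y := sub_nonneg.2 hs.1.le
      rw [Real.norm_of_nonneg (by positivity)]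
      refine mul_le_mul_of_nonneg_right (Real.rpow_le_rpow h2 ?_ (by linarith)) h1
      linarith [hs.2]
    refine hb.congr ?_
    refine (ae_restrict_iff' measurableSet_Ioc).2 (ae_of_all _ fun s hs => ?_)
    have h3 : ∀ x ∈ Ioc y e, ‖f s * (if x < s then (x - y) ^ (β - 1) * (s - x) ^ (α - 1) else 0)‖
        = ‖f s‖ * (if x < s then (x - y) ^ (β - 1) * (s - x) ^ (α - 1) else 0) := by
      intro x hx
      rw [norm_mul]
      congr 1
      split_ifs with h
      · have h1 : 0 ≤ x - y := sub_nonneg.2 hx.1.le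
        have h2 : 0 ≤ s - x := sub_nonneg.2 h.le
        exact Real.norm_of_nonneg (by positivity)
      · simp
    simp only
    rw [setIntegral_congr_fun measurableSet_Ioc h3, integral_const_mul, (hint s hs).2]

lemma integrable_abel_kernel (hα : 0 < α) (hβ : 0 < β) (hαβ : 1 ≤ α + β)
    (hf : IntegrableOn f (Ioc y e)) (hg : ContinuousOn (Function.uncurry g) (tri y e)) :
    Integrable (fun q : ℝ × ℝ => if q.2 < q.1 then f q.1 *
      ((q.2 - y) ^ (β - 1) * (q.1 - q.2) ^ (α - 1) * g q.1 q.2) else 0)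
      ((volume.restrict (Ioc y e)).prod (volume.restrict (Ioc y e))) := by
  obtain ⟨K, hK⟩ := (isCompact_tri y e).exists_bound_of_continuousOn hg
  have hgm : AEStronglyMeasurable ((tri y e).indicator (Function.uncurry g))
      ((volume.restrict (Ioc y e)).prod (volume.restrict (Ioc y e))) := by
    rw [aestronglyMeasurable_indicator_iff (isCompact_tri y e).measurableSet]
    exact hg.aestronglyMeasurable (isCompact_tri y e).measurableSet
  have h := (integrable_abel_weight hα hβ hαβ hf).mul_bdd (c := |K|) hgm (ae_of_all _ fun q => by
    by_cases hq : q ∈ tri y e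
    · rw [indicator_of_mem hq]; exact (hK q hq).trans (le_abs_self K)
    · rw [indicator_of_notMem hq]; simp)
  refine h.congr ?_
  rw [Measure.prod_restrict]
  refine (ae_restrict_iff' (measurableSet_Ioc.prod measurableSet_Ioc)).2 (ae_of_all _ ?_)
  rintro ⟨s, x⟩ ⟨hs, hx⟩
  simp only at hs hx ⊢
  split_ifs with hlt
  · rw [indicator_of_mem (show (s, x) ∈ tri y e from ⟨hx.1.le, hlt.le, hs.2⟩)]
    simp only [Function.uncurry]; ring
  · simp

lemma setIntegral_triangle_right (G : ℝ → ℝ) {x : ℝ} (hx : x ∈ Ioc y e) :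
    ∫ s in Ioc y e, (if x < s then G s else 0) = ∫ s in x..e, G s := by
  have e1 : ∀ s, (if x < s then G s else 0) = (Ioi x).indicator G s := fun s => by
    simp [indicator_apply]
  simp_rw [e1]
  rw [setIntegral_indicator measurableSet_Ioi, intervalIntegral.integral_of_le hx.2]
  congr 2
  ext s; simp only [mem_inter_iff, mem_Ioc, mem_Ioi]
  exact ⟨fun h => ⟨h.2, h.1.2⟩, fun h => ⟨⟨hx.1.trans h.1, h.2⟩, h.1⟩⟩

lemma setIntegral_triangle_left (G : ℝ → ℝ) {s : ℝ} (hs : s ∈ Ioc y e) :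
    ∫ x in Ioc y e, (if x < s then G x else 0) = ∫ x in y..s, G x := by
  have e1 : ∀ x, (if x < s then G x else 0) = (Iio s).indicator G x := fun x => by
    simp [indicator_apply]
  simp_rw [e1]
  rw [setIntegral_indicator measurableSet_Iio, intervalIntegral.integral_of_le hs.1.le,
    integral_Ioc_eq_integral_Ioo]
  congr 2
  ext x; simp only [mem_inter_iff, mem_Ioc, mem_Iio, mem_Ioo]
  exact ⟨fun h => ⟨h.1.1, h.2⟩, fun h => ⟨⟨h.1, h.2.le.trans hs.2⟩, h.2⟩⟩

/-- Dirichlet's formula for Abel kernels. -/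
lemma integral_abel_swap (hα : 0 < α) (hβ : 0 < β) (hαβ : 1 ≤ α + β) (hye : y ≤ e)
    (hf : IntegrableOn f (Ioc y e)) (hg : ContinuousOn (Function.uncurry g) (tri y e)) :
    ∫ x in y..e, ∫ s in x..e, f s * ((x - y) ^ (β - 1) * (s - x) ^ (α - 1) * g s x) =
      ∫ s in y..e, f s * ∫ x in y..s, (x - y) ^ (β - 1) * (s - x) ^ (α - 1) * g s x := by
  have key := integral_integral_swap (f := fun s x => if x < s then f s *
    ((x - y) ^ (β - 1) * (s - x) ^ (α - 1) * g s x) else 0) (integrable_abel_kernel hα hβ hαβ hf hg)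
  rw [intervalIntegral.integral_of_le hye, intervalIntegral.integral_of_le hye]
  have h1 : ∀ s ∈ Ioc y e, (∫ x in Ioc y e, if x < s then f s *
      ((x - y) ^ (β - 1) * (s - x) ^ (α - 1) * g s x) else 0) =
      f s * ∫ x in y..s, (x - y) ^ (β - 1) * (s - x) ^ (α - 1) * g s x := fun s hs => by
    rw [setIntegral_triangle_left _ hs, intervalIntegral.integral_const_mul]
  have h2 : ∀ x ∈ Ioc y e, (∫ s in Ioc y e, if x < s then f s *
      ((x - y) ^ (β - 1) * (s - x) ^ (α - 1) * g s x) else 0) =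
      ∫ s in x..e, f s * ((x - y) ^ (β - 1) * (s - x) ^ (α - 1) * g s x) := fun x hx =>
    setIntegral_triangle_right _ hx
  rw [setIntegral_congr_fun measurableSet_Ioc h1, setIntegral_congr_fun measurableSet_Ioc h2] at key
  exact key.symm

lemma integrableOn_abel (hα : 0 < α) (hβ : 0 < β) (hαβ : 1 ≤ α + β)
    (hf : IntegrableOn f (Ioc y e)) (hg : ContinuousOn (Function.uncurry g) (tri y e)) :
    IntegrableOn (fun x => ∫ s in x..e, f s * ((x - y) ^ (β - 1) * (s - x) ^ (α - 1) * g s x))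
      (Ioc y e) := by
  refine (integrable_abel_kernel hα hβ hαβ hf hg).integral_prod_right.congr ?_
  refine (ae_restrict_iff' measurableSet_Ioc).2 (ae_of_all _ fun x hx => ?_)
  exact setIntegral_triangle_right _ hx

/-- Dirichlet's formula with a single Abel singularity. -/
lemma integral_abel_swap_one (hα : 0 < α) (hye : y ≤ e)
    (hf : IntegrableOn f (Ioc y e)) (hg : ContinuousOn (Function.uncurry g) (tri y e)) :
    ∫ x in y..e, ∫ s in x..e, f s * ((s - x) ^ (α - 1) * g s x) =
      ∫ s in y..e, f s * ∫ x in y..s, (s - x) ^ (α - 1) * g s x := by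
  simpa using integral_abel_swap hα one_pos (by linarith) hye hf hg

lemma integrableOn_abel_one (hα : 0 < α)
    (hf : IntegrableOn f (Ioc y e)) (hg : ContinuousOn (Function.uncurry g) (tri y e)) :
    IntegrableOn (fun x => ∫ s in x..e, f s * ((s - x) ^ (α - 1) * g s x)) (Ioc y e) := by
  simpa using integrableOn_abel hα one_pos (by linarith) hf hg

end swap

end

section

/-! ### Abel-type integrals: integrability, continuity, differentiability -/

section abel

variable {f : ℝ → ℝ} {α x₀ e : ℝ}

/-- Near x the function f is continuous and the power is integrable; near e the power is continuous
and f is integrable. No bound on f at e is needed. -/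
lemma intervalIntegrable_abel (hα : 0 < α) {x : ℝ} (hx : x ∈ Ioo x₀ e)
    (hf : ContinuousOn f (Ioo x₀ e)) (hfi : IntegrableOn f (Ioc x₀ e)) {g : ℝ → ℝ}
    (hg : ContinuousOn g (Icc x e)) :
    IntervalIntegrable (fun s => f s * ((s - x) ^ (α - 1) * g s)) volume x e := by
  obtain ⟨c, hc⟩ := exists_between hx.2
  refine IntervalIntegrable.trans (b := c) ?_ ?_
  · have h1 : ContinuousOn (fun s => f s * g s) (uIcc x c) := by
      rw [uIcc_of_le hc.1.le]
      exact (hf.mono fun s hs => ⟨hx.1.trans_le hs.1, hs.2.trans_lt hc.2⟩).mul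
        (hg.mono (Icc_subset_Icc_right hc.2.le))
    refine ((intervalIntegrable_sub_rpow hα x x c).mul_continuousOn h1).congr ?_
    exact fun s _ => by ring
  · have h1 : IntervalIntegrable f volume c e :=
      (intervalIntegrable_iff_integrableOn_Ioc_of_le hc.2.le).2
        (hfi.mono_set (Ioc_subset_Ioc_left (hx.1.trans hc.1).le))
    refine h1.mul_continuousOn ?_
    rw [uIcc_of_le hc.2.le]
    refine ContinuousOn.mul (ContinuousOn.rpow_const (by fun_prop) fun s hs => Or.inl ?_)
      (hg.mono (Icc_subset_Icc_left hc.1.le))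
    linarith [hs.1, hc.1]

/-- Both the lower limit and the singularity move with w. Up to a fixed c the substitution s = X w +
τ(c - X w) fixes them at τ = 0; beyond c the power is bounded and |f| dominates. The parameter space
is left general because one and two variables are needed. -/
lemma continuousAt_abel {P : Type*} [TopologicalSpace P] [FirstCountableTopology P]
    [LocallyCompactSpace P] (hα : 0 < α) {X : P → ℝ} (hX : Continuous X) {O : Set P}
    (hO : IsOpen O) {z : P} (hz : z ∈ O) (hxz : X z ∈ Ioo x₀ e)
    (hf : ContinuousOn f (Ioo x₀ e)) (hfi : IntegrableOn f (Ioc x₀ e)) {g : ℝ → P → ℝ}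
    (hg : ContinuousOn (Function.uncurry g) {q | q.2 ∈ O ∧ X q.2 ≤ q.1 ∧ q.1 ≤ e}) :
    ContinuousAt (fun w => ∫ s in X w..e, f s * ((s - X w) ^ (α - 1) * g s w)) z := by
  obtain ⟨c, hc⟩ := exists_between hxz.2
  obtain ⟨x₂, hx₂⟩ := exists_between hc.1
  obtain ⟨x₁, hx₁⟩ := exists_between hxz.1
  -- On K the point X w stays in (x₁, x₂) with x₂ < c. Hence f is bounded on [x₁, c], and s - X w
  -- stays away from 0 for s ≥ c.
  obtain ⟨K, hKc, hK, hKsub⟩ := exists_compact_subset (hO.inter (isOpen_Ioo.preimage hX))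
    (show z ∈ O ∩ X ⁻¹' Ioo x₁ x₂ from ⟨hz, hx₁.2, hx₂.1⟩)
  have hKn : K ∈ 𝓝 z := mem_interior_iff_mem_nhds.1 hK
  have hsub : ∀ q : ℝ × P, q.2 ∈ K → X q.2 ≤ q.1 → q.1 ≤ e →
      q ∈ {q : ℝ × P | q.2 ∈ O ∧ X q.2 ≤ q.1 ∧ q.1 ≤ e} := fun q h1 h2 h3 =>
    ⟨(hKsub h1).1, h2, h3⟩
  obtain ⟨G, hG⟩ : ∃ G, ∀ q : ℝ × P, q.2 ∈ K → X q.2 ≤ q.1 → q.1 ≤ e →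
      ‖Function.uncurry g q‖ ≤ G := by
    have hcomp : IsCompact ((Icc x₁ e ×ˢ K) ∩ {q : ℝ × P | X q.2 ≤ q.1}) :=
      (isCompact_Icc.prod hKc).inter_right (isClosed_le (by fun_prop) (by fun_prop))
    obtain ⟨G, hG⟩ := hcomp.exists_bound_of_continuousOn
      (hg.mono fun q hq => hsub q hq.1.2 hq.2 hq.1.1.2)
    exact ⟨G, fun q h1 h2 h3 => hG q ⟨⟨⟨(hKsub h1).2.1.le.trans h2, h3⟩, h1⟩, h2⟩⟩
  obtain ⟨Mf, hMf⟩ := isCompact_Icc.exists_bound_of_continuousOn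
    (hf.mono fun s (hs : s ∈ Icc x₁ c) => ⟨hx₁.1.trans_le hs.1, hs.2.trans_lt hc.2⟩)
  have hgs : ∀ w ∈ K, ContinuousOn (fun s => g s w) (Icc (X w) e) := fun w hw =>
    hg.comp (f := fun s => (s, w)) (by fun_prop) fun s hs => hsub (s, w) hw hs.1 hs.2
  have hgat : ∀ s ∈ Ioo (X z) e, ContinuousAt (Function.uncurry g) (s, z) := by
    intro s hs
    refine hg.continuousAt (mem_nhds_iff.2 ⟨{q : ℝ × P | q.2 ∈ O ∧ X q.2 < q.1 ∧ q.1 < e},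
      fun q hq => ⟨hq.1, hq.2.1.le, hq.2.2.le⟩, ?_, ⟨hz, hs.1, hs.2⟩⟩)
    exact (hO.preimage continuous_snd).inter ((isOpen_lt (hX.comp continuous_snd)
      continuous_fst).inter (isOpen_lt continuous_fst continuous_const))
  have hKX : ∀ w ∈ K, X w ∈ Ioo x₁ x₂ := fun w hw => (hKsub hw).2
  have hsplit : ∀ w ∈ K, ∫ s in X w..e, f s * ((s - X w) ^ (α - 1) * g s w) =
      (c - X w) * ((c - X w) ^ (α - 1) * ∫ τ in (0 : ℝ)..1, f (X w + τ * (c - X w)) *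
        (τ ^ (α - 1) * g (X w + τ * (c - X w)) w)) +
      ∫ s in c..e, f s * ((s - X w) ^ (α - 1) * g s w) := by
    intro w hw
    have hXw := hKX w hw
    have hlt : X w < c := hXw.2.trans hx₂.2
    have hint := intervalIntegrable_abel hα (x := X w) ⟨hx₁.1.trans hXw.1, hlt.trans hc.2⟩ hf hfi
      (hgs w hw)
    rw [← intervalIntegral.integral_add_adjacent_intervals
      (hint.mono_set (c := X w) (d := c) (by
        rw [uIcc_of_le hlt.le, uIcc_of_le (hlt.trans hc.2).le]
        exact Icc_subset_Icc_right hc.2.le))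
      (hint.mono_set (by
        rw [uIcc_of_le hc.2.le, uIcc_of_le (hlt.trans hc.2).le]
        exact Icc_subset_Icc_left hlt.le))]
    congr 1
    have hs := intervalIntegral.smul_integral_comp_add_mul (a := 0) (b := 1)
      (fun s => f s * ((s - X w) ^ (α - 1) * g s w)) (c - X w) (X w)
    simp only [mul_zero, add_zero, mul_one, add_sub_cancel, smul_eq_mul] at hs
    rw [← hs]
    congr 1
    rw [← intervalIntegral.integral_const_mul]
    refine intervalIntegral.integral_congr fun τ hτ => ?_
    rw [uIcc_of_le zero_le_one] at hτ
    simp only [add_sub_cancel_left]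
    rw [mul_comm (c - X w) τ, Real.mul_rpow hτ.1 (sub_nonneg.2 hlt.le)]
    ring
  have hev : ∀ᶠ w in 𝓝 z, w ∈ K := hKn
  refine ContinuousAt.congr ?_ (hev.mono fun w hw => (hsplit w hw).symm)
  have hpos : c - X z ≠ 0 := (sub_pos.2 hc.1).ne'
  have hmem : ∀ w ∈ K, ∀ τ ∈ Ioc (0 : ℝ) 1, X w + τ * (c - X w) ∈ Ioc (X w) c := by
    intro w hw τ hτ
    have hlt : 0 < c - X w := sub_pos.2 ((hKX w hw).2.trans hx₂.2)
    constructor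
    · nlinarith [hτ.1]
    · nlinarith [hτ.2]
  refine ContinuousAt.add (ContinuousAt.mul (by fun_prop) (ContinuousAt.mul
    (ContinuousAt.rpow_const (by fun_prop) (Or.inl hpos)) ?_)) ?_
  · refine intervalIntegral.continuousAt_of_dominated_interval
      (bound := fun τ => Mf * (τ ^ (α - 1) * G)) ?_ ?_ ?_ ?_
    · refine hev.mono fun w hw => ?_
      rw [uIoc_of_le zero_le_one]
      have hco : ContinuousOn (fun τ : ℝ => X w + τ * (c - X w)) (Ioc 0 1) := by fun_prop
      refine ContinuousOn.aestronglyMeasurable ?_ measurableSet_Ioc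
      refine ContinuousOn.mul (hf.comp hco fun τ hτ => ?_) (ContinuousOn.mul
        (ContinuousOn.rpow_const continuousOn_id fun τ hτ => Or.inl hτ.1.ne')
        ((hgs w hw).comp hco fun τ hτ => ?_))
      · have := hmem w hw τ hτ
        exact ⟨(hx₁.1.trans (hKX w hw).1).trans this.1, this.2.trans_lt hc.2⟩
      · have := hmem w hw τ hτ
        exact ⟨this.1.le, this.2.trans hc.2.le⟩
    · refine hev.mono fun w hw => ae_of_all _ fun τ hτ => ?_
      rw [uIoc_of_le zero_le_one] at hτ
      have hm := hmem w hw τ hτ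
      have h1 := hMf _ (⟨((hKX w hw).1.trans hm.1).le, hm.2⟩ : _ ∈ Icc x₁ c)
      have h2 := hG (X w + τ * (c - X w), w) hw hm.1.le (hm.2.trans hc.2.le)
      rw [norm_mul, norm_mul, Real.norm_of_nonneg (Real.rpow_nonneg hτ.1.le _)]
      refine mul_le_mul h1 (mul_le_mul_of_nonneg_left h2 (Real.rpow_nonneg hτ.1.le _))
        (mul_nonneg (Real.rpow_nonneg hτ.1.le _) (norm_nonneg _)) ((norm_nonneg _).trans h1)
    · exact ((intervalIntegral.intervalIntegrable_rpow' (by linarith)).mul_const _).const_mul _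
    · refine ae_of_all _ fun τ hτ => ?_
      rw [uIoc_of_le zero_le_one] at hτ
      have hm := hmem z (mem_of_mem_nhds hKn) τ hτ
      have hco : ContinuousAt (fun w : P => X w + τ * (c - X w)) z := by fun_prop
      have hfc : ContinuousAt f (X z + τ * (c - X z)) :=
        hf.continuousAt (Ioo_mem_nhds (hxz.1.trans hm.1) (hm.2.trans_lt hc.2))
      have hgc := hgat _ ⟨hm.1, hm.2.trans_lt hc.2⟩
      exact (ContinuousAt.comp (f := fun w : P => X w + τ * (c - X w)) hfc hco).mul
        (continuousAt_const.mul (ContinuousAt.comp (f := fun w : P => (X w + τ * (c - X w), w)) hgc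
          (hco.prodMk continuousAt_id)))
  · have hb : ∃ Mp, ∀ q ∈ Icc c e ×ˢ Icc x₁ x₂, ‖(q.1 - q.2) ^ (α - 1)‖ ≤ Mp := by
      refine (isCompact_Icc.prod isCompact_Icc).exists_bound_of_continuousOn
        (ContinuousOn.rpow_const (by fun_prop) fun q hq => Or.inl ?_)
      linarith [hq.1.1, hq.2.2, hx₂.2]
    obtain ⟨Mp, hMp⟩ := hb
    have hfc : IntegrableOn f (Ioc c e) :=
      hfi.mono_set (Ioc_subset_Ioc_left (hxz.1.trans hc.1).le)
    refine intervalIntegral.continuousAt_of_dominated_interval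
      (bound := fun s => ‖f s‖ * (Mp * G)) ?_ ?_ ?_ ?_
    · refine hev.mono fun w hw => ?_
      rw [uIoc_of_le hc.2.le]
      refine hfc.aestronglyMeasurable.mul (ContinuousOn.aestronglyMeasurable ?_ measurableSet_Ioc)
      refine ContinuousOn.mul (ContinuousOn.rpow_const (by fun_prop) fun s hs => Or.inl ?_)
        ((hgs w hw).mono fun s hs => ⟨((hKX w hw).2.trans (hx₂.2.trans hs.1)).le, hs.2⟩)
      linarith [(hKX w hw).2, hx₂.2, hs.1]
    · refine hev.mono fun w hw => ae_of_all _ fun s hs => ?_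
      rw [uIoc_of_le hc.2.le] at hs
      have h1 := hMp (s, X w) ⟨⟨hs.1.le, hs.2⟩, (hKX w hw).1.le, (hKX w hw).2.le⟩
      have h2 := hG (s, w) hw ((hKX w hw).2.trans (hx₂.2.trans hs.1)).le hs.2
      rw [norm_mul, norm_mul]
      exact mul_le_mul_of_nonneg_left (mul_le_mul h1 h2 (norm_nonneg _)
        ((norm_nonneg _).trans h1)) (norm_nonneg _)
    · exact ((intervalIntegrable_iff_integrableOn_Ioc_of_le hc.2.le).2 hfc).norm.mul_const _
    · have hne : ∀ᵐ s : ℝ, s ≠ e := by simp [ae_iff]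
      filter_upwards [hne] with s hse hs
      rw [uIoc_of_le hc.2.le] at hs
      have hgc := hgat s ⟨hc.1.trans hs.1, lt_of_le_of_ne hs.2 hse⟩
      refine continuousAt_const.mul (ContinuousAt.mul (ContinuousAt.rpow_const (by fun_prop)
        (Or.inl ?_)) (ContinuousAt.comp (f := fun w : P => (s, w)) hgc (by fun_prop)))
      linarith [hc.1, hs.1]

/-- Since κ vanishes on the diagonal, κ(s,y) is the integral of -∂κ over (y,s), and Dirichlet's
formula applies. The result exhibits the integral as a primitive. -/
lemma integral_kernel_eq (hα : 0 < α) {y : ℝ} (hye : y ≤ e)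
    (hfi : IntegrableOn f (Ioc y e)) {κ g : ℝ → ℝ → ℝ}
    (hg : ContinuousOn (Function.uncurry g) (tri y e))
    (hκc : ∀ s ∈ Ioo y e, ContinuousOn (κ s) (Icc y s))
    (hκ : ∀ s ∈ Ioo y e, ∀ x ∈ Ioo y s, HasDerivAt (κ s) (-((s - x) ^ (α - 1) * g s x)) x)
    (hκ0 : ∀ s ∈ Ioo y e, κ s s = 0) :
    ∫ s in y..e, f s * κ s y = ∫ x in y..e, ∫ s in x..e, f s * ((s - x) ^ (α - 1) * g s x) := by
  rw [integral_abel_swap_one hα hye hfi hg]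
  refine intervalIntegral.integral_congr_ae ?_
  have hne : ∀ᵐ s : ℝ, s ≠ e := by simp [ae_iff]
  filter_upwards [hne] with s hse hs
  rw [uIoc_of_le hye] at hs
  have hs' : s ∈ Ioo y e := ⟨hs.1, lt_of_le_of_ne hs.2 hse⟩
  have hgs : ContinuousOn (fun x => g s x) (Icc y s) :=
    hg.comp (f := fun x => (s, x)) (by fun_prop) fun x hx => ⟨hx.1, hx.2, hs.2⟩
  have hi : IntervalIntegrable (fun x => (s - x) ^ (α - 1) * g s x) volume y s :=
    (intervalIntegrable_rpow_sub hα s y s).mul_continuousOn (by rwa [uIcc_of_le hs.1.le])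
  have := intervalIntegral.integral_eq_sub_of_hasDerivAt_of_le hs.1.le (hκc s hs') (hκ s hs') hi.neg
  rw [intervalIntegral.integral_neg, hκ0 s hs'] at this
  have e2 : ∫ x in y..s, (s - x) ^ (α - 1) * g s x = κ s y := by linarith
  rw [e2]

lemma hasDerivAt_integral_left {A : ℝ → ℝ} (hA : ContinuousOn A (Ioo x₀ e)) {x : ℝ}
    (hx : x ∈ Ioo x₀ e) (hAi : IntegrableOn A (Ioc x e)) :
    HasDerivAt (fun y => ∫ t in y..e, A t) (-A x) x :=
  intervalIntegral.integral_hasDerivAt_left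
    ((intervalIntegrable_iff_integrableOn_Ioc_of_le hx.2.le).2 hAi)
    (hA.stronglyMeasurableAtFilter isOpen_Ioo x hx)
    (hA.continuousAt (Ioo_mem_nhds hx.1 hx.2))

lemma continuousOn_abel (hα : 0 < α)
    (hf : ContinuousOn f (Ioo x₀ e)) (hfi : IntegrableOn f (Ioc x₀ e)) {g : ℝ → ℝ → ℝ}
    (hg : ContinuousOn (Function.uncurry g) {q | x₀ < q.2 ∧ q.2 ≤ q.1 ∧ q.1 ≤ e}) :
    ContinuousOn (fun x => ∫ s in x..e, f s * ((s - x) ^ (α - 1) * g s x)) (Ioo x₀ e) :=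
  fun _ hx => (continuousAt_abel hα continuous_id (isOpen_Ioi (a := x₀)) hx.1 hx hf hfi
    hg).continuousWithinAt

/-- By `integral_kernel_eq` the function is a primitive of a continuous one, so the fundamental
theorem of calculus replaces differentiation under a singular integral. -/
lemma hasDerivAt_abel (hα : 0 < α)
    (hf : ContinuousOn f (Ioo x₀ e)) (hfi : IntegrableOn f (Ioc x₀ e)) {κ g : ℝ → ℝ → ℝ}
    (hg : ContinuousOn (Function.uncurry g) {q | x₀ < q.2 ∧ q.2 ≤ q.1 ∧ q.1 ≤ e})
    (hκc : ∀ s ∈ Ioo x₀ e, ContinuousOn (κ s) (Ioc x₀ s))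
    (hκ : ∀ s ∈ Ioo x₀ e, ∀ x ∈ Ioo x₀ s, HasDerivAt (κ s) (-((s - x) ^ (α - 1) * g s x)) x)
    (hκ0 : ∀ s ∈ Ioo x₀ e, κ s s = 0) {x : ℝ} (hx : x ∈ Ioo x₀ e) :
    HasDerivAt (fun x => ∫ s in x..e, f s * κ s x)
      (-∫ s in x..e, f s * ((s - x) ^ (α - 1) * g s x)) x := by
  have htri : ∀ y ∈ Ioo x₀ e, ContinuousOn (Function.uncurry g) (tri y e) := fun y hy =>
    hg.mono fun q hq => ⟨hy.1.trans_le hq.1, hq.2.1, hq.2.2⟩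
  have hfy : ∀ y ∈ Ioo x₀ e, IntegrableOn f (Ioc y e) := fun y hy =>
    hfi.mono_set (Ioc_subset_Ioc_left hy.1.le)
  have h := hasDerivAt_integral_left (continuousOn_abel hα hf hfi hg) hx
    (integrableOn_abel_one hα (hfy x hx) (htri x hx))
  refine h.congr_of_eventuallyEq ?_
  filter_upwards [Ioo_mem_nhds hx.1 hx.2] with y hy
  exact integral_kernel_eq hα hy.2.le (hfy y hy) (htri y hy)
    (fun s hs => (hκc s ⟨hy.1.trans hs.1, hs.2⟩).mono fun t ht => ⟨hy.1.trans_le ht.1, ht.2⟩)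
    (fun s hs t ht => hκ s ⟨hy.1.trans hs.1, hs.2⟩ t ⟨hy.1.trans ht.1, ht.2⟩)
    (fun s hs => hκ0 s ⟨hy.1.trans hs.1, hs.2⟩)

end abel

end

section

/-! ### Injectivity of Abel-type operators -/

/-- Gronwall's argument run backwards from h: exp(Cy) ∫_y^h |f| is nondecreasing and nonnegative,
and it vanishes at h. -/
lemma eq_zero_of_abs_le_integral {f : ℝ → ℝ} {a h C : ℝ} (hf : ContinuousOn f (Ioo a h))
    (hfi : IntegrableOn f (Ioc a h))
    (hC : ∀ y ∈ Ioo a h, |f y| ≤ C * ∫ s in y..h, |f s|) {y : ℝ} (hy : y ∈ Ioo a h) :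
    f y = 0 := by
  have hfi' : ∀ x ∈ Ioo a h, IntegrableOn (fun s => |f s|) (Ioc x h) := fun x hx =>
    IntegrableOn.mono_set (t := Ioc a h) hfi.abs (Ioc_subset_Ioc_left hx.1.le)
  have hd : ∀ x ∈ Ioo a h, HasDerivAt (fun y => Real.exp (C * y) * ∫ s in y..h, |f s|)
      (Real.exp (C * x) * (C * (∫ s in x..h, |f s|) - |f x|)) x := by
    intro x hx
    have h1 := hasDerivAt_integral_left hf.abs hx (hfi' x hx)
    have h2 : HasDerivAt (fun y => Real.exp (C * y)) (Real.exp (C * x) * C) x := by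
      simpa using ((hasDerivAt_id x).const_mul C).exp
    exact (h2.mul h1).congr_deriv (by ring)
  have hcont : ContinuousOn (fun y => Real.exp (C * y) * ∫ s in y..h, |f s|) (Icc y h) := by
    refine ContinuousOn.mul (by fun_prop) ?_
    have h3 : IntegrableOn (fun s => |f s|) (uIcc h y) := by
      rw [uIcc_of_ge hy.2.le, integrableOn_Icc_iff_integrableOn_Ioc]
      exact hfi' y hy
    have h4 := intervalIntegral.continuousOn_primitive_interval h3
    rw [uIcc_of_ge hy.2.le] at h4
    refine h4.neg.congr fun x _ => ?_
    exact (intervalIntegral.integral_symm _ _)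
  have hmono : MonotoneOn (fun y => Real.exp (C * y) * ∫ s in y..h, |f s|) (Icc y h) := by
    refine monotoneOn_of_deriv_nonneg (convex_Icc _ _) hcont ?_ ?_
    · rw [interior_Icc]
      exact fun x hx => (hd x ⟨hy.1.trans hx.1, hx.2⟩).differentiableAt.differentiableWithinAt
    · rw [interior_Icc]
      intro x hx
      have hx' : x ∈ Ioo a h := ⟨hy.1.trans hx.1, hx.2⟩
      rw [(hd x hx').deriv]
      exact mul_nonneg (Real.exp_pos _).le (sub_nonneg.2 (hC x hx'))
  have h5 := hmono (left_mem_Icc.2 hy.2.le) (right_mem_Icc.2 hy.2.le) hy.2.le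
  simp only [intervalIntegral.integral_same, mul_zero] at h5
  have h6 : ∫ s in y..h, |f s| ≤ 0 := by
    by_contra hcon
    push Not at hcon
    exact absurd h5 (not_le.2 (mul_pos (Real.exp_pos _) hcon))
  have h7 : 0 ≤ ∫ s in y..h, |f s| :=
    intervalIntegral.integral_nonneg hy.2.le fun _ _ => abs_nonneg _
  have h8 : ∫ s in y..h, |f s| = 0 := le_antisymm h6 h7
  have := hC y hy
  rw [h8, mul_zero] at this
  exact abs_nonpos_iff.1 this

lemma exists_lipschitz_of_contDiff {k : ℝ → ℝ → ℝ} (hk : ContDiff ℝ 1 (Function.uncurry k))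
    (a b : ℝ) : ∃ L, 0 ≤ L ∧ ∀ s ∈ Icc a b, ∀ x ∈ Icc a b, ∀ x' ∈ Icc a b,
      |k s x - k s x'| ≤ L * |x - x'| := by
  obtain ⟨L, hL⟩ := (isCompact_Icc.prod isCompact_Icc : IsCompact (Icc a b ×ˢ Icc a b))
    |>.exists_bound_of_continuousOn (hk.continuous_fderiv one_ne_zero).continuousOn
  refine ⟨|L|, abs_nonneg _, fun s hs x hx x' hx' => ?_⟩
  have h := ((convex_Icc a b).prod (convex_Icc a b)).norm_image_sub_le_of_norm_fderiv_le
    (f := Function.uncurry k) (𝕜 := ℝ)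
    (fun q _ => (hk.differentiable one_ne_zero).differentiableAt)
    (fun q hq => (hL q hq).trans (le_abs_self L))
    (show (s, x') ∈ Icc a b ×ˢ Icc a b from ⟨hs, hx'⟩) (show (s, x) ∈ _ from ⟨hs, hx⟩)
  simpa [Function.uncurry, Prod.norm_def, Real.norm_eq_abs] using h

/-- The inner integral arising from the composition of two Abel kernels. -/
def abelInner (β α : ℝ) (k : ℝ → ℝ → ℝ) (s y : ℝ) : ℝ :=
  ∫ τ in (0 : ℝ)..1, τ ^ (β - 1) * (1 - τ) ^ (α - 1) * k s (y + τ * (s - y))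

section inner

variable {α β : ℝ} {k : ℝ → ℝ → ℝ}

/-- Scaling by x = y + τ(s - y) pulls the power out; for α + β = 1 no singular factor remains. -/
lemma integral_eq_abelInner (k : ℝ → ℝ → ℝ) {y s : ℝ} (hys : y < s) :
    ∫ x in y..s, (x - y) ^ (β - 1) * (s - x) ^ (α - 1) * k s x =
      (s - y) ^ (β + α - 1) * abelInner β α k s y := by
  have hpos : 0 < s - y := sub_pos.2 hys
  have hs := intervalIntegral.smul_integral_comp_add_mul (a := 0) (b := 1)
    (fun x => (x - y) ^ (β - 1) * (s - x) ^ (α - 1) * k s x) (s - y) y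
  simp only [mul_zero, add_zero, mul_one, add_sub_cancel, smul_eq_mul] at hs
  have hpow : (s - y) ^ (β + α - 1) = (s - y) * ((s - y) ^ (β - 1) * (s - y) ^ (α - 1)) := by
    rw [show β + α - 1 = 1 + ((β - 1) + (α - 1)) by ring, Real.rpow_add hpos, Real.rpow_one,
      Real.rpow_add hpos]
  rw [← hs, abelInner, hpow, mul_assoc]
  congr 1
  rw [← intervalIntegral.integral_const_mul]
  refine intervalIntegral.integral_congr fun τ hτ => ?_
  rw [uIcc_of_le zero_le_one] at hτ
  have e1 : y + (s - y) * τ - y = (s - y) * τ := by ring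
  have e2 : s - (y + (s - y) * τ) = (s - y) * (1 - τ) := by ring
  simp only [e1, e2]
  rw [Real.mul_rpow hpos.le hτ.1, Real.mul_rpow hpos.le (sub_nonneg.2 hτ.2), mul_comm (s - y) τ]
  ring

lemma intervalIntegrable_abelInner (hα : 0 < α) (hβ : 0 < β)
    (hk : Continuous (Function.uncurry k)) (s y : ℝ) :
    IntervalIntegrable (fun τ => τ ^ (β - 1) * (1 - τ) ^ (α - 1) * k s (y + τ * (s - y)))
      volume 0 1 :=
  (intervalIntegrable_beta hβ hα one_pos).mul_continuousOn
    (hk.comp (by fun_prop : Continuous fun τ : ℝ => (s, y + τ * (s - y)))).continuousOn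

lemma abs_abelInner_sub_le (hα : 0 < α) (hβ : 0 < β) (hk : Continuous (Function.uncurry k))
    {k' : ℝ → ℝ → ℝ} (hk' : Continuous (Function.uncurry k')) {s s' y y' M : ℝ}
    (hM : ∀ τ ∈ Icc (0 : ℝ) 1, |k s (y + τ * (s - y)) - k' s' (y' + τ * (s' - y'))| ≤ M) :
    |abelInner β α k s y - abelInner β α k' s' y'| ≤ ProbabilityTheory.beta β α * M := by
  rw [abelInner, abelInner, ← intervalIntegral.integral_sub
    (intervalIntegrable_abelInner hα hβ hk s y) (intervalIntegrable_abelInner hα hβ hk' s' y')]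
  have hb := integral_beta hβ hα one_pos
  rw [Real.one_rpow, one_mul] at hb
  rw [← hb, ← intervalIntegral.integral_mul_const, ← Real.norm_eq_abs]
  refine intervalIntegral.norm_integral_le_of_norm_le zero_le_one ?_
    ((intervalIntegrable_beta hβ hα one_pos).mul_const M)
  refine ae_of_all _ fun τ hτ => ?_
  rw [← mul_sub, norm_mul, Real.norm_eq_abs (_ - _), Real.norm_of_nonneg]
  · exact mul_le_mul_of_nonneg_left (hM τ ⟨hτ.1.le, hτ.2⟩) (mul_nonneg
      (Real.rpow_nonneg hτ.1.le _) (Real.rpow_nonneg (sub_nonneg.2 hτ.2) _))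
  · exact mul_nonneg (Real.rpow_nonneg hτ.1.le _) (Real.rpow_nonneg (sub_nonneg.2 hτ.2) _)

lemma continuous_abelInner (hα : 0 < α) (hβ : 0 < β) (hk : Continuous (Function.uncurry k))
    (y : ℝ) : Continuous fun s => abelInner β α k s y := by
  rw [continuous_iff_continuousAt]
  intro s₀
  obtain ⟨K, hK⟩ := (isCompact_Icc.prod isCompact_Icc :
    IsCompact (Icc (s₀ - 1) (s₀ + 1) ×ˢ Icc (0 : ℝ) 1)).exists_bound_of_continuousOn
    (f := fun q : ℝ × ℝ => k q.1 (y + q.2 * (q.1 - y)))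
    (hk.comp (by fun_prop : Continuous fun q : ℝ × ℝ => (q.1, y + q.2 * (q.1 - y)))).continuousOn
  refine intervalIntegral.continuousAt_of_dominated_interval
    (bound := fun τ => τ ^ (β - 1) * (1 - τ) ^ (α - 1) * K) ?_ ?_ ?_ ?_
  · exact Eventually.of_forall fun s =>
      (intervalIntegrable_abelInner hα hβ hk s y).aestronglyMeasurable_restrict_uIoc
  · filter_upwards [Icc_mem_nhds (show s₀ - 1 < s₀ by linarith) (show s₀ < s₀ + 1 by linarith)]
      with s hs
    refine ae_of_all _ fun τ hτ => ?_
    rw [uIoc_of_le zero_le_one] at hτ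
    have hn : 0 ≤ τ ^ (β - 1) * (1 - τ) ^ (α - 1) :=
      mul_nonneg (Real.rpow_nonneg hτ.1.le _) (Real.rpow_nonneg (sub_nonneg.2 hτ.2) _)
    rw [norm_mul, Real.norm_of_nonneg hn]
    exact mul_le_mul_of_nonneg_left (hK (s, τ) ⟨hs, hτ.1.le, hτ.2⟩) hn
  · exact (intervalIntegrable_beta hβ hα one_pos).mul_const K
  · refine ae_of_all _ fun τ _ => ?_
    exact continuousAt_const.mul
      (hk.comp (by fun_prop : Continuous fun s : ℝ => (s, y + τ * (s - y)))).continuousAt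

end inner

/-- Injectivity of a weakly singular Volterra operator of the first kind. -/
lemma eq_zero_of_abel_eq_zero {f : ℝ → ℝ} {α h k₀ : ℝ} (hα : 0 < α) (hα1 : α < 1)
    (hf : ContinuousOn f (Ioo 0 h)) (hfi : IntegrableOn f (Ioc 0 h)) {k : ℝ → ℝ → ℝ}
    (hk : ContDiff ℝ 1 (Function.uncurry k)) (hk₀ : k₀ ≠ 0) (hkd : ∀ s ∈ Ioo 0 h, k s s = k₀)
    (h0 : ∀ x ∈ Ioo 0 h, ∫ s in x..h, f s * ((s - x) ^ (α - 1) * k s x) = 0)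
    {y : ℝ} (hy : y ∈ Ioo 0 h) : f y = 0 := by
  have hβ : 0 < 1 - α := by linarith
  have hkc := hk.continuous
  set B := ProbabilityTheory.beta (1 - α) α with hB
  have hBpos : 0 < B := ProbabilityTheory.beta_pos hβ hα
  obtain ⟨L, hL0, hL⟩ := exists_lipschitz_of_contDiff hk 0 h
  set κ := abelInner (1 - α) α k with hκ
  have hfy : ∀ y ∈ Ioo 0 h, IntegrableOn f (Ioc y h) := fun y hy =>
    hfi.mono_set (Ioc_subset_Ioc_left hy.1.le)
  -- Abel's device: integrate the equation against (x - y)^(-α). The iterated kernel κ is no longer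
  -- singular and takes the value B k₀ ≠ 0 on the diagonal.
  have hΦ : ∀ y ∈ Ioo 0 h, ∫ s in y..h, f s * κ s y = 0 := by
    intro y hy
    have hsw := integral_abel_swap (g := k) hα hβ (by linarith) hy.2.le (hfy y hy) hkc.continuousOn
    have h1 : ∫ x in y..h, ∫ s in x..h, f s * ((x - y) ^ (1 - α - 1) * (s - x) ^ (α - 1) * k s x)
        = 0 := by
      rw [intervalIntegral.integral_of_le hy.2.le, integral_Ioc_eq_integral_Ioo]
      rw [setIntegral_congr_fun (g := fun _ => (0 : ℝ)) measurableSet_Ioo, integral_zero]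
      intro x hx
      have e1 : ∀ s, f s * ((x - y) ^ (1 - α - 1) * (s - x) ^ (α - 1) * k s x) =
          (x - y) ^ (1 - α - 1) * (f s * ((s - x) ^ (α - 1) * k s x)) := fun s => by ring
      simp only [e1]
      rw [intervalIntegral.integral_const_mul, h0 x ⟨hy.1.trans hx.1, hx.2⟩, mul_zero]
    rw [h1] at hsw
    rw [hsw]
    refine intervalIntegral.integral_congr_ae (ae_of_all _ fun s hs => ?_)
    rw [uIoc_of_le hy.2.le] at hs
    rw [integral_eq_abelInner k hs.1]
    simp [hκ]
  have hconst : ∀ s y, abelInner (1 - α) α (fun _ _ => k₀) s y = B * k₀ := fun s y => by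
    have hb := integral_beta hβ hα one_pos
    rw [Real.one_rpow, one_mul] at hb
    rw [abelInner, intervalIntegral.integral_mul_const, hb]
  have hmem : ∀ {s y τ : ℝ}, y ∈ Ioo 0 h → y ≤ s → s ≤ h → τ ∈ Icc (0 : ℝ) 1 →
      y + τ * (s - y) ∈ Icc 0 h := by
    intro s y τ hy hys hsh hτ
    constructor
    · nlinarith [hy.1, hτ.1]
    · nlinarith [hτ.2, hτ.1]
  have hdiag : ∀ y ∈ Ioo 0 h, ∀ s, y ≤ s → s < h → |κ s y - B * k₀| ≤ B * (L * (s - y)) := by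
    intro y hy s hys hsh
    rw [← hconst s y]
    refine abs_abelInner_sub_le hα hβ hkc continuous_const fun τ hτ => ?_
    have hs0 : s ∈ Ioo 0 h := ⟨hy.1.trans_le hys, hsh⟩
    rw [← hkd s hs0]
    refine (hL s ⟨hs0.1.le, hs0.2.le⟩ _ (hmem hy hys hsh.le hτ) s ⟨hs0.1.le, hs0.2.le⟩).trans ?_
    refine mul_le_mul_of_nonneg_left ?_ hL0
    rw [show y + τ * (s - y) - s = -((1 - τ) * (s - y)) by ring, abs_neg,
      abs_of_nonneg (mul_nonneg (sub_nonneg.2 hτ.2) (sub_nonneg.2 hys))]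
    nlinarith [hτ.1, sub_nonneg.2 hys]
  have hlip : ∀ y ∈ Ioo 0 h, ∀ y' ∈ Ioo 0 h, ∀ s, y ≤ s → y' ≤ s → s ≤ h →
      |κ s y - κ s y'| ≤ B * (L * |y - y'|) := by
    intro y hy y' hy' s hys hys' hsh
    refine abs_abelInner_sub_le hα hβ hkc hkc fun τ hτ => ?_
    have hs0 : s ∈ Icc 0 h := ⟨hy.1.le.trans hys, hsh⟩
    refine (hL s hs0 _ (hmem hy hys hsh hτ) _ (hmem hy' hys' hsh hτ)).trans ?_
    refine mul_le_mul_of_nonneg_left ?_ hL0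
    rw [show y + τ * (s - y) - (y' + τ * (s - y')) = (1 - τ) * (y - y') by ring, abs_mul,
      abs_of_nonneg (sub_nonneg.2 hτ.2)]
    nlinarith [hτ.1, abs_nonneg (y - y')]
  refine eq_zero_of_abs_le_integral (C := L / |k₀|) hf hfi (fun y hy => ?_) hy
  have hint : ∀ y ∈ Ioo 0 h, ∀ y' ∈ Ico y h, IntervalIntegrable (fun s => f s * κ s y) volume y' h ∧
      IntervalIntegrable (fun s => f s * κ s y) volume y y' := by
    intro y hy y' hy'
    have h1 : IntervalIntegrable f volume y h :=
      (intervalIntegrable_iff_integrableOn_Ioc_of_le hy.2.le).2 (hfy y hy)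
    have h2 := h1.mul_continuousOn (g := fun s => κ s y)
      (continuous_abelInner hα hβ hkc y).continuousOn
    exact ⟨h2.mono_set (by
      rw [uIcc_of_le hy'.2.le, uIcc_of_le hy.2.le]; exact Icc_subset_Icc_left hy'.1),
      h2.mono_set (by
      rw [uIcc_of_le hy'.1, uIcc_of_le hy.2.le]; exact Icc_subset_Icc_right hy'.2.le)⟩
  have hfI : ∀ y' ∈ Ico y h, IntervalIntegrable f volume y y' ∧ IntervalIntegrable f volume y' h :=
    fun y' hy' => by
    have h1 : IntervalIntegrable f volume y h :=
      (intervalIntegrable_iff_integrableOn_Ioc_of_le hy.2.le).2 (hfy y hy)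
    exact ⟨h1.mono_set (by
      rw [uIcc_of_le hy'.1, uIcc_of_le hy.2.le]; exact Icc_subset_Icc_right hy'.2.le),
      h1.mono_set (by
      rw [uIcc_of_le hy'.2.le, uIcc_of_le hy.2.le]; exact Icc_subset_Icc_left hy'.1)⟩
  set I := ∫ s in y..h, |f s|
  -- The identities at y and y' are subtracted. Only Lipschitz continuity of κ in y is available, so
  -- difference quotients take the place of differentiating the Volterra equation.
  have hquot : ∀ y' ∈ Ioo y h, |B * k₀ * ∫ s in y..y', f s| ≤ B * (L * (y' - y)) * I := by
    intro y' hy'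
    have hy'0 : y' ∈ Ioo 0 h := ⟨hy.1.trans hy'.1, hy'.2⟩
    have hy'1 : y' ∈ Ico y h := ⟨hy'.1.le, hy'.2⟩
    have e1 := intervalIntegral.integral_add_adjacent_intervals (hint y hy y' hy'1).2
      (hint y hy y' hy'1).1
    rw [hΦ y hy] at e1
    have e2 := intervalIntegral.integral_sub (hint y hy y' hy'1).1
      (hint y' hy'0 y' ⟨le_rfl, hy'.2⟩).1
    rw [hΦ y' hy'0, sub_zero] at e2
    have e3 := intervalIntegral.integral_sub (hint y hy y' hy'1).2
      ((hfI y' hy'1).1.mul_const (B * k₀))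
    rw [intervalIntegral.integral_mul_const] at e3
    have e4 : B * k₀ * ∫ s in y..y', f s = -(∫ s in y..y', (f s * κ s y - f s * (B * k₀))) -
        ∫ s in y'..h, (f s * κ s y - f s * κ s y') := by
      rw [e3, e2]; linarith
    have b1 : |∫ s in y..y', (f s * κ s y - f s * (B * k₀))| ≤
        ∫ s in y..y', |f s| * (B * (L * (y' - y))) := by
      rw [← Real.norm_eq_abs]
      refine intervalIntegral.norm_integral_le_of_norm_le hy'.1.le (ae_of_all _ fun s hs => ?_)
        ((hfI y' hy'1).1.abs.mul_const _)
      rw [← mul_sub, norm_mul, Real.norm_eq_abs, Real.norm_eq_abs]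
      refine mul_le_mul_of_nonneg_left ((hdiag y hy s hs.1.le (hs.2.trans_lt hy'.2)).trans ?_)
        (abs_nonneg _)
      have := hs.2
      gcongr
    have b2 : |∫ s in y'..h, (f s * κ s y - f s * κ s y')| ≤
        ∫ s in y'..h, |f s| * (B * (L * (y' - y))) := by
      rw [← Real.norm_eq_abs]
      refine intervalIntegral.norm_integral_le_of_norm_le hy'.2.le (ae_of_all _ fun s hs => ?_)
        ((hfI y' hy'1).2.abs.mul_const _)
      rw [← mul_sub, norm_mul, Real.norm_eq_abs, Real.norm_eq_abs]
      refine mul_le_mul_of_nonneg_left ((hlip y hy y' hy'0 s (hy'.1.trans hs.1).le hs.1.le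
        hs.2).trans ?_) (abs_nonneg _)
      rw [abs_sub_comm, abs_of_pos (sub_pos.2 hy'.1)]
    rw [e4]
    have e5 : B * (L * (y' - y)) * I = (∫ s in y..y', |f s| * (B * (L * (y' - y)))) +
        ∫ s in y'..h, |f s| * (B * (L * (y' - y))) := by
      rw [intervalIntegral.integral_mul_const, intervalIntegral.integral_mul_const, ← add_mul,
        intervalIntegral.integral_add_adjacent_intervals (hfI y' hy'1).1.abs (hfI y' hy'1).2.abs,
        mul_comm]
    rw [e5]
    refine (abs_sub _ _).trans ?_
    rw [abs_neg]
    exact add_le_add b1 b2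
  have hder : HasDerivWithinAt (fun u => ∫ s in y..u, f s) (f y) (Ioi y) y := by
    have h1 : HasDerivAt (fun u => ∫ s in y..u, f s) (f y) y :=
      intervalIntegral.integral_hasDerivAt_right (by simp)
        (hf.stronglyMeasurableAtFilter isOpen_Ioo y hy)
        (hf.continuousAt (Ioo_mem_nhds hy.1 hy.2))
    exact h1.hasDerivWithinAt
  have hlim := ((hasDerivWithinAt_iff_tendsto_slope' (self_notMem_Ioi)).1 hder).abs
  -- Division by y' - y and y' ↓ y produce the Gronwall inequality with C = L/|k₀|.
  have hle : |f y| ≤ L / |k₀| * I := by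
    refine le_of_tendsto hlim ?_
    filter_upwards [Ioo_mem_nhdsGT hy.2] with y' hy'
    have h1 := hquot y' hy'
    have h2 : 0 < y' - y := sub_pos.2 hy'.1
    rw [slope_def_field, intervalIntegral.integral_same, sub_zero, abs_div, abs_of_pos h2,
      div_le_iff₀ h2]
    rw [abs_mul, abs_mul, abs_of_pos hBpos] at h1
    have h3 : 0 < |k₀| := abs_pos.2 hk₀
    rw [div_mul_eq_mul_div, div_mul_eq_mul_div, le_div_iff₀ h3]
    refine le_of_mul_le_mul_left (le_trans (le_of_eq ?_) (h1.trans (le_of_eq ?_))) hBpos <;> ring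
  exact hle

end

section

/-! ### The Abel operator and its inversion -/

@[fun_prop]
lemma _root_.Continuous.hyp01 {X : Type*} [TopologicalSpace X] {a : ℝ} (ha : 0 < a) {u : X → ℝ}
    (hu : Continuous u) : Continuous fun x => hyp01 a (u x) :=
  (continuous_hyp01 ha).comp hu

/-- The Abel operator inverted by `opJ`. -/
def opA (p lam h c : ℝ) (f : ℝ → ℝ) (x : ℝ) : ℝ :=
  ∫ s in x..h, f s * ((s - x) ^ (p - 1) * hyp01 p (lam * (s - c) * (s - x)))

variable {p lam h c : ℝ}

lemma psi_eq (p lam h c : ℝ) (g : ℝ → ℝ) (x : ℝ) :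
    psi p lam h c g x = ∫ ξ in x..h, g ξ *
      ((ξ - x) ^ (1 - p - 1) * hyp01 (1 - p) (-lam * (x - c) * (ξ - x))) := by
  rw [psi]
  refine intervalIntegral.integral_congr fun ξ _ => ?_
  rw [show 1 - p - 1 = -p by ring]
  ring

lemma beta_one_sub (p : ℝ) :
    ProbabilityTheory.beta (1 - p) p = Real.pi / Real.sin (Real.pi * p) := by
  rw [ProbabilityTheory.beta, mul_comm, Real.Gamma_mul_Gamma_one_sub]
  simp

lemma continuous_opA_kernel (hp₀ : 0 < p) :
    Continuous (Function.uncurry fun s x : ℝ => hyp01 p (lam * (s - c) * (s - x))) :=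
  Continuous.hyp01 hp₀ (by fun_prop)

lemma continuous_psi_kernel (hp₁ : p < 1) :
    Continuous (Function.uncurry fun ξ x : ℝ => hyp01 (1 - p) (-lam * (x - c) * (ξ - x))) :=
  Continuous.hyp01 (by linarith) (by fun_prop)

lemma integrableOn_opA (hp₀ : 0 < p) {f : ℝ → ℝ} {y : ℝ} (hf : IntegrableOn f (Ioc y h)) :
    IntegrableOn (opA p lam h c f) (Ioc y h) :=
  integrableOn_abel_one hp₀ hf (continuous_opA_kernel hp₀).continuousOn

lemma continuousOn_opA (hp₀ : 0 < p) {f : ℝ → ℝ} {y : ℝ} (hf : ContinuousOn f (Ioo y h))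
    (hfi : IntegrableOn f (Ioc y h)) : ContinuousOn (opA p lam h c f) (Ioo y h) :=
  continuousOn_abel hp₀ hf hfi (continuous_opA_kernel hp₀).continuousOn

/-- After exchanging the integrals, the inner one is a beta convolution with exponents 1 - p and p,
whose sum 1 removes the power. The arguments add up to -λ(x - c) + λ(s - c) = λ(s - x), so the base
point c disappears. -/
lemma psi_opA (hp₀ : 0 < p) (hp₁ : p < 1) {f : ℝ → ℝ} {x : ℝ} (hx : x < h)
    (hf : IntegrableOn f (Ioc x h)) :
    psi p lam h c (opA p lam h c f) x = Real.pi / Real.sin (Real.pi * p) *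
      ∫ s in x..h, f s * hyp01 1 (lam * (s - x) ^ 2) := by
  have hg : Continuous (Function.uncurry fun s ξ : ℝ =>
      hyp01 (1 - p) (-lam * (x - c) * (ξ - x)) * hyp01 p (lam * (s - c) * (s - ξ))) :=
    (Continuous.hyp01 (by linarith) (by fun_prop)).mul (Continuous.hyp01 hp₀ (by fun_prop))
  have hsw := integral_abel_swap hp₀ (by linarith : 0 < 1 - p) (by linarith) hx.le hf
    hg.continuousOn
  rw [psi_eq]
  have e1 : ∀ ξ, opA p lam h c f ξ *
      ((ξ - x) ^ (1 - p - 1) * hyp01 (1 - p) (-lam * (x - c) * (ξ - x))) =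
      ∫ s in ξ..h, f s * ((ξ - x) ^ (1 - p - 1) * (s - ξ) ^ (p - 1) *
        (hyp01 (1 - p) (-lam * (x - c) * (ξ - x)) * hyp01 p (lam * (s - c) * (s - ξ)))) :=
    fun ξ => by
      rw [opA, ← intervalIntegral.integral_mul_const]
      refine intervalIntegral.integral_congr fun s _ => ?_
      ring
  simp_rw [e1]
  rw [hsw, ← intervalIntegral.integral_const_mul]
  refine intervalIntegral.integral_congr_ae (ae_of_all _ fun s hs => ?_)
  rw [uIoc_of_le hx.le] at hs
  have hb := integral_beta_hyp01 (by linarith : 0 < 1 - p) hp₀ (sub_pos.2 hs.1)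
    (-lam * (x - c)) (lam * (s - c))
  rw [show 1 - p + p - 1 = 0 by ring, show 1 - p + p = 1 by ring, Real.rpow_zero, one_mul,
    beta_one_sub p] at hb
  have hshift := intervalIntegral.integral_comp_sub_right (a := x) (b := s)
    (f := fun y => y ^ (1 - p - 1) * (s - x - y) ^ (p - 1) *
      (hyp01 (1 - p) (-lam * (x - c) * y) * hyp01 p (lam * (s - c) * (s - x - y)))) x
  rw [sub_self, hb] at hshift
  simp only [sub_sub_sub_cancel_right] at hshift
  rw [hshift, show (-lam * (x - c) + lam * (s - c)) * (s - x) = lam * (s - x) ^ 2 by ring]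
  ring

lemma hasDerivAt_hyp01_one_sq (lam x t : ℝ) :
    HasDerivAt (fun t => hyp01 1 (lam * (t - x) ^ 2))
      (2 * lam * ((t - x) * hyp01 2 (lam * (t - x) ^ 2))) t := by
  have h1 : HasDerivAt (fun t => lam * (t - x) ^ 2) (lam * (2 * (t - x))) t := by
    simpa using (((hasDerivAt_id t).sub_const x).pow 2).const_mul lam
  refine ((hasDerivAt_hyp01 one_pos (lam * (t - x) ^ 2)).comp t h1).congr_deriv ?_
  rw [show (1 : ℝ) + 1 = 2 by norm_num]
  ring

/-- Write F₁, F₂ for ₀F₁(1; ·), ₀F₁(2; ·). Integrating by parts, -∫ v F₁ becomes ψ(x) + 2λ ∫ ψ(t)(t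
- x)F₂, because the derivative of F₁ is 2λ(t - x)F₂. The double integral contributes -2λ ∫ ψ(t)(t -
x)F₂ by `integral_hyp01_two_mul_hyp01_one`, and the two integrals cancel. -/
lemma integral_hyp01_volterra (lam : ℝ) {v ψ : ℝ → ℝ} {x : ℝ} (hx : x < h)
    (hv : IntegrableOn v (Ioc x h)) (hψ : ∀ y ∈ Ico x h, ψ y = -∫ t in y..h, v t) :
    ∫ s in x..h, (-v s - 2 * lam * ∫ t in s..h, hyp01 2 (lam * (t - s) ^ 2) * ψ t) *
      hyp01 1 (lam * (s - x) ^ 2) = ψ x := by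
  -- This agrees with ψ on [x, h) but is continuous up to h, where nothing is assumed about ψ.
  set w : ℝ → ℝ := fun y => -∫ t in y..h, v t with hw
  have hvi : IntervalIntegrable v volume x h :=
    (intervalIntegrable_iff_integrableOn_Ioc_of_le hx.le).2 hv
  have hwc : ContinuousOn w (Icc x h) := by
    have h3 : IntegrableOn v (uIcc h x) := by
      rw [uIcc_of_ge hx.le, integrableOn_Icc_iff_integrableOn_Ioc]; exact hv
    have h4 := intervalIntegral.continuousOn_primitive_interval h3
    rw [uIcc_of_ge hx.le] at h4
    exact h4.congr fun y _ => by simp only [hw]; rw [intervalIntegral.integral_symm, neg_neg]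
  have hwi : IntegrableOn w (Ioc x h) :=
    (hwc.integrableOn_compact isCompact_Icc).mono_set Ioc_subset_Icc_self
  have hne : ∀ᵐ s : ℝ, s ≠ h := by simp [ae_iff]
  have hF1 : Continuous fun s => hyp01 1 (lam * (s - x) ^ 2) :=
    Continuous.hyp01 one_pos (by fun_prop)
  have hF2 : Continuous fun s => hyp01 2 (lam * (s - x) ^ 2) :=
    Continuous.hyp01 two_pos (by fun_prop)
  have e0 : ∀ s ∈ Ioc x h, ∫ t in s..h, hyp01 2 (lam * (t - s) ^ 2) * ψ t =
      ∫ t in s..h, w t * hyp01 2 (lam * (t - s) ^ 2) := fun s hs => by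
    refine intervalIntegral.integral_congr_ae ?_
    filter_upwards [hne] with t hth ht
    rw [uIoc_of_le hs.2] at ht
    rw [hψ t ⟨(hs.1.trans ht.1).le, lt_of_le_of_ne ht.2 hth⟩, mul_comm]
  -- the part containing `v`
  have hF2' : Continuous fun q : ℝ × ℝ => 2 * lam * ((q.2 - x) * hyp01 2 (lam * (q.2 - x) ^ 2)) :=
    continuous_const.mul ((by fun_prop : Continuous fun q : ℝ × ℝ => q.2 - x).mul
      (Continuous.hyp01 two_pos (by fun_prop)))
  have s1 := integral_abel_swap_one (α := 1)
    (g := fun _ t => 2 * lam * ((t - x) * hyp01 2 (lam * (t - x) ^ 2))) one_pos hx.le hv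
    hF2'.continuousOn
  simp only [sub_self, Real.rpow_zero, one_mul] at s1
  have e1 : ∀ s, ∫ t in x..s, 2 * lam * ((t - x) * hyp01 2 (lam * (t - x) ^ 2)) =
      hyp01 1 (lam * (s - x) ^ 2) - 1 := fun s => by
    rw [intervalIntegral.integral_eq_sub_of_hasDerivAt
      (fun t _ => hasDerivAt_hyp01_one_sq lam x t)
      (Continuous.intervalIntegrable (by fun_prop) _ _)]
    simp
  simp only [e1, intervalIntegral.integral_mul_const] at s1
  -- the part containing `ψ`
  have s2 := integral_abel_swap_one (α := 1)
    (g := fun t s => hyp01 1 (lam * (s - x) ^ 2) * hyp01 2 (lam * (t - s) ^ 2)) one_pos hx.le hwi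
    (Continuous.continuousOn (Continuous.mul
      (Continuous.hyp01 (u := fun q : ℝ × ℝ => lam * (q.2 - x) ^ 2) one_pos (by fun_prop))
      (Continuous.hyp01 (u := fun q : ℝ × ℝ => lam * (q.1 - q.2) ^ 2) two_pos (by fun_prop))))
  simp only [sub_self, Real.rpow_zero, one_mul] at s2
  have e2 : ∀ t ∈ Ioc x h, ∫ s in x..t, hyp01 1 (lam * (s - x) ^ 2) * hyp01 2 (lam * (t - s) ^ 2) =
      (t - x) * hyp01 2 (lam * (t - x) ^ 2) := fun t ht => by
    rw [← integral_hyp01_two_mul_hyp01_one lam (sub_pos.2 ht.1)]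
    have := intervalIntegral.integral_comp_sub_left (a := x) (b := t)
      (f := fun r => hyp01 2 (lam * r ^ 2) * hyp01 1 (lam * (t - x - r) ^ 2)) t
    rw [sub_self] at this
    rw [← this]
    refine intervalIntegral.integral_congr fun s _ => ?_
    rw [show t - x - (t - s) = s - x by ring, mul_comm]
  have e3 : ∫ t in x..h, w t * ∫ s in x..t, hyp01 1 (lam * (s - x) ^ 2) *
      hyp01 2 (lam * (t - s) ^ 2) =
      ∫ t in x..h, w t * ((t - x) * hyp01 2 (lam * (t - x) ^ 2)) := by
    refine intervalIntegral.integral_congr_ae (ae_of_all _ fun t ht => ?_)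
    rw [uIoc_of_le hx.le] at ht
    rw [e2 t ht]
  rw [e3] at s2
  have i1 : IntervalIntegrable (fun s => v s * hyp01 1 (lam * (s - x) ^ 2)) volume x h :=
    hvi.mul_continuousOn hF1.continuousOn
  have hj := integrableOn_abel_one (α := 1)
    (g := fun t s => hyp01 2 (lam * (t - s) ^ 2)) one_pos hwi
    (Continuous.continuousOn
      (Continuous.hyp01 (u := fun q : ℝ × ℝ => lam * (q.1 - q.2) ^ 2) two_pos (by fun_prop)))
  simp only [sub_self, Real.rpow_zero, one_mul] at hj
  have i2 : IntervalIntegrable (fun s => (∫ t in s..h, w t * hyp01 2 (lam * (t - s) ^ 2)) *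
      hyp01 1 (lam * (s - x) ^ 2)) volume x h :=
    ((intervalIntegrable_iff_integrableOn_Ioc_of_le hx.le).2 hj).mul_continuousOn hF1.continuousOn
  have e4 : ∫ s in x..h, (-v s - 2 * lam * ∫ t in s..h, hyp01 2 (lam * (t - s) ^ 2) * ψ t) *
      hyp01 1 (lam * (s - x) ^ 2) = ∫ s in x..h, (-(v s * hyp01 1 (lam * (s - x) ^ 2)) -
        2 * lam * ((∫ t in s..h, w t * hyp01 2 (lam * (t - s) ^ 2)) *
          hyp01 1 (lam * (s - x) ^ 2))) := by
    refine intervalIntegral.integral_congr_ae (ae_of_all _ fun s hs => ?_)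
    rw [uIoc_of_le hx.le] at hs
    rw [e0 s hs]; ring
  have e5 : ∀ s, (∫ t in s..h, w t * hyp01 2 (lam * (t - s) ^ 2)) * hyp01 1 (lam * (s - x) ^ 2) =
      ∫ t in s..h, w t * (hyp01 1 (lam * (s - x) ^ 2) * hyp01 2 (lam * (t - s) ^ 2)) := fun s => by
    rw [← intervalIntegral.integral_mul_const]
    refine intervalIntegral.integral_congr fun t _ => ?_
    ring
  have i3 : IntervalIntegrable (fun s => -(v s * hyp01 1 (lam * (s - x) ^ 2))) volume x h := i1.neg
  rw [e4, intervalIntegral.integral_sub i3 (i2.const_mul _), intervalIntegral.integral_neg,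
    intervalIntegral.integral_const_mul]
  simp_rw [e5]
  rw [s2]
  have e6 : ∫ s in x..h, v s * (hyp01 1 (lam * (s - x) ^ 2) - 1) =
      (∫ s in x..h, v s * hyp01 1 (lam * (s - x) ^ 2)) - ∫ s in x..h, v s := by
    rw [← intervalIntegral.integral_sub i1 hvi]
    refine intervalIntegral.integral_congr fun s _ => ?_
    ring
  have e7 : ∫ t in x..h, (∫ s in t..h, v s) * (2 * lam * ((t - x) * hyp01 2 (lam * (t - x) ^ 2)))
      = -(2 * lam * ∫ t in x..h, w t * ((t - x) * hyp01 2 (lam * (t - x) ^ 2))) := by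
    rw [← intervalIntegral.integral_const_mul, ← intervalIntegral.integral_neg]
    refine intervalIntegral.integral_congr fun s _ => ?_
    simp only [hw]; ring
  rw [hψ x ⟨le_rfl, hx⟩]
  rw [e6, e7] at s1
  linarith

/-- All properties of `opJ` are derived from a density v with Ψ = -∫ v. Constructing such a v for φ'
and for M is the remaining analytic task. -/
lemma opJ_eq_of_psi_eq {g v : ℝ → ℝ} (hv : ContinuousOn v (Ioo 0 h))
    (hvi : IntegrableOn v (Ioc 0 h))
    (hψ : ∀ x ∈ Ioo 0 h, psi p lam h c g x = -∫ t in x..h, v t) {x : ℝ} (hx : x ∈ Ioo 0 h) :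
    opJ p lam h c g x = Real.sin (Real.pi * p) / Real.pi *
      (-v x - 2 * lam * ∫ s in x..h, hyp01 2 (lam * (s - x) ^ 2) * psi p lam h c g s) := by
  have hd : HasDerivAt (psi p lam h c g) (v x) x := by
    have h1 := (hasDerivAt_integral_left hv hx (hvi.mono_set (Ioc_subset_Ioc_left hx.1.le))).neg
    rw [neg_neg] at h1
    refine h1.congr_of_eventuallyEq ?_
    filter_upwards [Ioo_mem_nhds hx.1 hx.2] with y hy using hψ y hy
  rw [opJ, hd.deriv]

lemma continuousOn_psi (hp₁ : p < 1) {g : ℝ → ℝ} {y : ℝ} (hg : ContinuousOn g (Ioo y h))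
    (hgi : IntegrableOn g (Ioc y h)) : ContinuousOn (psi p lam h c g) (Ioo y h) := by
  rw [funext (psi_eq p lam h c g)]
  exact continuousOn_abel (by linarith) hg hgi (continuous_psi_kernel hp₁).continuousOn

lemma integrableOn_psi (hp₁ : p < 1) {g : ℝ → ℝ} {y : ℝ}
    (hgi : IntegrableOn g (Ioc y h)) : IntegrableOn (psi p lam h c g) (Ioc y h) := by
  rw [funext (psi_eq p lam h c g)]
  exact integrableOn_abel_one (by linarith) hgi (continuous_psi_kernel hp₁).continuousOn

section volterra

variable {w : ℝ → ℝ} (lam)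

lemma continuousOn_integral_hyp01_two (hw : ContinuousOn w (Ioo 0 h))
    (hwi : IntegrableOn w (Ioc 0 h)) :
    ContinuousOn (fun x => ∫ s in x..h, hyp01 2 (lam * (s - x) ^ 2) * w s) (Ioo 0 h) := by
  have := continuousOn_abel (α := 1) (g := fun s x => hyp01 2 (lam * (s - x) ^ 2)) one_pos hw hwi
    (Continuous.continuousOn
      (Continuous.hyp01 (u := fun q : ℝ × ℝ => lam * (q.1 - q.2) ^ 2) two_pos (by fun_prop)))
  simpa [mul_comm] using this

lemma integrableOn_integral_hyp01_two (hwi : IntegrableOn w (Ioc 0 h)) :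
    IntegrableOn (fun x => ∫ s in x..h, hyp01 2 (lam * (s - x) ^ 2) * w s) (Ioc 0 h) := by
  have := integrableOn_abel_one (α := 1) (g := fun s x => hyp01 2 (lam * (s - x) ^ 2)) one_pos hwi
    (Continuous.continuousOn
      (Continuous.hyp01 (u := fun q : ℝ × ℝ => lam * (q.1 - q.2) ^ 2) two_pos (by fun_prop)))
  simpa [mul_comm] using this

end volterra

lemma integrableOn_congr_Ioo {f g : ℝ → ℝ} (hfg : EqOn f g (Ioo 0 h))
    (hg : IntegrableOn g (Ioc 0 h)) : IntegrableOn f (Ioc 0 h) := by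
  rw [integrableOn_Ioc_iff_integrableOn_Ioo] at hg ⊢
  exact hg.congr_fun hfg.symm measurableSet_Ioo

lemma opJ_regular (hp₁ : p < 1) {g v : ℝ → ℝ} (hg : ContinuousOn g (Ioo 0 h))
    (hgi : IntegrableOn g (Ioc 0 h)) (hv : ContinuousOn v (Ioo 0 h))
    (hvi : IntegrableOn v (Ioc 0 h))
    (hψ : ∀ x ∈ Ioo 0 h, psi p lam h c g x = -∫ t in x..h, v t) :
    ContinuousOn (opJ p lam h c g) (Ioo 0 h) ∧ IntegrableOn (opJ p lam h c g) (Ioc 0 h) := by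
  have heq : EqOn (opJ p lam h c g) _ (Ioo 0 h) := fun x hx => opJ_eq_of_psi_eq hv hvi hψ hx
  have hP := integrableOn_psi (p := p) (lam := lam) (c := c) hp₁ hgi
  constructor
  · refine ContinuousOn.congr ?_ heq
    exact continuousOn_const.mul (hv.neg.sub (continuousOn_const.mul
      (continuousOn_integral_hyp01_two lam (continuousOn_psi hp₁ hg hgi) hP)))
  · refine integrableOn_congr_Ioo heq ?_
    exact (hvi.neg.sub ((integrableOn_integral_hyp01_two lam hP).const_mul _)).const_mul _

/-- The operator `opJ` is a right inverse of the Abel operator. -/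
lemma opA_opJ (hp₀ : 0 < p) (hp₁ : p < 1) {g v : ℝ → ℝ} (hg : ContinuousOn g (Ioo 0 h))
    (hgi : IntegrableOn g (Ioc 0 h)) (hv : ContinuousOn v (Ioo 0 h))
    (hvi : IntegrableOn v (Ioc 0 h))
    (hψ : ∀ x ∈ Ioo 0 h, psi p lam h c g x = -∫ t in x..h, v t) {x : ℝ} (hx : x ∈ Ioo 0 h) :
    opA p lam h c (opJ p lam h c g) x = g x := by
  obtain ⟨hJc, hJi⟩ := opJ_regular hp₁ hg hgi hv hvi hψ
  set f := opJ p lam h c g with hf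
  have hsin : 0 < Real.sin (Real.pi * p) :=
    Real.sin_pos_of_pos_of_lt_pi (by positivity) (by nlinarith [Real.pi_pos])
  have hAc := continuousOn_opA (lam := lam) (c := c) hp₀ hJc hJi
  have hAi := integrableOn_opA (lam := lam) (c := c) hp₀ hJi
  -- The composition formula and the Volterra identity give Ψ(A J g) = Ψ(g); the constants π/sin πp
  -- and sin πp/π cancel.
  have key : ∀ x ∈ Ioo 0 h, psi p lam h c (opA p lam h c f) x = psi p lam h c g x := by
    intro x hx
    rw [psi_opA hp₀ hp₁ hx.2 (hJi.mono_set (Ioc_subset_Ioc_left hx.1.le)),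
      ← integral_hyp01_volterra (ψ := psi p lam h c g) lam hx.2
        (hvi.mono_set (Ioc_subset_Ioc_left hx.1.le))
        (fun y hy => hψ y ⟨hx.1.trans_le hy.1, hy.2⟩), ← intervalIntegral.integral_const_mul]
    refine intervalIntegral.integral_congr_ae ?_
    have hne : ∀ᵐ s : ℝ, s ≠ h := by simp [ae_iff]
    filter_upwards [hne] with s hsh hs
    rw [uIoc_of_le hx.2.le] at hs
    rw [hf, opJ_eq_of_psi_eq hv hvi hψ ⟨hx.1.trans hs.1, lt_of_le_of_ne hs.2 hsh⟩]
    have := Real.pi_pos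
    field_simp
  -- Ψ is itself an Abel operator, of order 1 - p and with kernel 1 on the diagonal. It is therefore
  -- injective, and it can be cancelled.
  have hr := eq_zero_of_abel_eq_zero (f := fun s => opA p lam h c f s - g s) (α := 1 - p)
    (k := fun s x => hyp01 (1 - p) (-lam * (x - c) * (s - x))) (k₀ := 1) (by linarith)
    (by linarith) (hAc.sub hg) (hAi.sub hgi)
    ((contDiff_one_hyp01 (by linarith : 0 < 1 - p)).comp
      (by fun_prop : ContDiff ℝ 1 fun q : ℝ × ℝ => -lam * (q.2 - c) * (q.1 - q.2)))
    one_ne_zero (fun s _ => by simp) (fun x hx => by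
      have hkc : ContinuousOn (fun s => hyp01 (1 - p) (-lam * (x - c) * (s - x))) (Icc x h) :=
        (Continuous.hyp01 (by linarith) (by fun_prop)).continuousOn
      have h1 := intervalIntegrable_abel (α := 1 - p) (by linarith) hx hAc hAi hkc
      have h2 := intervalIntegrable_abel (α := 1 - p) (by linarith) hx hg hgi hkc
      have h3 := key x hx
      rw [psi_eq, psi_eq, ← sub_eq_zero, ← intervalIntegral.integral_sub h1 h2] at h3
      rw [← h3]
      refine intervalIntegral.integral_congr fun s _ => ?_
      ring) hx
  exact sub_eq_zero.1 hr

end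

section

/-! ### Admissible data -/

section datum

variable {p h : ℝ} {φ : ℝ → ℝ}

lemma AdmissibleDatum.apply_right (hp₀ : 0 < p) (hh : 0 < h) (H : AdmissibleDatum p h φ) :
    φ h = 0 := by
  obtain ⟨ε, hε, φs, -, hφ⟩ := H.factor
  rw [hφ h ⟨hh.le, le_rfl⟩, sub_self, Real.zero_rpow (by positivity), zero_mul]

/-- The factor (h - ξ)^(1+p+ε) has zero derivative at h, since its exponent exceeds 1, and φs is
bounded near h. -/
lemma AdmissibleDatum.derivWithin_right (hp₀ : 0 < p) (hh : 0 < h) (H : AdmissibleDatum p h φ) :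
    derivWithin φ (Icc 0 h) h = 0 := by
  obtain ⟨ε, hε, φs, hφs, hφ⟩ := H.factor
  have hmem : h ∈ Icc 0 h := ⟨hh.le, le_rfl⟩
  have h1 : HasDerivAt (fun ξ => (h - ξ) ^ (1 + p + ε)) 0 h := by
    have h2 := (Real.hasDerivAt_rpow_const (x := h - h) (p := 1 + p + ε)
      (Or.inr (by linarith))).comp h ((hasDerivAt_id h).const_sub h)
    refine h2.congr_deriv ?_
    rw [sub_self, Real.zero_rpow (by linarith : 1 + p + ε - 1 ≠ 0)]
    simp
  have h3 := h1.hasDerivWithinAt (s := Icc 0 h)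
  rw [hasDerivWithinAt_iff_isLittleO] at h3
  have h4 : φs =O[𝓝[Icc 0 h] h] (fun _ => (1 : ℝ)) := (hφs h hmem).isBigO_one ℝ
  have h5 := h3.mul_isBigO h4
  have h6 : HasDerivWithinAt φ 0 (Icc 0 h) h := by
    rw [hasDerivWithinAt_iff_isLittleO]
    refine (h5.congr' ?_ (Eventually.of_forall fun x => by simp)).trans_isBigO
      (Asymptotics.isBigO_refl _ _)
    filter_upwards [self_mem_nhdsWithin] with x hx
    rw [hφ x hx, AdmissibleDatum.apply_right hp₀ hh H, sub_self,
      Real.zero_rpow (by linarith : 1 + p + ε ≠ 0)]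
    simp
  exact h6.derivWithin (uniqueDiffOn_Icc hh h hmem)

lemma AdmissibleDatum.contDiffOn_derivWithin (hh : 0 < h) (H : AdmissibleDatum p h φ) :
    ContDiffOn ℝ 1 (derivWithin φ (Icc 0 h)) (Icc 0 h) :=
  H.contDiff.derivWithin (uniqueDiffOn_Icc hh) (by norm_num)

lemma eq_neg_integral_derivWithin (hh : 0 < h) {g : ℝ → ℝ} (hg : ContDiffOn ℝ 1 g (Icc 0 h))
    (hgh : g h = 0) {x : ℝ} (hx : x ∈ Icc 0 h) :
    g x = -∫ t in x..h, derivWithin g (Icc 0 h) t := by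
  have hc : ContinuousOn (derivWithin g (Icc 0 h)) (Icc 0 h) :=
    hg.continuousOn_derivWithin (uniqueDiffOn_Icc hh) le_rfl
  have hsub : Icc x h ⊆ Icc 0 h := Icc_subset_Icc_left hx.1
  rw [intervalIntegral.integral_eq_sub_of_hasDerivAt_of_le hx.2 (hg.continuousOn.mono hsub)
    (fun t ht => ?_) ((hc.mono hsub).intervalIntegrable_of_Icc hx.2), hgh]
  · ring
  · have ht' : t ∈ Icc 0 h := hsub ⟨ht.1.le, ht.2.le⟩
    exact ((hg.differentiableOn one_ne_zero t ht').hasDerivWithinAt).hasDerivAt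
      (Icc_mem_nhds (hx.1.trans_lt ht.1) ht.2)

end datum

/-! ### The function `psi` for a continuously differentiable function -/

section primitive

variable {p lam h c : ℝ}

/-- The kernel obtained by differentiating the primitive of the kernel of `psi`. -/
def psiDerivKernel (p lam c s x : ℝ) : ℝ :=
  hyp01 (2 - p) (-lam * (x - c) * (s - x)) -
    (s - x) / (1 - p) * (hyp01 (3 - p) (-lam * (x - c) * (s - x)) / (2 - p)) *
      (lam * (2 * x - c - s))

lemma contDiff_psiDerivKernel (hp₁ : p < 1) :
    ContDiff ℝ 1 (Function.uncurry (psiDerivKernel p lam c)) := by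
  have h1 := (contDiff_one_hyp01 (by linarith : 0 < 2 - p)).comp
    (by fun_prop : ContDiff ℝ 1 fun q : ℝ × ℝ => -lam * (q.2 - c) * (q.1 - q.2))
  have h2 := (contDiff_one_hyp01 (by linarith : 0 < 3 - p)).comp
    (by fun_prop : ContDiff ℝ 1 fun q : ℝ × ℝ => -lam * (q.2 - c) * (q.1 - q.2))
  simp only [Function.comp_def] at h1 h2
  unfold psiDerivKernel Function.uncurry
  fun_prop

lemma hasDerivAt_psi_kernel_arg (lam c s x : ℝ) :
    HasDerivAt (fun x => -lam * (x - c) * (s - x)) (lam * (2 * x - c - s)) x := by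
  have h1 := (((hasDerivAt_id x).sub_const c).const_mul (-lam)).mul ((hasDerivAt_id x).const_sub s)
  refine h1.congr_deriv ?_
  simp only [id]; ring

lemma hasDerivAt_sub_rpow {q s x : ℝ} (hx : x < s) :
    HasDerivAt (fun x => (s - x) ^ q) (-(q * (s - x) ^ (q - 1))) x := by
  have := (Real.hasDerivAt_rpow_const (p := q) (Or.inl (sub_pos.2 hx).ne')).comp x
    ((hasDerivAt_id x).const_sub s)
  exact this.congr_deriv (by simp)

lemma hasDerivAt_psi_primitive_kernel (hp₁ : p < 1) {s x : ℝ} (hx : x < s) :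
    HasDerivAt (fun x => (s - x) ^ (1 - p) / (1 - p) * hyp01 (2 - p) (-lam * (x - c) * (s - x)))
      (-((s - x) ^ (1 - p - 1) * psiDerivKernel p lam c s x)) x := by
  have h1 := (hasDerivAt_sub_rpow (q := 1 - p) hx).div_const (1 - p)
  have h2 := (hasDerivAt_hyp01 (by linarith : 0 < 2 - p) (-lam * (x - c) * (s - x))).comp x
    (hasDerivAt_psi_kernel_arg lam c s x)
  refine (h1.mul h2).congr_deriv ?_
  have h3 : (s - x) ^ (1 - p) = (s - x) ^ (1 - p - 1) * (s - x) := by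
    rw [Real.rpow_sub_one (sub_pos.2 hx).ne']
    have := (sub_pos.2 hx).ne'
    field_simp
  have h4 : (1 - p) ≠ 0 := by linarith
  rw [psiDerivKernel, h3, show 2 - p + 1 = 3 - p by ring]
  simp only [Function.comp]
  field_simp
  ring

lemma integral_psi_kernel (hp₁ : p < 1) {x t : ℝ} (hxt : x < t) :
    ∫ ξ in x..t, (ξ - x) ^ (1 - p - 1) * hyp01 (1 - p) (-lam * (x - c) * (ξ - x)) =
      (t - x) ^ (1 - p) / (1 - p) * hyp01 (2 - p) (-lam * (x - c) * (t - x)) := by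
  have hd : ∀ ξ ∈ Ioo x t, HasDerivAt
      (fun ξ => (ξ - x) ^ (1 - p) * hyp01 (1 + (1 - p)) ((-lam * (x - c)) * (ξ - x)))
      ((1 - p) * ((ξ - x) ^ (1 - p - 1) * hyp01 (1 - p) (-lam * (x - c) * (ξ - x)))) ξ := by
    intro ξ hξ
    exact ((hasDerivAt_rpow_mul_hyp01 (by linarith : 0 < 1 - p) (-lam * (x - c))
      (sub_pos.2 hξ.1)).comp ξ ((hasDerivAt_id ξ).sub_const x)).congr_deriv (mul_one _)
  have hi : IntervalIntegrable (fun ξ => (1 - p) * ((ξ - x) ^ (1 - p - 1) *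
      hyp01 (1 - p) (-lam * (x - c) * (ξ - x)))) volume x t :=
    ((intervalIntegrable_sub_rpow (by linarith : 0 < 1 - p) x x t).mul_continuousOn
      (Continuous.hyp01 (by linarith) (by fun_prop)).continuousOn).const_mul _
  have hc : ContinuousOn (fun ξ => (ξ - x) ^ (1 - p) *
      hyp01 (1 + (1 - p)) ((-lam * (x - c)) * (ξ - x))) (Icc x t) :=
    ContinuousOn.mul (ContinuousOn.rpow_const (by fun_prop) fun _ _ => Or.inr (by linarith))
      (Continuous.hyp01 (by linarith) (by fun_prop)).continuousOn
  have := intervalIntegral.integral_eq_sub_of_hasDerivAt_of_le hxt.le hc hd hi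
  rw [intervalIntegral.integral_const_mul, sub_self, Real.zero_rpow (by linarith)] at this
  have h4 : (1 - p) ≠ 0 := by linarith
  rw [show 2 - p = 1 + (1 - p) by ring, div_mul_eq_mul_div, eq_div_iff h4, mul_comm, this]
  ring

/-- The derivative of `psi` for a function `g` with `g' = q`, `g h = 0`. -/
def psiDeriv (p lam h c : ℝ) (q : ℝ → ℝ) (x : ℝ) : ℝ :=
  ∫ s in x..h, q s * ((s - x) ^ (1 - p - 1) * psiDerivKernel p lam c s x)

/-- Inserting g = -∫ q and exchanging the integrals leaves an integrated kernel of order (s -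
x)^(1-p). It vanishes on the diagonal, so `integral_kernel_eq` applies, and `psiDeriv` is the
derivative of Ψ. -/
lemma psi_eq_of_primitive (hp₁ : p < 1) {g q : ℝ → ℝ} {x : ℝ} (hx : x < h)
    (hq : IntegrableOn q (Ioc x h)) (hg : ∀ ξ ∈ Icc x h, g ξ = -∫ t in ξ..h, q t) :
    psi p lam h c g x = -∫ t in x..h, psiDeriv p lam h c q t := by
  have hα : 0 < 1 - p := by linarith
  have hk : Continuous (Function.uncurry fun _ ξ : ℝ =>
      hyp01 (1 - p) (-lam * (x - c) * (ξ - x))) := Continuous.hyp01 hα (by fun_prop)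
  have hsw := integral_abel_swap one_pos hα (by linarith) hx.le hq hk.continuousOn
  simp only [sub_self, Real.rpow_zero, mul_one] at hsw
  have e1 : psi p lam h c g x = -∫ ξ in x..h, ∫ s in ξ..h, q s *
      ((ξ - x) ^ (1 - p - 1) * hyp01 (1 - p) (-lam * (x - c) * (ξ - x))) := by
    rw [psi_eq, ← intervalIntegral.integral_neg]
    refine intervalIntegral.integral_congr fun ξ hξ => ?_
    rw [uIcc_of_le hx.le] at hξ
    rw [hg ξ hξ, intervalIntegral.integral_mul_const]
    ring
  rw [e1, hsw]
  congr 1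
  refine Eq.trans ?_ (integral_kernel_eq (κ := fun s x =>
    (s - x) ^ (1 - p) / (1 - p) * hyp01 (2 - p) (-lam * (x - c) * (s - x))) hα hx.le hq
    (contDiff_psiDerivKernel hp₁).continuous.continuousOn (fun s _ => ?_)
    (fun s _ t ht => hasDerivAt_psi_primitive_kernel hp₁ ht.2)
    (fun s _ => by simp [Real.zero_rpow hα.ne']))
  · refine intervalIntegral.integral_congr_ae (ae_of_all _ fun s hs => ?_)
    rw [uIoc_of_le hx.le] at hs
    rw [integral_psi_kernel hp₁ hs.1]
  · exact ((ContinuousOn.rpow_const (by fun_prop) fun _ _ => Or.inr hα.le).div_const _).mul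
      (Continuous.hyp01 (by linarith) (by fun_prop)).continuousOn

end primitive

/-! ### Hölder estimates for Abel-type integrals -/

lemma integral_sub_rpow {α : ℝ} (hα : 0 < α) {x a b : ℝ} :
    ∫ s in a..b, (s - x) ^ (α - 1) = ((b - x) ^ α - (a - x) ^ α) / α := by
  have := intervalIntegral.integral_comp_sub_right (a := a) (b := b) (fun y : ℝ => y ^ (α - 1)) x
  rw [this, integral_rpow (Or.inl (by linarith)), sub_add_cancel]

lemma intervalIntegrable_abel_of_bdd {q k : ℝ → ℝ} {α h Q : ℝ} (hα : 0 < α)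
    (hqi : IntegrableOn q (Ioc 0 h)) (hQ : ∀ s ∈ Ioo 0 h, |q s| ≤ Q) (hk : Continuous k) {x : ℝ}
    (hx : x ∈ Icc 0 h) : IntervalIntegrable (fun s => q s * ((s - x) ^ (α - 1) * k s)) volume x h := by
  have h1 : IntervalIntegrable (fun s => (s - x) ^ (α - 1) * k s) volume x h :=
    (intervalIntegrable_sub_rpow hα x x h).mul_continuousOn hk.continuousOn
  rw [intervalIntegrable_iff_integrableOn_Ioc_of_le hx.2] at h1 ⊢
  refine h1.bdd_mul (c := Q) (hqi.mono_set (Ioc_subset_Ioc_left hx.1)).aestronglyMeasurable ?_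
  have hne : ∀ᵐ s : ℝ, s ≠ h := by simp [ae_iff]
  refine (ae_restrict_iff' measurableSet_Ioc).2 ?_
  filter_upwards [hne] with s hsh hs
  exact hQ s ⟨hx.1.trans_lt hs.1, lt_of_le_of_ne hs.2 hsh⟩

/-- The part over (x, y) is of order (y - x)^α directly. Over (y, h) the kernels differ by the
change of k, controlled by its Lipschitz constant, and by the change of the power, whose integral is
computed exactly and is at most (y - x)^α/α. -/
lemma holder_abel {q : ℝ → ℝ} {k : ℝ → ℝ → ℝ} {α h Q : ℝ} (hα : 0 < α) (hα1 : α ≤ 1)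
    (hqi : IntegrableOn q (Ioc 0 h)) (hQ : ∀ s ∈ Ioo 0 h, |q s| ≤ Q)
    (hk : ContDiff ℝ 1 (Function.uncurry k)) :
    ∃ C, 0 ≤ C ∧ ∀ x ∈ Icc 0 h, ∀ y ∈ Icc x h,
      |(∫ s in x..h, q s * ((s - x) ^ (α - 1) * k s x)) -
        ∫ s in y..h, q s * ((s - y) ^ (α - 1) * k s y)| ≤ C * (y - x) ^ α := by
  obtain ⟨L, hL0, hL⟩ := exists_lipschitz_of_contDiff hk 0 h
  obtain ⟨K, hK⟩ := (isCompact_Icc.prod isCompact_Icc : IsCompact (Icc 0 h ×ˢ Icc 0 h))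
    |>.exists_bound_of_continuousOn hk.continuous.continuousOn
  have hK' : ∀ s ∈ Icc 0 h, ∀ x ∈ Icc 0 h, |k s x| ≤ |K| := fun s hs x hx =>
    (hK (s, x) ⟨hs, hx⟩).trans (le_abs_self K)
  have hQ' : ∀ s ∈ Ioo 0 h, |q s| ≤ |Q| := fun s hs => (hQ s hs).trans (le_abs_self Q)
  refine ⟨|Q| * |K| / α + |Q| * (L * |h| ^ (1 - α) * (|h| ^ α / α) + |K| / α), by positivity,
    fun x hx y hy => ?_⟩
  have hy0 : y ∈ Icc 0 h := ⟨hx.1.trans hy.1, hy.2⟩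
  have hh : 0 ≤ h := hx.1.trans hx.2
  have hne : ∀ᵐ s : ℝ, s ≠ h := by simp [ae_iff]
  have hkc : ∀ x, Continuous fun s => k s x := fun x =>
    hk.continuous.comp (by fun_prop : Continuous fun s : ℝ => (s, x))
  have ix := intervalIntegrable_abel_of_bdd hα hqi hQ (hkc x) hx
  have iy := intervalIntegrable_abel_of_bdd hα hqi hQ (hkc y) hy0
  have ix1 := ix.mono_set (c := x) (d := y) (by
    rw [uIcc_of_le hy.1, uIcc_of_le hx.2]; exact Icc_subset_Icc_right hy.2)
  have ix2 := ix.mono_set (c := y) (d := h) (by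
    rw [uIcc_of_le hy.2, uIcc_of_le hx.2]; exact Icc_subset_Icc_left hy.1)
  rw [← intervalIntegral.integral_add_adjacent_intervals ix1 ix2, add_sub_assoc,
    ← intervalIntegral.integral_sub ix2 iy]
  have hd : 0 ≤ y - x := sub_nonneg.2 hy.1
  have b1 : |∫ s in x..y, q s * ((s - x) ^ (α - 1) * k s x)| ≤ |Q| * |K| / α * (y - x) ^ α := by
    have : |Q| * |K| / α * (y - x) ^ α = ∫ s in x..y, (|Q| * |K|) * (s - x) ^ (α - 1) := by
      rw [intervalIntegral.integral_const_mul, integral_sub_rpow hα, sub_self,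
        Real.zero_rpow hα.ne', sub_zero]
      ring
    rw [this, ← Real.norm_eq_abs]
    refine intervalIntegral.norm_integral_le_of_norm_le hy.1 ?_
      ((intervalIntegrable_sub_rpow hα x x y).const_mul _)
    filter_upwards [hne] with s hsh hs
    have hs0 : s ∈ Ioo 0 h := ⟨hx.1.trans_lt hs.1, lt_of_le_of_ne (hs.2.trans hy.2) hsh⟩
    have hpw : 0 ≤ (s - x) ^ (α - 1) := Real.rpow_nonneg (sub_nonneg.2 hs.1.le) _
    rw [norm_mul, norm_mul, Real.norm_of_nonneg hpw, Real.norm_eq_abs, Real.norm_eq_abs,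
      mul_comm ((s - x) ^ (α - 1)), ← mul_assoc]
    exact mul_le_mul_of_nonneg_right (mul_le_mul (hQ' s hs0) (hK' s ⟨hs0.1.le, hs0.2.le⟩ x hx)
      (abs_nonneg _) (abs_nonneg _)) hpw
  have b2 : |∫ s in y..h, (q s * ((s - x) ^ (α - 1) * k s x) - q s * ((s - y) ^ (α - 1) * k s y))|
      ≤ |Q| * (L * |h| ^ (1 - α) * (|h| ^ α / α) + |K| / α) * (y - x) ^ α := by
    have i1 := (intervalIntegrable_sub_rpow hα x y h).const_mul (L * (y - x))
    have i2 := ((intervalIntegrable_sub_rpow hα y y h).sub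
      (intervalIntegrable_sub_rpow hα x y h)).const_mul |K|
    have hb : |∫ s in y..h, (q s * ((s - x) ^ (α - 1) * k s x) -
        q s * ((s - y) ^ (α - 1) * k s y))| ≤ ∫ s in y..h, |Q| * (L * (y - x) * (s - x) ^ (α - 1) +
          |K| * ((s - y) ^ (α - 1) - (s - x) ^ (α - 1))) := by
      rw [← Real.norm_eq_abs]
      refine intervalIntegral.norm_integral_le_of_norm_le hy.2 ?_ ((i1.add i2).const_mul _)
      filter_upwards [hne] with s hsh hs
      have hs0 : s ∈ Ioo 0 h := ⟨hy0.1.trans_lt hs.1, lt_of_le_of_ne hs.2 hsh⟩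
      have hs1 : s ∈ Icc 0 h := ⟨hs0.1.le, hs0.2.le⟩
      have hpx : 0 ≤ (s - x) ^ (α - 1) := Real.rpow_nonneg (by linarith [hs.1, hy.1]) _
      have hpxy : (s - x) ^ (α - 1) ≤ (s - y) ^ (α - 1) :=
        Real.rpow_le_rpow_of_nonpos (sub_pos.2 hs.1) (by linarith [hy.1]) (by linarith)
      have e : q s * ((s - x) ^ (α - 1) * k s x) - q s * ((s - y) ^ (α - 1) * k s y) =
          q s * ((s - x) ^ (α - 1) * (k s x - k s y) -
            k s y * ((s - y) ^ (α - 1) - (s - x) ^ (α - 1))) := by ring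
      rw [e, norm_mul, Real.norm_eq_abs, Real.norm_eq_abs]
      refine mul_le_mul (hQ' s hs0) ((abs_sub _ _).trans (add_le_add ?_ ?_)) (abs_nonneg _)
        (abs_nonneg _)
      · rw [abs_mul, abs_of_nonneg hpx, mul_comm]
        refine mul_le_mul_of_nonneg_right ?_ hpx
        have := hL s hs1 x hx y hy0
        rwa [abs_sub_comm x y, abs_of_nonneg hd] at this
      · rw [abs_mul, abs_of_nonneg (sub_nonneg.2 hpxy)]
        exact mul_le_mul_of_nonneg_right (hK' s hs1 y hy0) (sub_nonneg.2 hpxy)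
    refine hb.trans ?_
    rw [intervalIntegral.integral_const_mul, intervalIntegral.integral_add i1 i2,
      intervalIntegral.integral_const_mul, intervalIntegral.integral_const_mul,
      intervalIntegral.integral_sub (intervalIntegrable_sub_rpow hα y y h)
      (intervalIntegrable_sub_rpow hα x y h), integral_sub_rpow hα, integral_sub_rpow hα, sub_self,
      Real.zero_rpow hα.ne', sub_zero, mul_assoc |Q|]
    refine mul_le_mul_of_nonneg_left ?_ (abs_nonneg Q)
    rw [add_mul]
    have hhx : 0 ≤ h - x := sub_nonneg.2 hx.2
    have hp0 : 0 ≤ (y - x) ^ α := Real.rpow_nonneg hd _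
    refine add_le_add ?_ ?_
    · have h1 : y - x ≤ |h| ^ (1 - α) * (y - x) ^ α := by
        rcases hd.eq_or_lt with h0 | h0
        · rw [← h0, Real.zero_rpow hα.ne', mul_zero]
        · calc y - x = (y - x) ^ (1 - α) * (y - x) ^ α := by
                rw [← Real.rpow_add h0]; simp
            _ ≤ |h| ^ (1 - α) * (y - x) ^ α := by
                refine mul_le_mul_of_nonneg_right (Real.rpow_le_rpow hd ?_ (by linarith)) hp0
                rw [abs_of_nonneg hh]; linarith [hx.1, hy.2]
      have h2 : ((h - x) ^ α - (y - x) ^ α) / α ≤ |h| ^ α / α := by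
        refine div_le_div_of_nonneg_right ?_ hα.le
        have : (h - x) ^ α ≤ |h| ^ α := Real.rpow_le_rpow hhx (by
          rw [abs_of_nonneg hh]; linarith [hx.1]) hα.le
        linarith
      calc L * (y - x) * (((h - x) ^ α - (y - x) ^ α) / α)
          ≤ L * (y - x) * (|h| ^ α / α) := mul_le_mul_of_nonneg_left h2 (by positivity)
        _ ≤ L * (|h| ^ (1 - α) * (y - x) ^ α) * (|h| ^ α / α) := by gcongr
        _ = _ := by ring
    · have h3 : (h - y) ^ α ≤ (h - x) ^ α :=
        Real.rpow_le_rpow (sub_nonneg.2 hy.2) (by linarith [hy.1]) hα.le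
      rw [div_mul_eq_mul_div, ← sub_div, mul_div_assoc]
      refine mul_le_mul_of_nonneg_left (div_le_div_of_nonneg_right ?_ hα.le) (abs_nonneg _)
      linarith
  refine (abs_add_le _ _).trans ?_
  rw [add_mul]
  exact add_le_add b1 b2

end

section

/-! ### Regularity of the density `N` -/

/-- Hölder continuity with exponent `α` on `[0, h]`. -/
def HolderIcc (α h : ℝ) (f : ℝ → ℝ) : Prop :=
  ∃ C, 0 ≤ C ∧ ∀ x ∈ Icc 0 h, ∀ y ∈ Icc x h, |f x - f y| ≤ C * (y - x) ^ α

lemma HolderIcc.abs_sub_le {α h : ℝ} {f : ℝ → ℝ} (hf : HolderIcc α h f) :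
    ∃ C, 0 ≤ C ∧ ∀ x ∈ Icc 0 h, ∀ y ∈ Icc 0 h, |f x - f y| ≤ C * |x - y| ^ α := by
  obtain ⟨C, hC, h1⟩ := hf
  refine ⟨C, hC, fun x hx y hy => ?_⟩
  rcases le_total x y with hxy | hxy
  · have := h1 x hx y ⟨hxy, hy.2⟩
    rwa [abs_sub_comm x y, abs_of_nonneg (sub_nonneg.2 hxy)]
  · have := h1 y hy x ⟨hxy, hx.2⟩
    rwa [abs_sub_comm (f x), abs_of_nonneg (sub_nonneg.2 hxy)]

lemma HolderIcc.continuousOn {α h : ℝ} {f : ℝ → ℝ} (hα : 0 < α) (hf : HolderIcc α h f) :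
    ContinuousOn f (Icc 0 h) := by
  obtain ⟨C, hC, h1⟩ := hf.abs_sub_le
  intro x hx
  rw [ContinuousWithinAt, tendsto_iff_norm_sub_tendsto_zero]
  have h2 : Tendsto (fun y => C * |y - x| ^ α) (𝓝[Icc 0 h] x) (𝓝 0) := by
    have : Continuous fun y : ℝ => C * |y - x| ^ α :=
      continuous_const.mul (Continuous.rpow_const (by fun_prop) fun _ => Or.inr hα.le)
    have h3 := (this.tendsto x).mono_left (nhdsWithin_le_nhds (s := Icc 0 h))
    simpa [Real.zero_rpow hα.ne'] using h3
  refine squeeze_zero' (Eventually.of_forall fun _ => norm_nonneg _) ?_ h2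
  filter_upwards [self_mem_nhdsWithin] with y hy using h1 y hy x hx

lemma le_rpow_mul_rpow {a b α β : ℝ} (ha : 0 ≤ a) (hab : a ≤ b) (hαβ : α ≤ β) (hα : 0 < α) :
    a ^ β ≤ b ^ (β - α) * a ^ α := by
  rcases ha.eq_or_lt with h0 | h0
  · rw [← h0, Real.zero_rpow (by linarith), Real.zero_rpow hα.ne', mul_zero]
  · calc a ^ β = a ^ (β - α) * a ^ α := by rw [← Real.rpow_add h0]; simp
      _ ≤ _ := mul_le_mul_of_nonneg_right (Real.rpow_le_rpow ha hab (by linarith))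
        (Real.rpow_nonneg ha _)

lemma HolderIcc.mono {α β h : ℝ} {f : ℝ → ℝ} (hα : 0 < α) (hαβ : α ≤ β) (hf : HolderIcc β h f) :
    HolderIcc α h f := by
  obtain ⟨C, hC, h1⟩ := hf
  refine ⟨C * |h| ^ (β - α), by positivity, fun x hx y hy => (h1 x hx y hy).trans ?_⟩
  rw [mul_assoc]
  refine mul_le_mul_of_nonneg_left (le_rpow_mul_rpow (sub_nonneg.2 hy.1) ?_ hαβ hα) hC
  exact le_trans (by linarith [hx.1, hy.2]) (le_abs_self h)

lemma HolderIcc.add {α h : ℝ} {f g : ℝ → ℝ} (hf : HolderIcc α h f) (hg : HolderIcc α h g) :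
    HolderIcc α h fun x => f x + g x := by
  obtain ⟨C, hC, h1⟩ := hf
  obtain ⟨D, hD, h2⟩ := hg
  refine ⟨C + D, by positivity, fun x hx y hy => ?_⟩
  rw [show f x + g x - (f y + g y) = (f x - f y) + (g x - g y) by ring, add_mul]
  exact (abs_add_le _ _).trans (add_le_add (h1 x hx y hy) (h2 x hx y hy))

lemma HolderIcc.const_mul {α h : ℝ} {f : ℝ → ℝ} (hf : HolderIcc α h f) (c : ℝ) :
    HolderIcc α h fun x => c * f x := by
  obtain ⟨C, hC, h1⟩ := hf
  refine ⟨|c| * C, by positivity, fun x hx y hy => ?_⟩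
  rw [← mul_sub, abs_mul, mul_assoc]
  exact mul_le_mul_of_nonneg_left (h1 x hx y hy) (abs_nonneg _)

variable {p lam h : ℝ} {φ : ℝ → ℝ}

lemma ContinuousOn.integrableOn_Ioc_zero {f : ℝ → ℝ} (hf : ContinuousOn f (Icc 0 h)) :
    IntegrableOn f (Ioc 0 h) :=
  (hf.integrableOn_compact isCompact_Icc).mono_set Ioc_subset_Icc_self

/-- As φ' is C¹ with φ'(h) = 0, the derivative of Ψ is an Abel integral of the bounded function φ''
and hence Hölder of exponent 1 - p. The Volterra term of `opJ` is even Lipschitz. Both vanish at h,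
where the integrals are empty. -/
lemma exists_weighted_densityN (lam : ℝ) (hp₀ : 0 < p) (hp₁ : p < 1 / 2) (hh : 0 < h)
    (H : AdmissibleDatum p h φ) :
    ∃ n : ℝ → ℝ, HolderIcc (1 - p) h n ∧ n h = 0 ∧
      (∀ s ∈ Ioo 0 h, densityN p lam h φ s = (h - s) ^ (-p) * n s) ∧
      ∀ x ∈ Ioo 0 h, opA p lam h h n x = -(1 / p) * derivWithin φ (Icc 0 h) x := by
  have hp1 : p < 1 := by linarith
  have hα : 0 < 1 - p := by linarith
  set g := derivWithin φ (Icc 0 h) with hg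
  have hg1 := H.contDiffOn_derivWithin hh
  have hgh := H.derivWithin_right hp₀ hh
  set q := derivWithin g (Icc 0 h) with hq
  have hqc : ContinuousOn q (Icc 0 h) :=
    hg1.continuousOn_derivWithin (uniqueDiffOn_Icc hh) le_rfl
  have hqi : IntegrableOn q (Ioc 0 h) := ContinuousOn.integrableOn_Ioc_zero hqc
  obtain ⟨Q, hQ⟩ := isCompact_Icc.exists_bound_of_continuousOn hqc
  set v := psiDeriv p lam h h q with hv
  have hvH : HolderIcc (1 - p) h v := holder_abel hα (by linarith) hqi
    (fun s hs => hQ s ⟨hs.1.le, hs.2.le⟩) (contDiff_psiDerivKernel hp1)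
  have hvc := hvH.continuousOn hα
  have hvi : IntegrableOn v (Ioc 0 h) := ContinuousOn.integrableOn_Ioc_zero hvc
  have hψ : ∀ x ∈ Ioo 0 h, psi p lam h h g x = -∫ t in x..h, v t := fun x hx =>
    psi_eq_of_primitive hp1 hx.2 (hqi.mono_set (Ioc_subset_Ioc_left hx.1.le)) fun ξ hξ =>
      eq_neg_integral_derivWithin hh hg1 hgh ⟨hx.1.le.trans hξ.1, hξ.2⟩
  have hgc : ContinuousOn g (Icc 0 h) := hg1.continuousOn
  have hgi : IntegrableOn g (Ioc 0 h) := ContinuousOn.integrableOn_Ioc_zero hgc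
  have hgo := hgc.mono Ioo_subset_Icc_self
  have hvo := hvc.mono Ioo_subset_Icc_self
  have hψi := integrableOn_psi (p := p) (lam := lam) (c := h) hp1 hgi
  have hψb : ∀ x ∈ Ioo 0 h, |psi p lam h h g x| ≤ ∫ t in (0 : ℝ)..h, |v t| := by
    intro x hx
    rw [hψ x hx, abs_neg]
    have hvI : IntervalIntegrable v volume 0 h :=
      (intervalIntegrable_iff_integrableOn_Ioc_of_le hh.le).2 hvi
    refine (intervalIntegral.abs_integral_le_integral_abs hx.2.le).trans ?_
    exact intervalIntegral.integral_mono_interval hx.1.le hx.2.le le_rfl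
      (ae_of_all _ fun _ => abs_nonneg _) hvI.abs
  have hwH : HolderIcc 1 h (fun x => ∫ s in x..h, hyp01 2 (lam * (s - x) ^ 2) *
      psi p lam h h g s) := by
    have := holder_abel one_pos le_rfl hψi hψb (k := fun s x => hyp01 2 (lam * (s - x) ^ 2))
      ((contDiff_one_hyp01 two_pos).comp
        (by fun_prop : ContDiff ℝ 1 fun q : ℝ × ℝ => lam * (q.1 - q.2) ^ 2))
    simp only [sub_self, Real.rpow_zero, one_mul] at this
    simpa only [HolderIcc, mul_comm (hyp01 _ _)] using this
  -- The integral formula is meaningful on the whole closed interval, whereas the derivative in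
  -- `opJ` is controlled only inside (0, h).
  set J : ℝ → ℝ := fun x => Real.sin (Real.pi * p) / Real.pi *
    (-v x - 2 * lam * ∫ s in x..h, hyp01 2 (lam * (s - x) ^ 2) * psi p lam h h g s) with hJ
  have hJeq : ∀ x ∈ Ioo 0 h, opJ p lam h h g x = J x := fun x hx => opJ_eq_of_psi_eq hvo hvi hψ hx
  have hJH : HolderIcc (1 - p) h J := by
    have := (((hvH.const_mul (-1)).add
      ((hwH.mono hα (by linarith)).const_mul (-(2 * lam))))).const_mul
      (Real.sin (Real.pi * p) / Real.pi)
    convert this using 2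
    ring
  refine ⟨fun x => -(1 / p) * J x, hJH.const_mul _, ?_, fun s hs => ?_, fun x hx => ?_⟩
  · simp [hJ, hv, psiDeriv]
  · rw [densityN, hJeq s hs]; ring
  · rw [← opA_opJ hp₀ hp1 hgo hgi hvo hvi hψ hx, opA, opA, ← intervalIntegral.integral_const_mul]
    refine intervalIntegral.integral_congr_ae ?_
    have hne : ∀ᵐ s : ℝ, s ≠ h := by simp [ae_iff]
    filter_upwards [hne] with s hsh hs
    rw [uIoc_of_le hx.2.le] at hs
    rw [hJeq s ⟨hx.1.trans hs.1, lt_of_le_of_ne hs.2 hsh⟩]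
    ring

section weighted

variable {n : ℝ → ℝ} {C : ℝ}

/-- Because n(h) = 0, the Hölder bound gives |n(x)| ≤ C(h - x)^(1-p); the weight costs a further p,
and 1 - 2p is positive. -/
lemma abs_weighted_le (hp₁ : p < 1 / 2)
    (hn : ∀ x ∈ Icc 0 h, ∀ y ∈ Icc x h, |n x - n y| ≤ C * (y - x) ^ (1 - p)) (hC : 0 ≤ C)
    (hnh : n h = 0) {x : ℝ} (hx : x ∈ Icc 0 h) :
    |(h - x) ^ (-p) * n x| ≤ C * h ^ (1 - 2 * p) := by
  have h1 := hn x hx h ⟨hx.2, le_rfl⟩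
  rw [hnh, sub_zero] at h1
  have hhx : 0 ≤ h - x := sub_nonneg.2 hx.2
  rw [abs_mul, abs_of_nonneg (Real.rpow_nonneg hhx _)]
  have hh0 : 0 ≤ h := hx.1.trans hx.2
  rcases hhx.eq_or_lt with h0 | h0
  · rw [← h0, Real.zero_rpow (by linarith : (1 - p) ≠ 0), mul_zero] at h1
    have : |n x| = 0 := le_antisymm h1 (abs_nonneg _)
    rw [this, mul_zero]; positivity
  · calc (h - x) ^ (-p) * |n x| ≤ (h - x) ^ (-p) * (C * (h - x) ^ (1 - p)) :=
        mul_le_mul_of_nonneg_left h1 (Real.rpow_nonneg hhx _)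
      _ = C * (h - x) ^ (1 - 2 * p) := by
        rw [show 1 - 2 * p = -p + (1 - p) by ring, Real.rpow_add h0]; ring
      _ ≤ C * h ^ (1 - 2 * p) := mul_le_mul_of_nonneg_left
        (Real.rpow_le_rpow hhx (by linarith [hx.1]) (by linarith)) hC

/-- After division by t^(-p) the claim is 1 - (1 + u)^(-p) ≤ u^θ with u = d/t. It is trivial for u ≥
1; for u ≤ 1 it follows from 1 - u ≤ 1/(1 + u) and u ≤ u^θ. -/
lemma rpow_neg_sub_le (hp₀ : 0 < p) (hp₁ : p < 1) {t d θ : ℝ} (ht : 0 < t) (hd : 0 ≤ d)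
    (hθ₀ : 0 < θ) (hθ₁ : θ ≤ 1) : t ^ (-p) - (t + d) ^ (-p) ≤ t ^ (-p) * (d ^ θ * t ^ (-θ)) := by
  have hu : 0 ≤ d / t := by positivity
  have e1 : (t + d) ^ (-p) = t ^ (-p) * (1 + d / t) ^ (-p) := by
    rw [← Real.mul_rpow ht.le (by positivity)]
    congr 1; field_simp
  have e2 : d ^ θ * t ^ (-θ) = (d / t) ^ θ := by
    rw [Real.div_rpow hd ht.le, Real.rpow_neg ht.le]; rfl
  rw [e1, e2, ← mul_one_sub]
  refine mul_le_mul_of_nonneg_left ?_ (Real.rpow_nonneg ht.le _)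
  rcases le_total 1 (d / t) with h1 | h1
  · have : 1 ≤ (d / t) ^ θ := Real.one_le_rpow h1 hθ₀.le
    have h2 : 0 ≤ (1 + d / t) ^ (-p) := Real.rpow_nonneg (by positivity) _
    linarith
  · have h2 : d / t ≤ (d / t) ^ θ := by
      rcases hu.eq_or_lt with h0 | h0
      · rw [← h0, Real.zero_rpow hθ₀.ne']
      · simpa using Real.rpow_le_rpow_of_exponent_ge h0 h1 hθ₁
    have h3 : (1 + d / t) ^ (-1 : ℝ) ≤ (1 + d / t) ^ (-p) :=
      Real.rpow_le_rpow_of_exponent_le (by linarith) (by linarith)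
    rw [Real.rpow_neg_one] at h3
    have h4 : 1 - d / t ≤ (1 + d / t)⁻¹ := by
      rw [← one_div, le_div_iff₀ (by positivity)]
      nlinarith
    linarith

/-- An interpolation: the Hölder exponent may rise from 1 - 2p to 1 - p at the price of a singular
factor (h - y)^(1-2p-θ). The gain matters for p ≥ 1/3, where 1 - 2p does not exceed p. -/
lemma weighted_sub_le (hp₀ : 0 < p) (hp₁ : p < 1 / 2)
    (hn : ∀ x ∈ Icc 0 h, ∀ y ∈ Icc x h, |n x - n y| ≤ C * (y - x) ^ (1 - p)) (hC : 0 ≤ C)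
    (hnh : n h = 0) {θ : ℝ} (hθ₁ : 1 - 2 * p ≤ θ) (hθ₂ : θ ≤ 1 - p) {x y : ℝ} (hx : 0 ≤ x)
    (hxy : x ≤ y) (hy : y < h) :
    |(h - x) ^ (-p) * n x - (h - y) ^ (-p) * n y| ≤
      2 * C * ((y - x) ^ θ * (h - y) ^ (1 - 2 * p - θ)) := by
  have hθ0 : 0 < θ := by linarith
  have hyp : 0 < h - y := sub_pos.2 hy
  have hxp : 0 < h - x := by linarith
  have hd : 0 ≤ y - x := sub_nonneg.2 hxy
  have h1 := hn x ⟨hx, by linarith⟩ y ⟨hxy, hy.le⟩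
  have h2 := hn y ⟨by linarith, hy.le⟩ h ⟨hy.le, le_rfl⟩
  rw [hnh, sub_zero] at h2
  have b1 : (h - x) ^ (-p) * |n x - n y| ≤ C * ((y - x) ^ θ * (h - y) ^ (1 - 2 * p - θ)) := by
    calc (h - x) ^ (-p) * |n x - n y| ≤ (h - x) ^ (-p) * (C * (y - x) ^ (1 - p)) :=
          mul_le_mul_of_nonneg_left h1 (Real.rpow_nonneg hxp.le _)
      _ ≤ (h - x) ^ (-p) * (C * ((h - x) ^ (1 - p - θ) * (y - x) ^ θ)) := by
          refine mul_le_mul_of_nonneg_left (mul_le_mul_of_nonneg_left ?_ hC)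
            (Real.rpow_nonneg hxp.le _)
          exact le_rpow_mul_rpow hd (by linarith) hθ₂ hθ0
      _ = C * ((y - x) ^ θ * (h - x) ^ (1 - 2 * p - θ)) := by
          rw [show 1 - 2 * p - θ = -p + (1 - p - θ) by ring, Real.rpow_add hxp]; ring
      _ ≤ _ := by
          refine mul_le_mul_of_nonneg_left (mul_le_mul_of_nonneg_left ?_
            (Real.rpow_nonneg hd _)) hC
          exact Real.rpow_le_rpow_of_nonpos hyp (by linarith) (by linarith)
  have b2 : ((h - y) ^ (-p) - (h - x) ^ (-p)) * |n y| ≤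
      C * ((y - x) ^ θ * (h - y) ^ (1 - 2 * p - θ)) := by
    have h3 := rpow_neg_sub_le hp₀ (by linarith) hyp hd hθ0 (by linarith : θ ≤ 1)
    rw [show h - y + (y - x) = h - x by ring] at h3
    calc ((h - y) ^ (-p) - (h - x) ^ (-p)) * |n y| ≤
          ((h - y) ^ (-p) * ((y - x) ^ θ * (h - y) ^ (-θ))) * (C * (h - y) ^ (1 - p)) :=
          mul_le_mul h3 h2 (abs_nonneg _) (mul_nonneg (Real.rpow_nonneg hyp.le _)
            (mul_nonneg (Real.rpow_nonneg hd _) (Real.rpow_nonneg hyp.le _)))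
      _ = _ := by
          rw [show 1 - 2 * p - θ = -p + -θ + (1 - p) by ring, Real.rpow_add hyp, Real.rpow_add hyp]
          ring
  have e : (h - x) ^ (-p) * n x - (h - y) ^ (-p) * n y =
      (h - x) ^ (-p) * (n x - n y) - ((h - y) ^ (-p) - (h - x) ^ (-p)) * n y := by ring
  have hmono : (h - x) ^ (-p) ≤ (h - y) ^ (-p) :=
    Real.rpow_le_rpow_of_nonpos hyp (by linarith) (by linarith)
  rw [e]
  refine (abs_sub _ _).trans ?_
  rw [abs_mul, abs_mul, abs_of_nonneg (Real.rpow_nonneg hxp.le _),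
    abs_of_nonneg (sub_nonneg.2 hmono)]
  linarith

end weighted

end

section

/-! ### Regularity of `M` -/

lemma HolderIcc.exists_abs_le {α h : ℝ} {f : ℝ → ℝ} (hα : 0 < α) (hf : HolderIcc α h f) :
    ∃ K, 0 ≤ K ∧ ∀ x ∈ Icc 0 h, |f x| ≤ K := by
  obtain ⟨K, hK⟩ := isCompact_Icc.exists_bound_of_continuousOn (hf.continuousOn hα)
  exact ⟨|K|, abs_nonneg _, fun x hx => (hK x hx).trans (le_abs_self K)⟩

lemma HolderIcc.mul {α h : ℝ} {f g : ℝ → ℝ} (hα : 0 < α) (hf : HolderIcc α h f)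
    (hg : HolderIcc α h g) : HolderIcc α h fun x => f x * g x := by
  obtain ⟨K, hK0, hK⟩ := hf.exists_abs_le hα
  obtain ⟨L, hL0, hL⟩ := hg.exists_abs_le hα
  obtain ⟨C, hC, h1⟩ := hf
  obtain ⟨D, hD, h2⟩ := hg
  refine ⟨K * D + C * L, by positivity, fun x hx y hy => ?_⟩
  have hy' : y ∈ Icc 0 h := ⟨hx.1.trans hy.1, hy.2⟩
  have hd : 0 ≤ (y - x) ^ α := Real.rpow_nonneg (sub_nonneg.2 hy.1) _
  rw [show f x * g x - f y * g y = f x * (g x - g y) + (f x - f y) * g y by ring]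
  refine (abs_add_le _ _).trans ?_
  rw [abs_mul, abs_mul, add_mul, mul_assoc K]
  refine add_le_add (mul_le_mul (hK x hx) (h2 x hx y hy) (abs_nonneg _) hK0) ?_
  rw [mul_right_comm]
  exact mul_le_mul (h1 x hx y hy) (hL y hy') (abs_nonneg _) (by positivity)

lemma holderIcc_rpow {q h : ℝ} (hq₀ : 0 < q) (hq₁ : q ≤ 1) : HolderIcc q h fun x => x ^ q := by
  refine ⟨1, zero_le_one, fun x hx y hy => ?_⟩
  have h1 := Real.rpow_add_le_add_rpow hx.1 (sub_nonneg.2 hy.1) hq₀.le hq₁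
  rw [add_sub_cancel] at h1
  have h2 := Real.rpow_le_rpow hx.1 hy.1 hq₀.le
  rw [abs_sub_comm, abs_of_nonneg (sub_nonneg.2 h2)]
  linarith

variable {p lam h : ℝ} {φ : ℝ → ℝ}

/-- The scaling s = τx moves the singularities to the fixed interval [0, 1], so that x enters only
through x^(2p) and regular factors. -/
lemma opM_eq_rpow_mul (N : ℝ → ℝ) {x : ℝ} (hx : 0 < x) :
    opM p lam N x = x ^ (2 * p) *
      ∫ τ in (0 : ℝ)..1, N (τ * x) * (τ ^ p * (1 - τ) ^ (p - 1)) *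
        hyp01 p (-lam * x ^ 2 * (τ * (1 - τ))) := by
  have h1 := intervalIntegral.integral_comp_mul_right (a := 0) (b := 1) (c := x)
    (fun s => N s * s ^ p * (x - s) ^ (p - 1) * hyp01 p (-lam * s * (x - s))) hx.ne'
  rw [zero_mul, one_mul, smul_eq_mul, eq_inv_mul_iff_mul_eq₀ hx.ne'] at h1
  rw [opM, ← h1, ← intervalIntegral.integral_const_mul, ← intervalIntegral.integral_const_mul]
  refine intervalIntegral.integral_congr fun τ hτ => ?_
  rw [uIcc_of_le zero_le_one] at hτ
  have e1 : x - τ * x = (1 - τ) * x := by ring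
  have e2 : -lam * (τ * x) * ((1 - τ) * x) = -lam * x ^ 2 * (τ * (1 - τ)) := by ring
  have e3 : x ^ (2 * p) = x * (x ^ p * x ^ (p - 1)) := by
    nth_rewrite 2 [← Real.rpow_one x]
    rw [← Real.rpow_add hx, ← Real.rpow_add hx]
    congr 1; ring
  rw [e1, e2, Real.mul_rpow hτ.1 hx.le, Real.mul_rpow (by linarith [hτ.2]) hx.le, e3]
  ring

lemma holderIcc_scaled_integral (hp₀ : 0 < p) (hp₁ : p < 1 / 2) (hh : 0 < h)
    {n : ℝ → ℝ} (hn : HolderIcc (1 - p) h n) (hnh : n h = 0) :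
    HolderIcc (1 - 2 * p + 2 * p ^ 2) h fun x => ∫ τ in (0 : ℝ)..1,
      (h - τ * x) ^ (-p) * n (τ * x) * (τ ^ p * (1 - τ) ^ (p - 1)) *
        hyp01 p (-lam * x ^ 2 * (τ * (1 - τ))) := by
  have hnc := hn.continuousOn (by linarith)
  obtain ⟨C, hC, hn⟩ := hn
  -- Write θ = 1 - 2p + δ with δ = 2p². Then θ > p, because 1 - 3p + 2p² = (1 - p)(1 - 2p) > 0. As h
  -- - τy ≥ h(1 - τ), the interpolation costs a factor (1 - τ)^(-δ), which (1 - τ)^(p-1) absorbs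
  -- since δ < p.
  set θ := 1 - 2 * p + 2 * p ^ 2 with hθ
  -- The Lipschitz lemma uses one interval for both variables; [0, b] contains the range of τ and
  -- that of x.
  set b := max 1 h with hb
  have hb1 : 1 ≤ b := le_max_left _ _
  have hbh : h ≤ b := le_max_right _ _
  have hcd : ContDiff ℝ 1 (Function.uncurry fun s x : ℝ =>
      hyp01 p (-lam * x ^ 2 * (s * (1 - s)))) := by
    have : ContDiff ℝ 1 fun q : ℝ × ℝ => -lam * q.2 ^ 2 * (q.1 * (1 - q.1)) := by fun_prop
    exact (contDiff_one_hyp01 hp₀).comp this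
  obtain ⟨L, hL, hlip⟩ := exists_lipschitz_of_contDiff hcd 0 b
  obtain ⟨K, hK⟩ := (isCompact_Icc (a := (0 : ℝ)) (b := b)).prod
    (isCompact_Icc (a := (0 : ℝ)) (b := b)) |>.exists_bound_of_continuousOn
    hcd.continuous.continuousOn
  have hK0 : 0 ≤ K := (norm_nonneg _).trans
    (hK (0, 0) ⟨⟨le_rfl, by positivity⟩, ⟨le_rfl, by positivity⟩⟩)
  set δ := 2 * p ^ 2 with hδ
  have hpδ : 0 < p - δ := by rw [hδ]; nlinarith
  have hθ1 : θ ≤ 1 := by rw [hθ]; nlinarith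
  have hθ0 : 0 < θ := by rw [hθ]; nlinarith
  set A := fun τ : ℝ => 2 * C * h ^ (-δ) * K * (1 - τ) ^ ((p - δ) - 1) +
    C * h ^ (1 - 2 * p) * L * h ^ (1 - θ) * (1 - τ) ^ (p - 1) with hA
  have hAi : IntervalIntegrable A volume 0 1 :=
    ((intervalIntegrable_rpow_sub hpδ 1 0 1).const_mul _).add
      ((intervalIntegrable_rpow_sub hp₀ 1 0 1).const_mul _)
  have hAn : ∀ τ ∈ Ioc (0 : ℝ) 1, 0 ≤ A τ := fun τ hτ => by
    have : 0 ≤ 1 - τ := by linarith [hτ.2]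
    have := Real.rpow_nonneg this (p - δ - 1)
    have := Real.rpow_nonneg ‹0 ≤ 1 - τ› (p - 1)
    simp only [hA]; positivity
  have hmem : ∀ x ∈ Icc 0 h, ∀ τ ∈ Icc (0 : ℝ) 1, τ * x ∈ Icc 0 h := fun x hx τ hτ =>
    ⟨mul_nonneg hτ.1 hx.1, (mul_le_of_le_one_left hx.1 hτ.2).trans hx.2⟩
  have hint : ∀ x ∈ Icc 0 h, IntervalIntegrable (fun τ => (h - τ * x) ^ (-p) * n (τ * x) *
      (τ ^ p * (1 - τ) ^ (p - 1)) * hyp01 p (-lam * x ^ 2 * (τ * (1 - τ)))) volume 0 1 := by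
    intro x hx
    have hdom : IntervalIntegrable (fun τ : ℝ => C * h ^ (1 - 2 * p) * K * (1 - τ) ^ (p - 1))
      volume 0 1 := (intervalIntegrable_rpow_sub hp₀ 1 0 1).const_mul _
    refine hdom.mono_fun ?_ ?_
    · rw [uIoc_of_le zero_le_one, ← restrict_Ioo_eq_restrict_Ioc]
      refine ContinuousOn.aestronglyMeasurable ?_ measurableSet_Ioo
      have h0 : ContinuousOn (fun τ : ℝ => n (τ * x)) (Ioo 0 1) :=
        hnc.comp (by fun_prop) fun τ hτ => hmem x hx τ (Ioo_subset_Icc_self hτ)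
      refine ((ContinuousOn.mul ?_ h0).mul (ContinuousOn.mul ?_ ?_)).mul
        (Continuous.hyp01 hp₀ (by fun_prop)).continuousOn
      · refine ContinuousOn.rpow_const (by fun_prop) fun τ hτ => Or.inl ?_
        have : τ * x < h := by
          rcases hx.1.eq_or_lt with h0 | h0
          · rw [← h0]; simpa using hh
          · exact (mul_lt_of_lt_one_left h0 hτ.2).trans_le hx.2
        exact (sub_pos.2 this).ne'
      · exact ContinuousOn.rpow_const (by fun_prop) fun τ hτ => Or.inr hp₀.le
      · exact ContinuousOn.rpow_const (by fun_prop) fun τ hτ =>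
          Or.inl (sub_pos.2 hτ.2).ne'
    · rw [uIoc_of_le zero_le_one]
      refine (ae_restrict_iff' measurableSet_Ioc).2 (Eventually.of_forall fun τ hτ => ?_)
      have hτ' := Ioc_subset_Icc_self hτ
      have h1 := abs_weighted_le hp₁ hn hC hnh (hmem x hx τ hτ')
      have h2 := hK (τ, x) ⟨⟨hτ'.1, hτ'.2.trans hb1⟩, ⟨hx.1, hx.2.trans hbh⟩⟩
      have h3 : 0 ≤ (1 - τ) ^ (p - 1) := Real.rpow_nonneg (by linarith [hτ.2]) _
      have h4 : τ ^ p ≤ 1 := Real.rpow_le_one hτ.1.le hτ.2 hp₀.le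
      have h5 : 0 ≤ τ ^ p := Real.rpow_nonneg hτ.1.le _
      beta_reduce
      rw [norm_mul, norm_mul, Real.norm_eq_abs, Real.norm_eq_abs (τ ^ p * _),
        abs_of_nonneg (mul_nonneg h5 h3), Real.norm_eq_abs (C * _ * _ * _),
        abs_of_nonneg (mul_nonneg (by positivity) h3)]
      calc _ ≤ C * h ^ (1 - 2 * p) * (1 * (1 - τ) ^ (p - 1)) * K :=
            mul_le_mul (mul_le_mul h1 (mul_le_mul_of_nonneg_right h4 h3) (by positivity)
              (by positivity)) h2 (norm_nonneg _) (by positivity)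
        _ = _ := by ring
  refine ⟨∫ τ in (0 : ℝ)..1, A τ, ?_, fun x hx y hy => ?_⟩
  · exact intervalIntegral.integral_nonneg_of_ae_restrict zero_le_one
      ((ae_restrict_iff' measurableSet_Icc).2 (by
        filter_upwards [show ∀ᵐ s : ℝ, s ≠ 0 by simp [ae_iff]] with s hs0 hs
        exact hAn s ⟨lt_of_le_of_ne hs.1 (Ne.symm hs0), hs.2⟩))
  have hy' : y ∈ Icc 0 h := ⟨hx.1.trans hy.1, hy.2⟩
  rw [← intervalIntegral.integral_sub (hint x hx) (hint y hy'),
    ← intervalIntegral.integral_mul_const, ← Real.norm_eq_abs]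
  refine intervalIntegral.norm_integral_le_of_norm_le zero_le_one ?_ (hAi.mul_const _)
  filter_upwards [show ∀ᵐ s : ℝ, s ≠ 1 by simp [ae_iff]] with τ hτ1 hτ
  have hτ' := Ioc_subset_Icc_self hτ
  have hτl : 0 < 1 - τ := sub_pos.2 (lt_of_le_of_ne hτ.2 hτ1)
  have hyx : 0 ≤ y - x := sub_nonneg.2 hy.1
  have h3 : 0 ≤ (1 - τ) ^ (p - 1) := Real.rpow_nonneg hτl.le _
  have h4 : τ ^ p ≤ 1 := Real.rpow_le_one hτ.1.le hτ.2 hp₀.le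
  have h5 : 0 ≤ τ ^ p := Real.rpow_nonneg hτ.1.le _
  have h6 : h * (1 - τ) ≤ h - τ * y := by nlinarith [hy.2, hτ.1]
  have h7 : 0 < h * (1 - τ) := by positivity
  have hw := weighted_sub_le hp₀ hp₁ hn hC hnh (θ := θ) (by rw [hθ]; nlinarith)
    (by rw [hθ]; nlinarith) (hmem x hx τ hτ').1 (mul_le_mul_of_nonneg_left hy.1 hτ'.1)
    (by linarith)
  have hw' : 2 * C * ((τ * y - τ * x) ^ θ * (h - τ * y) ^ (1 - 2 * p - θ)) ≤
      2 * C * ((y - x) ^ θ * (h ^ (-δ) * (1 - τ) ^ (-δ))) := by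
    refine mul_le_mul_of_nonneg_left (mul_le_mul ?_ ?_ (Real.rpow_nonneg (h7.le.trans h6) _)
      (Real.rpow_nonneg hyx _)) (by positivity)
    · exact Real.rpow_le_rpow (by nlinarith [hτ.1]) (by nlinarith [hτ.2, hτ.1]) hθ0.le
    · rw [← Real.mul_rpow hh.le hτl.le, show 1 - 2 * p - θ = -δ by rw [hθ]; ring]
      exact Real.rpow_le_rpow_of_nonpos h7 h6 (by rw [hδ]; nlinarith)
  have hk := hlip τ ⟨hτ'.1, hτ'.2.trans hb1⟩ x ⟨hx.1, hx.2.trans hbh⟩ y ⟨hy'.1, hy'.2.trans hbh⟩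
  have hk' : L * |x - y| ≤ L * (h ^ (1 - θ) * (y - x) ^ θ) := by
    refine mul_le_mul_of_nonneg_left ?_ hL
    rw [abs_sub_comm, abs_of_nonneg hyx]
    have := le_rpow_mul_rpow hyx (by linarith [hx.1, hy.2] : y - x ≤ h) hθ1 hθ0
    rwa [Real.rpow_one] at this
  have h2 := hK (τ, x) ⟨⟨hτ'.1, hτ'.2.trans hb1⟩, ⟨hx.1, hx.2.trans hbh⟩⟩
  have h1 := abs_weighted_le hp₁ hn hC hnh (hmem y hy' τ hτ')
  simp only [Function.uncurry_apply_pair] at h2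
  set u := (h - τ * x) ^ (-p) * n (τ * x)
  set u' := (h - τ * y) ^ (-p) * n (τ * y)
  set k := hyp01 p (-lam * x ^ 2 * (τ * (1 - τ)))
  set k' := hyp01 p (-lam * y ^ 2 * (τ * (1 - τ)))
  have e : u * (τ ^ p * (1 - τ) ^ (p - 1)) * k - u' * (τ ^ p * (1 - τ) ^ (p - 1)) * k' =
    τ ^ p * (1 - τ) ^ (p - 1) * ((u - u') * k + u' * (k - k')) := by ring
  rw [e, Real.norm_eq_abs, abs_mul, abs_of_nonneg (mul_nonneg h5 h3)]
  have h8 : |(u - u') * k + u' * (k - k')| ≤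
      2 * C * ((y - x) ^ θ * (h ^ (-δ) * (1 - τ) ^ (-δ))) * K +
      C * h ^ (1 - 2 * p) * (L * (h ^ (1 - θ) * (y - x) ^ θ)) := by
    refine (abs_add_le _ _).trans ?_
    rw [abs_mul, abs_mul]
    have hq := Real.rpow_nonneg hyx θ
    have hq' := Real.rpow_nonneg hτl.le (-δ)
    exact add_le_add (mul_le_mul (hw.trans hw') h2 (abs_nonneg _) (by positivity))
      (mul_le_mul h1 (hk.trans hk') (abs_nonneg _) (by positivity))
  calc _ ≤ 1 * (1 - τ) ^ (p - 1) * (2 * C * ((y - x) ^ θ * (h ^ (-δ) * (1 - τ) ^ (-δ))) * K +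
      C * h ^ (1 - 2 * p) * (L * (h ^ (1 - θ) * (y - x) ^ θ))) :=
        mul_le_mul (mul_le_mul_of_nonneg_right h4 h3) h8 (abs_nonneg _) (by positivity)
    _ = _ := by
        simp only [hA]
        rw [show p - δ - 1 = (p - 1) + -δ by ring, Real.rpow_add hτl]
        ring

/-- M is the product of x^(2p) and the scaled integral. Both Hölder exponents exceed p, which is
what the absolute convergence of the Marchaud derivative requires. -/
lemma exists_holderIcc_opM (lam : ℝ) (hp₀ : 0 < p) (hp₁ : p < 1 / 2) (hh : 0 < h)
    (H : AdmissibleDatum p h φ) :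
    ∃ μ, p < μ ∧ μ ≤ 1 ∧ HolderIcc μ h (opM p lam (densityN p lam h φ)) := by
  obtain ⟨n, hn, hnh, hN, -⟩ := exists_weighted_densityN lam hp₀ hp₁ hh H
  have hθ0 : p < 1 - 2 * p + 2 * p ^ 2 := by nlinarith
  have hμ : p < min (2 * p) (1 - 2 * p + 2 * p ^ 2) := lt_min (by linarith) hθ0
  have hμ0 := hp₀.trans hμ
  refine ⟨_, hμ, (min_le_left _ _).trans (by linarith), ?_⟩
  have h1 := HolderIcc.mul hμ0 ((holderIcc_rpow (h := h) (by linarith : 0 < 2 * p)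
    (by linarith)).mono hμ0 (min_le_left _ _))
    ((holderIcc_scaled_integral (lam := lam) hp₀ hp₁ hh hn hnh).mono hμ0 (min_le_right _ _))
  have heq : ∀ x ∈ Icc 0 h, opM p lam (densityN p lam h φ) x = x ^ (2 * p) *
      ∫ τ in (0 : ℝ)..1, (h - τ * x) ^ (-p) * n (τ * x) * (τ ^ p * (1 - τ) ^ (p - 1)) *
        hyp01 p (-lam * x ^ 2 * (τ * (1 - τ))) := by
    intro x hx
    rcases hx.1.eq_or_lt with h0 | h0
    · rw [← h0, Real.zero_rpow (by linarith), zero_mul, opM, intervalIntegral.integral_same]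
    rw [opM_eq_rpow_mul _ h0]
    congr 1
    refine intervalIntegral.integral_congr_ae ?_
    filter_upwards [show ∀ᵐ s : ℝ, s ≠ 1 by simp [ae_iff]] with τ hτ1 hτ
    rw [uIoc_of_le zero_le_one] at hτ
    have : τ * x < h := (mul_lt_of_lt_one_left h0 (lt_of_le_of_ne hτ.2 hτ1)).trans_le hx.2
    rw [hN _ ⟨mul_pos hτ.1 h0, this⟩]
  obtain ⟨C, hC, h2⟩ := h1
  refine ⟨C, hC, fun x hx y hy => ?_⟩
  rw [heq x hx, heq y ⟨hx.1.trans hy.1, hy.2⟩]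
  exact h2 x hx y hy

end

section

variable {p lam h c μ : ℝ} {M : ℝ → ℝ}

/-! ### The Marchaud form of the Abel transform of a Hölder function -/

/-- The Hölder quotient `(M ξ - M t) (ξ - t)^{-ν}`. -/
def holderQuot (M : ℝ → ℝ) (ν ξ t : ℝ) : ℝ := (M ξ - M t) * (ξ - t) ^ (-ν)

lemma HolderIcc.abs_holderQuot_le (ν : ℝ) (hM : HolderIcc μ h M) : ∃ C, 0 ≤ C ∧ ∀ t ∈ Icc 0 h, ∀ ξ ∈ Icc t h,
      |holderQuot M ν ξ t| ≤ C * (ξ - t) ^ (μ - ν) := by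
  obtain ⟨C, hC, h1⟩ := hM
  refine ⟨C, hC, fun t ht ξ hξ => ?_⟩
  rcases hξ.1.eq_or_lt with h0 | h0
  · rw [holderQuot, h0, sub_self, zero_mul, abs_zero]
    exact mul_nonneg hC (Real.rpow_nonneg (by simp) _)
  · have h2 := sub_pos.2 h0
    rw [holderQuot, abs_mul, abs_of_nonneg (Real.rpow_nonneg h2.le _), abs_sub_comm,
      sub_eq_add_neg μ, Real.rpow_add h2, ← mul_assoc]
    exact mul_le_mul_of_nonneg_right (h1 t ht ξ hξ) (Real.rpow_nonneg h2.le _)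

/-- For ν < μ the quotient is of order (ξ - t)^(μ-ν), so it is continuous up to the diagonal with
value 0. -/
lemma HolderIcc.continuousOn_holderQuot {ν : ℝ} (hμ : 0 < μ) (hν : ν < μ)
    (hM : HolderIcc μ h M) :
    ContinuousOn (Function.uncurry (holderQuot M ν)) {q | 0 ≤ q.2 ∧ q.2 ≤ q.1 ∧ q.1 ≤ h} := by
  obtain ⟨C, hC, h1⟩ := hM.abs_holderQuot_le ν
  have hMc := hM.continuousOn hμ
  rintro ⟨ξ, t⟩ ⟨ht, htξ, hξ⟩
  rcases htξ.eq_or_lt with h0 | h0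
  · have h0 : t = ξ := h0
    subst h0
    have h2 : Tendsto (fun q : ℝ × ℝ => C * |q.1 - q.2| ^ (μ - ν)) (𝓝 (t, t)) (𝓝 0) := by
      have : Continuous fun q : ℝ × ℝ => C * |q.1 - q.2| ^ (μ - ν) :=
        continuous_const.mul (Continuous.rpow_const (by fun_prop) fun _ => Or.inr
          (sub_nonneg.2 hν.le))
      simpa [Real.zero_rpow (sub_pos.2 hν).ne'] using this.tendsto (t, t)
    have h3 : Function.uncurry (holderQuot M ν) (t, t) = 0 := by simp [holderQuot]
    rw [ContinuousWithinAt, h3]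
    refine squeeze_zero_norm' ?_ (h2.mono_left nhdsWithin_le_nhds)
    filter_upwards [self_mem_nhdsWithin] with q hq
    have h4 : 0 ≤ q.1 - q.2 := sub_nonneg.2 hq.2.1
    rw [abs_of_nonneg h4]
    exact h1 q.2 ⟨hq.1, hq.2.1.trans hq.2.2⟩ q.1 ⟨hq.2.1, hq.2.2⟩
  · have e1 : ContinuousWithinAt (fun q : ℝ × ℝ => M q.1) {q | 0 ≤ q.2 ∧ q.2 ≤ q.1 ∧ q.1 ≤ h}
        (ξ, t) := ContinuousWithinAt.comp (t := Icc 0 h) (f := Prod.fst) (g := M) (hMc ξ ⟨ht.trans htξ, hξ⟩)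
        continuous_fst.continuousWithinAt fun q hq => ⟨hq.1.trans hq.2.1, hq.2.2⟩
    have e2 : ContinuousWithinAt (fun q : ℝ × ℝ => M q.2) {q | 0 ≤ q.2 ∧ q.2 ≤ q.1 ∧ q.1 ≤ h}
        (ξ, t) := ContinuousWithinAt.comp (t := Icc 0 h) (f := Prod.snd) (g := M) (hMc t ⟨ht, htξ.trans hξ⟩)
        continuous_snd.continuousWithinAt fun q hq => ⟨hq.1, hq.2.1.trans hq.2.2⟩
    refine (e1.sub e2).mul (ContinuousWithinAt.rpow_const ?_ (Or.inl (sub_pos.2 h0).ne'))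
    exact (continuous_fst.sub continuous_snd).continuousWithinAt

lemma integral_sub_add_rpow {t δ : ℝ} (hδ : 0 < δ) (hth : t ≤ h) :
    ∫ ξ in t..h, p * (ξ - t + δ) ^ (-p - 1) = δ ^ (-p) - (h - t + δ) ^ (-p) := by
  have h1 : ∀ ξ ∈ uIcc t h, HasDerivAt (fun ξ => -(ξ - t + δ) ^ (-p))
      (p * (ξ - t + δ) ^ (-p - 1)) ξ := fun ξ hξ => by
    rw [uIcc_of_le hth] at hξ
    have h2 : 0 < ξ - t + δ := by linarith [hξ.1]
    have := ((Real.hasDerivAt_rpow_const (p := -p) (Or.inl h2.ne')).comp ξ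
      (((hasDerivAt_id ξ).sub_const t).add_const δ)).neg
    exact this.congr_deriv (by simp)
  rw [intervalIntegral.integral_eq_sub_of_hasDerivAt h1]
  · simp; ring
  · refine (ContinuousOn.intervalIntegrable ?_)
    refine continuousOn_const.mul (ContinuousOn.rpow_const (by fun_prop) fun ξ hξ => Or.inl ?_)
    rw [uIcc_of_le hth] at hξ
    linarith [hξ.1]

/-- With ξ - t + δ in place of ξ - t nothing is singular, so the formula follows from Dirichlet's
formula and explicit integration. The limit δ → 0 is taken only in the integrated identity. -/
lemma marchaud_regularized (hM : ContinuousOn M (Icc 0 h))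
    {x δ : ℝ} (hx : x ∈ Ioo 0 h) (hδ : 0 < δ) :
    IntervalIntegrable (fun t => M t * (h - t + δ) ^ (-p) -
      p * ∫ ξ in t..h, (M ξ - M t) * (ξ - t + δ) ^ (-p - 1)) volume x h ∧
    ∫ ξ in x..h, M ξ * (ξ - x + δ) ^ (-p) = ∫ t in x..h, (M t * (h - t + δ) ^ (-p) -
      p * ∫ ξ in t..h, (M ξ - M t) * (ξ - t + δ) ^ (-p - 1)) := by
  have hMx : ContinuousOn M (Icc x h) := hM.mono (Icc_subset_Icc_left hx.1.le)
  have hfi : IntegrableOn M (Ioc x h) := (hMx.integrableOn_compact isCompact_Icc).mono_set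
    Ioc_subset_Icc_self
  have hg : ContinuousOn (Function.uncurry fun ξ t : ℝ => -p * (ξ - t + δ) ^ (-p - 1))
      (tri x h) := by
    refine continuousOn_const.mul (ContinuousOn.rpow_const (by fun_prop) fun q hq => Or.inl ?_)
    have : q.2 ≤ q.1 := hq.2.1
    linarith
  -- Subtracting δ^(-p) makes the kernel vanish on the diagonal, as `integral_kernel_eq` requires;
  -- the subtracted term returns through `hMδ`.
  have h1 := integral_kernel_eq (f := M) (κ := fun ξ t => (ξ - t + δ) ^ (-p) - δ ^ (-p))
    (g := fun ξ t => -p * (ξ - t + δ) ^ (-p - 1)) one_pos hx.2.le hfi hg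
    (fun ξ hξ => (ContinuousOn.rpow_const (by fun_prop) fun t ht =>
      Or.inl (by linarith [ht.2] : 0 < ξ - t + δ).ne').sub continuousOn_const)
    (fun ξ hξ t ht => by
      have h2 : 0 < ξ - t + δ := by linarith [ht.2]
      have := ((Real.hasDerivAt_rpow_const (p := -p) (Or.inl h2.ne')).comp t
        (((hasDerivAt_id t).const_sub ξ).add_const δ)).sub_const (δ ^ (-p))
      exact this.congr_deriv (by simp))
    (fun ξ hξ => by simp)
  have h2 := integrableOn_abel_one (f := M) (g := fun ξ t => -p * (ξ - t + δ) ^ (-p - 1)) one_pos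
    hfi hg
  simp only [sub_self, Real.rpow_zero, one_mul] at h1 h2
  rw [← intervalIntegrable_iff_integrableOn_Ioc_of_le hx.2.le] at h2
  have hMi : ∀ t ∈ Icc x h, IntervalIntegrable (fun ξ => M ξ * (ξ - t + δ) ^ (-p - 1)) volume t h ∧
      IntervalIntegrable (fun ξ => M t * (ξ - t + δ) ^ (-p - 1)) volume t h := by
    intro t ht
    have hc : ContinuousOn (fun ξ => (ξ - t + δ) ^ (-p - 1)) (uIcc t h) := by
      rw [uIcc_of_le ht.2]
      exact ContinuousOn.rpow_const (by fun_prop) fun ξ hξ => Or.inl (by linarith [hξ.1])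
    refine ⟨ContinuousOn.intervalIntegrable (ContinuousOn.mul ?_ hc),
      ContinuousOn.intervalIntegrable (continuousOn_const.mul hc)⟩
    rw [uIcc_of_le ht.2]
    exact hMx.mono (Icc_subset_Icc_left ht.1)
  have h3 : ∀ t ∈ uIcc x h, (∫ ξ in t..h, M ξ * (-p * (ξ - t + δ) ^ (-p - 1))) + M t * δ ^ (-p) =
      M t * (h - t + δ) ^ (-p) - p * ∫ ξ in t..h, (M ξ - M t) * (ξ - t + δ) ^ (-p - 1) := by
    intro t ht
    rw [uIcc_of_le hx.2.le] at ht
    have e1 : ∫ ξ in t..h, (M ξ - M t) * (ξ - t + δ) ^ (-p - 1) =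
        (∫ ξ in t..h, M ξ * (ξ - t + δ) ^ (-p - 1)) -
          ∫ ξ in t..h, M t * (ξ - t + δ) ^ (-p - 1) := by
      rw [← intervalIntegral.integral_sub (hMi t ht).1 (hMi t ht).2]
      exact intervalIntegral.integral_congr fun ξ _ => by ring
    have e2 := integral_sub_add_rpow (p := p) (h := h) hδ ht.2
    rw [intervalIntegral.integral_const_mul] at e2
    have e3 : ∫ ξ in t..h, M ξ * (-p * (ξ - t + δ) ^ (-p - 1)) =
        -p * ∫ ξ in t..h, M ξ * (ξ - t + δ) ^ (-p - 1) := by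
      rw [← intervalIntegral.integral_const_mul]
      exact intervalIntegral.integral_congr fun ξ _ => by ring
    rw [e1, e3, intervalIntegral.integral_const_mul, mul_sub,
      show p * (M t * ∫ ξ in t..h, (ξ - t + δ) ^ (-p - 1)) =
        M t * (p * ∫ ξ in t..h, (ξ - t + δ) ^ (-p - 1)) by ring, e2]
    ring
  have hMδ : IntervalIntegrable (fun t => M t * δ ^ (-p)) volume x h :=
    ((intervalIntegrable_iff_integrableOn_Ioc_of_le hx.2.le).2 hfi).mul_const _
  refine ⟨(h2.add hMδ).congr fun t ht => ?_, ?_⟩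
  · rw [uIoc_of_le hx.2.le] at ht
    exact h3 t (by rw [uIcc_of_le hx.2.le]; exact Ioc_subset_Icc_self ht)
  rw [← intervalIntegral.integral_congr h3, intervalIntegral.integral_add h2 hMδ, ← h1,
    ← intervalIntegral.integral_add _ hMδ]
  · exact intervalIntegral.integral_congr fun t _ => by ring
  · refine ContinuousOn.intervalIntegrable ?_
    rw [uIcc_of_le hx.2.le]
    exact hMx.mul ((ContinuousOn.rpow_const (by fun_prop) fun ξ hξ =>
      Or.inl (by linarith [hξ.1])).sub continuousOn_const)

lemma tendsto_rpow_add_zero {a q : ℝ} (ha : 0 < a) :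
    Tendsto (fun δ : ℝ => (a + δ) ^ q) (𝓝[>] 0) (𝓝 (a ^ q)) := by
  have h1 : ContinuousAt (fun δ : ℝ => (a + δ) ^ q) 0 :=
    ContinuousAt.rpow_const (by fun_prop) (Or.inl (by simpa using ha.ne'))
  have h2 : Tendsto (fun δ : ℝ => (a + δ) ^ q) (𝓝 0) (𝓝 (a ^ q)) := by
    simpa using h1.tendsto
  exact h2.mono_left nhdsWithin_le_nhds

/-- The Marchaud derivative, up to sign. -/
def marchaud (p h : ℝ) (M : ℝ → ℝ) (t : ℝ) : ℝ :=
  M t * (h - t) ^ (-p) - p * ∫ ξ in t..h, (M ξ - M t) * (ξ - t) ^ (-p - 1)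

/-- Dominated convergence in the regularized identity: since μ > p, the inner integrand is bounded
by the integrable C(ξ - t)^(μ-p-1), uniformly in δ. -/
lemma integral_rpow_eq_integral_marchaud (hp₀ : 0 < p) (hp₁ : p < 1) (hμ : p < μ)
    (hM : HolderIcc μ h M) {x : ℝ} (hx : x ∈ Ioo 0 h) :
    ∫ ξ in x..h, M ξ * (ξ - x) ^ (-p) = ∫ t in x..h, marchaud p h M t := by
  have hMc := hM.continuousOn (hp₀.trans hμ)
  obtain ⟨K, hK0, hK⟩ := hM.exists_abs_le (hp₀.trans hμ)
  obtain ⟨C, hC, hM⟩ := hM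
  have hs : ∀ t ∈ Icc x h, t ∈ Icc 0 h := fun t ht => ⟨hx.1.le.trans ht.1, ht.2⟩
  have hpos : ∀ᶠ δ : ℝ in 𝓝[>] 0, 0 < δ := self_mem_nhdsWithin
  have hL : Tendsto (fun δ => ∫ ξ in x..h, M ξ * (ξ - x + δ) ^ (-p)) (𝓝[>] 0)
      (𝓝 (∫ ξ in x..h, M ξ * (ξ - x) ^ (-p))) := by
    refine intervalIntegral.tendsto_integral_filter_of_dominated_convergence
      (fun ξ => K * (ξ - x) ^ (1 - p - 1)) ?_ ?_
      ((intervalIntegrable_sub_rpow (by linarith) x x h).const_mul K) ?_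
    · filter_upwards [hpos] with δ hδ
      rw [uIoc_of_le hx.2.le]
      refine ContinuousOn.aestronglyMeasurable ?_ measurableSet_Ioc
      refine (hMc.mono fun t ht => hs t (Ioc_subset_Icc_self ht)).mul
        (ContinuousOn.rpow_const (by fun_prop) fun ξ hξ => Or.inl ?_)
      linarith [hξ.1]
    · filter_upwards [hpos] with δ hδ
      refine Eventually.of_forall fun ξ hξ => ?_
      rw [uIoc_of_le hx.2.le] at hξ
      have h1 : 0 < ξ - x := sub_pos.2 hξ.1
      rw [norm_mul, Real.norm_eq_abs, Real.norm_eq_abs, abs_of_nonneg (Real.rpow_nonneg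
        (by linarith : 0 ≤ ξ - x + δ) _), show 1 - p - 1 = -p by ring]
      exact mul_le_mul (hK ξ (hs ξ (Ioc_subset_Icc_self hξ)))
        (Real.rpow_le_rpow_of_nonpos h1 (by linarith) (by linarith))
        (Real.rpow_nonneg (by linarith) _) hK0
    · refine Eventually.of_forall fun ξ hξ => ?_
      rw [uIoc_of_le hx.2.le] at hξ
      exact (tendsto_rpow_add_zero (sub_pos.2 hξ.1)).const_mul _
  have hinner : ∀ t ∈ Ico x h, ∀ δ > 0, |∫ ξ in t..h, (M ξ - M t) * (ξ - t + δ) ^ (-p - 1)| ≤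
      C * h ^ (μ - p) / (μ - p) := by
    intro t ht δ hδ
    have h1 : |∫ ξ in t..h, (M ξ - M t) * (ξ - t + δ) ^ (-p - 1)| ≤
        ∫ ξ in t..h, C * (ξ - t) ^ (μ - p - 1) := by
      rw [← Real.norm_eq_abs]
      refine intervalIntegral.norm_integral_le_of_norm_le ht.2.le
        (Eventually.of_forall fun ξ hξ => ?_)
        ((intervalIntegrable_sub_rpow (by linarith) t t h).const_mul C)
      have h1 : 0 < ξ - t := sub_pos.2 hξ.1
      rw [norm_mul, Real.norm_eq_abs, Real.norm_eq_abs, abs_of_nonneg (Real.rpow_nonneg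
        (by linarith : 0 ≤ ξ - t + δ) _), show μ - p - 1 = μ + (-p - 1) by ring, Real.rpow_add h1,
        abs_sub_comm, ← mul_assoc]
      exact mul_le_mul (hM t (hs t ⟨ht.1, ht.2.le⟩) ξ ⟨hξ.1.le, hξ.2⟩)
        (Real.rpow_le_rpow_of_nonpos h1 (by linarith) (by linarith))
        (Real.rpow_nonneg (by linarith) _) (by positivity)
    refine h1.trans ?_
    rw [intervalIntegral.integral_const_mul, integral_sub_rpow (by linarith), sub_self,
      Real.zero_rpow (by linarith), sub_zero, mul_div_assoc]
    refine mul_le_mul_of_nonneg_left (div_le_div_of_nonneg_right ?_ (by linarith)) hC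
    exact Real.rpow_le_rpow (by linarith [ht.2]) (by linarith [hx.1, ht.1]) (by linarith)
  have hR : Tendsto (fun δ => ∫ t in x..h, (M t * (h - t + δ) ^ (-p) -
      p * ∫ ξ in t..h, (M ξ - M t) * (ξ - t + δ) ^ (-p - 1))) (𝓝[>] 0)
      (𝓝 (∫ t in x..h, marchaud p h M t)) := by
    refine intervalIntegral.tendsto_integral_filter_of_dominated_convergence
      (fun t => K * (h - t) ^ (1 - p - 1) + p * (C * h ^ (μ - p) / (μ - p))) ?_ ?_
      (((intervalIntegrable_rpow_sub (by linarith) h x h).const_mul K).add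
        intervalIntegrable_const) ?_
    · filter_upwards [hpos] with δ hδ
      rw [uIoc_of_le hx.2.le]
      exact ((intervalIntegrable_iff_integrableOn_Ioc_of_le hx.2.le).1
        (marchaud_regularized hMc hx hδ).1).aestronglyMeasurable
    · filter_upwards [hpos] with δ hδ
      filter_upwards [show ∀ᵐ s : ℝ, s ≠ h by simp [ae_iff]] with t hth ht
      rw [uIoc_of_le hx.2.le] at ht
      have hth' : t < h := lt_of_le_of_ne ht.2 hth
      refine (norm_sub_le _ _).trans (add_le_add ?_ ?_)
      · rw [norm_mul, Real.norm_eq_abs, Real.norm_eq_abs, abs_of_nonneg (Real.rpow_nonneg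
          (by linarith : 0 ≤ h - t + δ) _), show 1 - p - 1 = -p by ring]
        exact mul_le_mul (hK t (hs t (Ioc_subset_Icc_self ht)))
          (Real.rpow_le_rpow_of_nonpos (by linarith) (by linarith) (by linarith))
          (Real.rpow_nonneg (by linarith) _) hK0
      · rw [norm_mul, Real.norm_eq_abs, Real.norm_eq_abs, abs_of_pos hp₀]
        exact mul_le_mul_of_nonneg_left (hinner t ⟨ht.1.le, hth'⟩ δ hδ) hp₀.le
    · filter_upwards [show ∀ᵐ s : ℝ, s ≠ h by simp [ae_iff]] with t hth ht
      rw [uIoc_of_le hx.2.le] at ht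
      have hth' : t < h := lt_of_le_of_ne ht.2 hth
      refine ((tendsto_rpow_add_zero (sub_pos.2 hth')).const_mul _).sub (Tendsto.const_mul _ ?_)
      refine intervalIntegral.tendsto_integral_filter_of_dominated_convergence
        (fun ξ => C * (ξ - t) ^ (μ - p - 1)) ?_ ?_
        ((intervalIntegrable_sub_rpow (by linarith) t t h).const_mul C) ?_
      · filter_upwards [hpos] with δ hδ
        rw [uIoc_of_le hth'.le]
        refine ContinuousOn.aestronglyMeasurable ?_ measurableSet_Ioc
        refine ((hMc.mono fun ξ hξ => ⟨?_, hξ.2⟩).sub continuousOn_const).mul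
          (ContinuousOn.rpow_const (by fun_prop) fun ξ hξ => Or.inl ?_)
        · linarith [hx.1, ht.1, hξ.1]
        · linarith [hξ.1]
      · filter_upwards [hpos] with δ hδ
        refine Eventually.of_forall fun ξ hξ => ?_
        rw [uIoc_of_le hth'.le] at hξ
        have h1 : 0 < ξ - t := sub_pos.2 hξ.1
        rw [norm_mul, Real.norm_eq_abs, Real.norm_eq_abs, abs_of_nonneg (Real.rpow_nonneg
          (by linarith : 0 ≤ ξ - t + δ) _), show μ - p - 1 = μ + (-p - 1) by ring,
          Real.rpow_add h1, abs_sub_comm, ← mul_assoc]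
        exact mul_le_mul (hM t (hs t (Ioc_subset_Icc_self ht)) ξ ⟨hξ.1.le, hξ.2⟩)
          (Real.rpow_le_rpow_of_nonpos h1 (by linarith) (by linarith))
          (Real.rpow_nonneg (by linarith) _) (by positivity)
      · refine Eventually.of_forall fun ξ hξ => ?_
        rw [uIoc_of_le hth'.le] at hξ
        exact (tendsto_rpow_add_zero (sub_pos.2 hξ.1)).const_mul _
  refine tendsto_nhds_unique hL (hR.congr' ?_)
  filter_upwards [hpos] with δ hδ using (marchaud_regularized hMc hx hδ).2.symm

end

/-! ### The transform Ψ of a Hölder function as a primitive -/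

section

variable {p lam h c μ : ℝ} {M : ℝ → ℝ} {φ : ℝ → ℝ}

lemma integrand_holderQuot {ν t ξ : ℝ} (ht : t < ξ) :
    (M ξ - M t) * (ξ - t) ^ (-p - 1) = 1 * ((ξ - t) ^ (ν - p - 1) * holderQuot M ν ξ t) := by
  rw [holderQuot, show -p - 1 = (ν - p - 1) + -ν by ring, Real.rpow_add (sub_pos.2 ht)]
  ring

lemma marchaud_regular (hp₀ : 0 < p) (hμ : p < μ) (hh : 0 < h) (hM : HolderIcc μ h M) :
    ContinuousOn (marchaud p h M) (Ioo 0 h) ∧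
      ∃ K, 0 ≤ K ∧ ∀ t ∈ Ioo 0 h, |marchaud p h M t| ≤ K * (1 + (h - t) ^ (-p)) := by
  have hMc := hM.continuousOn (hp₀.trans hμ)
  obtain ⟨K, hK0, hK⟩ := hM.exists_abs_le (hp₀.trans hμ)
  -- Any ν strictly between p and μ would do: the Hölder quotient is continuous, and the remaining
  -- exponent ν - p - 1 exceeds -1.
  set ν := (p + μ) / 2 with hν
  have hν1 : 0 < ν - p := by rw [hν]; linarith
  have hν2 : ν < μ := by rw [hν]; linarith
  have hq := hM.continuousOn_holderQuot (hp₀.trans hμ) hν2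
  obtain ⟨C, hC, hCb⟩ := hM.abs_holderQuot_le ν
  have heq : ∀ t ∈ Ioo 0 h, marchaud p h M t = M t * (h - t) ^ (-p) -
      p * ∫ ξ in t..h, 1 * ((ξ - t) ^ (ν - p - 1) * holderQuot M ν ξ t) := by
    intro t ht
    rw [marchaud]
    congr 2
    refine intervalIntegral.integral_congr_ae (Eventually.of_forall fun ξ hξ => ?_)
    rw [uIoc_of_le ht.2.le] at hξ
    exact integrand_holderQuot hξ.1
  constructor
  · refine ContinuousOn.congr ?_ heq
    refine ((hMc.mono Ioo_subset_Icc_self).mul (ContinuousOn.rpow_const (by fun_prop)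
      fun t ht => Or.inl (sub_pos.2 ht.2).ne')).sub (continuousOn_const.mul ?_)
    exact continuousOn_abel (f := fun _ => 1) (g := holderQuot M ν) hν1 continuousOn_const
      (by simp) (hq.mono fun q hq => ⟨hq.1.le, hq.2⟩)
  · refine ⟨K + p * (C * h ^ (μ - ν) * (h ^ (ν - p) / (ν - p))), ?_, fun t ht => ?_⟩
    · positivity
    have h1 : |∫ ξ in t..h, 1 * ((ξ - t) ^ (ν - p - 1) * holderQuot M ν ξ t)| ≤
        C * h ^ (μ - ν) * (h ^ (ν - p) / (ν - p)) := by
      have h2 : |∫ ξ in t..h, 1 * ((ξ - t) ^ (ν - p - 1) * holderQuot M ν ξ t)| ≤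
          ∫ ξ in t..h, C * h ^ (μ - ν) * (ξ - t) ^ (ν - p - 1) := by
        rw [← Real.norm_eq_abs]
        refine intervalIntegral.norm_integral_le_of_norm_le ht.2.le
          (Eventually.of_forall fun ξ hξ => ?_)
          ((intervalIntegrable_sub_rpow hν1 t t h).const_mul _)
        have h3 : 0 < ξ - t := sub_pos.2 hξ.1
        have h4 := Real.rpow_nonneg h3.le (ν - p - 1)
        rw [one_mul, norm_mul, Real.norm_eq_abs, Real.norm_eq_abs, abs_of_nonneg h4, mul_comm]
        refine mul_le_mul_of_nonneg_right ((hCb t (Ioo_subset_Icc_self ht) ξ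
          ⟨hξ.1.le, hξ.2⟩).trans (mul_le_mul_of_nonneg_left ?_ hC)) h4
        exact Real.rpow_le_rpow h3.le (by linarith [hξ.2, ht.1]) (by linarith)
      refine h2.trans ?_
      rw [intervalIntegral.integral_const_mul, integral_sub_rpow hν1, sub_self,
        Real.zero_rpow hν1.ne', sub_zero]
      refine mul_le_mul_of_nonneg_left (div_le_div_of_nonneg_right ?_ hν1.le) (by positivity)
      exact Real.rpow_le_rpow (by linarith [ht.2]) (by linarith [ht.1]) hν1.le
    have hr : 0 ≤ (h - t) ^ (-p) := Real.rpow_nonneg (by linarith [ht.2]) _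
    have hK2 : 0 ≤ p * (C * h ^ (μ - ν) * (h ^ (ν - p) / (ν - p))) := by positivity
    rw [heq t ht]
    refine (abs_sub _ _).trans ?_
    rw [abs_mul, abs_mul, abs_of_nonneg hr, abs_of_pos hp₀]
    have h5 := mul_le_mul_of_nonneg_right (hK t (Ioo_subset_Icc_self ht)) hr
    have h6 := mul_le_mul_of_nonneg_left h1 hp₀.le
    nlinarith [mul_nonneg hK2 hr]

/-- The kernel in the derivative of `(s - x)^{-p} (₀F₁(1 - p; -λ (x - c) (s - x)) - 1)`. -/
def psiRestKernel (p lam c s x : ℝ) : ℝ :=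
  p * lam * (x - c) * dslope (hyp01 (1 - p)) 0 (-lam * (x - c) * (s - x)) -
    hyp01 (2 - p) (-lam * (x - c) * (s - x)) / (1 - p) * (lam * (2 * x - c - s))

lemma continuous_psiRestKernel (hp₁ : p < 1) :
    Continuous (Function.uncurry (psiRestKernel p lam c)) := by
  have h1 : Continuous (dslope (hyp01 (1 - p)) 0) := by
    rw [← continuousOn_univ, continuousOn_dslope univ_mem]
    exact ⟨(continuous_hyp01 (by linarith)).continuousOn,
      (hasDerivAt_hyp01 (by linarith : 0 < 1 - p) 0).differentiableAt⟩
  have h2 : Continuous fun q : ℝ × ℝ => dslope (hyp01 (1 - p)) 0 (-lam * (q.2 - c) * (q.1 - q.2)) :=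
    h1.comp (by fun_prop)
  have h3 : Continuous fun q : ℝ × ℝ => hyp01 (2 - p) (-lam * (q.2 - c) * (q.1 - q.2)) :=
    Continuous.hyp01 (by linarith) (by fun_prop)
  exact ((by fun_prop : Continuous fun q : ℝ × ℝ => p * lam * (q.2 - c)).mul h2).sub
    ((h3.div_const _).mul (by fun_prop))

lemma hasDerivAt_psiRest (hp₁ : p < 1) {s x : ℝ} (hx : x < s) :
    HasDerivAt (fun x => (s - x) ^ (-p) * (hyp01 (1 - p) (-lam * (x - c) * (s - x)) - 1))
      (-((s - x) ^ (1 - p - 1) * psiRestKernel p lam c s x)) x := by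
  have h1 := hasDerivAt_sub_rpow (q := -p) hx
  have h2 := ((hasDerivAt_hyp01 (by linarith : 0 < 1 - p) (-lam * (x - c) * (s - x))).comp x
    (hasDerivAt_psi_kernel_arg lam c s x)).sub_const 1
  refine (h1.mul h2).congr_deriv ?_
  -- The slope at 0 writes ₀F₁ - 1 as its argument times a continuous function; the factor s - x in
  -- that argument compensates the extra negative power from differentiation.
  have h3 : hyp01 (1 - p) (-lam * (x - c) * (s - x)) - 1 = -lam * (x - c) * (s - x) *
      dslope (hyp01 (1 - p)) 0 (-lam * (x - c) * (s - x)) := by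
    have := sub_smul_dslope (hyp01 (1 - p)) 0 (-lam * (x - c) * (s - x))
    rw [sub_zero, hyp01_zero, smul_eq_mul] at this
    exact this.symm
  simp only [Function.comp_apply]
  rw [h3, psiRestKernel, Real.rpow_sub_one (sub_pos.2 hx).ne', show 1 - p - 1 = -p by ring,
    show 1 - p + 1 = 2 - p by ring]
  have := (sub_pos.2 hx).ne'
  field_simp
  ring

/-- The factor ₀F₁ in the kernel is written as 1 + (₀F₁ - 1). The first part gives the primitive of
the Marchaud derivative. In the second the kernel is of order (ξ - x)^(1-p) and vanishes on the
diagonal, so `integral_kernel_eq` applies. -/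
lemma exists_primitive_psi (hp₀ : 0 < p) (hp₁ : p < 1) (hμ : p < μ) (hM : HolderIcc μ h M)
    (hh : 0 < h) :
    ∃ v : ℝ → ℝ, ∃ K, 0 ≤ K ∧ ContinuousOn v (Ioo 0 h) ∧ IntegrableOn v (Ioc 0 h) ∧
      (∀ t ∈ Ioo 0 h, |v t| ≤ K * (1 + (h - t) ^ (-p))) ∧
      ∀ x ∈ Ioo 0 h, psi p lam h c M x = -∫ t in x..h, v t := by
  have hα : 0 < 1 - p := by linarith
  have hMc := hM.continuousOn (hp₀.trans hμ)
  have hMi : IntegrableOn M (Ioc 0 h) := ContinuousOn.integrableOn_Ioc_zero hMc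
  obtain ⟨B, hB0, hB⟩ := hM.exists_abs_le (hp₀.trans hμ)
  obtain ⟨hmc, K, hK0, hK⟩ := marchaud_regular hp₀ hμ hh hM
  have hkc := continuous_psiRestKernel (lam := lam) (c := c) hp₁
  obtain ⟨G, hG⟩ := ((isCompact_Icc (a := (0 : ℝ)) (b := h)).prod
    (isCompact_Icc (a := (0 : ℝ)) (b := h))).exists_bound_of_continuousOn hkc.continuousOn
  have hG0 : 0 ≤ G := (norm_nonneg _).trans (hG (0, 0) ⟨⟨le_rfl, hh.le⟩, ⟨le_rfl, hh.le⟩⟩)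
  set R := fun t => ∫ s in t..h, M s * ((s - t) ^ (1 - p - 1) * psiRestKernel p lam c s t) with hR
  have hRc : ContinuousOn R (Ioo 0 h) :=
    continuousOn_abel (f := M) (g := psiRestKernel p lam c) hα (hMc.mono Ioo_subset_Icc_self)
      hMi hkc.continuousOn
  have hRb : ∀ t ∈ Ioo 0 h, |R t| ≤ B * G * (h ^ (1 - p) / (1 - p)) := by
    intro t ht
    have h2 : |R t| ≤ ∫ ξ in t..h, B * G * (ξ - t) ^ (1 - p - 1) := by
      rw [← Real.norm_eq_abs]
      refine intervalIntegral.norm_integral_le_of_norm_le ht.2.le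
        (Eventually.of_forall fun ξ hξ => ?_)
        ((intervalIntegrable_sub_rpow hα t t h).const_mul _)
      have h3 : 0 < ξ - t := sub_pos.2 hξ.1
      have h4 := Real.rpow_nonneg h3.le (1 - p - 1)
      have h5 : ξ ∈ Icc 0 h := ⟨(ht.1.trans hξ.1).le, hξ.2⟩
      have h6 := hG (ξ, t) ⟨h5, Ioo_subset_Icc_self ht⟩
      rw [norm_mul, norm_mul, Real.norm_eq_abs, Real.norm_eq_abs, abs_of_nonneg h4,
        mul_comm (_ ^ _), ← mul_assoc]
      exact mul_le_mul_of_nonneg_right (mul_le_mul (hB ξ h5) h6 (norm_nonneg _) hB0) h4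
    refine h2.trans ?_
    rw [intervalIntegral.integral_const_mul, integral_sub_rpow hα, sub_self,
      Real.zero_rpow hα.ne', sub_zero]
    refine mul_le_mul_of_nonneg_left (div_le_div_of_nonneg_right ?_ hα.le) (by positivity)
    exact Real.rpow_le_rpow (by linarith [ht.2]) (by linarith [ht.1]) hα.le
  set D := B * G * (h ^ (1 - p) / (1 - p)) with hD
  have hD0 : 0 ≤ D := by positivity
  have hvb : ∀ t ∈ Ioo 0 h, |-(marchaud p h M t + R t)| ≤ (K + D) * (1 + (h - t) ^ (-p)) := by
    intro t ht
    have hr : 0 ≤ (h - t) ^ (-p) := Real.rpow_nonneg (by linarith [ht.2]) _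
    rw [abs_neg]
    refine (abs_add_le _ _).trans ?_
    have := hK t ht
    have := hRb t ht
    nlinarith [mul_nonneg hD0 hr]
  have hdomi : IntegrableOn (fun t => (K + D) * (1 + (h - t) ^ (-p))) (Ioc 0 h) := by
    rw [← intervalIntegrable_iff_integrableOn_Ioc_of_le hh.le]
    have h1 := intervalIntegrable_rpow_sub hα h 0 h
    rw [show 1 - p - 1 = -p by ring] at h1
    exact (intervalIntegrable_const.add h1).const_mul _
  have hvc : ContinuousOn (fun t => -(marchaud p h M t + R t)) (Ioo 0 h) := (hmc.add hRc).neg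
  have hvi : IntegrableOn (fun t => -(marchaud p h M t + R t)) (Ioc 0 h) := by
    rw [integrableOn_Ioc_iff_integrableOn_Ioo] at hdomi ⊢
    refine hdomi.mono' (hvc.aestronglyMeasurable measurableSet_Ioo)
      ((ae_restrict_iff' measurableSet_Ioo).2 (Eventually.of_forall fun t ht => ?_))
    exact hvb t ht
  refine ⟨_, K + D, by positivity, hvc, hvi, hvb, fun x hx => ?_⟩
  have hsub : Ioc x h ⊆ Ioc 0 h := Ioc_subset_Ioc_left hx.1.le
  have hRi : IntervalIntegrable R volume x h := by
    rw [intervalIntegrable_iff_integrableOn_Ioc_of_le hx.2.le]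
    exact integrableOn_abel_one hα (hMi.mono_set hsub) hkc.continuousOn
  have hmi : IntervalIntegrable (marchaud p h M) volume x h := by
    have h1 : IntervalIntegrable (fun t => -(marchaud p h M t + R t)) volume x h :=
      (intervalIntegrable_iff_integrableOn_Ioc_of_le hx.2.le).2 (hvi.mono_set hsub)
    refine (h1.neg.sub hRi).congr fun t _ => ?_
    simp
  have hrest := integral_kernel_eq (f := M) (g := psiRestKernel p lam c)
    (κ := fun s x => (s - x) ^ (-p) * (hyp01 (1 - p) (-lam * (x - c) * (s - x)) - 1)) hα hx.2.le
    (hMi.mono_set hsub) hkc.continuousOn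
    -- The power (s - t)^(-p) is not continuous at t = s, but ₀F₁ - 1 supplies a factor s - t, and
    -- (s - t)^(1-p) is continuous.
    (fun s hs => by
      have h1 : Continuous (dslope (hyp01 (1 - p)) 0) := by
        rw [← continuousOn_univ, continuousOn_dslope univ_mem]
        exact ⟨(continuous_hyp01 (by linarith)).continuousOn,
          (hasDerivAt_hyp01 (by linarith : 0 < 1 - p) 0).differentiableAt⟩
      have h2 : Continuous fun t => (s - t) ^ (1 - p) * (-lam * (t - c) *
          dslope (hyp01 (1 - p)) 0 (-lam * (t - c) * (s - t))) :=
        (Continuous.rpow_const (by fun_prop) fun _ => Or.inr hα.le).mul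
          ((by fun_prop : Continuous fun t : ℝ => -lam * (t - c)).mul (h1.comp (by fun_prop)))
      refine h2.continuousOn.congr fun t ht => ?_
      have h3 : hyp01 (1 - p) (-lam * (t - c) * (s - t)) - 1 = -lam * (t - c) * (s - t) *
          dslope (hyp01 (1 - p)) 0 (-lam * (t - c) * (s - t)) := by
        have := sub_smul_dslope (hyp01 (1 - p)) 0 (-lam * (t - c) * (s - t))
        rw [sub_zero, hyp01_zero, smul_eq_mul] at this
        exact this.symm
      beta_reduce
      rw [h3]
      rcases ht.2.eq_or_lt with h4 | h4
      · rw [h4, sub_self, Real.zero_rpow hα.ne']; simp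
      · rw [sub_eq_neg_add 1 p, Real.rpow_add_one (sub_pos.2 h4).ne']
        ring)
    (fun s hs t ht => hasDerivAt_psiRest hp₁ ht.2)
    (fun s hs => by simp)
  rw [intervalIntegral.integral_neg, neg_neg, intervalIntegral.integral_add hmi hRi,
    ← integral_rpow_eq_integral_marchaud hp₀ hp₁ hμ hM hx, hR, ← hrest,
    ← intervalIntegral.integral_add]
  · exact intervalIntegral.integral_congr fun s _ => by ring
  · have h1 := intervalIntegrable_abel (f := M) (g := fun _ => 1) hα hx
      (hMc.mono Ioo_subset_Icc_self) hMi continuousOn_const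
    simpa [show 1 - p - 1 = -p by ring] using h1
  · have h1 := intervalIntegrable_abel (f := M)
      (g := fun s => hyp01 (1 - p) (-lam * (x - c) * (s - x)) - 1) hα hx
      (hMc.mono Ioo_subset_Icc_self) hMi
      ((Continuous.hyp01 hα (by fun_prop)).sub continuous_const).continuousOn
    simpa [show 1 - p - 1 = -p by ring] using h1

end

section

variable {p lam h c μ : ℝ} {M : ℝ → ℝ} {φ : ℝ → ℝ}

/-! ### The densities of the explicit solution -/

/-- The growth rate (h - s)^(-p) is recorded because integrability of T depends on it. -/
lemma exists_abs_opJ_le (hp₀ : 0 < p) (hp₁ : p < 1) (hμ : p < μ) (hM : HolderIcc μ h M)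
    (hh : 0 < h) : ContinuousOn (opJ p lam h c M) (Ioo 0 h) ∧
      (∃ K, 0 ≤ K ∧ ∀ s ∈ Ioo 0 h, |opJ p lam h c M s| ≤ K * (1 + (h - s) ^ (-p))) ∧
      ∀ x ∈ Ioo 0 h, opA p lam h c (opJ p lam h c M) x = M x := by
  obtain ⟨v, K, hK0, hvc, hvi, hvb, hψ⟩ :=
    exists_primitive_psi (lam := lam) (c := c) hp₀ hp₁ hμ hM hh
  have hMc := hM.continuousOn (hp₀.trans hμ)
  have hMi : IntegrableOn M (Ioc 0 h) := ContinuousOn.integrableOn_Ioc_zero hMc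
  have hMc' := hMc.mono Ioo_subset_Icc_self
  refine ⟨(opJ_regular hp₁ hMc' hMi hvc hvi hψ).1, ?_,
    fun x hx => opA_opJ hp₀ hp₁ hMc' hMi hvc hvi hψ hx⟩
  have hψi := integrableOn_psi (p := p) (lam := lam) (c := c) hp₁ hMi
  have hk : Continuous fun q : ℝ × ℝ => hyp01 2 (lam * (q.1 - q.2) ^ 2) :=
    Continuous.hyp01 two_pos (by fun_prop)
  obtain ⟨G, hG⟩ := ((isCompact_Icc (a := (0 : ℝ)) (b := h)).prod
    (isCompact_Icc (a := (0 : ℝ)) (b := h))).exists_bound_of_continuousOn hk.continuousOn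
  have hG0 : 0 ≤ G := (norm_nonneg _).trans (hG (0, 0) ⟨⟨le_rfl, hh.le⟩, ⟨le_rfl, hh.le⟩⟩)
  set I := ∫ s in Ioc 0 h, G * ‖psi p lam h c M s‖ with hI
  have hI0 : 0 ≤ I := integral_nonneg fun s => by positivity
  have hb : ∀ x ∈ Ioo 0 h, |∫ s in x..h, hyp01 2 (lam * (s - x) ^ 2) * psi p lam h c M s| ≤ I := by
    intro x hx
    rw [← Real.norm_eq_abs, intervalIntegral.integral_of_le hx.2.le]
    refine (norm_integral_le_of_norm_le (g := fun s => G * ‖psi p lam h c M s‖)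
      (IntegrableOn.mono_set (hψi.norm.const_mul G) (Ioc_subset_Ioc_left hx.1.le)) ?_).trans ?_
    · refine (ae_restrict_iff' measurableSet_Ioc).2 (Eventually.of_forall fun s hs => ?_)
      rw [norm_mul]
      exact mul_le_mul_of_nonneg_right (hG (s, x) ⟨⟨(hx.1.trans hs.1).le, hs.2⟩,
        Ioo_subset_Icc_self hx⟩) (norm_nonneg _)
    · exact setIntegral_mono_set (hψi.norm.const_mul G)
        (Eventually.of_forall fun s => mul_nonneg hG0 (norm_nonneg _))
        (Ioc_subset_Ioc_left hx.1.le).eventuallyLE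
  set A := |Real.sin (Real.pi * p) / Real.pi| with hA
  refine ⟨A * (K + |2 * lam| * I), by positivity, fun x hx => ?_⟩
  have hr : 0 ≤ (h - x) ^ (-p) := Real.rpow_nonneg (by linarith [hx.2]) _
  rw [opJ_eq_of_psi_eq hvc hvi hψ hx, abs_mul, mul_assoc A]
  refine mul_le_mul_of_nonneg_left ((abs_sub _ _).trans ?_) (abs_nonneg _)
  rw [abs_neg, abs_mul]
  have h1 := hvb x hx
  have h2 := mul_le_mul_of_nonneg_left (hb x hx) (abs_nonneg (2 * lam))
  have h3 : 0 ≤ |2 * lam| * I := by positivity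
  nlinarith [mul_nonneg h3 hr]

lemma isDensity_of_bound {f g : ℝ → ℝ} (hf : ContinuousOn f (Ioo 0 h))
    (hg : IntegrableOn g (Ioc 0 h)) (hfg : ∀ s ∈ Ioo 0 h, |f s| ≤ g s) : IsDensity h f := by
  refine ⟨hf, ?_⟩
  rw [integrableOn_Icc_iff_integrableOn_Ioo]
  rw [integrableOn_Ioc_iff_integrableOn_Ioo] at hg
  exact hg.mono' (hf.aestronglyMeasurable measurableSet_Ioo)
    ((ae_restrict_iff' measurableSet_Ioo).2 (Eventually.of_forall fun t ht => hfg t ht))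

lemma IsDensity.integrableOn_Ioc {f : ℝ → ℝ} (hf : IsDensity h f) : IntegrableOn f (Ioc 0 h) :=
  hf.2.mono_set Ioc_subset_Icc_self

/-- T is dominated by a multiple of s^(-p)(1 + (h - s)^(-p)), integrable at both ends; the factor
s^p cancels s^(-p) and leaves the inversion formula for `opJ`. -/
lemma densityT_spec (lam : ℝ) (hp₀ : 0 < p) (hp₁ : p < 1 / 2) (hh : 0 < h)
    (H : AdmissibleDatum p h φ) :
    IsDensity h (densityT p lam h φ) ∧ ∀ x ∈ Ioo 0 h,
      opA p lam h 0 (fun s => densityT p lam h φ s * s ^ p) x =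
        opM p lam (densityN p lam h φ) x := by
  obtain ⟨μ, hμ, -, hM⟩ := exists_holderIcc_opM lam hp₀ hp₁ hh H
  obtain ⟨hJc, ⟨K, hK0, hK⟩, hA⟩ :=
    exists_abs_opJ_le (lam := lam) (c := 0) hp₀ (by linarith) hμ hM hh
  constructor
  · have hdom : IntegrableOn (fun s : ℝ => K * (s ^ (-p) + s ^ (-p) * (h - s) ^ (-p)))
        (Ioc 0 h) := by
      have hα : 0 < 1 - p := by linarith
      have h1 := intervalIntegrable_beta hα hα hh
      have h2 := intervalIntegrable_sub_rpow hα 0 0 h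
      simp only [sub_zero, show 1 - p - 1 = -p by ring] at h1 h2
      rw [← intervalIntegrable_iff_integrableOn_Ioc_of_le hh.le]
      exact (h2.add h1).const_mul K
    refine isDensity_of_bound ?_ hdom fun s hs => ?_
    · exact (ContinuousOn.rpow_const continuousOn_id fun s hs => Or.inl hs.1.ne').mul hJc
    · have hr : 0 ≤ s ^ (-p) := Real.rpow_nonneg hs.1.le _
      rw [densityT, abs_mul, abs_of_nonneg hr]
      calc _ ≤ s ^ (-p) * (K * (1 + (h - s) ^ (-p))) := mul_le_mul_of_nonneg_left (hK s hs) hr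
        _ = _ := by ring
  · intro x hx
    rw [← hA x hx, opA, opA]
    refine intervalIntegral.integral_congr_ae (Eventually.of_forall fun s hs => ?_)
    rw [uIoc_of_le hx.2.le] at hs
    have hs0 : 0 < s := hx.1.trans hs.1
    have h1 : s ^ (-p) * s ^ p = 1 := by rw [← Real.rpow_add hs0]; simp
    rw [densityT]
    linear_combination (opJ p lam h 0 (opM p lam (densityN p lam h φ)) s *
      ((s - x) ^ (p - 1) * hyp01 p (lam * (s - 0) * (s - x)))) * h1

/-- Both sides are continuous on [0, h], so the identity extends to x = 0. That endpoint is where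
the condition φ'(0) = 0 is used. -/
lemma opA_eq_of_bdd (hp₀ : 0 < p) (hp₁ : p ≤ 1) (hh : 0 < h) {n g : ℝ → ℝ}
    (hn : ContinuousOn n (Icc 0 h)) (hg : ContinuousOn g (Icc 0 h))
    (hA : ∀ x ∈ Ioo 0 h, opA p lam h c n x = g x) : ∀ x ∈ Ico 0 h, opA p lam h c n x = g x := by
  obtain ⟨Q, hQ⟩ := isCompact_Icc.exists_bound_of_continuousOn hn
  have hk : ContDiff ℝ 1 (Function.uncurry fun s x : ℝ => hyp01 p (lam * (s - c) * (s - x))) := by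
    have : ContDiff ℝ 1 fun q : ℝ × ℝ => lam * (q.1 - c) * (q.1 - q.2) := by fun_prop
    exact (contDiff_one_hyp01 hp₀).comp this
  have hH : HolderIcc p h (opA p lam h c n) :=
    holder_abel hp₀ hp₁ (ContinuousOn.integrableOn_Ioc_zero hn)
      (fun s hs => hQ s (Ioo_subset_Icc_self hs)) hk
  have hc := hH.continuousOn hp₀
  intro x hx
  have hcl : x ∈ closure (Ioo 0 h) := by
    rw [closure_Ioo hh.ne]
    exact Ico_subset_Icc_self hx
  have : (𝓝[Ioo 0 h] x).NeBot := mem_closure_iff_nhdsWithin_neBot.1 hcl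
  have h1 := (hc x (Ico_subset_Icc_self hx)).mono_left (nhdsWithin_mono x Ioo_subset_Icc_self)
  have h2 := (hg x (Ico_subset_Icc_self hx)).mono_left (nhdsWithin_mono x Ioo_subset_Icc_self)
  refine tendsto_nhds_unique (h1.congr' ?_) h2
  filter_upwards [self_mem_nhdsWithin] with y hy using hA y hy

lemma densityN_spec (lam : ℝ) (hp₀ : 0 < p) (hp₁ : p < 1 / 2) (hh : 0 < h)
    (H : AdmissibleDatum p h φ) :
    IsDensity h (densityN p lam h φ) ∧
      (∃ K, ∀ s ∈ Ioo 0 h, |densityN p lam h φ s| ≤ K) ∧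
      ∀ x ∈ Ico 0 h, opA p lam h h (fun s => densityN p lam h φ s * (h - s) ^ p) x =
        -(1 / p) * derivWithin φ (Icc 0 h) x := by
  obtain ⟨n, hn, hnh, hN, hA⟩ := exists_weighted_densityN lam hp₀ hp₁ hh H
  have hnc := hn.continuousOn (by linarith)
  replace hA := opA_eq_of_bdd (g := fun x => -(1 / p) * derivWithin φ (Icc 0 h) x) hp₀ (by linarith) hh hnc
    (continuousOn_const.mul (H.contDiffOn_derivWithin hh).continuousOn) hA
  obtain ⟨C, hC, hn⟩ := hn
  have hNc : ContinuousOn (fun s => (h - s) ^ (-p) * n s) (Ico 0 h) :=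
    (ContinuousOn.rpow_const (by fun_prop) fun s hs => Or.inl (sub_pos.2 hs.2).ne').mul
      (hnc.mono Ico_subset_Icc_self)
  have hb : ∀ s ∈ Ico 0 h, |(h - s) ^ (-p) * n s| ≤ C * h ^ (1 - 2 * p) := fun s hs =>
    abs_weighted_le hp₁ hn hC hnh (Ico_subset_Icc_self hs)
  have hb' : ∀ s ∈ Ioo 0 h, |densityN p lam h φ s| ≤ C * h ^ (1 - 2 * p) := fun s hs => by
    rw [hN s hs]
    exact hb s (Ioo_subset_Ico_self hs)
  refine ⟨?_, ⟨_, hb'⟩, fun x hx => ?_⟩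
  · exact isDensity_of_bound (g := fun _ => C * h ^ (1 - 2 * p))
      ((hNc.mono Ioo_subset_Ico_self).congr hN) (integrableOn_const (by simp)) hb'
  · rw [← hA x hx, opA, opA]
    refine intervalIntegral.integral_congr_ae ?_
    filter_upwards [show ∀ᵐ s : ℝ, s ≠ h by simp [ae_iff]] with s hsh hs
    rw [uIoc_of_le hx.2.le] at hs
    have hs1 : s < h := lt_of_le_of_ne hs.2 hsh
    have h1 : (h - s) ^ (-p) * (h - s) ^ p = 1 := by
      rw [← Real.rpow_add (sub_pos.2 hs1)]; simp
    rw [hN s ⟨hx.1.trans_lt hs.1, hs1⟩]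
    linear_combination (n s * ((s - x) ^ (p - 1) * hyp01 p (lam * (s - h) * (s - x)))) * h1

end

section

/-! ### Calculus of the kernels -/

section wedge

variable {p lam σ α β k e x₀ x y : ℝ} {f : ℝ → ℝ}

/-- The counterpart of `hasDerivAt_abel` for a variable that moves neither the limit nor the
singularity; ordinary differentiation under the integral suffices. -/
lemma hasDerivAt_abel_param (hα : 0 < α) (hx : x ∈ Ioo x₀ e)
    (hf : ContinuousOn f (Ioo x₀ e)) (hfi : IntegrableOn f (Ioc x₀ e)) {g g' : ℝ → ℝ → ℝ}
    {V : Set ℝ} (hV : V ∈ 𝓝 y) (hg : ∀ s ∈ Icc x e, ∀ z ∈ V, HasDerivAt (g s) (g' s z) z)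
    (hgc : ContinuousOn (Function.uncurry g) (Icc x e ×ˢ V))
    (hgc' : ContinuousOn (Function.uncurry g') (Icc x e ×ˢ V)) :
    HasDerivAt (fun y => ∫ s in x..e, f s * ((s - x) ^ (α - 1) * g s y))
      (∫ s in x..e, f s * ((s - x) ^ (α - 1) * g' s y)) y := by
  obtain ⟨ε, hε, hεV⟩ := Metric.nhds_basis_closedBall.mem_iff.1 hV
  obtain ⟨K, hK⟩ := (isCompact_Icc.prod (isCompact_closedBall y ε)).exists_bound_of_continuousOn
    (hgc'.mono (prod_mono_right hεV))
  have hyV : y ∈ V := mem_of_mem_nhds hV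
  have hslice : ∀ {G : ℝ → ℝ → ℝ}, ContinuousOn (Function.uncurry G) (Icc x e ×ˢ V) →
      ∀ z ∈ V, IntervalIntegrable (fun s => f s * ((s - x) ^ (α - 1) * G s z)) volume x e := by
    intro G hG z hz
    refine intervalIntegrable_abel hα hx hf hfi (g := fun s => G s z) ?_
    exact hG.comp (f := fun s => (s, z)) (by fun_prop) fun s hs => ⟨hs, hz⟩
  have h1 := intervalIntegrable_abel hα hx hf hfi (g := fun _ => (1 : ℝ)) continuousOn_const
  have hmeas : ∀ {G : ℝ → ℝ}, IntervalIntegrable G volume x e →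
      AEStronglyMeasurable G (volume.restrict (uIoc x e)) := fun h =>
    (intervalIntegrable_iff.1 h).aestronglyMeasurable
  refine (intervalIntegral.hasDerivAt_integral_of_dominated_loc_of_deriv_le
    (F := fun y s => f s * ((s - x) ^ (α - 1) * g s y))
    (F' := fun y s => f s * ((s - x) ^ (α - 1) * g' s y))
    (bound := fun s => ‖f s * ((s - x) ^ (α - 1) * 1)‖ * K) (Metric.ball_mem_nhds y hε)
    ?_ (hslice hgc y hyV) (hmeas (hslice hgc' y hyV)) ?_
    (h1.norm.mul_const K) ?_).2
  · filter_upwards [hV] with z hz using hmeas (hslice hgc z hz)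
  · refine Eventually.of_forall fun s hs z hz => ?_
    rw [uIoc_of_le hx.2.le] at hs
    have := hK (s, z) ⟨Ioc_subset_Icc_self hs, Metric.ball_subset_closedBall hz⟩
    rw [mul_one, ← mul_assoc, norm_mul]
    exact mul_le_mul_of_nonneg_left this (norm_nonneg _)
  · refine Eventually.of_forall fun s hs z hz => ?_
    rw [uIoc_of_le hx.2.le] at hs
    exact ((hg s (Ioc_subset_Icc_self hs) z
      (hεV (Metric.ball_subset_closedBall hz))).const_mul _).const_mul _

/-- The integrals `∫_x^e f(s) (s - x)^{α-1} (σ (s - y))^{β-1} ₀F₁(k; λ (s - x)(s - y)) ds`, used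
with `σ = 1` for `y < x` and with `σ = -1` for `e < y`. -/
def wedge (lam σ α β k : ℝ) (f : ℝ → ℝ) (e x y : ℝ) : ℝ :=
  ∫ s in x..e, f s * ((s - x) ^ (α - 1) *
    ((σ * (s - y)) ^ (β - 1) * hyp01 k (lam * (s - x) * (s - y))))

lemma mul_sub_pos_of_mem (hσx : 0 < σ * (x - y)) (hσe : 0 < σ * (e - y)) {s : ℝ}
    (hs : s ∈ Icc x e) : 0 < σ * (s - y) := by
  rcases le_or_gt 0 σ with h | h <;> nlinarith [hs.1, hs.2]

lemma continuousOn_wedge_kernel (hk : 0 < k) :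
    ContinuousOn (fun q : ℝ × ℝ × ℝ => (σ * (q.1 - q.2.2)) ^ (β - 1) *
      hyp01 k (lam * (q.1 - q.2.1) * (q.1 - q.2.2))) {q | 0 < σ * (q.1 - q.2.2)} :=
  (ContinuousOn.rpow_const (by fun_prop) fun _ hq => Or.inl (ne_of_gt hq)).mul
    (Continuous.hyp01 hk (by fun_prop)).continuousOn

lemma continuousOn_wedge_kernel_left (hk : 0 < k) (y : ℝ) :
    ContinuousOn (fun q : ℝ × ℝ => (σ * (q.1 - y)) ^ (β - 1) *
      hyp01 k (lam * (q.1 - q.2) * (q.1 - y))) {q | 0 < σ * (q.1 - y)} :=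
  (ContinuousOn.rpow_const (by fun_prop) fun _ hq => Or.inl (ne_of_gt hq)).mul
    (Continuous.hyp01 hk (by fun_prop)).continuousOn

lemma continuousOn_wedge_kernel_right (hk : 0 < k) (x : ℝ) :
    ContinuousOn (fun q : ℝ × ℝ => (σ * (q.1 - q.2)) ^ (β - 1) *
      hyp01 k (lam * (q.1 - x) * (q.1 - q.2))) {q | 0 < σ * (q.1 - q.2)} :=
  (ContinuousOn.rpow_const (by fun_prop) fun _ hq => Or.inl (ne_of_gt hq)).mul
    (Continuous.hyp01 hk (by fun_prop)).continuousOn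

lemma intervalIntegrable_wedge (hα : 0 < α) (hk : 0 < k) (hx : x ∈ Ioo x₀ e)
    (hf : ContinuousOn f (Ioo x₀ e)) (hfi : IntegrableOn f (Ioc x₀ e))
    (hσx : 0 < σ * (x - y)) (hσe : 0 < σ * (e - y)) :
    IntervalIntegrable (fun s => f s * ((s - x) ^ (α - 1) *
      ((σ * (s - y)) ^ (β - 1) * hyp01 k (lam * (s - x) * (s - y))))) volume x e := by
  refine intervalIntegrable_abel (g := fun s => (σ * (s - y)) ^ (β - 1) *
    hyp01 k (lam * (s - x) * (s - y))) hα hx hf hfi ?_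
  exact (ContinuousOn.rpow_const (by fun_prop) fun s hs =>
    Or.inl (mul_sub_pos_of_mem hσx hσe hs).ne').mul (Continuous.hyp01 hk (by fun_prop)).continuousOn

lemma continuousAt_wedge (hα : 0 < α) (hk : 0 < k) (hx : x ∈ Ioo x₀ e)
    (hf : ContinuousOn f (Ioo x₀ e)) (hfi : IntegrableOn f (Ioc x₀ e))
    (hσx : 0 < σ * (x - y)) (hσe : 0 < σ * (e - y)) :
    ContinuousAt (fun w : ℝ × ℝ => wedge lam σ α β k f e w.1 w.2) (x, y) := by
  have hO : IsOpen ({w : ℝ × ℝ | 0 < σ * (w.1 - w.2)} ∩ {w | 0 < σ * (e - w.2)}) :=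
    (isOpen_lt (by fun_prop) (by fun_prop)).inter (isOpen_lt (by fun_prop) (by fun_prop))
  refine continuousAt_abel (f := f) (g := fun s w => (σ * (s - w.2)) ^ (β - 1) *
    hyp01 k (lam * (s - w.1) * (s - w.2))) hα continuous_fst hO (z := (x, y)) ⟨hσx, hσe⟩ hx hf hfi ?_
  exact (continuousOn_wedge_kernel hk).mono fun q hq => mul_sub_pos_of_mem hq.1.1 hq.1.2 hq.2

lemma hasDerivAt_wedge_left (hp₀ : 0 < p) (hx : x ∈ Ioo x₀ e)
    (hf : ContinuousOn f (Ioo x₀ e)) (hfi : IntegrableOn f (Ioc x₀ e))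
    (hσ : ∀ s ∈ Ioc x₀ e, 0 < σ * (s - y)) :
    HasDerivAt (fun x => wedge lam σ (1 + p) β (1 + p) f e x y)
      (-(p * wedge lam σ p β p f e x y)) x := by
  have h1 := hasDerivAt_abel (f := f) (g := fun s x => p * ((σ * (s - y)) ^ (β - 1) *
      hyp01 p (lam * (s - x) * (s - y)))) (κ := fun s x => (s - x) ^ (1 + p - 1) *
      ((σ * (s - y)) ^ (β - 1) * hyp01 (1 + p) (lam * (s - x) * (s - y)))) hp₀ hf hfi
    (continuousOn_const.mul ((continuousOn_wedge_kernel_left hp₀ y).mono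
      fun q hq => hσ q.1 ⟨hq.1.trans_le hq.2.1, hq.2.2⟩))
    (fun s hs => (Continuous.mul (Continuous.rpow_const (by fun_prop) fun _ => Or.inr (by linarith))
      (continuous_const.mul (Continuous.hyp01 (by linarith) (by fun_prop)))).continuousOn)
    (fun s hs t ht => ?_) (fun s hs => by
      rw [sub_self, Real.zero_rpow (by linarith), zero_mul]) hx
  · refine h1.congr_deriv ?_
    rw [wedge, ← intervalIntegral.integral_const_mul]
    congr 1
    exact intervalIntegral.integral_congr fun s _ => by ring
  · have h2 := ((hasDerivAt_rpow_mul_hyp01 hp₀ (lam * (s - y)) (sub_pos.2 ht.2)).comp t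
      ((hasDerivAt_id t).const_sub s)).mul_const ((σ * (s - y)) ^ (β - 1))
    refine (h2.congr_deriv ?_).congr_of_eventuallyEq (Eventually.of_forall fun u => ?_)
    · rw [show lam * (s - y) * (s - t) = lam * (s - t) * (s - y) by ring]
      ring
    · simp only [Function.comp_apply]
      rw [show lam * (s - y) * (s - u) = lam * (s - u) * (s - y) by ring, add_sub_cancel_left]
      ring

/-- Differentiating ₀F₁ brings out λ(s - y). As σ² = 1, this is σλ times σ(s - y), which raises the
second exponent. -/
lemma hasDerivAt_wedge_left_self (hp₀ : 0 < p) (hσ2 : σ * σ = 1) (hx : x ∈ Ioo x₀ e)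
    (hf : ContinuousOn f (Ioo x₀ e)) (hfi : IntegrableOn f (Ioc x₀ e))
    (hσ : ∀ s ∈ Ioc x₀ e, 0 < σ * (s - y)) :
    HasDerivAt (fun x => wedge lam σ (1 + p) p p f e x y)
      (-(p * wedge lam σ p p p f e x y +
        σ * lam / p * wedge lam σ (1 + p) (1 + p) (1 + p) f e x y)) x := by
  have h1 := hasDerivAt_abel (f := f) (g := fun s x => p * ((σ * (s - y)) ^ (p - 1) *
      hyp01 p (lam * (s - x) * (s - y))) + σ * lam / p * ((s - x) * ((σ * (s - y)) ^ (1 + p - 1) *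
      hyp01 (1 + p) (lam * (s - x) * (s - y))))) (κ := fun s x => (s - x) ^ (1 + p - 1) *
      ((σ * (s - y)) ^ (p - 1) * hyp01 p (lam * (s - x) * (s - y)))) hp₀ hf hfi
    ((continuousOn_const.mul ((continuousOn_wedge_kernel_left hp₀ y).mono
      fun q hq => hσ q.1 ⟨hq.1.trans_le hq.2.1, hq.2.2⟩)).add
      (continuousOn_const.mul (ContinuousOn.mul (by fun_prop)
        ((continuousOn_wedge_kernel_left (by linarith) y).mono
        fun q hq => hσ q.1 ⟨hq.1.trans_le hq.2.1, hq.2.2⟩))))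
    (fun s hs => (Continuous.mul (Continuous.rpow_const (by fun_prop) fun _ => Or.inr (by linarith))
      (continuous_const.mul (Continuous.hyp01 (by linarith) (by fun_prop)))).continuousOn)
    (fun s hs t ht => ?_) (fun s hs => by
      rw [sub_self, Real.zero_rpow (by linarith), zero_mul]) hx
  · refine h1.congr_deriv ?_
    have hσx : 0 < σ * (x - y) := hσ x ⟨hx.1, hx.2.le⟩
    have hσe : 0 < σ * (e - y) := hσ e ⟨hx.1.trans hx.2, le_rfl⟩
    rw [wedge, wedge, ← intervalIntegral.integral_const_mul, ← intervalIntegral.integral_const_mul,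
      ← intervalIntegral.integral_add
        ((intervalIntegrable_wedge hp₀ hp₀ hx hf hfi hσx hσe).const_mul _)
        ((intervalIntegrable_wedge (by linarith) (by linarith) hx hf hfi hσx hσe).const_mul _)]
    congr 1
    refine intervalIntegral.integral_congr_ae (Eventually.of_forall fun s hs => ?_)
    rw [uIoc_of_le hx.2.le] at hs
    rw [add_sub_cancel_left (a := (1 : ℝ)), show p = (p - 1) + 1 by ring,
      Real.rpow_add_one (sub_pos.2 hs.1).ne']
    ring_nf
  · have hsy : 0 < σ * (s - y) := hσ s ⟨hs.1, hs.2.le⟩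
    have h2 := ((hasDerivAt_rpow_mul_hyp01_self hp₀ (lam * (s - y)) (sub_pos.2 ht.2)).comp t
      ((hasDerivAt_id t).const_sub s)).mul_const ((σ * (s - y)) ^ (p - 1))
    refine (h2.congr_deriv ?_).congr_of_eventuallyEq (Eventually.of_forall fun u => ?_)
    · rw [show lam * (s - y) * (s - t) = lam * (s - t) * (s - y) by ring,
        add_sub_cancel_left (a := (1 : ℝ))]
      have e1 : (s - t) ^ p = (s - t) ^ (p - 1) * (s - t) := by
        rw [← Real.rpow_add_one (sub_pos.2 ht.2).ne']; simp
      have e2 : (σ * (s - y)) ^ p = (σ * (s - y)) ^ (p - 1) * (σ * (s - y)) := by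
        rw [← Real.rpow_add_one hsy.ne']; simp
      rw [e1, e2]
      linear_combination (lam / p * (s - t) ^ (p - 1) * (s - t) * (σ * (s - y)) ^ (p - 1) * (s - y)
        * hyp01 (1 + p) (lam * (s - t) * (s - y))) * hσ2
    · simp only [Function.comp_apply]
      rw [show lam * (s - y) * (s - u) = lam * (s - u) * (s - y) by ring, add_sub_cancel_left]
      ring

lemma hasDerivAt_wedge_right (hα : 0 < α) (hp₀ : 0 < p) (hσ2 : σ * σ = 1) (hx : x ∈ Ioo x₀ e)
    (hf : ContinuousOn f (Ioo x₀ e)) (hfi : IntegrableOn f (Ioc x₀ e))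
    (hσx : 0 < σ * (x - y)) (hσe : 0 < σ * (e - y)) :
    HasDerivAt (fun y => wedge lam σ α (1 + p) (1 + p) f e x y)
      (-(σ * p * wedge lam σ α p p f e x y)) y := by
  have hV : {z | 0 < σ * (x - z)} ∩ {z | 0 < σ * (e - z)} ∈ 𝓝 y :=
    ((isOpen_lt (by fun_prop) (by fun_prop)).inter
      (isOpen_lt (by fun_prop) (by fun_prop))).mem_nhds ⟨hσx, hσe⟩
  have h1 := hasDerivAt_abel_param (f := f) (g := fun s y => (σ * (s - y)) ^ (1 + p - 1) *
      hyp01 (1 + p) (lam * (s - x) * (s - y))) (g' := fun s y => -(σ * p) * ((σ * (s - y)) ^ (p - 1) *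
      hyp01 p (lam * (s - x) * (s - y)))) hα hx hf hfi hV (fun s hs z hz => ?_)
    ((continuousOn_wedge_kernel_right (by linarith) x).mono
      fun q hq => mul_sub_pos_of_mem hq.2.1 hq.2.2 hq.1)
    (continuousOn_const.mul ((continuousOn_wedge_kernel_right hp₀ x).mono
      fun q hq => mul_sub_pos_of_mem hq.2.1 hq.2.2 hq.1))
  · refine h1.congr_deriv ?_
    rw [wedge, ← intervalIntegral.integral_const_mul, ← intervalIntegral.integral_neg]
    exact intervalIntegral.integral_congr fun s _ => by ring
  · have hsz := mul_sub_pos_of_mem hz.1 hz.2 hs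
    have h2 := (hasDerivAt_rpow_mul_hyp01 hp₀ (σ * lam * (s - x)) hsz).comp z
      (((hasDerivAt_id z).const_sub s).const_mul σ)
    have e1 : ∀ u, σ * lam * (s - x) * (σ * (s - u)) = lam * (s - x) * (s - u) := fun u => by
      linear_combination (lam * (s - x) * (s - u)) * hσ2
    refine (h2.congr_deriv ?_).congr_of_eventuallyEq (Eventually.of_forall fun u => ?_)
    · rw [e1]
      ring
    · simp only [Function.comp_apply, id]
      rw [e1, add_sub_cancel_left]

lemma hasDerivAt_wedge_right_self (hp₀ : 0 < p) (hσ2 : σ * σ = 1) (hx : x ∈ Ioo x₀ e)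
    (hf : ContinuousOn f (Ioo x₀ e)) (hfi : IntegrableOn f (Ioc x₀ e))
    (hσx : 0 < σ * (x - y)) (hσe : 0 < σ * (e - y)) :
    HasDerivAt (fun y => wedge lam σ p (1 + p) p f e x y)
      (-(σ * p * wedge lam σ p p p f e x y +
        lam / p * wedge lam σ (1 + p) (1 + p) (1 + p) f e x y)) y := by
  have hV : {z | 0 < σ * (x - z)} ∩ {z | 0 < σ * (e - z)} ∈ 𝓝 y :=
    ((isOpen_lt (by fun_prop) (by fun_prop)).inter
      (isOpen_lt (by fun_prop) (by fun_prop))).mem_nhds ⟨hσx, hσe⟩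
  have h1 := hasDerivAt_abel_param (f := f) (g := fun s y => (σ * (s - y)) ^ (1 + p - 1) *
      hyp01 p (lam * (s - x) * (s - y))) (g' := fun s y => -(σ * p * ((σ * (s - y)) ^ (p - 1) *
      hyp01 p (lam * (s - x) * (s - y))) + lam / p * ((s - x) * ((σ * (s - y)) ^ (1 + p - 1) *
      hyp01 (1 + p) (lam * (s - x) * (s - y)))))) hp₀ hx hf hfi hV (fun s hs z hz => ?_)
    ((continuousOn_wedge_kernel_right hp₀ x).mono
      fun q hq => mul_sub_pos_of_mem hq.2.1 hq.2.2 hq.1)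
    (((continuousOn_const.mul ((continuousOn_wedge_kernel_right hp₀ x).mono
      fun q hq => mul_sub_pos_of_mem hq.2.1 hq.2.2 hq.1)).add
      (continuousOn_const.mul (ContinuousOn.mul (by fun_prop)
        ((continuousOn_wedge_kernel_right (by linarith) x).mono
        fun q hq => mul_sub_pos_of_mem hq.2.1 hq.2.2 hq.1)))).neg)
  · refine h1.congr_deriv ?_
    rw [wedge, wedge, ← intervalIntegral.integral_const_mul, ← intervalIntegral.integral_const_mul,
      ← intervalIntegral.integral_add
        ((intervalIntegrable_wedge hp₀ hp₀ hx hf hfi hσx hσe).const_mul _)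
        ((intervalIntegrable_wedge (by linarith) (by linarith) hx hf hfi hσx hσe).const_mul _),
      ← intervalIntegral.integral_neg]
    refine intervalIntegral.integral_congr_ae (Eventually.of_forall fun s hs => ?_)
    rw [uIoc_of_le hx.2.le] at hs
    have e1 : (s - x) ^ p = (s - x) ^ (p - 1) * (s - x) := by
      rw [← Real.rpow_add_one (sub_pos.2 hs.1).ne']; simp
    rw [add_sub_cancel_left (a := (1 : ℝ)), e1]
    ring
  · have hsz := mul_sub_pos_of_mem hz.1 hz.2 hs
    have h2 := (hasDerivAt_rpow_mul_hyp01_self hp₀ (σ * lam * (s - x)) hsz).comp z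
      (((hasDerivAt_id z).const_sub s).const_mul σ)
    have e1 : ∀ u, σ * lam * (s - x) * (σ * (s - u)) = lam * (s - x) * (s - u) := fun u => by
      linear_combination (lam * (s - x) * (s - u)) * hσ2
    refine (h2.congr_deriv ?_).congr_of_eventuallyEq (Eventually.of_forall fun u => ?_)
    · rw [e1, add_sub_cancel_left (a := (1 : ℝ))]
      linear_combination (-(lam / p * (s - x) * (σ * (s - z)) ^ p *
        hyp01 (1 + p) (lam * (s - x) * (s - z)))) * hσ2
    · simp only [Function.comp_apply, id]
      rw [e1, add_sub_cancel_left]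

end wedge

end

/-! ### Integrals over (a, b) with singularities at both ends, and the Cauchy formula -/

section

variable {p lam h α β k a b c : ℝ} {T N : ℝ → ℝ}

/-- The integrals `∫_a^b N(s) (b - s)^{α-1} (s - a)^{β-1} ₀F₁(k; -λ (b - s)(s - a)) ds`. -/
def inner (lam α β k : ℝ) (N : ℝ → ℝ) (a b : ℝ) : ℝ :=
  ∫ s in a..b, N s * ((b - s) ^ (α - 1) * ((s - a) ^ (β - 1) *
    hyp01 k (-lam * (b - s) * (s - a))))

lemma IsDensity.comp_neg (hN : IsDensity h N) (hc : 0 < c) (hch : c < h) :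
    ContinuousOn (fun s => N (-s)) (Ioo (-h) (-c)) ∧
      IntegrableOn (fun s => N (-s)) (Ioc (-h) (-c)) := by
  constructor
  · refine hN.1.comp (by fun_prop) fun s hs => ⟨?_, ?_⟩ <;> linarith [hs.1, hs.2]
  · rw [← intervalIntegrable_iff_integrableOn_Ioc_of_le (by linarith),
      ← IntervalIntegrable.iff_comp_neg (f := N)]
    exact ((intervalIntegrable_iff_integrableOn_Ioc_of_le hch.le).2
      (hN.2.mono_set fun s hs => ⟨(hc.trans hs.1).le, hs.2⟩)).symm

lemma IsDensity.mono_left (hN : IsDensity h N) (ha : 0 ≤ a) :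
    ContinuousOn N (Ioo a h) ∧ IntegrableOn N (Ioc a h) :=
  ⟨hN.1.mono (Ioo_subset_Ioo_left ha), hN.2.mono_set fun _ hs => ⟨ha.trans hs.1.le, hs.2⟩⟩

lemma IsDensity.mono_right (hN : IsDensity h N) (hc : c ≤ h) :
    ContinuousOn N (Ioo 0 c) ∧ IntegrableOn N (Ioc 0 c) :=
  ⟨hN.1.mono (Ioo_subset_Ioo_right hc), hN.2.mono_set fun _ hs => ⟨hs.1.le, hs.2.trans hc⟩⟩

/-- The integrand of `inner`. -/
def innerIntegrand (lam α β k : ℝ) (N : ℝ → ℝ) (a b s : ℝ) : ℝ :=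
  N s * ((b - s) ^ (α - 1) * ((s - a) ^ (β - 1) * hyp01 k (-lam * (b - s) * (s - a))))

lemma innerIntegrand_eq_left (s : ℝ) : innerIntegrand lam α β k N a b s =
    N s * ((s - a) ^ (β - 1) * ((-1 * (s - b)) ^ (α - 1) * hyp01 k (lam * (s - a) * (s - b)))) := by
  rw [innerIntegrand, show -1 * (s - b) = b - s by ring,
    show lam * (s - a) * (s - b) = -lam * (b - s) * (s - a) by ring]
  ring

lemma innerIntegrand_eq_right (s : ℝ) : innerIntegrand lam α β k N a b (-s) =
    N (-s) * ((s - -b) ^ (α - 1) * ((-1 * (s - -a)) ^ (β - 1) *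
      hyp01 k (lam * (s - -b) * (s - -a)))) := by
  rw [innerIntegrand, show -1 * (s - -a) = -s - a by ring, show s - -b = b - -s by ring,
    show lam * (b - -s) * (s - -a) = -lam * (b - -s) * (-s - a) by ring]

lemma intervalIntegrable_innerIntegrand (hα : 0 < α) (hβ : 0 < β) (hk : 0 < k)
    (hN : IsDensity h N) (ha : 0 < a) (hac : a < c) (hcb : c < b) (hbh : b < h) :
    IntervalIntegrable (innerIntegrand lam α β k N a b) volume a c ∧
      IntervalIntegrable (innerIntegrand lam α β k N a b) volume c b := by
  have hNl := hN.mono_right (c := c) (by linarith)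
  have hNr := hN.comp_neg (ha.trans hac) (hcb.trans hbh)
  have i1 := intervalIntegrable_wedge (lam := lam) (k := k) (β := α) (σ := -1) (y := b) hβ hk
    ⟨ha, hac⟩ hNl.1 hNl.2 (by linarith) (by linarith)
  have i2 := intervalIntegrable_wedge (lam := lam) (k := k) (β := β) (σ := -1) (y := -a)
    (x := -b) hα hk ⟨by linarith, by linarith⟩ hNr.1 hNr.2 (by linarith) (by linarith)
  simp only [← innerIntegrand_eq_right] at i2
  simp only [← innerIntegrand_eq_left] at i1
  exact ⟨i1, ((IntervalIntegrable.iff_comp_neg (a := b) (b := c)).2 i2).symm⟩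

lemma intervalIntegrable_inner (hα : 0 < α) (hβ : 0 < β) (hk : 0 < k) (hN : IsDensity h N)
    (ha : 0 < a) (hab : a < b) (hbh : b < h) :
    IntervalIntegrable (innerIntegrand lam α β k N a b) volume a b := by
  obtain ⟨c, hac, hcb⟩ := exists_between hab
  have := intervalIntegrable_innerIntegrand (lam := lam) hα hβ hk hN ha hac hcb hbh
  exact this.1.trans this.2

/-- A cut at c isolates the two singular ends. On (a, c) the lower end is singular; the reflection s
↦ -s makes b the lower end of the other piece. Both are then wedge integrals with σ = -1, and their
derivative rules carry over. -/
lemma inner_eq_wedge (hα : 0 < α) (hβ : 0 < β) (hk : 0 < k) (hN : IsDensity h N) (ha : 0 < a)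
    (hac : a < c) (hcb : c < b) (hbh : b < h) :
    inner lam α β k N a b = wedge lam (-1) β α k N c a b +
      wedge lam (-1) α β k (fun s => N (-s)) (-c) (-b) (-a) := by
  have i := intervalIntegrable_innerIntegrand (lam := lam) hα hβ hk hN ha hac hcb hbh
  have e := intervalIntegral.integral_comp_neg (a := -b) (b := -c)
    (innerIntegrand lam α β k N a b)
  rw [neg_neg, neg_neg] at e
  simp only [inner, wedge, ← innerIntegrand_eq_left, ← innerIntegrand_eq_right]
  rw [e]
  exact (intervalIntegral.integral_add_adjacent_intervals i.1 i.2).symm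

lemma continuousAt_inner (hα : 0 < α) (hβ : 0 < β) (hk : 0 < k) (hN : IsDensity h N) (ha : 0 < a)
    (hab : a < b) (hbh : b < h) :
    ContinuousAt (fun w : ℝ × ℝ => inner lam α β k N w.1 w.2) (a, b) := by
  obtain ⟨c, hac, hcb⟩ := exists_between hab
  have hNl := hN.mono_right (c := c) (by linarith)
  have hNr := hN.comp_neg (ha.trans hac) (hcb.trans hbh)
  have i1 := continuousAt_wedge (lam := lam) (k := k) (β := α) (σ := -1) (y := b) hβ hk
    ⟨ha, hac⟩ hNl.1 hNl.2 (by linarith) (by linarith)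
  have i2 := continuousAt_wedge (lam := lam) (k := k) (β := β) (σ := -1) (y := -a)
    (x := -b) hα hk ⟨by linarith, by linarith⟩ hNr.1 hNr.2 (by linarith) (by linarith)
  have i3 : ContinuousAt (fun w : ℝ × ℝ =>
      wedge lam (-1) α β k (fun s => N (-s)) (-c) (-w.2) (-w.1)) (a, b) :=
    ContinuousAt.comp (f := fun w : ℝ × ℝ => (-w.2, -w.1)) (x := (a, b)) i2 (by fun_prop)
  refine (i1.add i3).congr ?_
  have hO : IsOpen ({w : ℝ × ℝ | 0 < w.1} ∩ {w | w.1 < c} ∩ {w | c < w.2} ∩ {w | w.2 < h}) :=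
    (((isOpen_lt (by fun_prop) (by fun_prop)).inter (isOpen_lt (by fun_prop) (by fun_prop))).inter
      (isOpen_lt (by fun_prop) (by fun_prop))).inter (isOpen_lt (by fun_prop) (by fun_prop))
  filter_upwards [hO.mem_nhds (x := (a, b)) ⟨⟨⟨ha, hac⟩, hcb⟩, hbh⟩] with w hw
  exact (inner_eq_wedge hα hβ hk hN hw.1.1.1 hw.1.1.2 hw.1.2 hw.2).symm

section derivatives

variable (lam) (hp₀ : 0 < p) (hN : IsDensity h N) (hT : IsDensity h T)
  (ha : 0 < a) (hab : a < b) (hbh : b < h)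
include hp₀ hN ha hab hbh

lemma hasDerivAt_inner_left :
    HasDerivAt (fun a => inner lam (1 + p) (1 + p) (1 + p) N a b)
      (-(p * inner lam (1 + p) p p N a b)) a := by
  obtain ⟨c, hac, hcb⟩ := exists_between hab
  have hp1 : 0 < 1 + p := by linarith
  have hNl := hN.mono_right (c := c) (by linarith)
  have hNr := hN.comp_neg (ha.trans hac) (hcb.trans hbh)
  have d1 := hasDerivAt_wedge_left (lam := lam) (β := 1 + p) (σ := -1) (y := b) hp₀
    ⟨ha, hac⟩ hNl.1 hNl.2 fun s hs => by linarith [hs.2]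
  have d2 := (hasDerivAt_wedge_right (lam := lam) (σ := -1) (y := -a)
    (x := -b) hp1 hp₀ (by norm_num) ⟨by linarith, by linarith⟩ hNr.1 hNr.2 (by linarith)
    (by linarith)).comp a (hasDerivAt_neg a)
  refine ((d1.add d2).congr_deriv ?_).congr_of_eventuallyEq ?_
  · rw [inner_eq_wedge hp1 hp₀ hp₀ hN ha hac hcb hbh]; ring
  · filter_upwards [Ioo_mem_nhds ha hac] with a' ha'
    exact inner_eq_wedge hp1 hp1 hp1 hN ha'.1 ha'.2 hcb hbh

lemma hasDerivAt_inner_right :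
    HasDerivAt (fun b => inner lam (1 + p) (1 + p) (1 + p) N a b)
      (p * inner lam p (1 + p) p N a b) b := by
  obtain ⟨c, hac, hcb⟩ := exists_between hab
  have hp1 : 0 < 1 + p := by linarith
  have hNl := hN.mono_right (c := c) (by linarith)
  have hNr := hN.comp_neg (ha.trans hac) (hcb.trans hbh)
  have d1 := hasDerivAt_wedge_right (lam := lam) (σ := -1) (y := b) hp1 hp₀ (by norm_num)
    ⟨ha, hac⟩ hNl.1 hNl.2 (by linarith) (by linarith)
  have d2 := (hasDerivAt_wedge_left (lam := lam) (β := 1 + p) (σ := -1) (y := -a)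
    (x := -b) hp₀ ⟨by linarith, by linarith⟩ hNr.1 hNr.2
    fun s hs => by linarith [hs.2]).comp b (hasDerivAt_neg b)
  refine ((d1.add d2).congr_deriv ?_).congr_of_eventuallyEq ?_
  · rw [inner_eq_wedge hp₀ hp1 hp₀ hN ha hac hcb hbh]; ring
  · filter_upwards [Ioo_mem_nhds hcb hbh] with b' hb'
    exact inner_eq_wedge hp1 hp1 hp1 hN ha hac hb'.1 hb'.2

lemma hasDerivAt_inner_left_right :
    HasDerivAt (fun b => inner lam (1 + p) p p N a b)
      (p * inner lam p p p N a b - lam / p * inner lam (1 + p) (1 + p) (1 + p) N a b) b := by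
  obtain ⟨c, hac, hcb⟩ := exists_between hab
  have hp1 : 0 < 1 + p := by linarith
  have hNl := hN.mono_right (c := c) (by linarith)
  have hNr := hN.comp_neg (ha.trans hac) (hcb.trans hbh)
  have d1 := hasDerivAt_wedge_right_self (lam := lam) (σ := -1) (y := b) hp₀ (by norm_num)
    ⟨ha, hac⟩ hNl.1 hNl.2 (by linarith) (by linarith)
  have d2 := (hasDerivAt_wedge_left_self (lam := lam) (σ := -1) (y := -a)
    (x := -b) hp₀ (by norm_num) ⟨by linarith, by linarith⟩ hNr.1 hNr.2
    fun s hs => by linarith [hs.2]).comp b (hasDerivAt_neg b)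
  refine ((d1.add d2).congr_deriv ?_).congr_of_eventuallyEq ?_
  · rw [inner_eq_wedge hp₀ hp₀ hp₀ hN ha hac hcb hbh,
      inner_eq_wedge hp1 hp1 hp1 hN ha hac hcb hbh]; ring
  · filter_upwards [Ioo_mem_nhds hcb hbh] with b' hb'
    exact inner_eq_wedge hp1 hp₀ hp₀ hN ha hac hb'.1 hb'.2

lemma hasDerivAt_inner_right_left :
    HasDerivAt (fun a => inner lam p (1 + p) p N a b)
      (-(p * inner lam p p p N a b - lam / p * inner lam (1 + p) (1 + p) (1 + p) N a b)) a := by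
  obtain ⟨c, hac, hcb⟩ := exists_between hab
  have hp1 : 0 < 1 + p := by linarith
  have hNl := hN.mono_right (c := c) (by linarith)
  have hNr := hN.comp_neg (ha.trans hac) (hcb.trans hbh)
  have d1 := hasDerivAt_wedge_left_self (lam := lam) (σ := -1) (y := b) hp₀ (by norm_num)
    ⟨ha, hac⟩ hNl.1 hNl.2 fun s hs => by linarith [hs.2]
  have d2 := (hasDerivAt_wedge_right_self (lam := lam) (σ := -1) (y := -a)
    (x := -b) hp₀ (by norm_num) ⟨by linarith, by linarith⟩ hNr.1 hNr.2 (by linarith)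
    (by linarith)).comp a (hasDerivAt_neg a)
  refine ((d1.add d2).congr_deriv ?_).congr_of_eventuallyEq ?_
  · rw [inner_eq_wedge hp₀ hp₀ hp₀ hN ha hac hcb hbh,
      inner_eq_wedge hp1 hp1 hp1 hN ha hac hcb hbh]; ring
  · filter_upwards [Ioo_mem_nhds ha hac] with a' ha'
    exact inner_eq_wedge hp₀ hp1 hp₀ hN ha'.1 ha'.2 hcb hbh

end derivatives

/-! ### Calculus of the Cauchy formula -/

/-- The derivative of `cauchyFormula` in the first variable. -/
def cauchyA (p lam h : ℝ) (T N : ℝ → ℝ) (a b : ℝ) : ℝ :=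
  -(p * (wedge lam 1 (1 + p) p p T h b a + inner lam (1 + p) p p N a b))

/-- The derivative of `cauchyFormula` in the second variable. -/
def cauchyB (p lam h : ℝ) (T N : ℝ → ℝ) (a b : ℝ) : ℝ :=
  p * (inner lam p (1 + p) p N a b - wedge lam 1 p (1 + p) p T h b a)

/-- The combination `(U_a - U_b) / (p (b - a))` for `U = cauchyFormula`. -/
def cauchyH (p lam h : ℝ) (T N : ℝ → ℝ) (a b : ℝ) : ℝ :=
  wedge lam 1 p p p T h b a - inner lam p p p N a b

lemma cauchyFormula_eq (p lam h : ℝ) (T N : ℝ → ℝ) (a b : ℝ) :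
    cauchyFormula p lam h T N a b =
      wedge lam 1 (1 + p) (1 + p) (1 + p) T h b a + inner lam (1 + p) (1 + p) (1 + p) N a b := by
  rw [cauchyFormula, wedge, inner]
  congr 1 <;> refine intervalIntegral.integral_congr fun s _ => ?_
  · rw [add_sub_cancel_left, one_mul,
      show lam * (s - a) * (s - b) = lam * (s - b) * (s - a) by ring]
    ring
  · rw [add_sub_cancel_left]
    ring

/-- This is (s - a) - (s - b) = b - a under the integral. -/
lemma wedge_contiguous (hp₀ : 0 < p) {x₀ : ℝ} (hb : b ∈ Ioo x₀ h) (hT : ContinuousOn T (Ioo x₀ h))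
    (hTi : IntegrableOn T (Ioc x₀ h)) (hab : a < b) :
    wedge lam 1 p (1 + p) p T h b a - wedge lam 1 (1 + p) p p T h b a =
      (b - a) * wedge lam 1 p p p T h b a := by
  have hp1 : 0 < 1 + p := by linarith
  have hbh := hb.2
  rw [wedge, wedge, wedge, ← intervalIntegral.integral_const_mul,
    ← intervalIntegral.integral_sub
      (intervalIntegrable_wedge hp₀ hp₀ hb hT hTi (by linarith) (by linarith))
      (intervalIntegrable_wedge hp1 hp₀ hb hT hTi (by linarith) (by linarith))]
  refine intervalIntegral.integral_congr_ae (Eventually.of_forall fun s hs => ?_)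
  rw [uIoc_of_le hbh.le] at hs
  rw [one_mul, show 1 + p - 1 = p - 1 + 1 by ring, Real.rpow_add_one (sub_pos.2 hs.1).ne',
    Real.rpow_add_one (by linarith [hs.1])]
  ring

/-- This is (s - a) + (b - s) = b - a under the integral. -/
lemma inner_contiguous (hab : a < b)
    (h₁ : IntervalIntegrable (innerIntegrand lam p (1 + p) p N a b) volume a b)
    (h₂ : IntervalIntegrable (innerIntegrand lam (1 + p) p p N a b) volume a b) :
    inner lam p (1 + p) p N a b + inner lam (1 + p) p p N a b =
      (b - a) * inner lam p p p N a b := by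
  have e : ∀ α β, inner lam α β p N a b = ∫ s in a..b, innerIntegrand lam α β p N a b s :=
    fun _ _ => rfl
  rw [e, e, e, ← intervalIntegral.integral_const_mul, ← intervalIntegral.integral_add h₁ h₂]
  refine intervalIntegral.integral_congr_ae ?_
  filter_upwards [show ∀ᵐ s : ℝ, s ≠ b by simp [ae_iff]] with s hsb hs
  rw [uIoc_of_le hab.le] at hs
  rw [innerIntegrand, innerIntegrand, innerIntegrand, show 1 + p - 1 = p - 1 + 1 by ring,
    Real.rpow_add_one (sub_pos.2 hs.1).ne', Real.rpow_add_one (sub_ne_zero.2 hsb.symm)]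
  ring

section cauchy

variable (lam) (hp₀ : 0 < p) (hT : IsDensity h T) (hN : IsDensity h N)
  (ha : 0 < a) (hab : a < b) (hbh : b < h)
include hp₀ hT hN ha hab hbh

lemma hasDerivAt_cauchyFormula_left :
    HasDerivAt (fun a => cauchyFormula p lam h T N a b) (cauchyA p lam h T N a b) a := by
  have hTl := hT.mono_left ha.le
  have d1 := hasDerivAt_wedge_right (lam := lam) (σ := 1) (y := a) (x := b) (α := 1 + p)
    (by linarith) hp₀ (by norm_num) ⟨hab, hbh⟩ hTl.1 hTl.2 (by linarith) (by linarith)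
  simp only [cauchyFormula_eq]
  exact (d1.add (hasDerivAt_inner_left lam hp₀ hN ha hab hbh)).congr_deriv (by rw [cauchyA]; ring)

lemma hasDerivAt_cauchyFormula_right :
    HasDerivAt (fun b => cauchyFormula p lam h T N a b) (cauchyB p lam h T N a b) b := by
  have hTl := hT.mono_left ha.le
  have d1 := hasDerivAt_wedge_left (lam := lam) (σ := 1) (y := a) (x := b) (β := 1 + p)
    hp₀ ⟨hab, hbh⟩ hTl.1 hTl.2 fun s hs => by linarith [hs.1]
  simp only [cauchyFormula_eq]
  exact (d1.add (hasDerivAt_inner_right lam hp₀ hN ha hab hbh)).congr_deriv (by rw [cauchyB]; ring)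

/-- The terms with raised parameter add up to λU and the others to p²H. With `cauchyA_sub_cauchyB`
this is the differential equation. -/
lemma hasDerivAt_cauchyA_right :
    HasDerivAt (fun b => cauchyA p lam h T N a b)
      (p ^ 2 * cauchyH p lam h T N a b + lam * cauchyFormula p lam h T N a b) b := by
  have hTl := hT.mono_left ha.le
  have d1 := hasDerivAt_wedge_left_self (lam := lam) (σ := 1) (y := a) (x := b)
    hp₀ (by norm_num) ⟨hab, hbh⟩ hTl.1 hTl.2 fun s hs => by linarith [hs.1]
  refine ((d1.add (hasDerivAt_inner_left_right lam hp₀ hN ha hab hbh)).const_mul p).neg.congr_deriv ?_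
  rw [cauchyH, cauchyFormula_eq]
  field_simp
  ring

lemma hasDerivAt_cauchyB_left :
    HasDerivAt (fun a => cauchyB p lam h T N a b)
      (p ^ 2 * cauchyH p lam h T N a b + lam * cauchyFormula p lam h T N a b) a := by
  have hTl := hT.mono_left ha.le
  have d1 := hasDerivAt_wedge_right_self (lam := lam) (σ := 1) (y := a) (x := b)
    hp₀ (by norm_num) ⟨hab, hbh⟩ hTl.1 hTl.2 (by linarith) (by linarith)
  refine (((hasDerivAt_inner_right_left lam hp₀ hN ha hab hbh).sub d1).const_mul p).congr_deriv ?_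
  rw [cauchyH, cauchyFormula_eq]
  field_simp
  ring

lemma continuousAt_cauchyA :
    ContinuousAt (fun w : ℝ × ℝ => cauchyA p lam h T N w.1 w.2) (a, b) := by
  have hTl := hT.mono_left ha.le
  have d1 := continuousAt_wedge (lam := lam) (σ := 1) (y := a) (x := b) (α := 1 + p) (β := p)
    (by linarith) hp₀ ⟨hab, hbh⟩ hTl.1 hTl.2 (by linarith) (by linarith)
  have d2 := ContinuousAt.comp (f := fun w : ℝ × ℝ => (w.2, w.1)) (x := (a, b)) d1 (by fun_prop)
  exact (continuousAt_const.mul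
    (d2.add (continuousAt_inner (by linarith) hp₀ hp₀ hN ha hab hbh))).neg

lemma continuousAt_cauchyB :
    ContinuousAt (fun w : ℝ × ℝ => cauchyB p lam h T N w.1 w.2) (a, b) := by
  have hTl := hT.mono_left ha.le
  have d1 := continuousAt_wedge (lam := lam) (σ := 1) (y := a) (x := b) (α := p) (β := 1 + p)
    hp₀ hp₀ ⟨hab, hbh⟩ hTl.1 hTl.2 (by linarith) (by linarith)
  have d2 := ContinuousAt.comp (f := fun w : ℝ × ℝ => (w.2, w.1)) (x := (a, b)) d1 (by fun_prop)
  exact continuousAt_const.mul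
    ((continuousAt_inner hp₀ (by linarith) hp₀ hN ha hab hbh).sub d2)

lemma cauchyA_sub_cauchyB :
    cauchyA p lam h T N a b - cauchyB p lam h T N a b = p * (b - a) * cauchyH p lam h T N a b := by
  have hTl := hT.mono_left ha.le
  have hp1 : 0 < 1 + p := by linarith
  have h1 := wedge_contiguous (lam := lam) hp₀ ⟨hab, hbh⟩ hTl.1 hTl.2 hab
  have h2 := inner_contiguous hab (intervalIntegrable_inner (lam := lam) hp₀ hp1 hp₀ hN ha hab hbh)
    (intervalIntegrable_inner hp1 hp₀ hp₀ hN ha hab hbh)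
  rw [cauchyA, cauchyB, cauchyH]
  linear_combination p * h1 - p * h2

end cauchy

end

section

variable {p lam h α β k a b c x : ℝ} {T N : ℝ → ℝ}

/-! ### Continuity of the Cauchy formula on the closed triangle -/

lemma continuous_integral_mul {P : Type*} [TopologicalSpace P] [FirstCountableTopology P]
    [LocallyCompactSpace P] {f : ℝ → ℝ} (hf : IntegrableOn f (Icc 0 h)) {K : ℝ → P → ℝ}
    (hK : Continuous (Function.uncurry K)) :
    Continuous fun w => ∫ s in Icc 0 h, f s * K s w := by
  rw [continuous_iff_continuousAt]
  intro w
  obtain ⟨V, hV, hwV⟩ := exists_compact_mem_nhds w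
  obtain ⟨C, hC⟩ := ((isCompact_Icc (a := (0 : ℝ)) (b := h)).prod hV).exists_bound_of_continuousOn
    hK.continuousOn
  refine continuousAt_of_dominated (bound := fun s => ‖f s‖ * C)
    (Eventually.of_forall fun w' => ?_) ?_ (hf.norm.mul_const C) (Eventually.of_forall fun s => ?_)
  · exact hf.aestronglyMeasurable.mul
      (hK.comp (by fun_prop : Continuous fun s : ℝ => (s, w'))).aestronglyMeasurable
  · filter_upwards [hwV] with w' hw'
    refine (ae_restrict_iff' measurableSet_Icc).2 (Eventually.of_forall fun s hs => ?_)
    rw [norm_mul]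
    exact mul_le_mul_of_nonneg_left (hC (s, w') ⟨hs, hw'⟩) (norm_nonneg _)
  · exact (continuous_const.mul
      (hK.comp (by fun_prop : Continuous fun w' : P => (s, w')))).continuousAt

/-- Truncated powers vanish outside their interval because p > 0. The limits of integration become
fixed and the kernels continuous, so continuity on the closed triangle follows by domination. -/
lemma cauchyFormula_eq_max (hp₀ : 0 < p) (ha : 0 ≤ a) (hab : a ≤ b) (hbh : b ≤ h) :
    cauchyFormula p lam h T N a b =
      (∫ s in Icc 0 h, T s * (max (s - a) 0 ^ p * max (s - b) 0 ^ p *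
        hyp01 (1 + p) (lam * (s - a) * (s - b)))) +
      ∫ s in Icc 0 h, N s * (max (b - s) 0 ^ p * max (s - a) 0 ^ p *
        hyp01 (1 + p) (-lam * (b - s) * (s - a))) := by
  have h0 : (0 : ℝ) ^ p = 0 := Real.zero_rpow hp₀.ne'
  rw [cauchyFormula, intervalIntegral.integral_of_le hbh, intervalIntegral.integral_of_le hab]
  congr 1
  · refine Eq.trans ?_ (setIntegral_eq_of_subset_of_forall_sdiff_eq_zero measurableSet_Icc
      (s := Ioc b h) (fun s hs => ⟨(ha.trans hab).trans hs.1.le, hs.2⟩) ?_).symm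
    · refine setIntegral_congr_fun measurableSet_Ioc fun s hs => ?_
      rw [max_eq_left (by linarith [hs.1]), max_eq_left (by linarith [hs.1])]
      ring
    · intro s hs
      have : s ≤ b := by
        by_contra hc
        exact hs.2 ⟨not_le.1 hc, hs.1.2⟩
      rw [max_eq_right (by linarith : s - b ≤ 0), h0]; ring
  · refine Eq.trans ?_ (setIntegral_eq_of_subset_of_forall_sdiff_eq_zero measurableSet_Icc
      (s := Ioc a b) (fun s hs => ⟨ha.trans hs.1.le, hs.2.trans hbh⟩) ?_).symm
    · refine setIntegral_congr_fun measurableSet_Ioc fun s hs => ?_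
      rw [max_eq_left (by linarith [hs.2]), max_eq_left (by linarith [hs.1])]
      ring
    · intro s hs
      rcases le_or_gt s a with h1 | h1
      · rw [max_eq_right (by linarith : s - a ≤ 0), h0]; ring
      · have : b ≤ s := by
          by_contra hc
          exact hs.2 ⟨h1, (not_le.1 hc).le⟩
        rw [max_eq_right (by linarith : b - s ≤ 0), h0]; ring

lemma continuousOn_cauchyFormula (hp₀ : 0 < p) (hT : IsDensity h T) (hN : IsDensity h N) :
    ContinuousOn (fun w : ℝ × ℝ => cauchyFormula p lam h T N w.1 w.2)
      {w | 0 ≤ w.1 ∧ w.1 ≤ w.2 ∧ w.2 ≤ h} := by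
  have hp1 : 0 < 1 + p := by linarith
  have hK1 : Continuous (Function.uncurry fun (s : ℝ) (w : ℝ × ℝ) =>
      max (s - w.1) 0 ^ p * max (s - w.2) 0 ^ p *
        hyp01 (1 + p) (lam * (s - w.1) * (s - w.2))) :=
    ((Continuous.rpow_const (by fun_prop) fun _ => Or.inr hp₀.le).mul
      (Continuous.rpow_const (by fun_prop) fun _ => Or.inr hp₀.le)).mul
      (Continuous.hyp01 (u := fun q : ℝ × ℝ × ℝ => lam * (q.1 - q.2.1) * (q.1 - q.2.2)) hp1
        (by fun_prop))
  have hK2 : Continuous (Function.uncurry fun (s : ℝ) (w : ℝ × ℝ) =>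
      max (w.2 - s) 0 ^ p * max (s - w.1) 0 ^ p *
        hyp01 (1 + p) (-lam * (w.2 - s) * (s - w.1))) :=
    ((Continuous.rpow_const (by fun_prop) fun _ => Or.inr hp₀.le).mul
      (Continuous.rpow_const (by fun_prop) fun _ => Or.inr hp₀.le)).mul
      (Continuous.hyp01 (u := fun q : ℝ × ℝ × ℝ => -lam * (q.2.2 - q.1) * (q.1 - q.2.1)) hp1
        (by fun_prop))
  refine ContinuousOn.congr
    ((continuous_integral_mul hT.2 hK1).add (continuous_integral_mul hN.2 hK2)).continuousOn ?_
  exact fun w hw => cauchyFormula_eq_max hp₀ hw.1 hw.2.1 hw.2.2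

/-! ### Limits on the singular lines -/

lemma inner_eq_scaled (hab : a < b) :
    inner lam p p p N a b = (b - a) ^ (2 * p - 1) * ∫ τ in (0 : ℝ)..1, N (a + (b - a) * τ) *
      (τ ^ (p - 1) * (1 - τ) ^ (p - 1) * hyp01 p (-lam * (b - a) ^ 2 * (τ * (1 - τ)))) := by
  have hd : 0 < b - a := sub_pos.2 hab
  have h1 := intervalIntegral.integral_comp_add_mul (a := 0) (b := 1)
    (fun s => N s * ((b - s) ^ (p - 1) * ((s - a) ^ (p - 1) *
      hyp01 p (-lam * (b - s) * (s - a))))) hd.ne' a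
  rw [mul_zero, add_zero, mul_one, add_sub_cancel, smul_eq_mul, eq_inv_mul_iff_mul_eq₀ hd.ne'] at h1
  rw [inner, ← h1, ← intervalIntegral.integral_const_mul, ← intervalIntegral.integral_const_mul]
  refine intervalIntegral.integral_congr fun τ hτ => ?_
  rw [uIcc_of_le zero_le_one] at hτ
  have e1 : b - (a + (b - a) * τ) = (b - a) * (1 - τ) := by ring
  have e2 : a + (b - a) * τ - a = (b - a) * τ := by ring
  have e3 : -lam * ((b - a) * (1 - τ)) * ((b - a) * τ) = -lam * (b - a) ^ 2 * (τ * (1 - τ)) := by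
    ring
  have e4 : (b - a) ^ (2 * p - 1) = (b - a) * ((b - a) ^ (p - 1) * (b - a) ^ (p - 1)) := by
    nth_rewrite 2 [← Real.rpow_one (b - a)]
    rw [← Real.rpow_add hd, ← Real.rpow_add hd]
    congr 1; ring
  rw [e1, e2, e3, Real.mul_rpow hd.le hτ.1, Real.mul_rpow hd.le (by linarith [hτ.2]), e4]
  ring

/-- One dominated convergence statement for a general filter covers both limits needed: to the
diagonal and to a = 0. -/
lemma tendsto_scaled_inner (hp₀ : 0 < p) (hN : ContinuousOn N (Ioo 0 h)) {l : Filter (ℝ × ℝ)}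
    [l.IsCountablyGenerated] {a₀ b₀ K : ℝ} {n₀ : ℝ → ℝ} (hl : Tendsto id l (𝓝 (a₀, b₀)))
    (hmem : ∀ᶠ w in l, 0 ≤ w.1 ∧ w.1 < w.2 ∧ w.2 ≤ h)
    (hK : ∀ᶠ w in l, ∀ τ ∈ Ioo (0 : ℝ) 1, |N (w.1 + (w.2 - w.1) * τ)| ≤ K)
    (hn₀ : ∀ τ ∈ Ioo (0 : ℝ) 1, Tendsto (fun w : ℝ × ℝ => N (w.1 + (w.2 - w.1) * τ)) l (𝓝 (n₀ τ))) :
    Tendsto (fun w : ℝ × ℝ => ∫ τ in (0 : ℝ)..1, N (w.1 + (w.2 - w.1) * τ) *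
      (τ ^ (p - 1) * (1 - τ) ^ (p - 1) * hyp01 p (-lam * (w.2 - w.1) ^ 2 * (τ * (1 - τ))))) l
      (𝓝 (∫ τ in (0 : ℝ)..1, n₀ τ *
        (τ ^ (p - 1) * (1 - τ) ^ (p - 1) * hyp01 p (-lam * (b₀ - a₀) ^ 2 * (τ * (1 - τ)))))) := by
  obtain ⟨G, hG⟩ := (isCompact_Icc (a := -(|lam| * h ^ 2)) (b := |lam| * h ^ 2)).exists_bound_of_continuousOn
    (continuous_hyp01 hp₀).continuousOn
  have harg : ∀ w : ℝ × ℝ, 0 ≤ w.1 → w.1 < w.2 → w.2 ≤ h → ∀ τ ∈ Ioo (0 : ℝ) 1,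
      ‖hyp01 p (-lam * (w.2 - w.1) ^ 2 * (τ * (1 - τ)))‖ ≤ G := by
    intro w h1 h2 h3 τ hτ
    refine hG _ (abs_le.1 ?_)
    rw [abs_mul, abs_mul, abs_neg, mul_assoc, abs_of_nonneg (sq_nonneg (w.2 - w.1)),
      abs_of_nonneg (mul_nonneg hτ.1.le (sub_pos.2 hτ.2).le)]
    refine mul_le_mul_of_nonneg_left ?_ (abs_nonneg _)
    have h4 : (w.2 - w.1) ^ 2 ≤ h ^ 2 := by nlinarith
    have h5 : τ * (1 - τ) ≤ 1 := by nlinarith [hτ.1, hτ.2]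
    calc _ ≤ h ^ 2 * 1 := mul_le_mul h4 h5 (mul_nonneg hτ.1.le (sub_pos.2 hτ.2).le) (sq_nonneg _)
      _ = _ := mul_one _
  have hdom := intervalIntegrable_beta (a := p) (b := p) (L := 1) hp₀ hp₀ one_pos
  refine intervalIntegral.tendsto_integral_filter_of_dominated_convergence
    (fun τ => K * (τ ^ (p - 1) * (1 - τ) ^ (p - 1) * G)) ?_ ?_ ((hdom.mul_const G).const_mul K) ?_
  · filter_upwards [hmem] with w hw
    rw [uIoc_of_le zero_le_one, ← restrict_Ioo_eq_restrict_Ioc]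
    refine ContinuousOn.aestronglyMeasurable ?_ measurableSet_Ioo
    refine ContinuousOn.mul (hN.comp (by fun_prop) fun τ hτ => ⟨?_, ?_⟩)
      (((ContinuousOn.rpow_const (by fun_prop) fun τ hτ => Or.inl hτ.1.ne').mul
      (ContinuousOn.rpow_const (by fun_prop) fun τ hτ => Or.inl (sub_pos.2 hτ.2).ne')).mul
      (Continuous.hyp01 hp₀ (by fun_prop)).continuousOn)
    · nlinarith [hτ.1, mul_pos (sub_pos.2 hw.2.1) hτ.1]
    · nlinarith [hτ.2, mul_pos (sub_pos.2 hw.2.1) (sub_pos.2 hτ.2)]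
  · filter_upwards [hmem, hK] with w hw hKw
    filter_upwards [show ∀ᵐ s : ℝ, s ≠ 1 by simp [ae_iff]] with τ hτ1 hτ
    rw [uIoc_of_le zero_le_one] at hτ
    have hτ' : τ ∈ Ioo (0 : ℝ) 1 := ⟨hτ.1, lt_of_le_of_ne hτ.2 hτ1⟩
    have h2 : 0 ≤ τ ^ (p - 1) * (1 - τ) ^ (p - 1) :=
      mul_nonneg (Real.rpow_nonneg hτ.1.le _) (Real.rpow_nonneg (sub_pos.2 hτ'.2).le _)
    rw [norm_mul, norm_mul, Real.norm_of_nonneg h2]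
    have h3 := hKw τ hτ'
    exact mul_le_mul h3 (mul_le_mul_of_nonneg_left (harg w hw.1 hw.2.1 hw.2.2 τ hτ') h2)
      (by positivity) ((abs_nonneg _).trans h3)
  · filter_upwards [show ∀ᵐ s : ℝ, s ≠ 1 by simp [ae_iff]] with τ hτ1 hτ
    rw [uIoc_of_le zero_le_one] at hτ
    refine (hn₀ τ ⟨hτ.1, lt_of_le_of_ne hτ.2 hτ1⟩).mul (Tendsto.const_mul _ ?_)
    have hc : Continuous fun w : ℝ × ℝ => hyp01 p (-lam * (w.2 - w.1) ^ 2 * (τ * (1 - τ))) :=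
      Continuous.hyp01 hp₀ (by fun_prop)
    exact (hc.tendsto (a₀, b₀)).comp hl

/-- At infinity the integrand is at most u^(2p-2), integrable exactly because p < 1/2. -/
lemma integrableOn_rpow_mul_one_add_rpow (hp₀ : 0 < p) (hp₁ : p < 1 / 2) :
    IntegrableOn (fun u : ℝ => u ^ (p - 1) * (1 + u) ^ (p - 1)) (Ioi 0) := by
  have hc : ContinuousOn (fun u : ℝ => u ^ (p - 1) * (1 + u) ^ (p - 1)) (Ioi 0) :=
    (ContinuousOn.rpow_const (by fun_prop) fun u hu => Or.inl (ne_of_gt hu)).mul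
      (ContinuousOn.rpow_const (by fun_prop) fun u hu => Or.inl
        (by linarith [mem_Ioi.1 hu] : (0 : ℝ) < 1 + u).ne')
  rw [← Ioc_union_Ioi_eq_Ioi (zero_le_one (α := ℝ))]
  refine IntegrableOn.union ?_ ?_
  · have h1 := intervalIntegrable_sub_rpow hp₀ 0 0 1
    rw [intervalIntegrable_iff_integrableOn_Ioc_of_le zero_le_one] at h1
    refine h1.mono' ((hc.mono Ioc_subset_Ioi_self).aestronglyMeasurable measurableSet_Ioc)
      ((ae_restrict_iff' measurableSet_Ioc).2 (Eventually.of_forall fun u hu => ?_))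
    have h2 := Real.rpow_nonneg hu.1.le (p - 1)
    have h3 := Real.rpow_nonneg (by linarith [hu.1] : 0 ≤ 1 + u) (p - 1)
    rw [Real.norm_of_nonneg (mul_nonneg h2 h3), sub_zero]
    exact mul_le_of_le_one_right h2
      (Real.rpow_le_one_of_one_le_of_nonpos (by linarith [hu.1]) (by linarith))
  · have h1 := integrableOn_Ioi_rpow_of_lt (by linarith : 2 * p - 2 < -1) one_pos
    refine h1.mono' ((hc.mono (Ioi_subset_Ioi zero_le_one)).aestronglyMeasurable measurableSet_Ioi)
      ((ae_restrict_iff' measurableSet_Ioi).2 (Eventually.of_forall fun u hu => ?_))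
    have hu0 : 0 < u := one_pos.trans hu
    have h2 := Real.rpow_nonneg hu0.le (p - 1)
    have h3 := Real.rpow_nonneg (by linarith : 0 ≤ 1 + u) (p - 1)
    rw [Real.norm_of_nonneg (mul_nonneg h2 h3), show 2 * p - 2 = (p - 1) + (p - 1) by ring,
      Real.rpow_add hu0]
    exact mul_le_mul_of_nonneg_left
      (Real.rpow_le_rpow_of_nonpos hu0 (by linarith) (by linarith)) h2

/-- The constant in the limit of the integral over `(b, h)`. -/
def gammaRight (p : ℝ) : ℝ := ∫ u in Ioi (0 : ℝ), u ^ (p - 1) * (1 + u) ^ (p - 1)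

/-- The substitution is s = b + (b - a)u. The indicator replaces the moving upper limit, which tends
to infinity as b - a → 0, so that dominated convergence can be applied on a fixed domain. -/
lemma wedge_eq_scaled {e : ℝ} (hab : a < b) (hbe : b < e) :
    (b - a) ^ (1 - 2 * p) * wedge lam 1 p p p T e b a =
      ∫ u, (Ioc 0 ((e - b) / (b - a))).indicator (fun u => T (b + (b - a) * u) *
        (u ^ (p - 1) * (1 + u) ^ (p - 1) * hyp01 p (lam * (b - a) ^ 2 * (u * (1 + u))))) u := by
  have hd : 0 < b - a := sub_pos.2 hab
  have hL : 0 < (e - b) / (b - a) := div_pos (sub_pos.2 hbe) hd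
  have h1 := intervalIntegral.integral_comp_add_mul (a := 0) (b := (e - b) / (b - a))
    (fun s => T s * ((s - b) ^ (p - 1) * ((1 * (s - a)) ^ (p - 1) *
      hyp01 p (lam * (s - b) * (s - a))))) hd.ne' b
  rw [mul_zero, add_zero, mul_div_cancel₀ _ hd.ne', add_sub_cancel, smul_eq_mul,
    eq_inv_mul_iff_mul_eq₀ hd.ne'] at h1
  rw [integral_indicator measurableSet_Ioc, ← intervalIntegral.integral_of_le hL.le, wedge, ← h1,
    ← intervalIntegral.integral_const_mul, ← intervalIntegral.integral_const_mul]
  refine intervalIntegral.integral_congr fun u hu => ?_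
  rw [uIcc_of_le hL.le] at hu
  have e1 : b + (b - a) * u - b = (b - a) * u := by ring
  have e2 : 1 * (b + (b - a) * u - a) = (b - a) * (1 + u) := by ring
  have e3 : lam * ((b - a) * u) * (b + (b - a) * u - a) = lam * (b - a) ^ 2 * (u * (1 + u)) := by
    ring
  have e4 : (b - a) ^ (1 - 2 * p) * ((b - a) * ((b - a) ^ (p - 1) * (b - a) ^ (p - 1))) = 1 := by
    nth_rewrite 2 [← Real.rpow_one (b - a)]
    rw [← Real.rpow_add hd, ← Real.rpow_add hd, ← Real.rpow_add hd]
    convert Real.rpow_zero _ using 2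
    ring
  rw [e1, e2, e3, Real.mul_rpow hd.le hu.1, Real.mul_rpow hd.le (by linarith [hu.1])]
  linear_combination (T (b + (b - a) * u) *
        (u ^ (p - 1) * (1 + u) ^ (p - 1) * hyp01 p (lam * (b - a) ^ 2 * (u * (1 + u))))) * e4

/-- The constant in the limit of the integral over `(a, b)`. -/
def gammaMid (p : ℝ) : ℝ := ∫ τ in (0 : ℝ)..1, τ ^ (p - 1) * (1 - τ) ^ (p - 1)

lemma gammaMid_pos (hp₀ : 0 < p) : 0 < gammaMid p := by
  refine intervalIntegral.intervalIntegral_pos_of_pos_on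
    (intervalIntegrable_beta hp₀ hp₀ one_pos) (fun τ hτ => ?_) one_pos
  exact mul_pos (Real.rpow_pos_of_pos hτ.1 _) (Real.rpow_pos_of_pos (sub_pos.2 hτ.2) _)

lemma exists_hyp01_bound (hk : 0 < k) (B : ℝ) :
    ∃ G, 0 ≤ G ∧ ∀ z, |z| ≤ B → ‖hyp01 k z‖ ≤ G := by
  obtain ⟨G, hG⟩ := (isCompact_Icc (a := -B) (b := B)).exists_bound_of_continuousOn
    (continuous_hyp01 hk).continuousOn
  exact ⟨|G|, abs_nonneg _, fun z hz => (hG z (abs_le.1 hz)).trans (le_abs_self G)⟩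

lemma abs_arg_le {s y z : ℝ} (hz : 0 ≤ z) (hy : 0 ≤ y) (hys : y ≤ s) (hzs : z ≤ s) (hs : s ≤ h) :
    |lam * (s - y) * (s - z)| ≤ |lam| * h ^ 2 := by
  rw [mul_assoc, abs_mul, abs_of_nonneg (mul_nonneg (sub_nonneg.2 hys) (sub_nonneg.2 hzs))]
  refine mul_le_mul_of_nonneg_left ?_ (abs_nonneg _)
  nlinarith

/-- Stopping at e < h keeps T bounded, which provides a majorant; T itself may be unbounded near h.
-/
lemma tendsto_wedge_near (hp₀ : 0 < p) (hp₁ : p < 1 / 2) (hT : ContinuousOn T (Ioo 0 h)) {e : ℝ}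
    (hx : 0 < x) (hxe : x < e) (heh : e < h) :
    Tendsto (fun w : ℝ × ℝ => (w.2 - w.1) ^ (1 - 2 * p) * wedge lam 1 p p p T e w.2 w.1)
      (𝓝[{w | w.1 < w.2}] (x, x)) (𝓝 (T x * gammaRight p)) := by
  obtain ⟨x₁, hx₁, hx₁x⟩ := exists_between hx
  obtain ⟨K, hK⟩ := (isCompact_Icc (a := x₁) (b := e)).exists_bound_of_continuousOn
    (hT.mono fun s hs => ⟨hx₁.trans_le hs.1, hs.2.trans_lt heh⟩)
  have hK0 : 0 ≤ K := (norm_nonneg _).trans (hK x ⟨hx₁x.le, hxe.le⟩)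
  obtain ⟨G, hG0, hG⟩ := exists_hyp01_bound hp₀ (|lam| * h ^ 2)
  set l := 𝓝[{w : ℝ × ℝ | w.1 < w.2}] (x, x) with hl
  have hlt : ∀ᶠ w in l, w.1 < w.2 := self_mem_nhdsWithin
  have hnear : ∀ᶠ w in l, x₁ < w.1 ∧ w.2 < e := by
    have hO : IsOpen ({w : ℝ × ℝ | x₁ < w.1} ∩ {w | w.2 < e}) :=
      (isOpen_lt (by fun_prop) (by fun_prop)).inter (isOpen_lt (by fun_prop) (by fun_prop))
    exact mem_nhdsWithin_of_mem_nhds (hO.mem_nhds ⟨hx₁x, hxe⟩)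
  have htend : Tendsto id l (𝓝 (x, x)) := nhdsWithin_le_nhds
  set Φ := fun u : ℝ => u ^ (p - 1) * (1 + u) ^ (p - 1) with hΦ
  have hΦ0 : ∀ u, 0 < u → 0 ≤ Φ u := fun u hu =>
    mul_nonneg (Real.rpow_nonneg hu.le _) (Real.rpow_nonneg (by linarith) _)
  have key : Tendsto (fun w : ℝ × ℝ => ∫ u, (Ioc 0 ((e - w.2) / (w.2 - w.1))).indicator
      (fun u => T (w.2 + (w.2 - w.1) * u) *
        (u ^ (p - 1) * (1 + u) ^ (p - 1) * hyp01 p (lam * (w.2 - w.1) ^ 2 * (u * (1 + u))))) u) l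
      (𝓝 (∫ u, (Ioi (0 : ℝ)).indicator (fun u => T x * Φ u) u)) := by
    refine tendsto_integral_filter_of_dominated_convergence
      ((Ioi 0).indicator fun u => K * (Φ u * G)) ?_ ?_ ?_ ?_
    · filter_upwards [hlt, hnear] with w hw hn
      refine (aestronglyMeasurable_indicator_iff measurableSet_Ioc).2
        (ContinuousOn.aestronglyMeasurable ?_ measurableSet_Ioc)
      have hmem : ∀ u ∈ Ioc 0 ((e - w.2) / (w.2 - w.1)), w.2 + (w.2 - w.1) * u ∈ Ioo 0 h := by
        intro u hu
        have h1 := (le_div_iff₀ (sub_pos.2 hw)).1 hu.2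
        have h2 := mul_pos (sub_pos.2 hw) hu.1
        exact ⟨by linarith, by nlinarith⟩
      refine ContinuousOn.mul (hT.comp (by fun_prop) hmem)
        (ContinuousOn.mul (ContinuousOn.mul ?_ ?_) (Continuous.hyp01 hp₀ (by fun_prop)).continuousOn)
      · exact ContinuousOn.rpow_const (by fun_prop) fun u hu => Or.inl hu.1.ne'
      · exact ContinuousOn.rpow_const (by fun_prop) fun u hu => Or.inl
          (by linarith [hu.1] : 0 < 1 + u).ne'
    · filter_upwards [hlt, hnear] with w hw hn
      refine Eventually.of_forall fun u => ?_
      by_cases hu : u ∈ Ioc 0 ((e - w.2) / (w.2 - w.1))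
      · have h1 := (le_div_iff₀ (sub_pos.2 hw)).1 hu.2
        have h2 := mul_pos (sub_pos.2 hw) hu.1
        rw [indicator_of_mem hu, indicator_of_mem (mem_Ioi.2 hu.1), norm_mul, norm_mul]
        have h3 := hΦ0 u hu.1
        rw [Real.norm_of_nonneg h3]
        have h4 := hK (w.2 + (w.2 - w.1) * u) ⟨by linarith, by linarith⟩
        refine mul_le_mul h4 (mul_le_mul_of_nonneg_left (hG _ ?_) h3)
          (mul_nonneg h3 (norm_nonneg _)) hK0
        have h5 := abs_arg_le (lam := lam) (h := h) (s := w.2 + (w.2 - w.1) * u) (y := w.2)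
          (z := w.1) (by linarith) (by linarith) (by linarith) (by linarith) (by linarith)
        convert h5 using 2
        ring
      · rw [indicator_of_notMem hu, norm_zero]
        exact indicator_nonneg (fun u hu => mul_nonneg hK0 (mul_nonneg (hΦ0 u hu) hG0)) u
    · rw [integrable_indicator_iff measurableSet_Ioi]
      exact ((integrableOn_rpow_mul_one_add_rpow hp₀ hp₁).mul_const G).const_mul K
    · refine Eventually.of_forall fun u => ?_
      rcases le_or_gt u 0 with hu | hu
      · rw [indicator_of_notMem (by simpa using hu)]
        refine tendsto_const_nhds.congr fun w => ?_
        rw [indicator_of_notMem fun hc => absurd hc.1 (not_lt.2 hu)]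
      · rw [indicator_of_mem (mem_Ioi.2 hu)]
        have hc1 : Tendsto (fun w : ℝ × ℝ => w.2 + (w.2 - w.1) * u) l (𝓝 x) := by
          have : Continuous fun w : ℝ × ℝ => w.2 + (w.2 - w.1) * u := by fun_prop
          simpa using (this.tendsto (x, x)).comp htend
        have hc2 : Tendsto (fun w : ℝ × ℝ => hyp01 p (lam * (w.2 - w.1) ^ 2 * (u * (1 + u)))) l
            (𝓝 1) := by
          have : Continuous fun w : ℝ × ℝ => hyp01 p (lam * (w.2 - w.1) ^ 2 * (u * (1 + u))) :=
            Continuous.hyp01 hp₀ (by fun_prop)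
          simpa using (this.tendsto (x, x)).comp htend
        have hTx : ContinuousAt T x := hT.continuousAt (Ioo_mem_nhds hx (hxe.trans heh))
        have h1 := (hTx.tendsto.comp hc1).mul (hc2.const_mul (Φ u))
        rw [mul_one] at h1
        refine h1.congr' ?_
        have hev : ∀ᶠ w in l, w.2 + (w.2 - w.1) * u < e := hc1.eventually_lt_const hxe
        filter_upwards [hlt, hev] with w hw hw2
        rw [indicator_of_mem]
        · rfl
        · exact ⟨hu, (le_div_iff₀ (sub_pos.2 hw)).2 (by linarith)⟩
  rw [integral_indicator measurableSet_Ioi, integral_const_mul] at key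
  refine key.congr' ?_
  filter_upwards [hlt, hnear] with w hw hn
  exact (wedge_eq_scaled hw hn.2).symm

lemma tendsto_sub_rpow_diag (hp₁ : p < 1 / 2) :
    Tendsto (fun w : ℝ × ℝ => (w.2 - w.1) ^ (1 - 2 * p)) (𝓝[{w | w.1 < w.2}] (x, x)) (𝓝 0) := by
  have h1 : Continuous fun w : ℝ × ℝ => (w.2 - w.1) ^ (1 - 2 * p) :=
    Continuous.rpow_const (by fun_prop) fun _ => Or.inr (by linarith)
  have h2 := h1.tendsto (x, x)
  simp only [sub_self, Real.zero_rpow (by linarith : 1 - 2 * p ≠ 0)] at h2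
  exact h2.mono_left nhdsWithin_le_nhds

/-- Beyond e the integral stays bounded, by integrability of T, and the factor (b - a)^(1-2p) sends
it to 0. Only the part near the diagonal contributes. -/
lemma tendsto_wedge_diag (hp₀ : 0 < p) (hp₁ : p < 1 / 2) (hT : IsDensity h T)
    (hx : x ∈ Ioo 0 h) :
    Tendsto (fun w : ℝ × ℝ => (w.2 - w.1) ^ (1 - 2 * p) * wedge lam 1 p p p T h w.2 w.1)
      (𝓝[{w | w.1 < w.2}] (x, x)) (𝓝 (T x * gammaRight p)) := by
  obtain ⟨e, hxe, heh⟩ := exists_between hx.2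
  obtain ⟨e₁, hxe₁, he₁⟩ := exists_between hxe
  obtain ⟨G, hG0, hG⟩ := exists_hyp01_bound hp₀ (|lam| * h ^ 2)
  set q := (e - e₁) ^ (p - 1) with hq
  have hq0 : 0 ≤ q := Real.rpow_nonneg (sub_pos.2 he₁).le _
  set W : ℝ × ℝ → ℝ → ℝ := fun w s => T s * ((s - w.2) ^ (p - 1) *
    ((1 * (s - w.1)) ^ (p - 1) * hyp01 p (lam * (s - w.2) * (s - w.1)))) with hW
  have hlt : ∀ᶠ w in 𝓝[{w : ℝ × ℝ | w.1 < w.2}] (x, x), w.1 < w.2 := self_mem_nhdsWithin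
  have hnear : ∀ᶠ w in 𝓝[{w : ℝ × ℝ | w.1 < w.2}] (x, x), 0 < w.1 ∧ w.2 < e₁ := by
    have hO : IsOpen ({w : ℝ × ℝ | 0 < w.1} ∩ {w | w.2 < e₁}) :=
      (isOpen_lt (by fun_prop) (by fun_prop)).inter (isOpen_lt (by fun_prop) (by fun_prop))
    exact mem_nhdsWithin_of_mem_nhds (hO.mem_nhds ⟨hx.1, hxe₁⟩)
  have htail : Tendsto (fun w : ℝ × ℝ => (w.2 - w.1) ^ (1 - 2 * p) * ∫ s in e..h, W w s)
      (𝓝[{w | w.1 < w.2}] (x, x)) (𝓝 0) := by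
    refine (tendsto_sub_rpow_diag hp₁).zero_mul_isBoundedUnder_le ?_
    refine isBoundedUnder_of_eventually_le (a := ∫ s in e..h, ‖T s‖ * (q * (q * G))) ?_
    filter_upwards [hlt, hnear] with w hw hn
    have hTi : IntervalIntegrable T volume e h :=
      (intervalIntegrable_iff_integrableOn_Ioc_of_le heh.le).2
        (hT.mono_left (hx.1.trans hxe).le).2
    refine intervalIntegral.norm_integral_le_of_norm_le heh.le (Eventually.of_forall fun s hs => ?_)
      (hTi.norm.mul_const _)
    have h1 := Real.rpow_nonneg (by linarith [hs.1] : 0 ≤ s - w.2) (p - 1)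
    have h2 := Real.rpow_nonneg (by linarith [hs.1] : 0 ≤ s - w.1) (p - 1)
    rw [norm_mul, norm_mul, norm_mul, one_mul, Real.norm_of_nonneg h1, Real.norm_of_nonneg h2]
    refine mul_le_mul_of_nonneg_left (mul_le_mul ?_ (mul_le_mul ?_ (hG _ ?_) (norm_nonneg _) hq0)
      (by positivity) hq0) (norm_nonneg _)
    · exact Real.rpow_le_rpow_of_nonpos (sub_pos.2 he₁) (by linarith [hs.1]) (by linarith)
    · exact Real.rpow_le_rpow_of_nonpos (sub_pos.2 he₁) (by linarith [hs.1]) (by linarith)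
    · exact abs_arg_le (by linarith) (by linarith) (by linarith [hs.1]) (by linarith [hs.1]) hs.2
  have h3 := (tendsto_wedge_near (lam := lam) hp₀ hp₁ hT.1 hx.1 hxe heh).add htail
  rw [add_zero] at h3
  refine h3.congr' ?_
  filter_upwards [hlt, hnear] with w hw hn
  have hTl := hT.mono_left hn.1.le
  have hi := intervalIntegrable_wedge (lam := lam) (σ := 1) (x := w.2) (y := w.1) (β := p) hp₀ hp₀
    ⟨hw, by linarith⟩ hTl.1 hTl.2 (by linarith) (by linarith)
  rw [← mul_add, wedge, wedge]
  congr 1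
  refine intervalIntegral.integral_add_adjacent_intervals (hi.mono_set ?_) (hi.mono_set ?_)
  · rw [uIcc_of_le (by linarith), uIcc_of_le (by linarith)]
    exact Icc_subset_Icc_right heh.le
  · rw [uIcc_of_le (by linarith), uIcc_of_le (by linarith)]
    exact Icc_subset_Icc_left (by linarith)

lemma tendsto_inner_diag (hp₀ : 0 < p) (hN : ContinuousOn N (Ioo 0 h)) (hx : x ∈ Ioo 0 h) :
    Tendsto (fun w : ℝ × ℝ => (w.2 - w.1) ^ (1 - 2 * p) * inner lam p p p N w.1 w.2)
      (𝓝[{w | w.1 < w.2}] (x, x)) (𝓝 (N x * gammaMid p)) := by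
  obtain ⟨x₁, hx₁, hx₁x⟩ := exists_between hx.1
  obtain ⟨e, hxe, heh⟩ := exists_between hx.2
  obtain ⟨K, hK⟩ := (isCompact_Icc (a := x₁) (b := e)).exists_bound_of_continuousOn
    (hN.mono fun s hs => ⟨hx₁.trans_le hs.1, hs.2.trans_lt heh⟩)
  have hlt : ∀ᶠ w in 𝓝[{w : ℝ × ℝ | w.1 < w.2}] (x, x), w.1 < w.2 := self_mem_nhdsWithin
  have hnear : ∀ᶠ w in 𝓝[{w : ℝ × ℝ | w.1 < w.2}] (x, x), x₁ < w.1 ∧ w.2 < e := by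
    have hO : IsOpen ({w : ℝ × ℝ | x₁ < w.1} ∩ {w | w.2 < e}) :=
      (isOpen_lt (by fun_prop) (by fun_prop)).inter (isOpen_lt (by fun_prop) (by fun_prop))
    exact mem_nhdsWithin_of_mem_nhds (hO.mem_nhds ⟨hx₁x, hxe⟩)
  have htend : Tendsto id (𝓝[{w : ℝ × ℝ | w.1 < w.2}] (x, x)) (𝓝 (x, x)) := nhdsWithin_le_nhds
  have h1 := tendsto_scaled_inner (p := p) (lam := lam) (h := h) (K := K) (n₀ := fun _ => N x) hp₀
    hN htend (by filter_upwards [hlt, hnear] with w hw hn using ⟨by linarith, hw, by linarith⟩)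
    (by
      filter_upwards [hlt, hnear] with w hw hn τ hτ
      refine hK _ ⟨?_, ?_⟩
      · nlinarith [mul_pos (sub_pos.2 hw) hτ.1]
      · nlinarith [mul_pos (sub_pos.2 hw) (sub_pos.2 hτ.2)])
    (fun τ _ => by
      have hc : Continuous fun w : ℝ × ℝ => w.1 + (w.2 - w.1) * τ := by fun_prop
      have hc1 : Tendsto (fun w : ℝ × ℝ => w.1 + (w.2 - w.1) * τ)
          (𝓝[{w : ℝ × ℝ | w.1 < w.2}] (x, x)) (𝓝 x) := by
        simpa using (hc.tendsto (x, x)).comp htend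
      exact (hN.continuousAt (Ioo_mem_nhds hx.1 hx.2)).tendsto.comp hc1)
  have h2 : ∫ τ in (0 : ℝ)..1, N x *
      (τ ^ (p - 1) * (1 - τ) ^ (p - 1) * hyp01 p (-lam * (x - x) ^ 2 * (τ * (1 - τ)))) =
      N x * gammaMid p := by
    rw [gammaMid, ← intervalIntegral.integral_const_mul]
    exact intervalIntegral.integral_congr fun τ _ => by simp
  rw [h2] at h1
  refine h1.congr' ?_
  filter_upwards [hlt] with w hw
  have hd := sub_pos.2 hw
  rw [inner_eq_scaled hw, ← mul_assoc, ← Real.rpow_add hd]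
  simp

/-- The weighted limit of the normal derivative on the singular line. -/
lemma tendsto_cauchy_diag (hp₀ : 0 < p) (hp₁ : p < 1 / 2) (hT : IsDensity h T)
    (hN : IsDensity h N) (hx : x ∈ Ioo 0 h) :
    Tendsto (fun w : ℝ × ℝ => (w.2 - w.1) ^ (-2 * p) *
      (cauchyA p lam h T N w.1 w.2 - cauchyB p lam h T N w.1 w.2))
      (𝓝[{w | w.1 < w.2}] (x, x)) (𝓝 (p * (T x * gammaRight p - N x * gammaMid p))) := by
  have h1 := ((tendsto_wedge_diag (lam := lam) hp₀ hp₁ hT hx).sub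
    (tendsto_inner_diag (lam := lam) hp₀ hN.1 hx)).const_mul p
  refine h1.congr' ?_
  have hO : IsOpen ({w : ℝ × ℝ | 0 < w.1} ∩ {w | w.2 < h}) :=
    (isOpen_lt (by fun_prop) (by fun_prop)).inter (isOpen_lt (by fun_prop) (by fun_prop))
  filter_upwards [self_mem_nhdsWithin, mem_nhdsWithin_of_mem_nhds (hO.mem_nhds (x := (x, x))
    ⟨hx.1, hx.2⟩)] with w hw hn
  have hw : w.1 < w.2 := hw
  rw [cauchyA_sub_cauchyB lam hp₀ hT hN hn.1 hw hn.2, cauchyH,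
    show 1 - 2 * p = -2 * p + 1 by ring, Real.rpow_add_one (sub_pos.2 hw).ne']
  ring

/-- Integrability of N near 0 does not control the factor (s - a)^(p-1) as a → 0; the bound K does.
-/
lemma tendsto_inner_zero {K : ℝ} (hp₀ : 0 < p) (hN : ContinuousOn N (Ioo 0 h))
    (hK : ∀ s ∈ Ioo 0 h, |N s| ≤ K) (hb : b ∈ Ioo 0 h) :
    Tendsto (fun a => inner lam p p p N a b) (𝓝[>] 0) (𝓝 (inner lam p p p N 0 b)) := by
  set l := 𝓝[{w : ℝ × ℝ | 0 < w.1}] ((0 : ℝ), b) with hl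
  have htend : Tendsto id l (𝓝 (0, b)) := nhdsWithin_le_nhds
  have hpos : ∀ᶠ w in l, 0 < w.1 := self_mem_nhdsWithin
  have hnear : ∀ᶠ w in l, w.1 < w.2 ∧ w.2 < h := by
    have hO : IsOpen ({w : ℝ × ℝ | w.1 < w.2} ∩ {w | w.2 < h}) :=
      (isOpen_lt (by fun_prop) (by fun_prop)).inter (isOpen_lt (by fun_prop) (by fun_prop))
    exact mem_nhdsWithin_of_mem_nhds (hO.mem_nhds ⟨hb.1, hb.2⟩)
  have h1 := tendsto_scaled_inner (p := p) (lam := lam) (h := h) (K := K)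
    (n₀ := fun τ => N (0 + (b - 0) * τ)) hp₀ hN htend
    (by filter_upwards [hpos, hnear] with w hw hn using ⟨hw.le, hn.1, hn.2.le⟩)
    (by
      filter_upwards [hpos, hnear] with w hw hn τ hτ
      refine hK _ ⟨?_, ?_⟩
      · nlinarith [mul_pos (sub_pos.2 hn.1) hτ.1]
      · nlinarith [mul_pos (sub_pos.2 hn.1) (sub_pos.2 hτ.2)])
    (fun τ hτ => by
      have hc : Continuous fun w : ℝ × ℝ => w.1 + (w.2 - w.1) * τ := by fun_prop
      have hc1 : Tendsto (fun w : ℝ × ℝ => w.1 + (w.2 - w.1) * τ) l (𝓝 (0 + (b - 0) * τ)) :=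
        (hc.tendsto (0, b)).comp htend
      refine (hN.continuousAt (Ioo_mem_nhds ?_ ?_)).tendsto.comp hc1
      · nlinarith [mul_pos hb.1 hτ.1]
      · nlinarith [mul_pos hb.1 (sub_pos.2 hτ.2), hb.2])
  have h2 : Tendsto (fun w : ℝ × ℝ => (w.2 - w.1) ^ (2 * p - 1)) l (𝓝 ((b - 0) ^ (2 * p - 1))) := by
    have : ContinuousAt (fun w : ℝ × ℝ => (w.2 - w.1) ^ (2 * p - 1)) (0, b) :=
      ContinuousAt.rpow_const (by fun_prop) (Or.inl (by simpa using hb.1.ne'))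
    exact this.tendsto.comp htend
  have h3 := h2.mul h1
  rw [← inner_eq_scaled hb.1] at h3
  have h4 : Tendsto (fun a : ℝ => (a, b)) (𝓝[>] 0) l := by
    refine tendsto_nhdsWithin_iff.2 ⟨?_, self_mem_nhdsWithin⟩
    exact ((by fun_prop : Continuous fun a : ℝ => (a, b)).tendsto 0).mono_left nhdsWithin_le_nhds
  refine (h3.comp h4).congr' ?_
  filter_upwards [h4.eventually hnear] with a ha
  exact (inner_eq_scaled ha.1).symm

lemma tendsto_wedge_zero (hα : 0 < α) (hk : 0 < k) (hT : IsDensity h T) (hb : b ∈ Ioo 0 h) :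
    Tendsto (fun a => wedge lam 1 α β k T h b a) (𝓝[>] 0) (𝓝 (wedge lam 1 α β k T h b 0)) := by
  have h1 := continuousAt_wedge (lam := lam) (σ := 1) (y := 0) (β := β) hα hk hb hT.1
    hT.integrableOn_Ioc (by linarith [hb.1]) (by linarith [hb.1, hb.2])
  have h2 : ContinuousAt (fun a : ℝ => (b, a)) 0 := by fun_prop
  exact (ContinuousAt.comp (f := fun a : ℝ => (b, a)) (x := 0) h1 h2).tendsto.mono_left
    nhdsWithin_le_nhds

/-- The limit of the derivative across the characteristic `a = 0`. -/
lemma tendsto_cauchy_zero {K : ℝ} (hp₀ : 0 < p) (hT : IsDensity h T) (hN : IsDensity h N)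
    (hK : ∀ s ∈ Ioo 0 h, |N s| ≤ K) (hb : b ∈ Ioo 0 h) :
    Tendsto (fun a => cauchyA p lam h T N a b - cauchyB p lam h T N a b) (𝓝[>] 0)
      (𝓝 (p * (b - 0) * cauchyH p lam h T N 0 b)) := by
  have h1 : Tendsto (fun a : ℝ => p * (b - a)) (𝓝[>] 0) (𝓝 (p * (b - 0))) :=
    ((by fun_prop : Continuous fun a : ℝ => p * (b - a)).tendsto 0).mono_left nhdsWithin_le_nhds
  have h2 := h1.mul ((tendsto_wedge_zero (lam := lam) (β := p) hp₀ hp₀ hT hb).sub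
    (tendsto_inner_zero (lam := lam) hp₀ hN.1 hK hb))
  refine h2.congr' ?_
  filter_upwards [self_mem_nhdsWithin, mem_nhdsWithin_of_mem_nhds (Iio_mem_nhds hb.1)] with a ha hab
  exact (cauchyA_sub_cauchyB lam hp₀ hT hN ha hab hb.2).symm

end

section

variable {p lam h c e x y a b : ℝ} {f T N φ : ℝ → ℝ}

/-! ### Boundary values of the explicit solution -/

/-- The traces of the Cauchy formula on b = h and on a = 0 have this shape, so they are primitives
of `opA`. -/
lemma integral_rpow_kernel (hp₀ : 0 < p) (hye : y ≤ e) (hf : IntegrableOn f (Ioc y e)) :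
    ∫ s in y..e, f s * ((s - y) ^ p * hyp01 (1 + p) (lam * (s - c) * (s - y))) =
      p * ∫ x in y..e, opA p lam e c f x := by
  have hk : Continuous (Function.uncurry fun s x : ℝ => p * hyp01 p (lam * (s - c) * (s - x))) :=
    continuous_const.mul (Continuous.hyp01 hp₀ (by fun_prop))
  rw [integral_kernel_eq (f := f) (g := fun s x => p * hyp01 p (lam * (s - c) * (s - x)))
    (κ := fun s x => (s - x) ^ p * hyp01 (1 + p) (lam * (s - c) * (s - x))) hp₀ hye hf
    hk.continuousOn (fun s _ => (Continuous.mul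
      (Continuous.rpow_const (by fun_prop) fun _ => Or.inr hp₀.le)
      (Continuous.hyp01 (by linarith) (by fun_prop))).continuousOn)
    (fun s hs t ht => ?_) (fun s hs => by rw [sub_self, Real.zero_rpow hp₀.ne', zero_mul]),
    ← intervalIntegral.integral_const_mul]
  · refine intervalIntegral.integral_congr fun x _ => ?_
    rw [opA, ← intervalIntegral.integral_const_mul]
    exact intervalIntegral.integral_congr fun s _ => by ring
  · exact ((hasDerivAt_rpow_mul_hyp01 hp₀ (lam * (s - c)) (sub_pos.2 ht.2)).comp t
      ((hasDerivAt_id t).const_sub s)).congr_deriv (by ring)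

lemma continuous_rpow_kernel_self (hp₀ : 0 < p) : Continuous (Function.uncurry fun s x : ℝ =>
    p * hyp01 p (lam * (s - c) * (s - x)) +
      lam / p * ((s - c) * (s - x)) * hyp01 (1 + p) (lam * (s - c) * (s - x))) :=
  (continuous_const.mul (Continuous.hyp01 (u := fun q : ℝ × ℝ => lam * (q.1 - c) * (q.1 - q.2)) hp₀
    (by fun_prop))).add
    ((by fun_prop : Continuous fun q : ℝ × ℝ => lam / p * ((q.1 - c) * (q.1 - q.2))).mul
    (Continuous.hyp01 (u := fun q : ℝ × ℝ => lam * (q.1 - c) * (q.1 - q.2)) (by linarith)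
      (by fun_prop)))

/-- The analogue for the trace of the derivative U_a on a = 0, where parameter and exponent have
come to coincide. -/
lemma integral_rpow_kernel_self (hp₀ : 0 < p) (hye : y ≤ e) (hf : IntegrableOn f (Ioc y e)) :
    ∫ s in y..e, f s * ((s - y) ^ p * hyp01 p (lam * (s - c) * (s - y))) =
      ∫ x in y..e, ∫ s in x..e, f s * ((s - x) ^ (p - 1) *
        (p * hyp01 p (lam * (s - c) * (s - x)) +
          lam / p * ((s - c) * (s - x)) * hyp01 (1 + p) (lam * (s - c) * (s - x)))) := by
  refine integral_kernel_eq (f := f)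
    (g := fun s x => p * hyp01 p (lam * (s - c) * (s - x)) +
          lam / p * ((s - c) * (s - x)) * hyp01 (1 + p) (lam * (s - c) * (s - x)))
    (κ := fun s x => (s - x) ^ p * hyp01 p (lam * (s - c) * (s - x))) hp₀ hye hf
    (continuous_rpow_kernel_self hp₀).continuousOn (fun s _ => (Continuous.mul
      (Continuous.rpow_const (by fun_prop) fun _ => Or.inr hp₀.le)
      (Continuous.hyp01 hp₀ (by fun_prop))).continuousOn)
    (fun s hs t ht => ?_) (fun s hs => by rw [sub_self, Real.zero_rpow hp₀.ne', zero_mul])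
  have h1 : (s - t) ^ p = (s - t) ^ (p - 1) * (s - t) := by
    rw [← Real.rpow_add_one (sub_pos.2 ht.2).ne']; simp
  refine ((hasDerivAt_rpow_mul_hyp01_self hp₀ (lam * (s - c)) (sub_pos.2 ht.2)).comp t
    ((hasDerivAt_id t).const_sub s)).congr_deriv ?_
  rw [h1]
  ring

/-- On b = h the integral of T is empty. The integral of N equals p ∫_a^h A_h(N (h - s)^p) = -∫_a^h
φ', which is φ(a) because φ(h) = 0. -/
lemma cauchyFormula_right (lam : ℝ) (hp₀ : 0 < p) (hp₁ : p < 1 / 2) (hh : 0 < h)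
    (H : AdmissibleDatum p h φ) (T : ℝ → ℝ) (ha : a ∈ Icc 0 h) :
    cauchyFormula p lam h T (densityN p lam h φ) a h = φ a := by
  obtain ⟨hN, -, hA⟩ := densityN_spec lam hp₀ hp₁ hh H
  have hf : IntegrableOn (fun s => densityN p lam h φ s * (h - s) ^ p) (Icc 0 h) :=
    hN.2.mul_continuousOn
      (Continuous.rpow_const (by fun_prop) fun _ => Or.inr hp₀.le).continuousOn isCompact_Icc
  have h1 := integral_rpow_kernel (lam := lam) (c := h) hp₀ ha.2
    (hf.mono_set fun s hs => ⟨ha.1.trans hs.1.le, hs.2⟩)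
  have h2 := eq_neg_integral_derivWithin hh (H.contDiff.of_le (by norm_num))
    (H.apply_right hp₀ hh) ha
  rw [cauchyFormula, intervalIntegral.integral_same, zero_add, h2]
  have h3 : ∫ x in a..h, opA p lam h h (fun s => densityN p lam h φ s * (h - s) ^ p) x =
      ∫ x in a..h, -(1 / p) * derivWithin φ (Icc 0 h) x := by
    refine intervalIntegral.integral_congr_ae ?_
    filter_upwards [show ∀ᵐ s : ℝ, s ≠ h by simp [ae_iff]] with s hsh hs
    rw [uIoc_of_le ha.2] at hs
    exact hA s ⟨ha.1.trans hs.1.le, lt_of_le_of_ne hs.2 hsh⟩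
  rw [h3, intervalIntegral.integral_const_mul] at h1
  have h4 : p * (-(1 / p) * ∫ x in a..h, derivWithin φ (Icc 0 h) x) =
      -∫ x in a..h, derivWithin φ (Icc 0 h) x := by
    field_simp
  rw [← h4, ← h1]
  refine intervalIntegral.integral_congr fun s _ => ?_
  rw [show lam * (s - h) * (s - a) = -lam * (h - s) * (s - a) by ring]
  ring

lemma integral_comp_neg_zero (F : ℝ → ℝ) (b : ℝ) : ∫ s in (-b)..0, F (-s) = ∫ s in (0 : ℝ)..b, F s := by
  rw [intervalIntegral.integral_comp_neg, neg_neg, neg_zero]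

/-- M has its singularity at the upper limit; reflection turns it into an Abel operator with base
point 0 and upper limit 0, so `integral_rpow_kernel` serves for N as well. -/
lemma opA_comp_neg (p lam : ℝ) (N : ℝ → ℝ) (x : ℝ) :
    opA p lam 0 0 (fun s => N (-s) * (-s) ^ p) (-x) = opM p lam N x := by
  rw [opM, ← integral_comp_neg_zero, opA]
  refine intervalIntegral.integral_congr fun s _ => ?_
  rw [show s - -x = x - -s by ring, show lam * (s - 0) * (x - -s) = -lam * -s * (x - -s) by ring]
  ring

lemma integrableOn_comp_neg_mul_rpow {K q : ℝ} (hq : 0 < q) (hN : IsDensity h N)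
    (hK : ∀ s ∈ Ioo 0 h, |N s| ≤ K) (hb : b ∈ Icc 0 h) :
    IntegrableOn (fun s => N (-s) * (-s) ^ (q - 1)) (Ioc (-b) 0) := by
  have h1 : IntervalIntegrable (fun s => N s * s ^ (q - 1)) volume 0 b := by
    have h2 := intervalIntegrable_sub_rpow hq 0 0 b
    simp only [sub_zero] at h2
    rw [intervalIntegrable_iff_integrableOn_Ioc_of_le hb.1] at h2 ⊢
    refine Integrable.bdd_mul (c := K) h2
      (hN.2.mono_set fun s hs => ⟨hs.1.le, hs.2.trans hb.2⟩).aestronglyMeasurable ?_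
    refine (ae_restrict_iff' measurableSet_Ioc).2 ?_
    filter_upwards [show ∀ᵐ s : ℝ, s ≠ h by simp [ae_iff]] with s hsh hs
    exact hK s ⟨hs.1, lt_of_le_of_ne (hs.2.trans hb.2) hsh⟩
  rw [← intervalIntegrable_iff_integrableOn_Ioc_of_le (by linarith [hb.1])]
  have h3 := ((IntervalIntegrable.iff_comp_neg (a := 0) (b := b)).1 h1).symm
  rwa [neg_zero] at h3

lemma integrableOn_mul_rpow (hp₀ : 0 < p) (hT : IsDensity h T) (hb : 0 ≤ b) :
    IntegrableOn (fun s => T s * s ^ p) (Ioc b h) :=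
  (hT.2.mul_continuousOn (Continuous.rpow_const continuous_id fun _ => Or.inr hp₀.le).continuousOn
    isCompact_Icc).mono_set fun _ hs => ⟨hb.trans hs.1.le, hs.2⟩

/-- The trace is p ∫_0^b M from N plus p ∫_b^h M from T, hence independent of b. At b = h it equals
φ(0) = 0. -/
lemma cauchyFormula_zero (lam : ℝ) (hp₀ : 0 < p) (hp₁ : p < 1 / 2) (hh : 0 < h)
    (H : AdmissibleDatum p h φ) (hb : b ∈ Icc 0 h) :
    cauchyFormula p lam h (densityT p lam h φ) (densityN p lam h φ) 0 b = 0 := by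
  obtain ⟨hN, ⟨K, hK⟩, -⟩ := densityN_spec lam hp₀ hp₁ hh H
  obtain ⟨hT, hA⟩ := densityT_spec lam hp₀ hp₁ hh H
  obtain ⟨μ, hμ, -, hM⟩ := exists_holderIcc_opM lam hp₀ hp₁ hh H
  have hMi := ContinuousOn.integrableOn_Ioc_zero (hM.continuousOn (hp₀.trans hμ))
  rw [← intervalIntegrable_iff_integrableOn_Ioc_of_le hh.le] at hMi
  set M := opM p lam (densityN p lam h φ) with hMdef
  have key : ∀ b ∈ Icc 0 h,
      cauchyFormula p lam h (densityT p lam h φ) (densityN p lam h φ) 0 b =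
        p * ∫ x in (0 : ℝ)..h, M x := by
    intro b hb
    have h1 := integral_rpow_kernel (lam := lam) (c := 0) hp₀ hb.2
      (integrableOn_mul_rpow hp₀ hT hb.1)
    have h2 : ∫ x in b..h, opA p lam h 0 (fun s => densityT p lam h φ s * s ^ p) x =
        ∫ x in b..h, M x := by
      refine intervalIntegral.integral_congr_ae ?_
      filter_upwards [show ∀ᵐ s : ℝ, s ≠ h by simp [ae_iff]] with s hsh hs
      rw [uIoc_of_le hb.2] at hs
      exact hA s ⟨hb.1.trans_lt hs.1, lt_of_le_of_ne hs.2 hsh⟩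
    have hfi : IntegrableOn (fun s => densityN p lam h φ (-s) * (-s) ^ p) (Ioc (-b) 0) := by
      have := integrableOn_comp_neg_mul_rpow (q := 1 + p) (by linarith) hN hK hb
      simpa using this
    have h3 := integral_rpow_kernel (lam := lam) (c := 0) hp₀ (by linarith [hb.1] : -b ≤ 0) hfi
    have h4 : ∫ x in (-b)..0, opA p lam 0 0 (fun s => densityN p lam h φ (-s) * (-s) ^ p) x =
        ∫ x in (0 : ℝ)..b, M x := by
      rw [← integral_comp_neg_zero]
      refine intervalIntegral.integral_congr fun x _ => ?_
      rw [hMdef, ← opA_comp_neg, neg_neg]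
    have h5 : (∫ x in (0 : ℝ)..b, M x) + ∫ x in b..h, M x = ∫ x in (0 : ℝ)..h, M x := by
      refine intervalIntegral.integral_add_adjacent_intervals (hMi.mono_set ?_) (hMi.mono_set ?_)
      · rw [uIcc_of_le hb.1, uIcc_of_le hh.le]
        exact Icc_subset_Icc_right hb.2
      · rw [uIcc_of_le hb.2, uIcc_of_le hh.le]
        exact Icc_subset_Icc_left hb.1
    rw [cauchyFormula, ← h5, mul_add, ← h4, ← h2, ← h3, ← h1, add_comm]
    congr 1
    · rw [← integral_comp_neg_zero]
      refine intervalIntegral.integral_congr fun s _ => ?_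
      rw [show lam * (s - 0) * (s - -b) = -lam * (b - -s) * (-s - 0) by ring,
        show s - -b = b - -s by ring, sub_zero]
      ring
    · refine intervalIntegral.integral_congr fun s _ => ?_
      rw [sub_zero]
      ring
  rw [key b hb, ← key h ⟨hh.le, le_rfl⟩,
    cauchyFormula_right lam hp₀ hp₁ hh H _ ⟨le_rfl, hh.le⟩, H.zero]

lemma intervalIntegrable_inner_zero {K α β k : ℝ} (hα : 0 < α) (hβ : 0 < β) (hk : 0 < k)
    (hN : IsDensity h N) (hK : ∀ s ∈ Ioo 0 h, |N s| ≤ K) (hb : b ∈ Ioc 0 h) :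
    IntervalIntegrable (innerIntegrand lam α β k N 0 b) volume 0 b := by
  have h1 : IntervalIntegrable (fun s => (b - s) ^ (α - 1) * ((s - 0) ^ (β - 1) *
      hyp01 k (-lam * (b - s) * (s - 0)))) volume 0 b := by
    have h2 := (intervalIntegrable_beta hβ hα hb.1).mul_continuousOn
      (g := fun s => hyp01 k (-lam * (b - s) * (s - 0)))
      (Continuous.hyp01 hk (by fun_prop)).continuousOn
    refine h2.congr fun s _ => ?_
    simp only [sub_zero]
    ring
  rw [intervalIntegrable_iff_integrableOn_Ioc_of_le hb.1.le] at h1 ⊢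
  refine Integrable.bdd_mul (c := K) h1
    (hN.2.mono_set fun s hs => ⟨hs.1.le, hs.2.trans hb.2⟩).aestronglyMeasurable ?_
  refine (ae_restrict_iff' measurableSet_Ioc).2 ?_
  filter_upwards [show ∀ᵐ s : ℝ, s ≠ h by simp [ae_iff]] with s hsh hs
  exact hK s ⟨hs.1, lt_of_le_of_ne (hs.2.trans hb.2) hsh⟩

lemma inner_comp_neg (lam : ℝ) (α β k : ℝ) (N : ℝ → ℝ) (b : ℝ) : inner lam α β k N 0 b =
    ∫ s in (-b)..0, N (-s) * ((s - -b) ^ (α - 1) * ((-s) ^ (β - 1) *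
      hyp01 k (lam * (s - 0) * (s - -b)))) := by
  rw [inner, ← integral_comp_neg_zero]
  refine intervalIntegral.integral_congr fun s _ => ?_
  rw [show lam * (s - 0) * (s - -b) = -lam * (b - -s) * (-s - 0) by ring,
    show s - -b = b - -s by ring, sub_zero]

/-- Let G₁, G₂ be the two integrals whose sum, times -p, is U_a on a = 0. The contiguity relations
and A_0(T s^p) = M give t H(0,t) = -G₁(t) - G₂(t). Here G₁(t) is a primitive vanishing at h, and so
is G₂(t), because φ'(0) = 0. The difference of their densities w(t) - v(-t) equals p H(0,t), since U
vanishes on a = 0. Thus t H = -p ∫_t^h H, which forces H = 0. -/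
lemma cauchyH_zero (lam : ℝ) (hp₀ : 0 < p) (hp₁ : p < 1 / 2) (hh : 0 < h)
    (H : AdmissibleDatum p h φ) (hb : b ∈ Ioo 0 h) :
    cauchyH p lam h (densityT p lam h φ) (densityN p lam h φ) 0 b = 0 := by
  obtain ⟨hN, ⟨K, hK⟩, hAN⟩ := densityN_spec lam hp₀ hp₁ hh H
  obtain ⟨hT, hA⟩ := densityT_spec lam hp₀ hp₁ hh H
  have hC := fun t (ht : t ∈ Icc 0 h) => cauchyFormula_zero lam hp₀ hp₁ hh H ht
  set N := densityN p lam h φ with hNdef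
  set T := densityT p lam h φ with hTdef
  have hp1 : 0 < 1 + p := by linarith
  have hpp : p ≠ 0 := hp₀.ne'
  have hkc := continuous_rpow_kernel_self (lam := lam) (c := 0) hp₀
  set k := fun s x : ℝ => p * hyp01 p (lam * (s - 0) * (s - x)) +
      lam / p * ((s - 0) * (s - x)) * hyp01 (1 + p) (lam * (s - 0) * (s - x)) with hk
  set f₁ := fun s => T s * s ^ (p - 1) with hf₁
  set f₂ := fun s => N (-s) * (-s) ^ (p - 1) with hf₂
  set w := fun t => ∫ s in t..h, f₁ s * ((s - t) ^ (p - 1) * k s t) with hw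
  set v := fun t => ∫ s in t..0, f₂ s * ((s - t) ^ (p - 1) * k s t) with hv
  have hf₁i : ∀ t, 0 < t → IntegrableOn f₁ (Ioc t h) := fun t ht =>
    (IntegrableOn.mul_continuousOn (hT.2.mono_set (Icc_subset_Icc_left ht.le))
      (ContinuousOn.rpow_const continuousOn_id fun s hs => Or.inl (ht.trans_le hs.1).ne')
      isCompact_Icc).mono_set Ioc_subset_Icc_self
  have hf₂i : ∀ t ∈ Icc 0 h, IntegrableOn f₂ (Ioc (-t) 0) := fun t ht =>
    integrableOn_comp_neg_mul_rpow hp₀ hN hK ht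
  have hweq : ∀ t ∈ Ioo 0 h, w t =
      p * wedge lam 1 p p p T h t 0 + lam / p * wedge lam 1 (1 + p) (1 + p) (1 + p) T h t 0 := by
    intro t ht
    have i1 := intervalIntegrable_wedge (lam := lam) (σ := 1) (y := 0) (β := p) hp₀ hp₀ ht hT.1
      hT.integrableOn_Ioc (by linarith [ht.1]) (by linarith [ht.1, ht.2])
    have i2 := intervalIntegrable_wedge (lam := lam) (σ := 1) (y := 0) (β := 1 + p) hp1 hp1 ht hT.1
      hT.integrableOn_Ioc (by linarith [ht.1]) (by linarith [ht.1, ht.2])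
    rw [wedge, wedge, ← intervalIntegral.integral_const_mul, ← intervalIntegral.integral_const_mul,
      ← intervalIntegral.integral_add (i1.const_mul _) (i2.const_mul _)]
    refine intervalIntegral.integral_congr_ae (Eventually.of_forall fun s hs => ?_)
    rw [uIoc_of_le ht.2.le] at hs
    have hs0 : 0 < s := ht.1.trans hs.1
    rw [sub_zero, one_mul, show 1 + p - 1 = p - 1 + 1 by ring, Real.rpow_add_one hs0.ne',
      Real.rpow_add_one (sub_pos.2 hs.1).ne']
    simp only [hf₁, hk, sub_zero]
    rw [show lam * (s - t) * s = lam * s * (s - t) by ring]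
    ring
  have hveq : ∀ t ∈ Ioo 0 h, v (-t) =
      p * inner lam p p p N 0 t - lam / p * inner lam (1 + p) (1 + p) (1 + p) N 0 t := by
    intro t ht
    have ht' : t ∈ Ioc 0 h := ⟨ht.1, ht.2.le⟩
    have i1 := intervalIntegrable_inner_zero (lam := lam) hp₀ hp₀ hp₀ hN hK ht'
    have i2 := intervalIntegrable_inner_zero (lam := lam) hp1 hp1 hp1 hN hK ht'
    have e : ∀ α k, inner lam α α k N 0 t = ∫ s in (0 : ℝ)..t, innerIntegrand lam α α k N 0 t s :=
      fun _ _ => rfl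
    rw [e, e, ← intervalIntegral.integral_const_mul, ← intervalIntegral.integral_const_mul,
      ← intervalIntegral.integral_sub (i1.const_mul _) (i2.const_mul _), ← integral_comp_neg_zero]
    refine intervalIntegral.integral_congr_ae ?_
    filter_upwards [show ∀ᵐ s : ℝ, s ≠ 0 by simp [ae_iff]] with s hs0 hs
    rw [uIoc_of_le (by linarith [ht.1])] at hs
    have h1 : 0 < s - -t := by linarith [hs.1]
    have h2 : -s ≠ 0 := neg_ne_zero.2 hs0
    simp only [hf₂, hk, sub_zero, innerIntegrand]
    rw [show t - -s = s - -t by ring, show -lam * (s - -t) * -s = lam * s * (s - -t) by ring,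
      show 1 + p - 1 = p - 1 + 1 by ring, Real.rpow_add_one h2, Real.rpow_add_one h1.ne']
    ring
  have hwi : ∀ t, 0 < t → t < h → IntervalIntegrable w volume t h := fun t ht hth => by
    rw [intervalIntegrable_iff_integrableOn_Ioc_of_le hth.le]
    exact integrableOn_abel_one (g := k) hp₀ (hf₁i t ht) hkc.continuousOn
  have hvi : IntervalIntegrable (fun t => v (-t)) volume 0 h := by
    have h1 : IntegrableOn v (Ioc (-h) 0) :=
      integrableOn_abel_one (g := k) hp₀ (hf₂i h ⟨hh.le, le_rfl⟩) hkc.continuousOn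
    rw [← intervalIntegrable_iff_integrableOn_Ioc_of_le (by linarith)] at h1
    have h2 := ((IntervalIntegrable.iff_comp_neg (a := -h) (b := 0)).1 h1).symm
    rwa [neg_neg, neg_zero] at h2
  have hG₁ : ∀ t ∈ Ioo 0 h, wedge lam 1 (1 + p) p p T h t 0 = ∫ x in t..h, w x := by
    intro t ht
    rw [← integral_rpow_kernel_self (lam := lam) (c := 0) hp₀ ht.2.le (hf₁i t ht.1), wedge]
    refine intervalIntegral.integral_congr fun s _ => ?_
    simp only [hf₁, sub_zero, one_mul, add_sub_cancel_left]
    rw [show lam * (s - t) * s = lam * s * (s - t) by ring]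
    ring
  have hG₂ : ∀ t ∈ Icc 0 h, inner lam (1 + p) p p N 0 t = ∫ x in (0 : ℝ)..t, v (-x) := by
    intro t ht
    rw [inner_comp_neg, ← integral_comp_neg_zero (fun x => v (-x))]
    simp only [neg_neg]
    rw [hv, ← integral_rpow_kernel_self (lam := lam) (c := 0) hp₀ (by linarith [ht.1] : -t ≤ 0)
      (hf₂i t ht)]
    refine intervalIntegral.integral_congr fun s _ => ?_
    simp only [hf₂, add_sub_cancel_left]
    ring
  -- The integral is G₂(h) = A_h(N (h - s)^p)(0) = -φ'(0)/p, which is why the Abel equation for N is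
  -- needed at the endpoint 0.
  have hG₂h : ∫ x in (0 : ℝ)..h, v (-x) = 0 := by
    rw [← hG₂ h ⟨hh.le, le_rfl⟩]
    have h1 := hAN 0 ⟨le_rfl, hh⟩
    rw [H.deriv_zero, mul_zero] at h1
    refine Eq.trans ?_ h1
    rw [inner, opA]
    refine intervalIntegral.integral_congr fun s _ => ?_
    rw [show lam * (s - h) * (s - 0) = -lam * (h - s) * (s - 0) by ring, add_sub_cancel_left]
    ring
  -- The terms with raised parameter add up to (λ/p) U(0,t), which is zero.
  have hHeq : ∀ t ∈ Ioo 0 h, w t - v (-t) = p * cauchyH p lam h T N 0 t := by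
    intro t ht
    have h1 := hC t (Ioo_subset_Icc_self ht)
    rw [cauchyFormula_eq] at h1
    rw [hweq t ht, hveq t ht, cauchyH]
    linear_combination lam / p * h1
  have hGH : ∀ t ∈ Ioo 0 h, t * cauchyH p lam h T N 0 t = -∫ x in t..h, (w x - v (-x)) := by
    intro t ht
    have ht' : t ∈ Ioc 0 h := ⟨ht.1, ht.2.le⟩
    have c1 := wedge_contiguous (lam := lam) hp₀ ht hT.1 hT.integrableOn_Ioc ht.1
    have c2 := inner_contiguous ht.1 (intervalIntegrable_inner_zero (lam := lam) hp₀ hp1 hp₀ hN hK ht')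
      (intervalIntegrable_inner_zero hp1 hp₀ hp₀ hN hK ht')
    have c3 : wedge lam 1 p (1 + p) p T h t 0 = inner lam p (1 + p) p N 0 t := by
      have h1 := hA t ht
      have h2 : wedge lam 1 p (1 + p) p T h t 0 = opA p lam h 0 (fun s => T s * s ^ p) t := by
        rw [wedge, opA]
        refine intervalIntegral.integral_congr fun s _ => ?_
        rw [add_sub_cancel_left, one_mul, sub_zero,
          show lam * (s - t) * s = lam * s * (s - t) by ring]
        ring
      have h3 : inner lam p (1 + p) p N 0 t = opM p lam N t := by
        rw [inner, opM]
        refine intervalIntegral.integral_congr fun s _ => ?_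
        rw [add_sub_cancel_left, sub_zero, show -lam * (t - s) * s = -lam * s * (t - s) by ring]
        ring
      rw [h2, h3, h1]
    have c4 : (∫ x in (0 : ℝ)..t, v (-x)) + ∫ x in t..h, v (-x) = ∫ x in (0 : ℝ)..h, v (-x) := by
      refine intervalIntegral.integral_add_adjacent_intervals (hvi.mono_set ?_) (hvi.mono_set ?_)
      · rw [uIcc_of_le ht.1.le, uIcc_of_le hh.le]
        exact Icc_subset_Icc_right ht.2.le
      · rw [uIcc_of_le ht.2.le, uIcc_of_le hh.le]
        exact Icc_subset_Icc_left ht.1.le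
    have hvt : IntervalIntegrable (fun t => v (-t)) volume t h := hvi.mono_set (by
      rw [uIcc_of_le ht.2.le, uIcc_of_le hh.le]
      exact Icc_subset_Icc_left ht.1.le)
    rw [intervalIntegral.integral_sub (hwi t ht.1 ht.2) hvt, ← hG₁ t ht, cauchyH]
    rw [hG₂h, ← hG₂ t (Ioo_subset_Icc_self ht)] at c4
    linear_combination -c1 + c2 + c3 - c4
  -- On (b₀, h) the coefficient p/t is bounded by p/b₀, so Gronwall's lemma applies; b₀ > 0 is any
  -- point below b.
  obtain ⟨b₀, hb₀, hb₀b⟩ := exists_between hb.1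
  set F := fun t => (w t - v (-t)) / p with hF
  have hb₀h : b₀ < h := hb₀b.trans hb.2
  have hFI : IntervalIntegrable F volume b₀ h := by
    refine ((hwi b₀ hb₀ hb₀h).sub (hvi.mono_set ?_)).div_const p
    rw [uIcc_of_le hb₀h.le, uIcc_of_le hh.le]
    exact Icc_subset_Icc_left hb₀.le
  have hFi := (intervalIntegrable_iff_integrableOn_Ioc_of_le hb₀h.le).1 hFI
  have hFeq : ∀ t ∈ Ioo b₀ h, F t = -(p / t * ∫ x in t..h, F x) := by
    intro t ht
    have ht0 : 0 < t := hb₀.trans ht.1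
    have h1 := hGH t ⟨ht0, ht.2⟩
    have h2 : ∫ x in t..h, (w x - v (-x)) = p * ∫ x in t..h, F x := by
      rw [← intervalIntegral.integral_const_mul]
      exact intervalIntegral.integral_congr fun x _ => by simp only [hF]; field_simp
    have h3 : F t = cauchyH p lam h T N 0 t := by
      simp only [hF]
      rw [hHeq t ⟨ht0, ht.2⟩]
      field_simp
    rw [h2] at h1
    rw [h3]
    field_simp
    linarith
  have hFc : ContinuousOn F (Ioo b₀ h) := by
    refine ContinuousOn.congr (ContinuousOn.neg (ContinuousOn.mul ?_ ?_)) hFeq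
    · exact continuousOn_const.div continuousOn_id fun t ht => (hb₀.trans ht.1).ne'
    · have h1 := intervalIntegral.continuousOn_primitive_interval_left (f := F) (a := b₀) (b := h)
        (μ := volume) (by rw [uIcc_of_le hb₀h.le, integrableOn_Icc_iff_integrableOn_Ioc]; exact hFi)
      rw [uIcc_of_le hb₀h.le] at h1
      exact h1.mono Ioo_subset_Icc_self
  have hzero := eq_zero_of_abs_le_integral (C := p / b₀) hFc hFi (fun t ht => by
    have ht0 : 0 < t := hb₀.trans ht.1
    rw [hFeq t ht, abs_neg, abs_mul, abs_of_pos (div_pos hp₀ ht0)]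
    exact mul_le_mul (div_le_div_of_nonneg_left hp₀.le hb₀ ht.1.le)
      (intervalIntegral.abs_integral_le_integral_abs ht.2.le) (abs_nonneg _) (by positivity))
    ⟨hb₀b, hb.2⟩
  have h1 := hHeq b hb
  simp only [hF, div_eq_zero_iff, hpp, or_false] at hzero
  rw [hzero] at h1
  exact (mul_eq_zero.1 h1.symm).resolve_left hpp

end

section

variable {p lam h a b ξ η : ℝ}

/-! ### Functions of the class `R_h` -/

lemma isOpen_triangle (h : ℝ) : IsOpen {w : ℝ × ℝ | 0 < w.1 ∧ w.1 < w.2 ∧ w.2 < h} := by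
  have : IsOpen ({w : ℝ × ℝ | 0 < w.1} ∩ ({w | w.1 < w.2} ∩ {w | w.2 < h})) :=
    (isOpen_lt (by fun_prop) (by fun_prop)).inter
      ((isOpen_lt (by fun_prop) (by fun_prop)).inter (isOpen_lt (by fun_prop) (by fun_prop)))
  exact this

/-- Continuous partial derivatives yield strict differentiability, with total derivative assembled
from `cauchyA` and `cauchyB`. -/
lemma contDiffOn_cauchyFormula (lam : ℝ) {T N : ℝ → ℝ} (hp₀ : 0 < p) (hT : IsDensity h T)
    (hN : IsDensity h N) :
    ContDiffOn ℝ 1 (fun w : ℝ × ℝ => cauchyFormula p lam h T N w.1 w.2)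
      {w | 0 < w.1 ∧ w.1 < w.2 ∧ w.2 < h} := by
  have hO := isOpen_triangle h
  intro z hz
  have hcA : ∀ w : ℝ × ℝ, 0 < w.1 ∧ w.1 < w.2 ∧ w.2 < h → ContinuousAt (fun w : ℝ × ℝ =>
      ContinuousLinearMap.toSpanSingleton ℝ (cauchyA p lam h T N w.1 w.2)) w := fun w hw =>
    (ContinuousLinearMap.toSpanSingletonCLE (𝕜 := ℝ) (E := ℝ)).continuous.continuousAt.comp
      (f := fun w : ℝ × ℝ => cauchyA p lam h T N w.1 w.2)
      (continuousAt_cauchyA lam hp₀ hT hN hw.1 hw.2.1 hw.2.2)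
  have hcB : ∀ w : ℝ × ℝ, 0 < w.1 ∧ w.1 < w.2 ∧ w.2 < h → ContinuousAt (fun w : ℝ × ℝ =>
      ContinuousLinearMap.toSpanSingleton ℝ (cauchyB p lam h T N w.1 w.2)) w := fun w hw =>
    (ContinuousLinearMap.toSpanSingletonCLE (𝕜 := ℝ) (E := ℝ)).continuous.continuousAt.comp
      (f := fun w : ℝ × ℝ => cauchyB p lam h T N w.1 w.2)
      (continuousAt_cauchyB lam hp₀ hT hN hw.1 hw.2.1 hw.2.2)
  refine ContDiffAt.contDiffWithinAt (contDiffAt_one_iff.2 ⟨fun w =>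
    ((ContinuousLinearMap.toSpanSingleton ℝ (cauchyA p lam h T N w.1 w.2)).coprod
      (ContinuousLinearMap.toSpanSingleton ℝ (cauchyB p lam h T N w.1 w.2))), _, hO.mem_nhds hz,
    fun w hw => ?_, fun w hw => ?_⟩)
  · have h1 : ContinuousAt (fun w : ℝ × ℝ =>
        (ContinuousLinearMap.toSpanSingleton ℝ (cauchyA p lam h T N w.1 w.2)).comp
          (ContinuousLinearMap.fst ℝ ℝ ℝ) +
        (ContinuousLinearMap.toSpanSingleton ℝ (cauchyB p lam h T N w.1 w.2)).comp
          (ContinuousLinearMap.snd ℝ ℝ ℝ)) w :=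
      ((hcA w hw).clm_comp continuousAt_const).add ((hcB w hw).clm_comp continuousAt_const)
    refine (h1.congr (Eventually.of_forall fun w => ?_)).continuousWithinAt
    ext <;> simp
  · exact (hasStrictFDerivAt_uncurry_coprod (u := w) (f := cauchyFormula p lam h T N)
      (f₁ := fun a b => ContinuousLinearMap.toSpanSingleton ℝ (cauchyA p lam h T N a b))
      (f₂ := fun a b => ContinuousLinearMap.toSpanSingleton ℝ (cauchyB p lam h T N a b))
      (by
        filter_upwards [hO.mem_nhds hw] with v hv
        exact hasDerivAt_cauchyFormula_left lam hp₀ hT hN hv.1 hv.2.1 hv.2.2)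
      (by
        filter_upwards [hO.mem_nhds hw] with v hv
        exact hasDerivAt_cauchyFormula_right lam hp₀ hT hN hv.1 hv.2.1 hv.2.2)
      (hcA w hw) (hcB w hw)).hasFDerivAt

lemma hasDerivAt_comp_neg {f : ℝ → ℝ} {f' x : ℝ} (hf : HasDerivAt f f' (-x)) :
    HasDerivAt (fun y => f (-y)) (-f') x :=
  (hf.comp x (hasDerivAt_neg x)).congr_deriv (by ring)

lemma div_mul_sub_div_mul {d H A B : ℝ} (hd : d ≠ 0) (h : A - B = p * d * H) :
    p / d * A - p / d * B = p ^ 2 * H := by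
  rw [← mul_sub, h]
  field_simp

/-- The weighted limit of the normal derivative as a function of the densities. -/
def nuLimit (p t n : ℝ) : ℝ := p * (t * gammaRight p - n * gammaMid p)

lemma tendsto_diag_path {F : Filter ℝ} {g : ℝ → ℝ × ℝ} {x₀ x : ℝ} (hF : F ≤ 𝓝 x₀)
    (hg : Continuous g) (hgx : g x₀ = (x, x)) (hlt : ∀ᶠ η in F, (g η).1 < (g η).2) :
    Tendsto g F (𝓝[{w | w.1 < w.2}] (x, x)) :=
  tendsto_nhdsWithin_iff.2 ⟨hgx ▸ (hg.tendsto x₀).mono_left hF, hlt⟩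

section data

variable {U : ℝ → ℝ → ℝ} {T N : Fin 4 → ℝ → ℝ} (hp₀ : 0 < p)
  (hd : ∀ k, IsDensity h (T k) ∧ IsDensity h (N k))
  (hU : ∀ a b : ℝ, 0 < a → a < b → b < h →
      U a b = cauchyFormula p lam h (T 0) (N 0) a b ∧
      U b a = cauchyFormula p lam h (T 1) (N 1) a b ∧
      U b (-a) = cauchyFormula p lam h (T 2) (N 2) a b ∧
      U a (-b) = cauchyFormula p lam h (T 3) (N 3) a b)

include hp₀ hd hU

lemma classR_top (hξ : 0 < ξ) (hξη : ξ < η) (hη : η < h) :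
    dXi U ξ η = cauchyA p lam h (T 0) (N 0) ξ η ∧
      dEta U ξ η = cauchyB p lam h (T 0) (N 0) ξ η := by
  constructor
  · refine ((hasDerivAt_cauchyFormula_left lam hp₀ (hd 0).1 (hd 0).2 hξ hξη hη).congr_of_eventuallyEq
      ?_).deriv
    filter_upwards [Ioo_mem_nhds hξ hξη] with x hx using (hU x η hx.1 hx.2 hη).1
  · refine ((hasDerivAt_cauchyFormula_right lam hp₀ (hd 0).1 (hd 0).2 hξ hξη hη).congr_of_eventuallyEq
      ?_).deriv
    filter_upwards [Ioo_mem_nhds hξη hη] with y hy using (hU ξ y hξ hy.1 hy.2).1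

lemma classR_right_top (hη : 0 < η) (hηξ : η < ξ) (hξ : ξ < h) :
    dXi U ξ η = cauchyB p lam h (T 1) (N 1) η ξ ∧
      dEta U ξ η = cauchyA p lam h (T 1) (N 1) η ξ := by
  constructor
  · refine ((hasDerivAt_cauchyFormula_right lam hp₀ (hd 1).1 (hd 1).2 hη hηξ hξ).congr_of_eventuallyEq
      ?_).deriv
    filter_upwards [Ioo_mem_nhds hηξ hξ] with x hx using (hU η x hη hx.1 hx.2).2.1
  · refine ((hasDerivAt_cauchyFormula_left lam hp₀ (hd 1).1 (hd 1).2 hη hηξ hξ).congr_of_eventuallyEq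
      ?_).deriv
    filter_upwards [Ioo_mem_nhds hη hηξ] with y hy using (hU y ξ hy.1 hy.2 hξ).2.1

lemma classR_right_bottom (hη : 0 < -η) (hηξ : -η < ξ) (hξ : ξ < h) :
    dXi U ξ η = cauchyB p lam h (T 2) (N 2) (-η) ξ ∧
      dEta U ξ η = -cauchyA p lam h (T 2) (N 2) (-η) ξ := by
  constructor
  · refine ((hasDerivAt_cauchyFormula_right lam hp₀ (hd 2).1 (hd 2).2 hη hηξ hξ).congr_of_eventuallyEq
      ?_).deriv
    filter_upwards [Ioo_mem_nhds hηξ hξ] with x hx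
    have := (hU (-η) x hη hx.1 hx.2).2.2.1
    rwa [neg_neg] at this
  · refine ((hasDerivAt_comp_neg (hasDerivAt_cauchyFormula_left lam hp₀ (hd 2).1 (hd 2).2 hη hηξ
      hξ)).congr_of_eventuallyEq ?_).deriv
    filter_upwards [Ioo_mem_nhds (by linarith : -ξ < η) (by linarith : η < 0)] with y hy
    have := (hU (-y) ξ (by linarith [hy.2]) (by linarith [hy.1]) hξ).2.2.1
    rwa [neg_neg] at this

lemma classR_bottom (hξ : 0 < ξ) (hξη : ξ < -η) (hη : -η < h) :
    dXi U ξ η = cauchyA p lam h (T 3) (N 3) ξ (-η) ∧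
      dEta U ξ η = -cauchyB p lam h (T 3) (N 3) ξ (-η) := by
  constructor
  · refine ((hasDerivAt_cauchyFormula_left lam hp₀ (hd 3).1 (hd 3).2 hξ hξη hη).congr_of_eventuallyEq
      ?_).deriv
    filter_upwards [Ioo_mem_nhds hξ hξη] with x hx
    have := (hU x (-η) hx.1 hx.2 hη).2.2.2
    rwa [neg_neg] at this
  · refine ((hasDerivAt_comp_neg (hasDerivAt_cauchyFormula_right lam hp₀ (hd 3).1 (hd 3).2 hξ hξη
      hη)).congr_of_eventuallyEq ?_).deriv
    filter_upwards [Ioo_mem_nhds (by linarith : -h < η) (by linarith : η < -ξ)] with y hy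
    have := (hU ξ (-y) hξ (by linarith [hy.2]) (by linarith [hy.1])).2.2.2
    rwa [neg_neg] at this

lemma classR_contDiffOn : ContDiffOn ℝ 1 (fun z : ℝ × ℝ => U z.1 z.2) (triangles h) := by
  rintro ⟨ξ, η⟩ ⟨hξ, hη, h0, h1, h2⟩
  simp only at hξ hη h0 h1 h2
  refine ContDiffAt.contDiffWithinAt ?_
  have hO := isOpen_triangle h
  -- L is the reflection carrying the triangle in question to 0 < a < b < h, where the Cauchy
  -- formula is already known to be C¹.
  have key : ∀ (k : Fin 4) (L : ℝ × ℝ → ℝ × ℝ), ContDiff ℝ 1 L →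
      (0 < (L (ξ, η)).1 ∧ (L (ξ, η)).1 < (L (ξ, η)).2 ∧ (L (ξ, η)).2 < h) →
      (∀ w, 0 < (L w).1 → (L w).1 < (L w).2 → (L w).2 < h →
        U w.1 w.2 = cauchyFormula p lam h (T k) (N k) (L w).1 (L w).2) →
      ContDiffAt ℝ 1 (fun z : ℝ × ℝ => U z.1 z.2) (ξ, η) := by
    intro k L hL hm hUL
    have c1 := (contDiffOn_cauchyFormula lam hp₀ (hd k).1 (hd k).2).contDiffAt (hO.mem_nhds hm)
    refine (c1.comp (ξ, η) hL.contDiffAt).congr_of_eventuallyEq ?_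
    filter_upwards [(hO.preimage hL.continuous).mem_nhds hm] with w hw
    exact hUL w hw.1 hw.2.1 hw.2.2
  rcases lt_or_gt_of_ne h0 with h0 | h0
  · rcases lt_or_gt_of_ne h2 with h2 | h2
    · refine key 3 (fun w => (w.1, -w.2)) (by fun_prop)
        ⟨hξ.1, by simp only; linarith, by simp only; linarith [hη.1]⟩ fun w h1 h2 h3 => ?_
      have := (hU _ _ h1 h2 h3).2.2.2
      rwa [neg_neg] at this
    · refine key 2 (fun w => (-w.2, w.1)) (by fun_prop)
        ⟨by simp only; linarith, by simp only; linarith, hξ.2⟩ fun w h1 h2 h3 => ?_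
      have := (hU _ _ h1 h2 h3).2.2.1
      rwa [neg_neg] at this
  · rcases lt_or_gt_of_ne h1 with h1 | h1
    · exact key 1 (fun w => (w.2, w.1)) (by fun_prop) ⟨h0, h1, hξ.2⟩
        fun w h1 h2 h3 => (hU _ _ h1 h2 h3).2.1
    · exact key 0 (fun w => (w.1, w.2)) (by fun_prop) ⟨hξ.1, h1, hη.2⟩
        fun w h1 h2 h3 => (hU _ _ h1 h2 h3).1

/-- In the coordinates a = min(ξ, |η|), b = max(ξ, |η|) the equation becomes, up to sign, U_ab -
p(U_a - U_b)/(b - a) - λU = 0 in all four triangles. -/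
lemma classR_solvesEquation : SolvesEquation p lam h U := by
  refine ⟨classR_contDiffOn hp₀ hd hU, ?_⟩
  rintro ξ η ⟨hξ, hη, h0, h1, h2⟩
  simp only at hξ hη h0 h1 h2
  rcases lt_or_gt_of_ne h0 with h0 | h0
  · rw [Real.sign_of_neg h0]
    rcases lt_or_gt_of_ne h2 with h2 | h2
    · have m1 : ξ < -η := by linarith
      have m2 : -η < h := by linarith [hη.1]
      obtain ⟨e1, e2⟩ := classR_bottom hp₀ hd hU hξ.1 m1 m2
      have d : HasDerivAt (fun y => dXi U ξ y) _ η :=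
        (hasDerivAt_comp_neg (hasDerivAt_cauchyA_right lam hp₀ (hd 3).1 (hd 3).2 hξ.1 m1
          m2)).congr_of_eventuallyEq (by
          filter_upwards [Ioo_mem_nhds hη.1 h2] with y hy
          exact (classR_bottom hp₀ hd hU hξ.1 (by linarith [hy.2]) (by linarith [hy.1])).1)
      have hu := (hU ξ (-η) hξ.1 m1 m2).2.2.2
      rw [neg_neg] at hu
      have hs := div_mul_sub_div_mul (sub_pos.2 m1).ne'
        (cauchyA_sub_cauchyB lam hp₀ (hd 3).1 (hd 3).2 hξ.1 m1 m2)
      refine ⟨d.differentiableAt, ?_⟩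
      rw [dEta, d.deriv, e1, e2, hu, show η - -1 * ξ = -(-η - ξ) by ring,
        show -1 * η - ξ = -η - ξ by ring, div_neg]
      linear_combination hs
    · have m1 : 0 < -η := by linarith
      have m2 : -η < ξ := by linarith
      obtain ⟨e1, e2⟩ := classR_right_bottom hp₀ hd hU m1 m2 hξ.2
      have d : HasDerivAt (fun y => dXi U ξ y) _ η :=
        (hasDerivAt_comp_neg (hasDerivAt_cauchyB_left lam hp₀ (hd 2).1 (hd 2).2 m1 m2
          hξ.2)).congr_of_eventuallyEq (by
          filter_upwards [Ioo_mem_nhds h2 h0] with y hy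
          exact (classR_right_bottom hp₀ hd hU (by linarith [hy.2]) (by linarith [hy.1]) hξ.2).1)
      have hu := (hU (-η) ξ m1 m2 hξ.2).2.2.1
      rw [neg_neg] at hu
      have hs := div_mul_sub_div_mul (sub_pos.2 m2).ne'
        (cauchyA_sub_cauchyB lam hp₀ (hd 2).1 (hd 2).2 m1 m2 hξ.2)
      refine ⟨d.differentiableAt, ?_⟩
      rw [dEta, d.deriv, e1, e2, hu, show η - -1 * ξ = ξ - -η by ring,
        show -1 * η - ξ = -(ξ - -η) by ring, div_neg]
      linear_combination hs
  · rw [Real.sign_of_pos h0]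
    rcases lt_or_gt_of_ne h1 with h1 | h1
    · obtain ⟨e1, e2⟩ := classR_right_top hp₀ hd hU h0 h1 hξ.2
      have d : HasDerivAt (fun y => dXi U ξ y) _ η :=
        (hasDerivAt_cauchyB_left lam hp₀ (hd 1).1 (hd 1).2 h0 h1 hξ.2).congr_of_eventuallyEq (by
          filter_upwards [Ioo_mem_nhds h0 h1] with y hy
          exact (classR_right_top hp₀ hd hU hy.1 hy.2 hξ.2).1)
      have hu := (hU η ξ h0 h1 hξ.2).2.1
      have hs := div_mul_sub_div_mul (sub_pos.2 h1).ne'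
        (cauchyA_sub_cauchyB lam hp₀ (hd 1).1 (hd 1).2 h0 h1 hξ.2)
      refine ⟨d.differentiableAt, ?_⟩
      rw [dEta, d.deriv, e1, e2, hu, show η - 1 * ξ = -(ξ - η) by ring,
        show 1 * η - ξ = -(ξ - η) by ring, div_neg]
      linear_combination -hs
    · obtain ⟨e1, e2⟩ := classR_top hp₀ hd hU hξ.1 h1 hη.2
      have d : HasDerivAt (fun y => dXi U ξ y) _ η :=
        (hasDerivAt_cauchyA_right lam hp₀ (hd 0).1 (hd 0).2 hξ.1 h1
          hη.2).congr_of_eventuallyEq (by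
          filter_upwards [Ioo_mem_nhds h1 hη.2] with y hy
          exact (classR_top hp₀ hd hU hξ.1 hy.1 hy.2).1)
      have hu := (hU ξ η hξ.1 h1 hη.2).1
      have hs := div_mul_sub_div_mul (sub_pos.2 h1).ne'
        (cauchyA_sub_cauchyB lam hp₀ (hd 0).1 (hd 0).2 hξ.1 h1 hη.2)
      refine ⟨d.differentiableAt, ?_⟩
      rw [dEta, d.deriv, e1, e2, hu, one_mul, one_mul]
      linear_combination -hs

/-- The signs record whether the given combination of derivatives is U_a - U_b or U_b - U_a.
Frankl's conditions therefore say that `nuLimit` agrees on the two sides of each singular line. -/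
lemma classR_tendsto_nu (hp₁ : p < 1 / 2) (hξ : ξ ∈ Ioo 0 h) :
    Tendsto (fun η => (η - ξ) ^ (-2 * p) * (dXi U ξ η - dEta U ξ η)) (𝓝[>] ξ)
      (𝓝 (nuLimit p (T 0 ξ) (N 0 ξ))) ∧
    Tendsto (fun η => (ξ - η) ^ (-2 * p) * (dXi U ξ η - dEta U ξ η)) (𝓝[<] ξ)
      (𝓝 (-nuLimit p (T 1 ξ) (N 1 ξ))) ∧
    Tendsto (fun η => (η + ξ) ^ (-2 * p) * (dXi U ξ η + dEta U ξ η)) (𝓝[>] (-ξ))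
      (𝓝 (-nuLimit p (T 2 ξ) (N 2 ξ))) ∧
    Tendsto (fun η => (-ξ - η) ^ (-2 * p) * (dXi U ξ η + dEta U ξ η)) (𝓝[<] (-ξ))
      (𝓝 (nuLimit p (T 3 ξ) (N 3 ξ))) := by
  refine ⟨?_, ?_, ?_, ?_⟩
  · refine ((tendsto_cauchy_diag (lam := lam) hp₀ hp₁ (hd 0).1 (hd 0).2 hξ).comp
      (tendsto_diag_path (g := fun η => (ξ, η)) nhdsWithin_le_nhds (by fun_prop) rfl
        self_mem_nhdsWithin)).congr' ?_
    filter_upwards [self_mem_nhdsWithin, mem_nhdsWithin_of_mem_nhds (Iio_mem_nhds hξ.2)]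
      with η h1 h2
    obtain ⟨e1, e2⟩ := classR_top hp₀ hd hU hξ.1 h1 h2
    rw [e1, e2, Function.comp_apply]
  · refine ((tendsto_cauchy_diag (lam := lam) hp₀ hp₁ (hd 1).1 (hd 1).2 hξ).neg.comp
      (tendsto_diag_path (g := fun η => (η, ξ)) nhdsWithin_le_nhds (by fun_prop) rfl
        self_mem_nhdsWithin)).congr' ?_
    filter_upwards [self_mem_nhdsWithin, mem_nhdsWithin_of_mem_nhds (Ioi_mem_nhds hξ.1)]
      with η h1 h2
    obtain ⟨e1, e2⟩ := classR_right_top hp₀ hd hU h2 h1 hξ.2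
    rw [e1, e2, Function.comp_apply]
    ring
  · refine ((tendsto_cauchy_diag (lam := lam) hp₀ hp₁ (hd 2).1 (hd 2).2 hξ).neg.comp
      (tendsto_diag_path (g := fun η => (-η, ξ)) nhdsWithin_le_nhds (by fun_prop)
        (by rw [neg_neg]) (by
          filter_upwards [self_mem_nhdsWithin] with η (h1 : -ξ < η)
          exact neg_lt.1 h1))).congr' ?_
    filter_upwards [self_mem_nhdsWithin, mem_nhdsWithin_of_mem_nhds
      (Iio_mem_nhds (neg_lt_zero.2 hξ.1))] with η (h1 : -ξ < η) (h2 : η < 0)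
    obtain ⟨e1, e2⟩ := classR_right_bottom hp₀ hd hU (neg_pos.2 h2) (neg_lt.1 h1) hξ.2
    rw [e1, e2, Function.comp_apply, sub_neg_eq_add, add_comm ξ η]
    ring
  · refine ((tendsto_cauchy_diag (lam := lam) hp₀ hp₁ (hd 3).1 (hd 3).2 hξ).comp
      (tendsto_diag_path (g := fun η => (ξ, -η)) nhdsWithin_le_nhds (by fun_prop)
        (by rw [neg_neg]) (by
          filter_upwards [self_mem_nhdsWithin] with η (h1 : η < -ξ)
          exact lt_neg.1 h1))).congr' ?_
    filter_upwards [self_mem_nhdsWithin, mem_nhdsWithin_of_mem_nhds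
      (Ioi_mem_nhds (neg_lt_neg hξ.2))] with η (h1 : η < -ξ) (h2 : -h < η)
    obtain ⟨e1, e2⟩ := classR_bottom hp₀ hd hU hξ.1 (lt_neg.1 h1) (neg_lt.1 h2)
    rw [e1, e2, Function.comp_apply, show -ξ - η = -η - ξ by ring, sub_eq_add_neg (cauchyA ..)]

lemma classR_tendsto_zero {K₁ K₂ : ℝ} (hK₁ : ∀ s ∈ Ioo 0 h, |N 1 s| ≤ K₁)
    (hK₂ : ∀ s ∈ Ioo 0 h, |N 2 s| ≤ K₂) (hξ : ξ ∈ Ioo 0 h) :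
    Tendsto (fun η => dEta U ξ η - dXi U ξ η) (𝓝[>] 0)
      (𝓝 (p * (ξ - 0) * cauchyH p lam h (T 1) (N 1) 0 ξ)) ∧
    Tendsto (fun η => dEta U ξ η + dXi U ξ η) (𝓝[<] 0)
      (𝓝 (-(p * (ξ - 0) * cauchyH p lam h (T 2) (N 2) 0 ξ))) := by
  constructor
  · refine (tendsto_cauchy_zero hp₀ (hd 1).1 (hd 1).2 hK₁ hξ).congr' ?_
    filter_upwards [self_mem_nhdsWithin, mem_nhdsWithin_of_mem_nhds (Iio_mem_nhds hξ.1)]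
      with η h1 h2
    obtain ⟨e1, e2⟩ := classR_right_top hp₀ hd hU h1 h2 hξ.2
    rw [e1, e2]
  · have hneg : Tendsto (fun η : ℝ => -η) (𝓝[<] 0) (𝓝[>] 0) := by
      refine tendsto_nhdsWithin_iff.2 ⟨?_, ?_⟩
      · have : Tendsto (fun η : ℝ => -η) (𝓝 0) (𝓝 0) := by
          simpa using (continuous_neg (G := ℝ)).tendsto 0
        exact this.mono_left nhdsWithin_le_nhds
      · filter_upwards [self_mem_nhdsWithin] with η (h1 : η < 0)
        exact neg_pos.2 h1
    refine ((tendsto_cauchy_zero hp₀ (hd 2).1 (hd 2).2 hK₂ hξ).neg.comp hneg).congr' ?_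
    filter_upwards [self_mem_nhdsWithin, mem_nhdsWithin_of_mem_nhds
      (Ioi_mem_nhds (neg_lt_zero.2 hξ.1))] with η (h1 : η < 0) (h2 : -ξ < η)
    obtain ⟨e1, e2⟩ := classR_right_bottom hp₀ hd hU (neg_pos.2 h1) (neg_lt.1 h2) hξ.2
    rw [e1, e2, Function.comp_apply]
    ring

end data

end

section

variable {p lam h a b ξ : ℝ} {φ φ₁ φ₂ : ℝ → ℝ}

/-! ### The explicit formula solves the problem -/

lemma explicitSolution_of_nonneg {η : ℝ} (hη : 0 ≤ η) :
    explicitSolution p lam h φ₁ φ₂ ξ η = cauchyFormula p lam h (densityT p lam h φ₁)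
      (densityN p lam h φ₁) (min ξ |η|) (max ξ |η|) := by
  simp only [explicitSolution, if_pos hη]

lemma explicitSolution_of_neg {η : ℝ} (hη : η < 0) :
    explicitSolution p lam h φ₁ φ₂ ξ η = cauchyFormula p lam h (densityT p lam h φ₂)
      (densityN p lam h φ₂) (min ξ |η|) (max ξ |η|) := by
  simp only [explicitSolution, if_neg hη.not_ge]

lemma explicitSolution_classR (lam : ℝ) (ha : 0 < a) (hab : a < b) :
    explicitSolution p lam h φ₁ φ₂ a b =
        cauchyFormula p lam h (densityT p lam h φ₁) (densityN p lam h φ₁) a b ∧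
      explicitSolution p lam h φ₁ φ₂ b a =
        cauchyFormula p lam h (densityT p lam h φ₁) (densityN p lam h φ₁) a b ∧
      explicitSolution p lam h φ₁ φ₂ b (-a) =
        cauchyFormula p lam h (densityT p lam h φ₂) (densityN p lam h φ₂) a b ∧
      explicitSolution p lam h φ₁ φ₂ a (-b) =
        cauchyFormula p lam h (densityT p lam h φ₂) (densityN p lam h φ₂) a b := by
  have hb := ha.trans hab
  refine ⟨?_, ?_, ?_, ?_⟩
  · rw [explicitSolution_of_nonneg hb.le, abs_of_pos hb, min_eq_left hab.le, max_eq_right hab.le]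
  · rw [explicitSolution_of_nonneg ha.le, abs_of_pos ha, min_eq_right hab.le, max_eq_left hab.le]
  · rw [explicitSolution_of_neg (neg_lt_zero.2 ha), abs_neg, abs_of_pos ha, min_eq_right hab.le,
      max_eq_left hab.le]
  · rw [explicitSolution_of_neg (neg_lt_zero.2 hb), abs_neg, abs_of_pos hb, min_eq_left hab.le,
      max_eq_right hab.le]

section admissible

variable (lam) (hp₀ : 0 < p) (hp₁ : p < 1 / 2) (hh : 0 < h) (h₁ : AdmissibleDatum p h φ₁)
  (h₂ : AdmissibleDatum p h φ₂)

include hp₀ hp₁ hh h₁ h₂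

/-- The definition assigns η = 0 to φ₁. Both traces vanish there, so the formula for φ₂ holds on
that line as well; this is the continuity across η = 0. -/
lemma explicitSolution_of_nonpos {η : ℝ} (hη : η ≤ 0) (hξ : ξ ∈ Icc 0 h) :
    explicitSolution p lam h φ₁ φ₂ ξ η = cauchyFormula p lam h (densityT p lam h φ₂)
      (densityN p lam h φ₂) (min ξ |η|) (max ξ |η|) := by
  rcases hη.lt_or_eq with hη | rfl
  · exact explicitSolution_of_neg hη
  · rw [explicitSolution_of_nonneg le_rfl, abs_zero, min_eq_right hξ.1, max_eq_left hξ.1,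
      cauchyFormula_zero lam hp₀ hp₁ hh h₁ hξ, cauchyFormula_zero lam hp₀ hp₁ hh h₂ hξ]

lemma continuousOn_explicitSolution :
    ContinuousOn (fun z : ℝ × ℝ => explicitSolution p lam h φ₁ φ₂ z.1 z.2) (rect h) := by
  have key : ∀ φ, AdmissibleDatum p h φ → ContinuousOn (fun z : ℝ × ℝ =>
      cauchyFormula p lam h (densityT p lam h φ) (densityN p lam h φ) (min z.1 |z.2|)
        (max z.1 |z.2|)) (rect h) := by
    intro φ H
    refine (continuousOn_cauchyFormula hp₀ (densityT_spec lam hp₀ hp₁ hh H).1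
      (densityN_spec lam hp₀ hp₁ hh H).1).comp
      (g := fun w : ℝ × ℝ => cauchyFormula p lam h (densityT p lam h φ) (densityN p lam h φ) w.1 w.2)
      (f := fun z : ℝ × ℝ => (min z.1 |z.2|, max z.1 |z.2|)) (by fun_prop) ?_
    rintro z ⟨hz1, hz2⟩
    exact ⟨le_min hz1.1 (abs_nonneg _), min_le_max, max_le hz1.2 (abs_le.2 hz2)⟩
  have hsplit : rect h = (rect h ∩ {z | 0 ≤ z.2}) ∪ (rect h ∩ {z | z.2 ≤ 0}) := by
    rw [← inter_union_distrib_left, eq_comm, inter_eq_left]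
    exact fun z _ => le_total 0 z.2
  have hr : IsClosed (rect h) := isClosed_Icc.prod isClosed_Icc
  rw [hsplit]
  refine ContinuousOn.union_of_isClosed ?_ ?_
    (hr.inter (isClosed_le continuous_const continuous_snd))
    (hr.inter (isClosed_le continuous_snd continuous_const))
  · exact ((key φ₁ h₁).mono inter_subset_left).congr fun z hz => explicitSolution_of_nonneg hz.2
  · exact ((key φ₂ h₂).mono inter_subset_left).congr fun z hz =>
      explicitSolution_of_nonpos lam hp₀ hp₁ hh h₁ h₂ hz.2 hz.1.1

theorem solvesDeltaTwoStar_explicitSolution :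
    SolvesDeltaTwoStar p lam h φ₁ φ₂ (explicitSolution p lam h φ₁ φ₂) := by
  obtain ⟨hN₁, ⟨K₁, hK₁⟩, -⟩ := densityN_spec lam hp₀ hp₁ hh h₁
  obtain ⟨hN₂, ⟨K₂, hK₂⟩, -⟩ := densityN_spec lam hp₀ hp₁ hh h₂
  have hT₁ := (densityT_spec lam hp₀ hp₁ hh h₁).1
  have hT₂ := (densityT_spec lam hp₀ hp₁ hh h₂).1
  set T₁ := densityT p lam h φ₁ with eT₁
  set T₂ := densityT p lam h φ₂ with eT₂
  set N₁ := densityN p lam h φ₁ with eN₁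
  set N₂ := densityN p lam h φ₂ with eN₂
  -- The same pair of densities serves on both sides of η = ξ, and likewise of η = -ξ; continuity
  -- there and Frankl's conditions become automatic.
  have hd : ∀ k, IsDensity h ((![T₁, T₁, T₂, T₂] : Fin 4 → ℝ → ℝ) k) ∧
      IsDensity h ((![N₁, N₁, N₂, N₂] : Fin 4 → ℝ → ℝ) k) := by
    intro k
    fin_cases k
    exacts [⟨hT₁, hN₁⟩, ⟨hT₁, hN₁⟩, ⟨hT₂, hN₂⟩, ⟨hT₂, hN₂⟩]
  have hU : ∀ a b : ℝ, 0 < a → a < b → b < h →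
      explicitSolution p lam h φ₁ φ₂ a b = cauchyFormula p lam h
        ((![T₁, T₁, T₂, T₂] : Fin 4 → ℝ → ℝ) 0) ((![N₁, N₁, N₂, N₂] : Fin 4 → ℝ → ℝ) 0) a b ∧
      explicitSolution p lam h φ₁ φ₂ b a = cauchyFormula p lam h
        ((![T₁, T₁, T₂, T₂] : Fin 4 → ℝ → ℝ) 1) ((![N₁, N₁, N₂, N₂] : Fin 4 → ℝ → ℝ) 1) a b ∧
      explicitSolution p lam h φ₁ φ₂ b (-a) = cauchyFormula p lam h
        ((![T₁, T₁, T₂, T₂] : Fin 4 → ℝ → ℝ) 2) ((![N₁, N₁, N₂, N₂] : Fin 4 → ℝ → ℝ) 2) a b ∧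
      explicitSolution p lam h φ₁ φ₂ a (-b) = cauchyFormula p lam h
        ((![T₁, T₁, T₂, T₂] : Fin 4 → ℝ → ℝ) 3) ((![N₁, N₁, N₂, N₂] : Fin 4 → ℝ → ℝ) 3) a b :=
    fun a b ha hab _ => explicitSolution_classR lam ha hab
  refine ⟨continuousOn_explicitSolution lam hp₀ hp₁ hh h₁ h₂, classR_solvesEquation hp₀ hd hU,
    ⟨_, _, hd, hU⟩, fun ξ hξ => ?_, fun ξ hξ => ?_, fun ξ hξ => ?_, fun ξ hξ => ?_⟩
  · rw [explicitSolution_of_nonneg hh.le, abs_of_pos hh, min_eq_left hξ.2, max_eq_right hξ.2,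
      cauchyFormula_right lam hp₀ hp₁ hh h₁ _ hξ]
  · rw [explicitSolution_of_neg (neg_lt_zero.2 hh), abs_neg, abs_of_pos hh, min_eq_left hξ.2,
      max_eq_right hξ.2, cauchyFormula_right lam hp₀ hp₁ hh h₂ _ hξ]
  · obtain ⟨l1, l2, l3, l4⟩ := classR_tendsto_nu hp₀ hd hU hp₁ hξ
    exact ⟨_, _, _, _, l1, l2, l3, l4, (neg_neg _).symm, rfl⟩
  · obtain ⟨l1, l2⟩ := classR_tendsto_zero hp₀ hd hU (K₁ := K₁) (K₂ := K₂) hK₁ hK₂ hξ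
    have e1 : cauchyH p lam h T₁ N₁ 0 ξ = 0 := cauchyH_zero lam hp₀ hp₁ hh h₁ hξ
    have e2 : cauchyH p lam h T₂ N₂ 0 ξ = 0 := cauchyH_zero lam hp₀ hp₁ hh h₂ hξ
    -- Both one-sided limits contain the factor `cauchyH` on a = 0, which vanishes.
    refine ⟨0, ?_, ?_⟩
    · refine l1.trans (le_of_eq ?_)
      congr 1
      exact (congrArg (fun t => p * (ξ - 0) * t) e1).trans (mul_zero _)
    · refine l2.trans (le_of_eq ?_)
      congr 1
      exact (congrArg (fun t => -(p * (ξ - 0) * t)) e2).trans (by simp)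

end admissible

end

section

variable {p lam h a b c ξ : ℝ} {f t n T N T' N' φ φ₁ φ₂ : ℝ → ℝ}

/-! ### Densities determined by the values of the Cauchy formula -/

lemma cauchyFormula_sub (hp₀ : 0 < p) (hT : IsDensity h T) (hN : IsDensity h N)
    (hT' : IsDensity h T') (hN' : IsDensity h N') (ha : 0 ≤ a) (hab : a ≤ b) (hbh : b ≤ h) :
    cauchyFormula p lam h (fun s => T s - T' s) (fun s => N s - N' s) a b =
      cauchyFormula p lam h T N a b - cauchyFormula p lam h T' N' a b := by
  have hp : 0 < 1 + p := by linarith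
  have hmax : ∀ u : ℝ → ℝ, Continuous u → Continuous fun s => max (u s) 0 ^ p := fun u hu =>
    (hu.max continuous_const).rpow_const fun _ => Or.inr hp₀.le
  have k1 : Continuous fun s => max (s - a) 0 ^ p * max (s - b) 0 ^ p *
      hyp01 (1 + p) (lam * (s - a) * (s - b)) :=
    ((hmax _ (by fun_prop)).mul (hmax _ (by fun_prop))).mul (Continuous.hyp01 hp (by fun_prop))
  have k2 : Continuous fun s => max (b - s) 0 ^ p * max (s - a) 0 ^ p *
      hyp01 (1 + p) (-lam * (b - s) * (s - a)) :=
    ((hmax _ (by fun_prop)).mul (hmax _ (by fun_prop))).mul (Continuous.hyp01 hp (by fun_prop))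
  rw [cauchyFormula_eq_max hp₀ ha hab hbh, cauchyFormula_eq_max hp₀ ha hab hbh,
    cauchyFormula_eq_max hp₀ ha hab hbh, add_sub_add_comm,
    ← integral_sub (hT.2.mul_continuousOn k1.continuousOn isCompact_Icc)
      (hT'.2.mul_continuousOn k1.continuousOn isCompact_Icc),
    ← integral_sub (hN.2.mul_continuousOn k2.continuousOn isCompact_Icc)
      (hN'.2.mul_continuousOn k2.continuousOn isCompact_Icc)]
  simp only [sub_mul]

lemma IsDensity.sub (hT : IsDensity h T) (hT' : IsDensity h T') :
    IsDensity h (fun s => T s - T' s) :=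
  ⟨hT.1.sub hT'.1, Integrable.sub hT.2 hT'.2⟩

lemma cauchyFormula_congr (hT : EqOn T T' (Ioo 0 h)) (hN : EqOn N N' (Ioo 0 h)) (ha : 0 ≤ a)
    (hab : a ≤ b) (hbh : b ≤ h) :
    cauchyFormula p lam h T N a b = cauchyFormula p lam h T' N' a b := by
  rw [cauchyFormula, cauchyFormula]
  congr 1
  · refine intervalIntegral.integral_congr_ae ?_
    filter_upwards [show ∀ᵐ s : ℝ, s ≠ h by simp [ae_iff]] with s hsh hs
    rw [uIoc_of_le hbh] at hs
    rw [hT ⟨(ha.trans hab).trans_lt hs.1, lt_of_le_of_ne hs.2 hsh⟩]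
  · refine intervalIntegral.integral_congr_ae ?_
    filter_upwards [show ∀ᵐ s : ℝ, s ≠ h by simp [ae_iff]] with s hsh hs
    rw [uIoc_of_le hab] at hs
    rw [hN ⟨ha.trans_lt hs.1, lt_of_le_of_ne (hs.2.trans hbh) hsh⟩]

lemma eq_zero_of_opA_eq_zero (hp₀ : 0 < p) (hp₁ : p < 1) (hf : ContinuousOn f (Ioo 0 h))
    (hfi : ∀ y ∈ Ioo 0 h, IntegrableOn f (Ioc y h)) (h0 : ∀ x ∈ Ioo 0 h, opA p lam h c f x = 0)
    {y : ℝ} (hy : y ∈ Ioo 0 h) : f y = 0 := by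
  -- Near 0 the function f need not be integrable, so the problem is translated to start at some x₀
  -- between 0 and y.
  obtain ⟨x₀, hx₀⟩ := exists_between hy.1
  have hx₀h : x₀ ∈ Ioo 0 h := ⟨hx₀.1, hx₀.2.trans hy.2⟩
  have hk : ContDiff ℝ 1 (Function.uncurry fun s x : ℝ =>
      hyp01 p (lam * (s + x₀ - c) * (s - x))) :=
    (contDiff_one_hyp01 hp₀).comp (by fun_prop)
  have key := eq_zero_of_abel_eq_zero (f := fun s => f (s + x₀)) (α := p) (h := h - x₀) (k₀ := 1)
    hp₀ hp₁ (hf.comp (by fun_prop) fun s hs => ⟨by linarith [hs.1, hx₀.1], by linarith [hs.2]⟩)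
    ?_ hk one_ne_zero (fun s _ => by simp [hyp01_zero]) (fun x hx => ?_) (y := y - x₀)
    ⟨by linarith [hx₀.2], by linarith [hy.2]⟩
  · simpa using key
  · have h1 := (intervalIntegrable_iff_integrableOn_Ioc_of_le hx₀h.2.le).2 (hfi x₀ hx₀h)
    have h2 := h1.comp_add_right x₀
    rw [sub_self] at h2
    exact (intervalIntegrable_iff_integrableOn_Ioc_of_le (by linarith [hx₀h.2])).1 h2
  · have h1 := h0 (x + x₀) ⟨by linarith [hx.1, hx₀.1], by linarith [hx.2]⟩
    rw [opA, ← sub_add_cancel h x₀, ← intervalIntegral.integral_comp_add_right] at h1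
    simpa only [add_sub_add_right_eq_sub] using h1

/-- Differentiating the vanishing primitive reduces the claim to A_c f = 0. Traces of the Cauchy
formula come in this integrated form. -/
lemma eq_zero_of_integral_opA_eq_zero (hp₀ : 0 < p) (hp₁ : p < 1) (hf : ContinuousOn f (Ioo 0 h))
    (hfi : IntegrableOn f (Ioc 0 h)) (h0 : ∀ y ∈ Ioo 0 h, ∫ x in y..h, opA p lam h c f x = 0)
    {y : ℝ} (hy : y ∈ Ioo 0 h) : f y = 0 := by
  refine eq_zero_of_opA_eq_zero (lam := lam) (c := c) hp₀ hp₁ hf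
    (fun y hy => hfi.mono_set (Ioc_subset_Ioc_left hy.1.le)) (fun x hx => ?_) hy
  have h1 := hasDerivAt_integral_left (continuousOn_opA (lam := lam) (c := c) hp₀ hf hfi) hx
    ((integrableOn_opA hp₀ hfi).mono_set (Ioc_subset_Ioc_left hx.1.le))
  have h2 : HasDerivAt (fun y => ∫ x in y..h, opA p lam h c f x) 0 x :=
    (hasDerivAt_const x (0 : ℝ)).congr_of_eventuallyEq
      (by filter_upwards [Ioo_mem_nhds hx.1 hx.2] with y hy using h0 y hy)
  exact neg_eq_zero.1 (h1.unique h2)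

lemma eq_zero_of_cauchyFormula_right (hp₀ : 0 < p) (hp₁ : p < 1) (hn : IsDensity h n)
    (h0 : ∀ a ∈ Ioo 0 h, cauchyFormula p lam h t n a h = 0) {y : ℝ} (hy : y ∈ Ioo 0 h) :
    n y = 0 := by
  have hc : Continuous fun s : ℝ => (h - s) ^ p :=
    Continuous.rpow_const (by fun_prop) fun _ => Or.inr hp₀.le
  have hfi : IntegrableOn (fun s => n s * (h - s) ^ p) (Ioc 0 h) :=
    (hn.2.mul_continuousOn hc.continuousOn isCompact_Icc).mono_set Ioc_subset_Icc_self
  have key := eq_zero_of_integral_opA_eq_zero (f := fun s => n s * (h - s) ^ p) (lam := lam)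
    (c := h) hp₀ hp₁ (hn.1.mul hc.continuousOn) hfi (fun a ha => ?_) hy
  · exact (mul_eq_zero.1 key).resolve_right (Real.rpow_pos_of_pos (sub_pos.2 hy.2) p).ne'
  · have h1 := integral_rpow_kernel (lam := lam) (c := h) hp₀ ha.2.le
      (hfi.mono_set (Ioc_subset_Ioc_left ha.1.le))
    have h2 := h0 a ha
    rw [cauchyFormula, intervalIntegral.integral_same, zero_add] at h2
    refine (mul_eq_zero.1 (h1.symm.trans (Eq.trans ?_ h2))).resolve_left hp₀.ne'
    refine intervalIntegral.integral_congr fun s _ => ?_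
    rw [show lam * (s - h) * (s - a) = -lam * (h - s) * (s - a) by ring]
    ring

lemma eq_zero_of_cauchyFormula_zero (hp₀ : 0 < p) (hp₁ : p < 1) (ht : IsDensity h t)
    (hn : ∀ s ∈ Ioo 0 h, n s = 0) (h0 : ∀ b ∈ Ioo 0 h, cauchyFormula p lam h t n 0 b = 0)
    {y : ℝ} (hy : y ∈ Ioo 0 h) : t y = 0 := by
  have hc : Continuous fun s : ℝ => s ^ p :=
    Continuous.rpow_const (by fun_prop) fun _ => Or.inr hp₀.le
  have hfi := integrableOn_mul_rpow hp₀ ht le_rfl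
  have key := eq_zero_of_integral_opA_eq_zero (f := fun s => t s * s ^ p) (lam := lam)
    (c := 0) hp₀ hp₁ (ht.1.mul hc.continuousOn) hfi (fun b hb => ?_) hy
  · exact (mul_eq_zero.1 key).resolve_right (Real.rpow_pos_of_pos hy.1 p).ne'
  · have h1 := integral_rpow_kernel (lam := lam) (c := 0) hp₀ hb.2.le
      (hfi.mono_set (Ioc_subset_Ioc_left hb.1.le))
    have h2 := h0 b hb
    rw [cauchyFormula_congr (T' := t) (N' := 0) (fun _ _ => rfl) hn le_rfl hb.1.le hb.2.le,
      cauchyFormula] at h2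
    simp only [Pi.zero_apply, zero_mul, intervalIntegral.integral_zero, add_zero] at h2
    refine (mul_eq_zero.1 (h1.symm.trans (Eq.trans ?_ h2))).resolve_left hp₀.ne'
    refine intervalIntegral.integral_congr fun s _ => ?_
    rw [sub_zero]
    ring

/-- On a = b only t remains, with kernel (s - x)^(2p) ₀F₁. One differentiation gives an Abel
equation of order 2p < 1 whose regular kernel is 2p on the diagonal, and injectivity applies. -/
lemma eq_zero_of_cauchyFormula_diag (hp₀ : 0 < p) (hp₁ : p < 1 / 2) (ht : IsDensity h t)
    (h0 : ∀ x ∈ Ioo 0 h, cauchyFormula p lam h t n x x = 0) {y : ℝ} (hy : y ∈ Ioo 0 h) :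
    t y = 0 := by
  have hp : 0 < 1 + p := by linarith
  have hp2 : 0 < 1 + p + 1 := by linarith
  have hα : 0 < 2 * p := by linarith
  set g : ℝ → ℝ → ℝ := fun s x => 2 * p * hyp01 (1 + p) (lam * (s - x) ^ 2) +
    2 * lam / (1 + p) * (s - x) ^ 2 * hyp01 (1 + p + 1) (lam * (s - x) ^ 2) with hg
  have hgd : ContDiff ℝ 1 (Function.uncurry g) := by
    have d1 : ContDiff ℝ 1 fun q : ℝ × ℝ => hyp01 (1 + p) (lam * (q.1 - q.2) ^ 2) :=
      (contDiff_one_hyp01 hp).comp (by fun_prop)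
    have d2 : ContDiff ℝ 1 fun q : ℝ × ℝ => hyp01 (1 + p + 1) (lam * (q.1 - q.2) ^ 2) :=
      (contDiff_one_hyp01 hp2).comp (by fun_prop)
    exact (contDiff_const.mul d1).add
      ((by fun_prop : ContDiff ℝ 1 fun q : ℝ × ℝ => 2 * lam / (1 + p) * (q.1 - q.2) ^ 2).mul d2)
  have hκ : ∀ s ∈ Ioo 0 h, ∀ x ∈ Ioo 0 s, HasDerivAt
      (fun x => (s - x) ^ (2 * p) * hyp01 (1 + p) (lam * (s - x) ^ 2))
      (-((s - x) ^ (2 * p - 1) * g s x)) x := by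
    intro s _ x hx
    have hpos := sub_pos.2 hx.2
    have d1 : HasDerivAt (fun x => lam * (s - x) ^ 2) (-(2 * lam * (s - x))) x :=
      ((((hasDerivAt_id x).const_sub s).pow 2).const_mul lam).congr_deriv (by simp; ring)
    have d2 := (hasDerivAt_hyp01 hp (lam * (s - x) ^ 2)).comp x d1
    refine ((hasDerivAt_sub_rpow (q := 2 * p) hx.2).mul d2).congr_deriv ?_
    have h1 : (s - x) ^ (2 * p) = (s - x) ^ (2 * p - 1) * (s - x) := by
      rw [← Real.rpow_add_one hpos.ne']; simp
    rw [h1, hg, Function.comp_apply]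
    ring
  refine eq_zero_of_abel_eq_zero (k := g) (k₀ := 2 * p) hα (by linarith) ht.1
    ht.integrableOn_Ioc hgd hα.ne' (fun s _ => by simp [hg, hyp01_zero]) (fun x hx => ?_) hy
  have h1 := hasDerivAt_abel (f := t) (g := g)
    (κ := fun s x => (s - x) ^ (2 * p) * hyp01 (1 + p) (lam * (s - x) ^ 2)) hα ht.1
    ht.integrableOn_Ioc hgd.continuous.continuousOn
    (fun s _ => (Continuous.mul (Continuous.rpow_const (by fun_prop) fun _ => Or.inr hα.le)
      (Continuous.hyp01 hp (by fun_prop))).continuousOn) hκ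
    (fun s _ => by rw [sub_self, Real.zero_rpow hα.ne', zero_mul]) hx
  have h2 : HasDerivAt (fun x => ∫ s in x..h, t s *
      ((s - x) ^ (2 * p) * hyp01 (1 + p) (lam * (s - x) ^ 2))) 0 x := by
    refine (hasDerivAt_const x (0 : ℝ)).congr_of_eventuallyEq ?_
    filter_upwards [Ioo_mem_nhds hx.1 hx.2] with y hy
    rw [← h0 y hy, cauchyFormula, intervalIntegral.integral_same, add_zero]
    refine intervalIntegral.integral_congr fun s hs => ?_
    rw [uIcc_of_le hy.2.le] at hs
    have h3 : (s - y) ^ (2 * p) = (s - y) ^ p * (s - y) ^ p := by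
      rw [two_mul, Real.rpow_add_of_nonneg (sub_nonneg.2 hs.1) hp₀.le hp₀.le]
    rw [h3, show lam * (s - y) ^ 2 = lam * (s - y) * (s - y) by ring]
    ring
  exact neg_eq_zero.1 (h1.unique h2)

lemma cauchyH_congr_right (hN : EqOn N N' (Ioo 0 h)) (hb : b ∈ Ioo 0 h) :
    cauchyH p lam h T N 0 b = cauchyH p lam h T N' 0 b := by
  rw [cauchyH, cauchyH, inner, inner]
  congr 1
  refine intervalIntegral.integral_congr_ae (Eventually.of_forall fun s hs => ?_)
  rw [uIoc_of_le hb.1.le] at hs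
  rw [hN ⟨hs.1, hs.2.trans_lt hb.2⟩]

lemma wedge_zero_eq_opA (p lam h : ℝ) (T : ℝ → ℝ) (b : ℝ) :
    wedge lam 1 p p p T h b 0 = opA p lam h 0 (fun s => T s * s ^ (p - 1)) b := by
  rw [wedge, opA]
  refine intervalIntegral.integral_congr fun s _ => ?_
  rw [show lam * (s - b) * (s - 0) = lam * (s - 0) * (s - b) by ring, sub_zero, one_mul]
  ring

lemma continuousOn_mul_rpow_sub_one (hT : IsDensity h T) :
    ContinuousOn (fun s => T s * s ^ (p - 1)) (Ioo 0 h) :=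
  hT.1.mul (continuousOn_id.rpow_const fun _ hs => Or.inl hs.1.ne')

lemma integrableOn_mul_rpow_sub_one (hT : IsDensity h T) {y : ℝ} (hy : y ∈ Ioo 0 h) :
    IntegrableOn (fun s => T s * s ^ (p - 1)) (Ioc y h) :=
  ((hT.2.mono_set (Icc_subset_Icc_left hy.1.le)).mul_continuousOn
    (continuousOn_id.rpow_const fun _ hs => Or.inl (hy.1.trans_le hs.1).ne')
    isCompact_Icc).mono_set Ioc_subset_Icc_self

lemma opA_sub_of_isDensity (hp₀ : 0 < p) (hT : IsDensity h T) (hT' : IsDensity h T')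
    (hb : b ∈ Ioo 0 h) :
    opA p lam h 0 (fun s => (T s - T' s) * s ^ (p - 1)) b =
      opA p lam h 0 (fun s => T s * s ^ (p - 1)) b -
        opA p lam h 0 (fun s => T' s * s ^ (p - 1)) b := by
  obtain ⟨x₀, hx₀⟩ := exists_between hb.1
  have key : ∀ S, IsDensity h S → IntervalIntegrable (fun s => S s * s ^ (p - 1) *
      ((s - b) ^ (p - 1) * hyp01 p (lam * (s - 0) * (s - b)))) volume b h := fun S hS =>
    intervalIntegrable_abel (x₀ := x₀) (f := fun s => S s * s ^ (p - 1)) hp₀ ⟨hx₀.2, hb.2⟩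
      ((continuousOn_mul_rpow_sub_one hS).mono (Ioo_subset_Ioo_left hx₀.1.le))
      (integrableOn_mul_rpow_sub_one hS ⟨hx₀.1, hx₀.2.trans hb.2⟩)
      (Continuous.hyp01 hp₀ (by fun_prop)).continuousOn
  rw [opA, opA, opA, ← intervalIntegral.integral_sub (key T hT) (key T' hT')]
  exact intervalIntegral.integral_congr fun s _ => by ring

lemma eqOn_closed_triangle {F G : ℝ × ℝ → ℝ} (hh : 0 < h)
    (hF : ContinuousOn F {w | 0 ≤ w.1 ∧ w.1 ≤ w.2 ∧ w.2 ≤ h})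
    (hG : ContinuousOn G {w | 0 ≤ w.1 ∧ w.1 ≤ w.2 ∧ w.2 ≤ h})
    (hFG : EqOn F G {w | 0 < w.1 ∧ w.1 < w.2 ∧ w.2 < h}) :
    EqOn F G {w | 0 ≤ w.1 ∧ w.1 ≤ w.2 ∧ w.2 ≤ h} := by
  refine hFG.of_subset_closure hF hG (fun w hw => ⟨hw.1.le, hw.2.1.le, hw.2.2.le⟩) ?_
  rintro ⟨a, b⟩ ⟨ha, hab, hb⟩
  simp only at ha hab hb
  -- Every closed-triangle point is the limit along a segment towards the interior point (h/3,
  -- 2h/3).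
  have hc : Continuous fun r : ℝ => ((1 - r) * a + r * (h / 3), (1 - r) * b + r * (2 * h / 3)) := by
    fun_prop
  have hl := (hc.tendsto 0).mono_left (nhdsWithin_le_nhds (s := Ioi 0))
  simp only [sub_zero, one_mul, zero_mul, add_zero] at hl
  refine mem_closure_of_tendsto hl ?_
  filter_upwards [Ioo_mem_nhdsGT (zero_lt_one (α := ℝ))] with r hr
  have h1 := mul_nonneg (sub_nonneg.2 hr.2.le) ha
  have h2 := mul_le_mul_of_nonneg_left hab (sub_nonneg.2 hr.2.le)
  have h3 := mul_le_mul_of_nonneg_left hb (sub_nonneg.2 hr.2.le)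
  have h4 := mul_pos hr.1 hh
  refine ⟨?_, ?_, ?_⟩ <;> nlinarith

end

section

variable {p lam h a b ξ : ℝ} {φ₁ φ₂ : ℝ → ℝ}

/-! ### Uniqueness -/

section data

variable {U : ℝ → ℝ → ℝ} {T N : Fin 4 → ℝ → ℝ} (hp₀ : 0 < p) (hh : 0 < h)
  (hd : ∀ k, IsDensity h (T k) ∧ IsDensity h (N k))
  (hU : ∀ a b : ℝ, 0 < a → a < b → b < h →
      U a b = cauchyFormula p lam h (T 0) (N 0) a b ∧
      U b a = cauchyFormula p lam h (T 1) (N 1) a b ∧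
      U b (-a) = cauchyFormula p lam h (T 2) (N 2) a b ∧
      U a (-b) = cauchyFormula p lam h (T 3) (N 3) a b)
  (hc : ContinuousOn (fun z : ℝ × ℝ => U z.1 z.2) (rect h))

include hp₀ hh hd hU hc

/-- By continuity, the representation of the class `R_h` holds on the closed triangles. -/
lemma classR_closed (ha : 0 ≤ a) (hab : a ≤ b) (hb : b ≤ h) :
    U a b = cauchyFormula p lam h (T 0) (N 0) a b ∧
      U b a = cauchyFormula p lam h (T 1) (N 1) a b ∧
      U b (-a) = cauchyFormula p lam h (T 2) (N 2) a b ∧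
      U a (-b) = cauchyFormula p lam h (T 3) (N 3) a b := by
  have key : ∀ (k : Fin 4) (L : ℝ × ℝ → ℝ × ℝ), Continuous L →
      (∀ w : ℝ × ℝ, 0 ≤ w.1 → w.1 ≤ w.2 → w.2 ≤ h → L w ∈ rect h) →
      (∀ w : ℝ × ℝ, 0 < w.1 → w.1 < w.2 → w.2 < h →
        U (L w).1 (L w).2 = cauchyFormula p lam h (T k) (N k) w.1 w.2) →
      U (L (a, b)).1 (L (a, b)).2 = cauchyFormula p lam h (T k) (N k) a b := by
    intro k L hL hm hUL
    exact eqOn_closed_triangle (F := fun w => U (L w).1 (L w).2)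
      (G := fun w => cauchyFormula p lam h (T k) (N k) w.1 w.2) hh
      (hc.comp (f := L) hL.continuousOn fun w hw => hm w hw.1 hw.2.1 hw.2.2)
      (continuousOn_cauchyFormula hp₀ (hd k).1 (hd k).2)
      (fun w hw => hUL w hw.1 hw.2.1 hw.2.2) (x := (a, b)) ⟨ha, hab, hb⟩
  refine ⟨key 0 (fun w => (w.1, w.2)) (by fun_prop) (fun w h1 h2 h3 => ?_)
      fun w h1 h2 h3 => (hU _ _ h1 h2 h3).1,
    key 1 (fun w => (w.2, w.1)) (by fun_prop) (fun w h1 h2 h3 => ?_)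
      fun w h1 h2 h3 => (hU _ _ h1 h2 h3).2.1,
    key 2 (fun w => (w.2, -w.1)) (by fun_prop) (fun w h1 h2 h3 => ?_)
      fun w h1 h2 h3 => (hU _ _ h1 h2 h3).2.2.1,
    key 3 (fun w => (w.1, -w.2)) (by fun_prop) (fun w h1 h2 h3 => ?_)
      fun w h1 h2 h3 => (hU _ _ h1 h2 h3).2.2.2⟩ <;>
  exact ⟨⟨by simp only; linarith, by simp only; linarith⟩,
    ⟨by simp only; linarith, by simp only; linarith⟩⟩

/-- Adjacent triangles share their diagonal, where continuity makes the two Cauchy formulas agree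
and N does not contribute. -/
lemma classR_eqOn_tangential (hp₁ : p < 1 / 2) :
    EqOn (T 0) (T 1) (Ioo 0 h) ∧ EqOn (T 2) (T 3) (Ioo 0 h) := by
  have key : ∀ i j : Fin 4, (∀ x ∈ Ioo 0 h, cauchyFormula p lam h (T i) (N i) x x =
      cauchyFormula p lam h (T j) (N j) x x) → EqOn (T i) (T j) (Ioo 0 h) := by
    intro i j hij y hy
    refine sub_eq_zero.1 (eq_zero_of_cauchyFormula_diag (lam := lam)
      (n := fun s => N i s - N j s) hp₀ hp₁ ((hd i).1.sub (hd j).1) (fun x hx => ?_) hy)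
    rw [cauchyFormula_sub hp₀ (hd i).1 (hd i).2 (hd j).1 (hd j).2 hx.1.le le_rfl hx.2.le,
      hij x hx, sub_self]
  constructor
  · refine key 0 1 fun x hx => ?_
    have := classR_closed hp₀ hh hd hU hc hx.1.le le_rfl hx.2.le
    rw [← this.1, ← this.2.1]
  · refine key 2 3 fun x hx => ?_
    have := classR_closed hp₀ hh hd hU hc hx.1.le le_rfl hx.2.le
    rw [← this.2.2.1, ← this.2.2.2]

/-- Once the T agree, `nuLimit` determines N, because `gammaMid` is positive. -/
lemma classR_eqOn_normal (hp₁ : p < 1 / 2) (hF : FranklConditions p h U) :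
    EqOn (N 0) (N 1) (Ioo 0 h) ∧ EqOn (N 2) (N 3) (Ioo 0 h) := by
  obtain ⟨t1, t2⟩ := classR_eqOn_tangential hp₀ hh hd hU hc hp₁
  have key : ∀ {t n n' : ℝ}, nuLimit p t n = nuLimit p t n' → n = n' := by
    intro t n n' e
    have e1 := mul_left_cancel₀ hp₀.ne' e
    exact mul_right_cancel₀ (gammaMid_pos hp₀).ne' (sub_right_injective e1)
  refine ⟨fun ξ hξ => ?_, fun ξ hξ => ?_⟩ <;>
  obtain ⟨l1, l2, l3, l4⟩ := classR_tendsto_nu hp₀ hd hU hp₁ hξ <;>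
  obtain ⟨ν₁, ν₂, ν₃, ν₄, m1, m2, m3, m4, e1, e2⟩ := hF ξ hξ
  · rw [tendsto_nhds_unique m1 l1, tendsto_nhds_unique m2 l2, neg_neg, t1 hξ] at e1
    exact key e1
  · rw [tendsto_nhds_unique m3 l3, tendsto_nhds_unique m4 l4, neg_inj, t2 hξ] at e2
    exact key e2

lemma classR_eqOn_densityN (hp₁ : p < 1 / 2) (h₁ : AdmissibleDatum p h φ₁)
    (h₂ : AdmissibleDatum p h φ₂) (hφ₁ : ∀ ξ ∈ Icc 0 h, U ξ h = φ₁ ξ)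
    (hφ₂ : ∀ ξ ∈ Icc 0 h, U ξ (-h) = φ₂ ξ) :
    EqOn (N 0) (densityN p lam h φ₁) (Ioo 0 h) ∧ EqOn (N 3) (densityN p lam h φ₂) (Ioo 0 h) := by
  have key : ∀ (i : Fin 4) (φ : ℝ → ℝ), AdmissibleDatum p h φ →
      (∀ a ∈ Ioo 0 h, cauchyFormula p lam h (T i) (N i) a h = φ a) →
      EqOn (N i) (densityN p lam h φ) (Ioo 0 h) := by
    intro i φ H hi y hy
    have hN := (densityN_spec lam hp₀ hp₁ hh H).1
    -- T plays no role on b = h, so the same T is used for both formulas and their difference has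
    -- T-density zero.
    refine sub_eq_zero.1 (eq_zero_of_cauchyFormula_right (lam := lam)
      (t := fun s => T i s - T i s) hp₀ (by linarith) ((hd i).2.sub hN) (fun a ha => ?_) hy)
    rw [cauchyFormula_sub hp₀ (hd i).1 (hd i).2 (hd i).1 hN ha.1.le ha.2.le le_rfl, hi a ha,
      cauchyFormula_right lam hp₀ hp₁ hh H _ (Ioo_subset_Icc_self ha), sub_self]
  constructor
  · refine key 0 φ₁ h₁ fun a ha => ?_
    rw [← (classR_closed hp₀ hh hd hU hc ha.1.le ha.2.le le_rfl).1,
      hφ₁ a (Ioo_subset_Icc_self ha)]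
  · refine key 3 φ₂ h₂ fun a ha => ?_
    rw [← (classR_closed hp₀ hh hd hU hc ha.1.le ha.2.le le_rfl).2.2.2,
      hφ₂ a (Ioo_subset_Icc_self ha)]

/-- N being known, only T minus the explicit T is free in the two triangles adjacent to η = 0. Equal
values on η = 0 give a vanishing difference of these two quantities. The reflection η ↦ -η flips the
sign in the conjugation condition, which gives a vanishing sum. -/
lemma classR_eqOn_densityT (hp₁ : p < 1 / 2) (h₁ : AdmissibleDatum p h φ₁)
    (h₂ : AdmissibleDatum p h φ₂) (hN₁ : EqOn (N 1) (densityN p lam h φ₁) (Ioo 0 h))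
    (hN₂ : EqOn (N 2) (densityN p lam h φ₂) (Ioo 0 h)) (hC : ConjugationCondition h U) :
    EqOn (T 1) (densityT p lam h φ₁) (Ioo 0 h) ∧ EqOn (T 2) (densityT p lam h φ₂) (Ioo 0 h) := by
  obtain ⟨hNe₁, ⟨K₁, hK₁⟩, -⟩ := densityN_spec lam hp₀ hp₁ hh h₁
  obtain ⟨hNe₂, ⟨K₂, hK₂⟩, -⟩ := densityN_spec lam hp₀ hp₁ hh h₂
  have hTe₁ := (densityT_spec lam hp₀ hp₁ hh h₁).1
  have hTe₂ := (densityT_spec lam hp₀ hp₁ hh h₂).1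
  have hp : p < 1 := by linarith
  have hsub : ∀ s ∈ Ioo 0 h,
      (T 1 s - densityT p lam h φ₁ s) - (T 2 s - densityT p lam h φ₂ s) = 0 := by
    intro s hs
    refine eq_zero_of_cauchyFormula_zero (lam := lam) (t := fun s =>
      (T 1 s - densityT p lam h φ₁ s) - (T 2 s - densityT p lam h φ₂ s)) (n := fun s =>
      (N 1 s - densityN p lam h φ₁ s) - (N 2 s - densityN p lam h φ₂ s)) hp₀ hp
      (((hd 1).1.sub hTe₁).sub ((hd 2).1.sub hTe₂)) (fun s hs => ?_) (fun b hb => ?_) hs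
    · rw [hN₁ hs, hN₂ hs, sub_self, sub_self, sub_self]
    · have hbI : b ∈ Icc 0 h := Ioo_subset_Icc_self hb
      have hcl := classR_closed hp₀ hh hd hU hc le_rfl hbI.1 hbI.2
      rw [cauchyFormula_sub hp₀ ((hd 1).1.sub hTe₁) ((hd 1).2.sub hNe₁) ((hd 2).1.sub hTe₂)
        ((hd 2).2.sub hNe₂) le_rfl hbI.1 hbI.2,
        cauchyFormula_sub hp₀ (hd 1).1 (hd 1).2 hTe₁ hNe₁ le_rfl hbI.1 hbI.2,
        cauchyFormula_sub hp₀ (hd 2).1 (hd 2).2 hTe₂ hNe₂ le_rfl hbI.1 hbI.2,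
        cauchyFormula_zero lam hp₀ hp₁ hh h₁ hbI, cauchyFormula_zero lam hp₀ hp₁ hh h₂ hbI,
        ← hcl.2.1, ← hcl.2.2.1, neg_zero, sub_zero, sub_self]
  -- The conjugation condition reads H₁ = -H₂ on a = 0. Subtracting the explicit solutions, for
  -- which H vanishes, removes the N terms and leaves a homogeneous Abel equation.
  have hadd : ∀ s ∈ Ioo 0 h,
      (T 1 s - densityT p lam h φ₁ s) - (densityT p lam h φ₂ s - T 2 s) = 0 := by
    intro s hs
    have hD := ((hd 1).1.sub hTe₁).sub (hTe₂.sub (hd 2).1)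
    have key := eq_zero_of_opA_eq_zero (lam := lam) (c := 0) hp₀ hp
      (continuousOn_mul_rpow_sub_one (p := p) hD)
      (fun y hy => integrableOn_mul_rpow_sub_one hD hy) (fun ξ hξ => ?_) hs
    · exact (mul_eq_zero.1 key).resolve_right (Real.rpow_pos_of_pos hs.1 _).ne'
    · obtain ⟨l, m1, m2⟩ := hC ξ hξ
      obtain ⟨l1, l2⟩ := classR_tendsto_zero hp₀ hd hU (K₁ := K₁) (K₂ := K₂)
        (fun s hs => by rw [hN₁ hs]; exact hK₁ s hs) (fun s hs => by rw [hN₂ hs]; exact hK₂ s hs) hξ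
      have e := (tendsto_nhds_unique m1 l1).symm.trans (tendsto_nhds_unique m2 l2)
      rw [cauchyH_congr_right hN₁ hξ, cauchyH_congr_right hN₂ hξ, ← mul_neg] at e
      have e' := mul_left_cancel₀ (mul_ne_zero hp₀.ne' (sub_ne_zero.2 hξ.1.ne')) e
      have z1 := cauchyH_zero lam hp₀ hp₁ hh h₁ hξ
      have z2 := cauchyH_zero lam hp₀ hp₁ hh h₂ hξ
      rw [cauchyH, wedge_zero_eq_opA] at z1 z2
      rw [cauchyH, cauchyH, wedge_zero_eq_opA, wedge_zero_eq_opA] at e'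
      rw [opA_sub_of_isDensity hp₀ ((hd 1).1.sub hTe₁) (hTe₂.sub (hd 2).1) hξ,
        opA_sub_of_isDensity hp₀ (hd 1).1 hTe₁ hξ, opA_sub_of_isDensity hp₀ hTe₂ (hd 2).1 hξ]
      linear_combination e' - z1 - z2
  exact ⟨fun s hs => by linarith [hsub s hs, hadd s hs],
    fun s hs => by linarith [hsub s hs, hadd s hs]⟩

end data

theorem SolvesDeltaTwoStar.eq_explicitSolution {U : ℝ → ℝ → ℝ} (hp₀ : 0 < p) (hp₁ : p < 1 / 2)
    (hh : 0 < h) (h₁ : AdmissibleDatum p h φ₁) (h₂ : AdmissibleDatum p h φ₂)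
    (hS : SolvesDeltaTwoStar p lam h φ₁ φ₂ U) {η : ℝ} (hξ : ξ ∈ Icc 0 h) (hη : η ∈ Icc (-h) h) :
    U ξ η = explicitSolution p lam h φ₁ φ₂ ξ η := by
  obtain ⟨T, N, hd, hU⟩ := hS.classR
  have hc := hS.continuous
  obtain ⟨t01, t23⟩ := classR_eqOn_tangential hp₀ hh hd hU hc hp₁
  obtain ⟨n01, n23⟩ := classR_eqOn_normal hp₀ hh hd hU hc hp₁ hS.frankl
  obtain ⟨n0, n3⟩ := classR_eqOn_densityN hp₀ hh hd hU hc hp₁ h₁ h₂ hS.boundary_top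
    hS.boundary_bottom
  -- N is identified in the outer triangles, which touch η = ±h, and T in the inner ones, which
  -- touch η = 0; the relations on η = ±ξ carry each to the neighbouring triangle.
  have n1 := n01.symm.trans n0
  have n2 := n23.trans n3
  obtain ⟨t1, t2⟩ := classR_eqOn_densityT hp₀ hh hd hU hc hp₁ h₁ h₂ n1 n2 hS.conjugation
  have t0 := t01.trans t1
  have t3 := t23.symm.trans t2
  rcases le_or_gt 0 η with h0 | h0
  · rw [explicitSolution_of_nonneg h0, abs_of_nonneg h0]
    rcases le_total ξ η with hle | hle
    · rw [(classR_closed hp₀ hh hd hU hc hξ.1 hle hη.2).1, min_eq_left hle, max_eq_right hle,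
        cauchyFormula_congr t0 n0 hξ.1 hle hη.2]
    · rw [(classR_closed hp₀ hh hd hU hc h0 hle hξ.2).2.1, min_eq_right hle, max_eq_left hle,
        cauchyFormula_congr t1 n1 h0 hle hξ.2]
  · rw [explicitSolution_of_neg h0, abs_of_neg h0]
    have h0' : 0 ≤ -η := by linarith
    have hη' : -η ≤ h := by linarith [hη.1]
    rcases le_total ξ (-η) with hle | hle
    · have e := (classR_closed hp₀ hh hd hU hc hξ.1 hle hη').2.2.2
      rw [neg_neg] at e
      rw [e, min_eq_left hle, max_eq_right hle, cauchyFormula_congr t3 n3 hξ.1 hle hη']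
    · have e := (classR_closed hp₀ hh hd hU hc h0' hle hξ.2).2.2.1
      rw [neg_neg] at e
      rw [e, min_eq_right hle, max_eq_left hle, cauchyFormula_congr t2 n2 h0' hle hξ.2]

end

end EulerDarboux

end

theorem mainTheorem1 (p lam h : ℝ) (hp₀ : 0 < p) (hp₁ : p < 1 / 2) (hh : 0 < h)
    (φ₁ φ₂ : ℝ → ℝ)
    (hφ₁ : EulerDarboux.AdmissibleDatum p h φ₁) (hφ₂ : EulerDarboux.AdmissibleDatum p h φ₂) :
    EulerDarboux.SolvesDeltaTwoStar p lam h φ₁ φ₂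
        (EulerDarboux.explicitSolution p lam h φ₁ φ₂) ∧
      ∀ U : ℝ → ℝ → ℝ, EulerDarboux.SolvesDeltaTwoStar p lam h φ₁ φ₂ U →
        ∀ ξ ∈ Icc 0 h, ∀ η ∈ Icc (-h) h,
          U ξ η = EulerDarboux.explicitSolution p lam h φ₁ φ₂ ξ η := by
  exact ⟨EulerDarboux.solvesDeltaTwoStar_explicitSolution lam hp₀ hp₁ hh hφ₁ hφ₂,
    fun _ hU _ hξ _ hη => hU.eq_explicitSolution hp₀ hp₁ hh hφ₁ hφ₂ hξ hη⟩
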